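/- Let $F$ be a nonarchimedean local field with ring of integers $\mathcal O$, maximal ideal $\mathfrak p$, residue field of cardinality $q$ and of characteristic greater than $3$, normalized valuation $\mathrm{val}$ and uniformizer $\varpi$. Assume that $F$ contains a primitive cube root of unity, fix an identification of $\mu_3=\mu_3(F)$ with $\mu_3(\mathbb C)$, and let $(\cdot,\cdot):F^\times\times F^\times\to\mu_3$ be the cubic Hilbert symbol. Let $\psi$ be an additive character of $F$ with conductor $\mathcal O$, let $dx$ be the Haar measure on $F$ with $\int_{\mathcal O}dx=1$, and let $$\mathfrak g=\int_{\mathrm{val}(x)=-1}(\varpi,x)\,\psi(x)\,dx .$$ Let $\sigma$ be the block-compatible $2$-cocycle of Banks, Levy and Sepanski on $\mathrm{GL}_3(F)$ with values in $\mu_3$, so that $\sigma(t,t')=\prod_{i<j}(t_i,t'_j)$ on diagonal matrices, and let $G'=\mathrm{SL}_3(F)\times\mu_3$ with the operation $(g_1,z_1)(g_2,z_2)=(g_1g_2,z_1z_2\sigma(g_1,g_2))$ be the cubic metaplectic cover of $\mathrm{SL}_3(F)$. Write $\sec(g)=(g,1)$, and embed $\mu_3$ in $G'$ by $z\mapsto(e,z)$.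 There is a unique map $\kappa:\mathrm{SL}_3(\mathcal O)\to\mu_3$ with $\kappa(k_1k_2)=\kappa(k_1)\kappa(k_2)\sigma(k_1,k_2)$ for all $k_1,k_2$; let $K'=\{(k,\kappa(k)):k\in\mathrm{SL}_3(\mathcal O)\}\subset G'$. For integers $m,n\ge 0$ let $d'_{m,n}=\mathrm{diag}(\varpi^{-n-2m},\varpi^{m-n},\varpi^{2n+m})$. There is a unique bi-$K'$-invariant function $f'_{m,n}:G'\to\mathbb C$ which is anti-genuine ($f'_{m,n}(zg)=z^{-1}f'_{m,n}(g)$ for $z\in\mu_3$, $g\in G'$), is supported on $K'\sec(d'_{m,n})K'\mu_3$, and satisfies $f'_{m,n}(\sec(d'_{m,n}))=1$. For $(i,j)\in\mathbb Z^2$ with $2i\ge j$ and $2j\ge i$ let $c_{i,j}=\mathrm{diag}(\varpi^{-j},\varpi^{j-i},\varpi^{i})$ and $$\Psi'_{m,n}(i,j)=\int_{F^3} f'_{m,n}\bigl(\sec(u)\sec(c_{i,j}^{-1})\bigr)\,\psi(x+y)\,dx\,dy\,dz,\qquad u=\begin{pmatrix}1&x&z\\&1&y\\&&1\end{pmatrix}.$$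 These integrals converge absolutely. For all integers $m,n\ge0$ and all $(i,j)\in\mathbb Z^2$ with $2i\ge j$ and $2j\ge i$, $\Psi'_{m,n}(i,j)$ is nonzero if and only if $(i,j)$ is one of the six pairs below, and if $(i,j)$ is one of these pairs (and satisfies $2i\ge j$, $2j\ge i$), then its value is as follows: 1. $\Psi'_{m,n}(2m+n,m+2n)=1$; 2. $\Psi'_{m,n}(2m+n-1,m+2n)=\overline{\mathfrak g}$; 3. $\Psi'_{m,n}(2m+n,m+2n-1)=\overline{\mathfrak g}$; 4. $\Psi'_{m,n}(2m+n-2,m+2n-1)=q^2$; 5. $\Psi'_{m,n}(2m+n-1,m+2n-2)=q^2$; 6. $\Psi'_{m,n}(2m+n-2,m+2n-2)=q^2\,\overline{\mathfrak g}$. -/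

import Mathlib

open ValuativeRel MeasureTheory
open scoped Matrix ComplexConjugate

namespace CubicCover

noncomputable section

/-! ### The local field, the cubic Hilbert symbol and the Gauss sum -/

section LocalField

variable {F : Type*} [Field F] [ValuativeRel F] [TopologicalSpace F]
  [IsNonarchimedeanLocalField F]

/-- The normalized discrete valuation `F → ℤ` (with junk value `0` at `0`).  The isomorphism of
the value group with `ℤᵐ⁰` preserves the order, so uniformizers have valuation `1`. -/
def val (x : F) : ℤ :=
  -WithZero.log
    (IsNonarchimedeanLocalField.valueGroupWithZeroIsoInt F (valuation F x))

variable (F) in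
/-- The number of elements of the residue field. -/
def resCard : ℕ := Nat.card 𝓀[F]

/-- The unit `(-1)^{val x val y} x^{val y} y^{-val x}` of the tame symbol (for `x, y ≠ 0`). -/
def tameUnit (x y : F) : F :=
  (-1) ^ (val x * val y) * x ^ val y / y ^ val x

open Classical in
/-- The cubic Hilbert symbol `(x, y) ∈ μ₃(F)` for `x, y ≠ 0`, for a field `F` that contains the
cube roots of unity and has residual characteristic different from `3`.  In this tame case it is
the cube root of unity congruent, modulo the maximal ideal, to the `(q - 1) / 3`-th power of
`tameUnit x y`.  (The cube roots of unity are pairwise incongruent, so that it is unique.) -/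
def hilbertSymbol (x y : F) : rootsOfUnity 3 F :=
  if h : ∃ ζ : rootsOfUnity 3 F,
      valuation F (tameUnit x y ^ ((resCard F - 1) / 3) - ((ζ : Fˣ) : F)) < 1
  then h.choose else 1

/-- The value in `ℂ` of a cube root of unity of `F` under an identification `ι`. -/
def toComplex (ι : rootsOfUnity 3 F ≃* rootsOfUnity 3 ℂ) (ζ : rootsOfUnity 3 F) : ℂ :=
  ((ι ζ : ℂˣ) : ℂ)

/-- The cubic Gauss sum `𝔤 = ∫_{val x = -1} (ϖ, x) ψ(x) dx`. -/
def gaussSum [MeasurableSpace F] (μ : Measure F)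
    (ι : rootsOfUnity 3 F ≃* rootsOfUnity 3 ℂ) (ψ : AddChar F Circle) (ϖ : Fˣ) : ℂ :=
  ∫ x in {x : F | val x = -1}, toComplex ι (hilbertSymbol (ϖ : F) x) * (ψ x : ℂ) ∂μ

end LocalField

/-! ### Bruhat coordinates on `GL₃(F)`

Every `g ∈ GL₃(F)` is `g = n t w n'` with `n, n'` upper triangular unipotent, `t` diagonal and
`w = s_{a₁} ⋯ s_{aₖ}` a reduced product of simple reflections.  The functions below compute `t`
(up to signs of its entries), the word `a₁, …, aₖ`, and a possible `n'`, from the bottom row of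
`g` and the minors of its two bottom rows.  Signs play no role: `-1` is a cube, hence
`(-1, x) = (x, -1) = 1` for the cubic Hilbert symbol. -/

section Bruhat

variable {F : Type*} [Field F]

open Classical in
/-- The first nonzero element among `a`, `b`, `c`. -/
def firstNonzero (a b c : F) : F := if a ≠ 0 then a else if b ≠ 0 then b else c

/-- The minor of the two bottom rows on the columns `i`, `j`. -/
def bottomMinor (g : Matrix (Fin 3) (Fin 3) F) (i j : Fin 3) : F :=
  g 1 i * g 2 j - g 1 j * g 2 i

/-- The diagonal part `(t₁, t₂, t₃)` in the Bruhat decomposition, up to signs: `t₃` is the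
leading entry of the bottom row, `t₂ t₃` the leading minor of the two bottom rows, and
`t₁ t₂ t₃` the determinant. -/
def torusPart (g : Matrix (Fin 3) (Fin 3) F) : Fin 3 → F :=
  ![g.det / firstNonzero (bottomMinor g 0 1) (bottomMinor g 0 2) (bottomMinor g 1 2),
    firstNonzero (bottomMinor g 0 1) (bottomMinor g 0 2) (bottomMinor g 1 2) /
      firstNonzero (g 2 0) (g 2 1) (g 2 2),
    firstNonzero (g 2 0) (g 2 1) (g 2 2)]

/-- The upper triangular unipotent matrix with coordinates `x, y, z`. -/
def unip (x y z : F) : Matrix (Fin 3) (Fin 3) F :=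
  !![1, x, z; 0, 1, y; 0, 0, 1]

/-- The simple reflections. -/
def simpleRefl : Fin 2 → Matrix (Fin 3) (Fin 3) F :=
  ![!![0, -1, 0; 1, 0, 0; 0, 0, 1], !![1, 0, 0; 0, 0, -1; 0, 1, 0]]

/-- The product of the simple reflections in a word. -/
def wordProd (l : List (Fin 2)) : Matrix (Fin 3) (Fin 3) F := (l.map simpleRefl).prod

open Classical in
/-- The reduced word of the Weyl group part of `g`. -/
def bruhatWord (g : Matrix (Fin 3) (Fin 3) F) : List (Fin 2) :=
  if g 2 0 ≠ 0 then
    if bottomMinor g 0 1 ≠ 0 then [0, 1, 0] else [1, 0]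
  else if g 2 1 ≠ 0 then
    if bottomMinor g 0 1 ≠ 0 then [0, 1] else [1]
  else if bottomMinor g 0 2 ≠ 0 then [0] else []

open Classical in
/-- An upper triangular unipotent `n'` such that `g ∈ B w n'`, `w` the product of the word
`bruhatWord g`. -/
def bruhatRight (g : Matrix (Fin 3) (Fin 3) F) : Matrix (Fin 3) (Fin 3) F :=
  if g 2 0 ≠ 0 then
    if bottomMinor g 0 1 ≠ 0 then
      unip (g 2 1 / g 2 0) (bottomMinor g 0 2 / bottomMinor g 0 1) (g 2 2 / g 2 0)
    else unip (g 2 1 / g 2 0) 0 (g 2 2 / g 2 0)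
  else if g 2 1 ≠ 0 then
    if bottomMinor g 0 1 ≠ 0 then
      unip 0 (g 2 2 / g 2 1) (-(bottomMinor g 1 2 / bottomMinor g 0 1))
    else unip 0 (g 2 2 / g 2 1) 0
  else if bottomMinor g 0 2 ≠ 0 then unip (bottomMinor g 1 2 / bottomMinor g 0 2) 0 0
  else 1

end Bruhat

/-! ### The block compatible cocycle of Banks, Levy and Sepanski on `GL₃(F)` for the cubic cover

It is determined by its values on generators on the left, by means of the section `sec g = (g, 1)`:
* `sec (n g n') = sec n * sec g * sec n'` for `n, n'` upper triangular unipotent;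
* `sec g = sec n * sec t * sec s_{a₁} * ⋯ * sec s_{aₖ} * sec n'` for a Bruhat decomposition with a
  reduced word;
* `σ(t, g) = ∏_{i < j} (tᵢ, t(g)ⱼ)` for diagonal `t`, where `t(g)` is the diagonal part of `g`;
* `σ(s_a, g) = (t(g)_{a+1}, t(s_a g)_{a+1})` for a simple reflection in rows `a, a+1`, which is
  Kubota's cocycle for `GL₂`.
-/

section Cocycle

variable {F : Type*} [Field F] [ValuativeRel F] [TopologicalSpace F]
  [IsNonarchimedeanLocalField F]

/-- `σ(s_a, g)`. -/
def reflCocycle (a : Fin 2) (g : Matrix (Fin 3) (Fin 3) F) : rootsOfUnity 3 F :=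
  hilbertSymbol (torusPart g a.succ) (torusPart (simpleRefl a * g) a.succ)

/-- The root of unity `z` with `sec s_{a₁} * ⋯ * sec s_{aₖ} * sec g = (s_{a₁} ⋯ s_{aₖ} g, z)`. -/
def wordCocycle : List (Fin 2) → Matrix (Fin 3) (Fin 3) F → rootsOfUnity 3 F
  | [], _ => 1
  | a :: l, g => reflCocycle a (wordProd l * g) * wordCocycle l g

/-- `∏_{i < j} (tᵢ, uⱼ)`. -/
def torusCocycle (t u : Fin 3 → F) : rootsOfUnity 3 F :=
  hilbertSymbol (t 0) (u 1) * hilbertSymbol (t 0) (u 2) * hilbertSymbol (t 1) (u 2)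

/-- The block compatible `2`-cocycle `σ(g, h)` (meaningful for invertible `g`, `h`). -/
def blockCocycle (g h : Matrix (Fin 3) (Fin 3) F) : rootsOfUnity 3 F :=
  torusCocycle (torusPart g) (torusPart (wordProd (bruhatWord g) * (bruhatRight g * h))) *
    wordCocycle (bruhatWord g) (bruhatRight g * h)

end Cocycle

/-! ### The cubic cover of `SL₃(F)` -/

/-- The underlying set `SL₃(F) × μ₃` of the cubic metaplectic cover `G'` of `SL₃(F)`. -/
@[ext]
structure MetaSL3 (F : Type*) [Field F] where
  /-- the projection to `SL₃(F)` -/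
  mat : Matrix.SpecialLinearGroup (Fin 3) F
  /-- the component in `μ₃` -/
  root : rootsOfUnity 3 F

section Cover

variable {F : Type*} [Field F] [ValuativeRel F] [TopologicalSpace F]
  [IsNonarchimedeanLocalField F]

/-- The group operation `(g₁, z₁) (g₂, z₂) = (g₁ g₂, z₁ z₂ σ(g₁, g₂))` of `G'`. -/
instance : Mul (MetaSL3 F) :=
  ⟨fun x y => ⟨x.mat * y.mat, x.root * y.root * blockCocycle x.mat.1 y.mat.1⟩⟩

/-- The section `g ↦ (g, 1)`. -/
def sec (g : Matrix.SpecialLinearGroup (Fin 3) F) : MetaSL3 F := ⟨g, 1⟩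

/-- The central embedding `z ↦ (e, z)` of `μ₃`. -/
def central (ζ : rootsOfUnity 3 F) : MetaSL3 F := ⟨1, ζ⟩

/-- The element of `N` with coordinates `x, y, z`. -/
def unipSL (x y z : F) : Matrix.SpecialLinearGroup (Fin 3) F :=
  ⟨unip x y z, by simp [unip, Matrix.det_fin_three]⟩

/-- The matrix `diag(ϖ^a, ϖ^b, ϖ^c)` with `a + b + c = 0`. -/
def diagPow (ϖ : Fˣ) (a b c : ℤ) (h : a + b + c = 0) :
    Matrix.SpecialLinearGroup (Fin 3) F :=
  ⟨Matrix.diagonal ![(ϖ : F) ^ a, (ϖ : F) ^ b, (ϖ : F) ^ c], by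
    rw [Matrix.det_diagonal, Fin.prod_univ_three]
    simp [← zpow_add₀ ϖ.ne_zero, h]⟩

/-- `c_{i,j} = diag(ϖ^{-j}, ϖ^{j-i}, ϖ^i)`. -/
def cMat (ϖ : Fˣ) (i j : ℤ) : Matrix.SpecialLinearGroup (Fin 3) F :=
  diagPow ϖ (-j) (j - i) i (by ring)

/-- `d'_{m,n} = diag(ϖ^{-n-2m}, ϖ^{m-n}, ϖ^{2n+m})`. -/
def dMat (ϖ : Fˣ) (m n : ℤ) : Matrix.SpecialLinearGroup (Fin 3) F :=
  diagPow ϖ (-n - 2 * m) (m - n) (2 * n + m) (by ring)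

/-- The inclusion of `K₁ = SL₃(𝒪)` in `SL₃(F)`. -/
def inclK (k : Matrix.SpecialLinearGroup (Fin 3) 𝒪[F]) :
    Matrix.SpecialLinearGroup (Fin 3) F :=
  Matrix.SpecialLinearGroup.map (algebraMap 𝒪[F] F) k

/-- `κ` splits the cover over `K₁`, i.e. `k ↦ (k, κ(k))` is multiplicative on `K₁`. -/
def IsSplitting (κ : Matrix.SpecialLinearGroup (Fin 3) 𝒪[F] → rootsOfUnity 3 F) : Prop :=
  ∀ k₁ k₂, κ (k₁ * k₂) = κ k₁ * κ k₂ * blockCocycle (inclK k₁).1 (inclK k₂).1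

/-- The map `k ↦ (k, κ(k))`, whose image is `K'`. -/
def liftK (κ : Matrix.SpecialLinearGroup (Fin 3) 𝒪[F] → rootsOfUnity 3 F)
    (k : Matrix.SpecialLinearGroup (Fin 3) 𝒪[F]) : MetaSL3 F := ⟨inclK k, κ k⟩

/-- `f` is the basis element `f'_{m,n}` of the anti-genuine spherical Hecke algebra: it is
anti-genuine, bi-`K'`-invariant, supported on `K' sec(d'_{m,n}) K' μ₃`, with value `1` at
`sec(d'_{m,n})`.  (Smoothness and compactness of the support follow, `K'` being compact and
open.) -/
structure IsHeckeBasis (ι : rootsOfUnity 3 F ≃* rootsOfUnity 3 ℂ) (ϖ : Fˣ)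
    (κ : Matrix.SpecialLinearGroup (Fin 3) 𝒪[F] → rootsOfUnity 3 F) (m n : ℕ)
    (f : MetaSL3 F → ℂ) : Prop where
  antigenuine : ∀ ζ x, f (central ζ * x) = (toComplex ι ζ)⁻¹ * f x
  left_invariant : ∀ k x, f (liftK κ k * x) = f x
  right_invariant : ∀ k x, f (x * liftK κ k) = f x
  support : ∀ x, f x ≠ 0 →
    ∃ k₁ k₂ ζ, x = liftK κ k₁ * sec (dMat ϖ m n) * liftK κ k₂ * central ζ
  value : f (sec (dMat ϖ m n)) = 1

/-- Right translation `(R(x) f)(y) = f(y x)`. -/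
def rightTranslate (x : MetaSL3 F) (f : MetaSL3 F → ℂ) : MetaSL3 F → ℂ := fun y => f (y * x)

/-- The integrand `u ↦ f(u) θ(u)` on `N`, in the coordinates `(x, y, z)` of `u`, where
`θ(u) = ψ(x + y)`. -/
def whittakerIntegrand (ψ : AddChar F Circle) (f : MetaSL3 F → ℂ) (u : F × F × F) : ℂ :=
  f (sec (unipSL u.1 u.2.1 u.2.2)) * (ψ (u.1 + u.2.1) : ℂ)

/-- The linear form `W'(f) = ∫_N f(u) θ(u) du`. -/
def whittaker [MeasurableSpace F] (μ : Measure F) (ψ : AddChar F Circle)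
    (f : MetaSL3 F → ℂ) : ℂ :=
  ∫ u, whittakerIntegrand ψ f u ∂(μ.prod (μ.prod μ))

/-- `Ψ'(i, j) = W'(R(sec(c_{i,j}⁻¹)) f)`. -/
def whittakerCoeff [MeasurableSpace F] (μ : Measure F) (ψ : AddChar F Circle) (ϖ : Fˣ)
    (f : MetaSL3 F → ℂ) (i j : ℤ) : ℂ :=
  whittaker μ ψ (rightTranslate (sec (cMat ϖ i j)⁻¹) f)

end Cover

end

end CubicCover

set_option linter.unusedSectionVars false
set_option linter.unusedSimpArgs false
set_option linter.unusedVariables false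

namespace CubicCover

noncomputable section

/-! Let D = c_{i,j}⁻¹ = diag(ϖ^e₀, ϖ^e₁, ϖ^(−e₀−e₁)), where e₀ = j and e₁ = i − j. The inequalities
on (i, j) say that the exponents of D decrease. The function to be integrated against ψ(x + y) is
`phi f D`, the value of f at sec(u) sec(D). It is left invariant under N(𝒪). It is multiplied by
powers of χ = (·, ϖ) under the unit torus (`phi_torus`). Integral lower unipotent matrices can be
inserted between u and D without changing it, because D⁻¹ conjugates them into integral ones
(`absorb`).

Let C(x, y) be the integral of `phi f D` over the central coordinate z. Outside ϖ⁻¹𝒪, adding an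
element of ϖ⁻¹𝒪 to x or to y amounts to multiplication by the cube of a 1-unit, up to 𝒪, and such a
multiplication is realised by the torus. So C does not change, while ψ is not trivial on ϖ⁻¹𝒪, and
only x, y ∈ ϖ⁻¹𝒪 contribute (`whittaker_eq_iterated`). There C depends on residues only. Rank-one
reflections express it through a constant and the values of f at the six torus elements w(D + ρ) −
ρ, written in exponents with ρ = (1, 0, −1) and w in the Weyl group (`centralIntegral_residual`).
The constant dies against ψ. The other terms are Gauss sums, with one Jacobi sum; the relations
𝔤·conj 𝔤 = q and 𝔤 J(χ, χ) = (conj 𝔤)² turn the coefficients into 1, conj 𝔤, q², q² conj 𝔤 according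
to the length of w (`whittaker_formula`). By elementary divisors, f is 1 at a torus power of ϖ whose
exponents are a permutation of those of d'_{m,n}, and 0 at the others (`Admissible.sec_eq`). This
gives six pairwise distinct pairs (i, j).

The cover has to be built before this makes sense. The explicit σ is a cocycle because the elements
that associate on the left form a set closed under products (`Nuc.mul`), which contains N, the torus
and the simple reflections, hence everything by the Bruhat decomposition. The reflections are the
real case: they rest on the Steinberg relation applied to leading terms of rows and minors
(`rank_one`, `wc_braid`).

On SL₃(𝒪) the splitting is forced on an open cell to be the inverse of σ(w₀, g) and is extended by
integral unipotent translation. Multiplicativity is checked on generators (`kap_mul`), and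
uniqueness holds because SL₃(𝒪) has no nontrivial character of order three (`IsInt.char_trivial`).

Computations in the cover are kept free of cocycles by one remark: the kernel μ₃ is central of
exponent three, so the cube of an element depends only on its matrix. Since 3 is a unit, unipotent
matrices are cubes, and conjugation relations between them lift automatically (`conj_cube`). Only
the unit torus produces roots of unity. Its commutation with sec(d'_{m,n}) is guaranteed by
congruent exponents modulo 3, which is why f'_{m,n} exists (`sec_pT_lift`, `InCoset.unique`). -/

/-- Residue characteristic different from `2` and `3`, and cube roots of unity in `F`. -/
class TameCubic (F : Type*) [Field F] [ValuativeRel F] : Prop where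
  two : valuation F 2 = 1
  three : valuation F 3 = 1
  root : ∃ ρ : F, IsPrimitiveRoot ρ 3

/-! ### Valuation, residues and the tame cubic symbol -/

section Symbol

variable {F : Type*} [Field F] [ValuativeRel F] [TopologicalSpace F]
  [IsNonarchimedeanLocalField F]

local notation "v" => valuation F

lemma v_ne_zero {x : F} (hx : x ≠ 0) : v x ≠ 0 := (Valuation.ne_zero_iff _).2 hx

lemma iso_ne_zero {x : F} (hx : x ≠ 0) :
    IsNonarchimedeanLocalField.valueGroupWithZeroIsoInt F (v x) ≠ 0 := by
  simpa using hx

lemma val_mul {x y : F} (hx : x ≠ 0) (hy : y ≠ 0) : val (x * y) = val x + val y := by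
  unfold val
  rw [map_mul, map_mul, WithZero.log_mul (iso_ne_zero hx) (iso_ne_zero hy)]
  ring

@[simp] lemma val_one : val (1 : F) = 0 := by simp [val]

@[simp] lemma val_neg (x : F) : val (-x) = val x := by simp [val, Valuation.map_neg]

@[simp] lemma val_inv (x : F) : val x⁻¹ = - val x := by
  simp [val, map_inv₀, WithZero.log_inv]

lemma val_div {x y : F} (hx : x ≠ 0) (hy : y ≠ 0) : val (x / y) = val x - val y := by
  rw [div_eq_mul_inv, val_mul hx (inv_ne_zero hy), val_inv]; ring

lemma val_zpow (x : F) (n : ℤ) : val (x ^ n) = n * val x := by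
  simp [val, map_zpow₀, WithZero.log_zpow]

lemma val_pow (x : F) (n : ℕ) : val (x ^ n) = n * val x := by
  simpa using val_zpow x n

lemma v_le_iff {x y : F} (hx : x ≠ 0) (hy : y ≠ 0) : v x ≤ v y ↔ val y ≤ val x := by
  unfold val
  rw [neg_le_neg_iff, WithZero.log_le_log (iso_ne_zero hx) (iso_ne_zero hy)]
  simp

lemma v_lt_iff {x y : F} (hx : x ≠ 0) (hy : y ≠ 0) : v x < v y ↔ val y < val x := by
  rw [← not_le, ← not_le, v_le_iff hy hx]

lemma v_eq_iff {x y : F} (hx : x ≠ 0) (hy : y ≠ 0) : v x = v y ↔ val x = val y := by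
  rw [le_antisymm_iff, v_le_iff hx hy, v_le_iff hy hx, le_antisymm_iff, and_comm]

lemma v_le_one_iff {x : F} (hx : x ≠ 0) : v x ≤ 1 ↔ 0 ≤ val x := by
  simpa using v_le_iff hx (one_ne_zero (α := F))

lemma v_lt_one_iff {x : F} (hx : x ≠ 0) : v x < 1 ↔ 0 < val x := by
  simpa using v_lt_iff hx (one_ne_zero (α := F))

lemma v_eq_one_iff {x : F} (hx : x ≠ 0) : v x = 1 ↔ val x = 0 := by
  simpa using v_eq_iff hx (one_ne_zero (α := F))

lemma ne_zero_of_v {x : F} (hx : v x = 1) : x ≠ 0 := by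
  rintro rfl; simp at hx

lemma val_of_v {x : F} (hx : v x = 1) : val x = 0 := (v_eq_one_iff (ne_zero_of_v hx)).1 hx

/-! Congruences modulo the maximal ideal -/

lemma v_add_lt {x y : F} (hx : v x < 1) (hy : v y < 1) : v (x + y) < 1 :=
  Valuation.map_add_lt _ hx hy

lemma v_add_le {x y : F} (hx : v x ≤ 1) (hy : v y ≤ 1) : v (x + y) ≤ 1 :=
  Valuation.map_add_le _ hx hy

lemma v_sub_lt {x y : F} (hx : v x < 1) (hy : v y < 1) : v (x - y) < 1 :=
  Valuation.map_sub_lt _ hx hy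

lemma v_sub_le {x y : F} (hx : v x ≤ 1) (hy : v y ≤ 1) : v (x - y) ≤ 1 :=
  (Valuation.map_sub _ _ _).trans (max_le hx hy)

lemma v_mul_le {x y : F} (hx : v x ≤ 1) (hy : v y ≤ 1) : v (x * y) ≤ 1 := by
  rw [map_mul]; exact mul_le_one' hx hy

lemma v_mul_lt {x y : F} (hx : v x ≤ 1) (hy : v y < 1) : v (x * y) < 1 := by
  rw [map_mul]; exact mul_lt_one_of_nonneg_of_lt_one_right hx zero_le hy

lemma v_mul_lt' {x y : F} (hx : v x < 1) (hy : v y ≤ 1) : v (x * y) < 1 := by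
  rw [mul_comm]; exact v_mul_lt hy hx

lemma v_unit_mul {x y : F} (hx : v x = 1) (hy : v y = 1) : v (x * y) = 1 := by
  rw [map_mul, hx, hy, one_mul]

lemma v_unit_div {x y : F} (hx : v x = 1) (hy : v y = 1) : v (x / y) = 1 := by
  rw [map_div₀, hx, hy, div_one]

lemma v_unit_of_cong {x y : F} (hx : v x = 1) (h : v (x - y) < 1) : v y = 1 := by
  have : y = x + (y - x) := by ring
  rw [this, Valuation.map_add_eq_of_lt_left _ (by rw [hx, Valuation.map_sub_swap]; exact h), hx]

lemma v_eq_one_of_not_lt {x : F} (hx : v x ≤ 1) (h : ¬ v x < 1) : v x = 1 :=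
  le_antisymm hx (not_lt.1 h)

lemma v_unit_add {x y : F} (hx : v x = 1) (h : v y < 1) : v (x + y) = 1 := by
  rw [Valuation.map_add_eq_of_lt_left _ (by rw [hx]; exact h), hx]

/-! Residues -/

/-- The residue class of an integral element (junk value `0` otherwise). -/
def red (x : F) : 𝓀[F] := open Classical in
  if h : v x ≤ 1 then IsLocalRing.residue 𝒪[F] ⟨x, h⟩ else 0

lemma red_eq {x : F} (hx : v x ≤ 1) : red x = IsLocalRing.residue 𝒪[F] ⟨x, hx⟩ := dif_pos hx

lemma red_eq_zero {x : F} (hx : v x ≤ 1) : red x = 0 ↔ v x < 1 := by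
  rw [red_eq hx, IsLocalRing.residue_eq_zero_iff]
  exact Valuation.Integer.not_isUnit_iff_valuation_lt_one (x := (⟨x, hx⟩ : 𝒪[F]))

lemma red_mul {x y : F} (hx : v x ≤ 1) (hy : v y ≤ 1) : red (x * y) = red x * red y := by
  rw [red_eq hx, red_eq hy, red_eq (v_mul_le hx hy), ← map_mul]; rfl

lemma red_add {x y : F} (hx : v x ≤ 1) (hy : v y ≤ 1) : red (x + y) = red x + red y := by
  rw [red_eq hx, red_eq hy, red_eq (v_add_le hx hy), ← map_add]; rfl

lemma red_sub {x y : F} (hx : v x ≤ 1) (hy : v y ≤ 1) : red (x - y) = red x - red y := by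
  rw [red_eq hx, red_eq hy, red_eq (v_sub_le hx hy), ← map_sub]; rfl

@[simp] lemma red_one : red (1 : F) = 1 := by
  rw [red_eq (by simp), ← map_one (IsLocalRing.residue 𝒪[F])]; rfl

lemma v_pow_le {x : F} (hx : v x ≤ 1) (n : ℕ) : v (x ^ n) ≤ 1 := by
  rw [map_pow]; exact pow_le_one' hx n

lemma red_pow {x : F} (hx : v x ≤ 1) (n : ℕ) : red (x ^ n) = red x ^ n := by
  rw [red_eq hx, red_eq (v_pow_le hx n), ← map_pow]; rfl

lemma red_surjective (a : 𝓀[F]) : ∃ x : F, v x ≤ 1 ∧ red x = a := by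
  obtain ⟨⟨x, hx⟩, rfl⟩ := IsLocalRing.residue_surjective a
  exact ⟨x, hx, red_eq hx⟩

lemma cong_iff_red {x y : F} (hx : v x ≤ 1) (hy : v y ≤ 1) : v (x - y) < 1 ↔ red x = red y := by
  rw [← red_eq_zero (v_sub_le hx hy), red_sub hx hy, sub_eq_zero]

/-! Cube roots of unity -/

lemma v_root (ζ : rootsOfUnity 3 F) : v ((ζ : Fˣ) : F) = 1 := by
  have h : ((ζ : Fˣ) : F) ^ 3 = 1 := by
    have := ζ.2; rw [mem_rootsOfUnity] at this
    simpa using congrArg Units.val this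
  have h2 := congrArg v h
  rw [map_pow, map_one] at h2
  exact (pow_eq_one_iff_of_nonneg zero_le (by norm_num)).1 h2

lemma root_cube (ζ : rootsOfUnity 3 F) : ζ ^ 3 = 1 := by
  ext
  have := ζ.2; rw [mem_rootsOfUnity] at this
  simpa using congrArg Units.val this

variable [TameCubic F]

/-- If a ≡ b, then a² + ab + b² ≡ 3b² is a unit, so the other factor a − b of a³ − b³ = 0 must
vanish. -/
lemma root_unique {ζ ξ : rootsOfUnity 3 F} (h : v (((ζ : Fˣ) : F) - ((ξ : Fˣ) : F)) < 1) :
    ζ = ξ := by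
  set a : F := ((ζ : Fˣ) : F) with ha
  set b : F := ((ξ : Fˣ) : F) with hb
  have hva : v a = 1 := v_root ζ
  have hvb : v b = 1 := v_root ξ
  have ha3 : a ^ 3 = 1 := by
    simpa using congrArg (fun z : rootsOfUnity 3 F => ((z : Fˣ) : F)) (root_cube ζ)
  have hb3 : b ^ 3 = 1 := by
    simpa using congrArg (fun z : rootsOfUnity 3 F => ((z : Fˣ) : F)) (root_cube ξ)
  have hab : (a - b) * (a ^ 2 + a * b + b ^ 2) = 0 := by linear_combination ha3 - hb3
  rcases mul_eq_zero.1 hab with h0 | h0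
  · ext; exact sub_eq_zero.1 h0
  · exfalso
    have h3 : 3 * b ^ 2 = -((a - b) * (a + 2 * b)) := by linear_combination h0
    have : v (3 * b ^ 2) = 1 := by rw [map_mul, map_pow, hvb, TameCubic.three]; simp
    rw [h3, Valuation.map_neg] at this
    have h4 : v ((a - b) * (a + 2 * b)) < 1 := by
      refine v_mul_lt' h (v_add_le hva.le ?_)
      rw [map_mul, TameCubic.two, hvb, one_mul]
    rw [this] at h4; exact lt_irrefl _ h4

instance : Fintype 𝓀[F] := Fintype.ofFinite _

lemma resCard_eq : resCard F = Fintype.card 𝓀[F] := Nat.card_eq_fintype_card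

lemma exists_primitive : ∃ ρ : F, IsPrimitiveRoot ρ 3 ∧ v ρ = 1 ∧ 1 + ρ + ρ ^ 2 = 0 ∧
    red ρ ≠ 1 := by
  obtain ⟨ρ, hρ⟩ := TameCubic.root (F := F)
  have h3 : ρ ^ 3 = 1 := hρ.pow_eq_one
  have hv : v ρ = 1 := by
    have h2 := congrArg v h3
    rw [map_pow, map_one] at h2
    exact (pow_eq_one_iff_of_nonneg zero_le (by norm_num)).1 h2
  have hsum : 1 + ρ + ρ ^ 2 = 0 := by
    have h0 : (ρ - 1) * (1 + ρ + ρ ^ 2) = 0 := by linear_combination h3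
    rcases mul_eq_zero.1 h0 with h | h
    · exact absurd (sub_eq_zero.1 h) (hρ.ne_one (by norm_num))
    · exact h
  refine ⟨ρ, hρ, hv, hsum, fun h => ?_⟩
  rw [← red_one, ← cong_iff_red hv.le (by simp)] at h
  have h3 : (3 : F) = -((ρ - 1) * (ρ + 2)) := by linear_combination hsum
  have : v (3 : F) = 1 := TameCubic.three
  rw [h3, Valuation.map_neg] at this
  have h4 : v ((ρ - 1) * (ρ + 2)) < 1 :=
    v_mul_lt' h (v_add_le hv.le (TameCubic.two (F := F)).le)
  rw [this] at h4; exact lt_irrefl _ h4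

lemma three_dvd : 3 ∣ resCard F - 1 := by
  obtain ⟨ρ, hρ, hv, -, hr⟩ := exists_primitive (F := F)
  have h3 : red ρ ^ 3 = 1 := by rw [← red_pow hv.le, hρ.pow_eq_one, red_one]
  have h0 : red ρ ≠ 0 := by rw [Ne, red_eq_zero hv.le, hv]; exact lt_irrefl _
  have h1 : red ρ ^ (resCard F - 1) = 1 := by
    rw [resCard_eq]; exact FiniteField.pow_card_sub_one_eq_one _ h0
  have : orderOf (red ρ) = 3 := orderOf_eq_prime h3 hr
  rw [← this]; exact orderOf_dvd_of_pow_eq_one h1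

/-- Ensures that `hilbertSymbol` is never given by its default value: the power has a residue whose
cube is 1, and the residues of 1, ρ, ρ² exhaust the roots of X³ − 1 in the residue field. -/
lemma exists_root {u : F} (hu : v u = 1) :
    ∃ ζ : rootsOfUnity 3 F, v (u ^ ((resCard F - 1) / 3) - ((ζ : Fˣ) : F)) < 1 := by
  obtain ⟨ρ, hρ, hv, hsum, -⟩ := exists_primitive (F := F)
  have h3 : ρ ^ 3 = 1 := hρ.pow_eq_one
  set w : F := u ^ ((resCard F - 1) / 3) with hw
  have hvw : v w = 1 := by rw [hw, map_pow, hu, one_pow]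
  have hw3 : red w ^ 3 = 1 := by
    rw [← red_pow hvw.le, hw, ← pow_mul, Nat.div_mul_cancel three_dvd, red_pow hu.le, resCard_eq]
    apply FiniteField.pow_card_sub_one_eq_one
    rw [Ne, red_eq_zero hu.le, hu]; exact lt_irrefl _
  have hs : 1 + red ρ + red ρ ^ 2 = 0 := by
    have := congrArg red hsum
    rw [red_add (v_add_le (by simp) hv.le) (v_pow_le hv.le 2), red_add (by simp) hv.le,
      red_pow hv.le, red_one] at this
    rw [this, red_eq_zero (by simp)]; simp
  have hprod : (red w - 1) * ((red w - red ρ) * (red w - red ρ ^ 2)) = 0 := by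
    linear_combination hw3 + (-(red w)^2 + red w * red ρ - red ρ + 1 ) * hs
  have key : ∀ n : ℕ, red w = red ρ ^ n →
      ∃ ζ : rootsOfUnity 3 F, v (w - ((ζ : Fˣ) : F)) < 1 := by
    intro n hn
    have hu : (Units.mk0 ρ (ne_zero_of_v hv)) ^ 3 = 1 := by ext; simpa using h3
    refine ⟨⟨(Units.mk0 ρ (ne_zero_of_v hv)) ^ n, ?_⟩, ?_⟩
    · rw [mem_rootsOfUnity, ← pow_mul, mul_comm, pow_mul, hu, one_pow]
    · simp only [Units.val_pow_eq_pow_val, Units.val_mk0]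
      rw [cong_iff_red hvw.le (v_pow_le hv.le n), red_pow hv.le, hn]
  rcases mul_eq_zero.1 hprod with h | h
  · exact key 0 (by simpa using sub_eq_zero.1 h)
  rcases mul_eq_zero.1 h with h | h
  · exact key 1 (by simpa using sub_eq_zero.1 h)
  · exact key 2 (sub_eq_zero.1 h)

lemma v_tameUnit {x y : F} (hx : x ≠ 0) (hy : y ≠ 0) : v (tameUnit x y) = 1 := by
  have h1 : x ^ val y ≠ 0 := zpow_ne_zero _ hx
  have h2 : y ^ val x ≠ 0 := zpow_ne_zero _ hy
  have h3 : ((-1 : F) ^ (val x * val y)) ≠ 0 := zpow_ne_zero _ (by simp)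
  unfold tameUnit
  rw [v_eq_one_iff (div_ne_zero (mul_ne_zero h3 h1) h2), val_div (mul_ne_zero h3 h1) h2,
    val_mul h3 h1, val_zpow, val_zpow, val_zpow]
  simp; ring

lemma hilbert_spec {x y : F} (hx : x ≠ 0) (hy : y ≠ 0) :
    v (tameUnit x y ^ ((resCard F - 1) / 3) - ((hilbertSymbol x y : Fˣ) : F)) < 1 := by
  have h := exists_root (v_tameUnit hx hy)
  unfold hilbertSymbol
  rw [dif_pos h]; exact h.choose_spec

lemma hilbert_eq_of {x y : F} (hx : x ≠ 0) (hy : y ≠ 0) {ζ : rootsOfUnity 3 F}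
    (h : red (tameUnit x y) ^ ((resCard F - 1) / 3) = red ((ζ : Fˣ) : F)) :
    hilbertSymbol x y = ζ := by
  apply root_unique
  have h1 := hilbert_spec hx hy
  have ht := (v_tameUnit hx hy).le
  rw [cong_iff_red (v_pow_le ht _) (v_root _).le, red_pow ht] at h1
  rw [cong_iff_red (v_root _).le (v_root _).le, ← h1, h]

lemma red_hilbert {x y : F} (hx : x ≠ 0) (hy : y ≠ 0) :
    red ((hilbertSymbol x y : Fˣ) : F) = red (tameUnit x y) ^ ((resCard F - 1) / 3) := by
  have h1 := hilbert_spec hx hy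
  have ht := (v_tameUnit hx hy).le
  rw [cong_iff_red (v_pow_le ht _) (v_root _).le, red_pow ht] at h1
  exact h1.symm

lemma hilbert_of_tame_mul {x y x' y' x'' y'' : F} (hx : x ≠ 0) (hy : y ≠ 0) (hx' : x' ≠ 0)
    (hy' : y' ≠ 0) (hx'' : x'' ≠ 0) (hy'' : y'' ≠ 0)
    (h : tameUnit x y = tameUnit x' y' * tameUnit x'' y'') :
    hilbertSymbol x y = hilbertSymbol x' y' * hilbertSymbol x'' y'' := by
  apply hilbert_eq_of hx hy
  have e : ((((hilbertSymbol x' y' * hilbertSymbol x'' y'' : rootsOfUnity 3 F) : Fˣ)) : F) =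
    ((hilbertSymbol x' y' : Fˣ) : F) * ((hilbertSymbol x'' y'' : Fˣ) : F) := by simp
  rw [e, red_mul (v_root _).le (v_root _).le, red_hilbert hx' hy', red_hilbert hx'' hy'', h,
    red_mul (v_tameUnit hx' hy').le (v_tameUnit hx'' hy'').le, mul_pow]

lemma hilbert_of_tame_one {x y : F} (hx : x ≠ 0) (hy : y ≠ 0)
    (h : v (tameUnit x y - 1) < 1) : hilbertSymbol x y = 1 := by
  apply hilbert_eq_of hx hy
  rw [cong_iff_red (v_tameUnit hx hy).le (by simp)] at h
  rw [h]; simp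

/-- The cubic Hilbert symbol, written additively. -/
def hs (x y : F) : Additive (rootsOfUnity 3 F) := Additive.ofMul (hilbertSymbol x y)

lemma hs_mul_left {x x' y : F} (hx : x ≠ 0) (hx' : x' ≠ 0) (hy : y ≠ 0) :
    hs (x * x') y = hs x y + hs x' y := by
  unfold hs
  rw [← ofMul_mul, hilbert_of_tame_mul (mul_ne_zero hx hx') hy hx hy hx' hy]
  unfold tameUnit
  rw [val_mul hx hx', add_mul, zpow_add₀ (by simp), zpow_add₀ hy, mul_zpow]
  ring

lemma hs_mul_right {x y y' : F} (hx : x ≠ 0) (hy : y ≠ 0) (hy' : y' ≠ 0) :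
    hs x (y * y') = hs x y + hs x y' := by
  unfold hs
  rw [← ofMul_mul, hilbert_of_tame_mul hx (mul_ne_zero hy hy') hx hy hx hy']
  unfold tameUnit
  rw [val_mul hy hy', mul_add, zpow_add₀ (by simp), zpow_add₀ hx, mul_zpow]
  ring

lemma three_hs (a : Additive (rootsOfUnity 3 F)) : 3 • a = 0 := by
  have := root_cube a.toMul
  rw [← ofMul_eq_zero, ofMul_pow] at this
  exact this

@[simp] lemma hs_one_left {y : F} (hy : y ≠ 0) : hs 1 y = 0 := by
  have := hs_mul_left (one_ne_zero (α := F)) one_ne_zero hy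
  rw [one_mul] at this
  exact left_eq_add.1 this

@[simp] lemma hs_one_right {x : F} (hx : x ≠ 0) : hs x 1 = 0 := by
  have := hs_mul_right hx (one_ne_zero (α := F)) one_ne_zero
  rw [one_mul] at this
  exact left_eq_add.1 this

lemma hs_inv_left {x y : F} (hx : x ≠ 0) (hy : y ≠ 0) : hs x⁻¹ y = - hs x y := by
  have := hs_mul_left hx (inv_ne_zero hx) hy
  rw [mul_inv_cancel₀ hx, hs_one_left hy] at this
  exact (neg_eq_of_add_eq_zero_right this.symm).symm

lemma hs_inv_right {x y : F} (hx : x ≠ 0) (hy : y ≠ 0) : hs x y⁻¹ = - hs x y := by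
  have := hs_mul_right hx hy (inv_ne_zero hy)
  rw [mul_inv_cancel₀ hy, hs_one_right hx] at this
  exact (neg_eq_of_add_eq_zero_right this.symm).symm

lemma hs_div_left {x x' y : F} (hx : x ≠ 0) (hx' : x' ≠ 0) (hy : y ≠ 0) :
    hs (x / x') y = hs x y - hs x' y := by
  rw [div_eq_mul_inv, hs_mul_left hx (inv_ne_zero hx') hy, hs_inv_left hx' hy, sub_eq_add_neg]

lemma hs_div_right {x y y' : F} (hx : x ≠ 0) (hy : y ≠ 0) (hy' : y' ≠ 0) :
    hs x (y / y') = hs x y - hs x y' := by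
  rw [div_eq_mul_inv, hs_mul_right hx hy (inv_ne_zero hy'), hs_inv_right hx hy', sub_eq_add_neg]

lemma hs_pow_left {x y : F} (hx : x ≠ 0) (hy : y ≠ 0) (n : ℕ) : hs (x ^ n) y = n • hs x y := by
  induction n with
  | zero => simp [hs_one_left hy]
  | succ n ih => rw [pow_succ, hs_mul_left (pow_ne_zero _ hx) hx hy, ih, succ_nsmul]

lemma hs_zpow_left {x y : F} (hx : x ≠ 0) (hy : y ≠ 0) (n : ℤ) : hs (x ^ n) y = n • hs x y := by
  cases n with
  | ofNat n => simpa using hs_pow_left hx hy n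
  | negSucc n =>
    rw [zpow_negSucc, hs_inv_left (pow_ne_zero _ hx) hy, hs_pow_left hx hy, negSucc_zsmul]

lemma hs_antisymm {x y : F} (hx : x ≠ 0) (hy : y ≠ 0) : hs x y = - hs y x := by
  rw [eq_neg_iff_add_eq_zero]
  unfold hs
  rw [← ofMul_mul, ofMul_eq_zero,
    ← hilbert_of_tame_mul (one_ne_zero (α := F)) one_ne_zero hx hy hy hx]
  · have := hs_one_left (one_ne_zero (α := F))
    exact this
  · have h1 : x ^ val y ≠ 0 := zpow_ne_zero _ hx
    have h2 : y ^ val x ≠ 0 := zpow_ne_zero _ hy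
    have h3 : ((-1 : F) ^ (val x * val y)) * ((-1 : F) ^ (val x * val y)) = 1 := by
      rw [← mul_zpow]; simp
    unfold tameUnit
    rw [mul_comm (val y) (val x)]
    field_simp
    simpa [sq] using h3.symm

lemma hs_zpow_right {x y : F} (hx : x ≠ 0) (hy : y ≠ 0) (n : ℤ) : hs x (y ^ n) = n • hs x y := by
  rw [hs_antisymm hx (zpow_ne_zero _ hy), hs_zpow_left hy hx, hs_antisymm hx hy, zsmul_neg]

@[simp] lemma hs_neg_one_left {y : F} (hy : y ≠ 0) : hs (-1) y = 0 := by
  have h := hs_pow_left (x := (-1 : F)) (by simp) hy 3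
  rw [three_hs] at h
  rwa [show ((-1 : F)) ^ 3 = -1 by ring] at h

@[simp] lemma hs_neg_left {x y : F} (hx : x ≠ 0) (hy : y ≠ 0) : hs (-x) y = hs x y := by
  rw [← neg_one_mul, hs_mul_left (by simp) hx hy, hs_neg_one_left hy, zero_add]

@[simp] lemma hs_neg_right {x y : F} (hx : x ≠ 0) (hy : y ≠ 0) : hs x (-y) = hs x y := by
  rw [hs_antisymm hx (neg_ne_zero.2 hy), hs_neg_left hy hx, ← hs_antisymm hx hy]

-- Antisymmetry makes this element 2-torsion, and the group is 3-torsion.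
@[simp] lemma hs_self {x : F} (hx : x ≠ 0) : hs x x = 0 := by
  have h := hs_antisymm hx hx
  have h3 := three_hs (hs x x)
  have : hs x x + hs x x = 0 := by nth_rw 1 [h]; simp
  have e : 3 • hs x x = (hs x x + hs x x) + hs x x := by abel
  rw [e, this, zero_add] at h3; exact h3

lemma hs_unit_unit {x y : F} (hx : v x = 1) (hy : v y = 1) : hs x y = 0 := by
  unfold hs
  rw [ofMul_eq_zero]
  apply hilbert_of_tame_one (ne_zero_of_v hx) (ne_zero_of_v hy)
  simp [tameUnit, val_of_v hx, val_of_v hy]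

lemma hs_one_unit_right {x y : F} (hx : x ≠ 0) (h : v (y - 1) < 1) : hs x y = 0 := by
  have hy : v y = 1 := v_unit_of_cong (x := 1) (by simp) (by rwa [Valuation.map_sub_swap])
  unfold hs
  rw [ofMul_eq_zero]
  apply hilbert_of_tame_one hx (ne_zero_of_v hy)
  have hr : red y = 1 := by
    rw [← red_one, ← cong_iff_red hy.le (by simp)]; exact h
  have key : ∀ n : ℕ, v (y ^ n - 1) < 1 := fun n => by
    rw [cong_iff_red (v_pow_le hy.le n) (by simp), red_pow hy.le, hr]; simp
  simp only [tameUnit, val_of_v hy, mul_zero, zpow_zero, mul_one, one_div]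
  rw [← zpow_neg]
  rcases (- val x).eq_nat_or_neg with ⟨n, h | h⟩ <;> rw [h]
  · simpa using key n
  · have hn : v (y ^ n) = 1 := by simp [hy]
    have : (y ^ (-(n : ℤ)) - 1) = -((y ^ n - 1) / y ^ n) := by
      have := ne_zero_of_v hn
      rw [zpow_neg, zpow_natCast]; field_simp; ring
    rw [this, Valuation.map_neg, map_div₀, hn, div_one]
    exact key n

lemma hs_cong_right {x y y' : F} (hx : x ≠ 0) (hy : v y = 1) (h : v (y - y') < 1) :
    hs x y = hs x y' := by
  have hy' := v_unit_of_cong hy h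
  rw [← sub_eq_zero, ← hs_div_right hx (ne_zero_of_v hy) (ne_zero_of_v hy')]
  apply hs_one_unit_right hx
  rw [show y / y' - 1 = (y - y') / y' by have := ne_zero_of_v hy'; field_simp, map_div₀, hy', div_one]
  exact h

/-- If x or y lies in 𝔭, the other is a 1-unit; two units pair trivially. If x is not integral,
y/(−x) is a 1-unit, and (x, y) reduces to (x, −x) = (x, x) = 1. -/
lemma hs_steinberg {x y : F} (hx : x ≠ 0) (hy : y ≠ 0) (h : x + y = 1) : hs x y = 0 := by
  have hxy : x = 1 - y := by rw [← h]; ring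
  have hyx : y = 1 - x := by rw [← h]; ring
  rcases lt_trichotomy (v x) 1 with h1 | h1 | h1
  · apply hs_one_unit_right hx
    rw [hyx]; simpa using h1
  · rcases lt_trichotomy (v y) 1 with h2 | h2 | h2
    · rw [hs_antisymm hx hy, hs_one_unit_right hy, neg_zero]
      rw [hxy]; simpa using h2
    · exact hs_unit_unit h1 h2
    · exfalso
      rw [hyx] at h2
      exact absurd h2 (not_lt.2 (v_sub_le (by simp) h1.le))
  · have hq : v (y / (-x) - 1) < 1 := by
      rw [show y / (-x) - 1 = - x⁻¹ by rw [hyx]; field_simp; ring, Valuation.map_neg, map_inv₀]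
      exact inv_lt_one_of_one_lt₀ h1
    have := hs_one_unit_right hx hq
    rw [hs_div_right hx hy (neg_ne_zero.2 hx), hs_neg_right hx hx, hs_self hx, sub_zero] at this
    exact this

/-- Leading-term form of a vanishing sum of three nonzero elements. -/
def Trop (P Q R : F) : Prop := P + Q + R = 0 ∨ P + Q = 0 ∨ Q + R = 0 ∨ P + R = 0

/-- A genuine relation P + Q + R = 0 is the Steinberg relation for −P/R and −Q/R. When just two of
the terms cancel, antisymmetry and (x, x) = 1 suffice. The Steinberg relation enters the cocycle
identities only in this form. -/
lemma hs_trop {P Q R : F} (hP : P ≠ 0) (hQ : Q ≠ 0) (hR : R ≠ 0) (h : Trop P Q R) :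
    hs P Q + hs Q R + hs R P = 0 := by
  rcases h with h | h | h | h
  · have e : (-P) / R + (-Q) / R = 1 := by
      rw [← add_div, div_eq_one_iff_eq hR]; linear_combination -h
    have := hs_steinberg (div_ne_zero (neg_ne_zero.2 hP) hR) (div_ne_zero (neg_ne_zero.2 hQ) hR) e
    rw [hs_div_left (neg_ne_zero.2 hP) hR (div_ne_zero (neg_ne_zero.2 hQ) hR),
      hs_div_right (neg_ne_zero.2 hP) (neg_ne_zero.2 hQ) hR, hs_div_right hR (neg_ne_zero.2 hQ) hR,
      hs_neg_left hP (neg_ne_zero.2 hQ), hs_neg_right hP hQ, hs_neg_right hR hQ, hs_neg_left hP hR,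
      hs_self hR] at this
    rw [hs_antisymm hQ hR, hs_antisymm hR hP, ← this]; abel
  · obtain rfl : P = -Q := by linear_combination h
    rw [hs_neg_left hQ hQ, hs_neg_right hR hQ, hs_self hQ, hs_antisymm hQ hR]; abel
  · obtain rfl : Q = -R := by linear_combination h
    rw [hs_neg_right hP hR, hs_neg_left hR hR, hs_self hR, hs_antisymm hP hR]; abel
  · obtain rfl : P = -R := by linear_combination h
    rw [hs_neg_left hR hQ, hs_neg_right hR hR, hs_self hR, hs_antisymm hQ hR]; abel

end Symbol

/-! ### Leading entries of rows and of minors -/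

section Lead

variable {F : Type*} [Field F]

/-- The first nonzero entry of a row. -/
def lead (r : Fin 3 → F) : F := firstNonzero (r 0) (r 1) (r 2)

/-- The `2 × 2` minors of two rows, in the order `01, 02, 12` of the columns. -/
def wedge (r s : Fin 3 → F) : Fin 3 → F :=
  ![r 0 * s 1 - r 1 * s 0, r 0 * s 2 - r 2 * s 0, r 1 * s 2 - r 2 * s 1]

lemma lead_of_zero {r : Fin 3 → F} (h : r 0 ≠ 0) : lead r = r 0 := by
  simp [lead, firstNonzero, h]

lemma lead_of_one {r : Fin 3 → F} (h0 : r 0 = 0) (h : r 1 ≠ 0) : lead r = r 1 := by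
  simp [lead, firstNonzero, h0, h]

lemma lead_of_two {r : Fin 3 → F} (h0 : r 0 = 0) (h : r 1 = 0) : lead r = r 2 := by
  simp [lead, firstNonzero, h0, h]

lemma lead_ne_zero {r : Fin 3 → F} (h : r ≠ 0) : lead r ≠ 0 := by
  by_cases h0 : r 0 = 0
  · by_cases h1 : r 1 = 0
    · rw [lead_of_two h0 h1]
      intro h2; apply h; funext i; fin_cases i <;> simpa
    · rwa [lead_of_one h0 h1]
  · rwa [lead_of_zero h0]

lemma lead_smul (c : F) (r : Fin 3 → F) : lead (c • r) = c * lead r := by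
  by_cases hc : c = 0
  · simp [hc, lead, firstNonzero]
  by_cases h0 : r 0 = 0
  · by_cases h1 : r 1 = 0
    · rw [lead_of_two h0 h1, lead_of_two (by simp [h0]) (by simp [h1])]; rfl
    · rw [lead_of_one h0 h1, lead_of_one (by simp [h0]) (by simp [h1, hc])]; rfl
  · rw [lead_of_zero h0, lead_of_zero (by simp [h0, hc])]; rfl

lemma lead_neg (r : Fin 3 → F) : lead (-r) = - lead r := by
  have := lead_smul (-1) r
  simpa using this

lemma lead_triangular {r r' : Fin 3 → F} {a b c : F} (h0 : r' 0 = r 0)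
    (h1 : r' 1 = a * r 0 + r 1) (h2 : r' 2 = b * r 0 + c * r 1 + r 2) : lead r' = lead r := by
  by_cases e0 : r 0 = 0
  · by_cases e1 : r 1 = 0
    · rw [lead_of_two e0 e1, lead_of_two (by simp [h0, e0]) (by simp [h1, e0, e1]), h2, e0, e1]
      simp
    · rw [lead_of_one e0 e1, lead_of_one (by simp [h0, e0]) (by simp [h1, e0, e1]), h1, e0]
      simp
  · rw [lead_of_zero e0, lead_of_zero (by simpa [h0] using e0), h0]

/-- In the first column where r or s does not vanish, the relation between the rows is read off:
either all three leads sit there, or one of the entries is zero and the other two cancel. -/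
lemma trop_lead {r s t : Fin 3 → F} (h : r + s + t = 0) :
    Trop (lead r) (lead s) (lead t) := by
  have e : ∀ i, t i = -(r i + s i) := fun i => by
    have := congrFun h i
    simp only [Pi.add_apply, Pi.zero_apply] at this
    linear_combination this
  have key : ∀ i, ∀ q : Fin 3 → F, (∀ j < i, q j = 0) → q i ≠ 0 → lead q = q i := by
    intro i q hq h
    fin_cases i
    · exact lead_of_zero h
    · exact lead_of_one (hq 0 (by decide)) h
    · exact lead_of_two (hq 0 (by decide)) (hq 1 (by decide))
  have fin : ∀ i, (∀ j < i, r j = 0) → (∀ j < i, s j = 0) → r i ≠ 0 ∨ s i ≠ 0 →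
      Trop (lead r) (lead s) (lead t) := by
    intro i hr hs hne
    have ht : ∀ j < i, t j = 0 := fun j hj => by rw [e, hr j hj, hs j hj]; simp
    have h1 := key i r hr
    have h2 := key i s hs
    have h3 := key i t ht
    by_cases r0 : r i = 0
    · have s0 : s i ≠ 0 := by simpa [r0] using hne
      have t0 : t i = - s i := by rw [e, r0]; ring
      have t1 : t i ≠ 0 := by rw [t0]; simpa using s0
      right; right; left; rw [h2 s0, h3 t1, t0]; ring
    · by_cases s0 : s i = 0
      · have t0 : t i = - r i := by rw [e, s0]; ring
        have t1 : t i ≠ 0 := by rw [t0]; simpa using r0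
        right; right; right; rw [h1 r0, h3 t1, t0]; ring
      · by_cases t0 : t i = 0
        · right; left; rw [h1 r0, h2 s0]; rw [e] at t0; linear_combination -t0
        · left; rw [h1 r0, h2 s0, h3 t0, e]; ring
  by_cases h0 : r 0 ≠ 0 ∨ s 0 ≠ 0
  · exact fin 0 (by simp) (by simp) h0
  push Not at h0
  by_cases h1 : r 1 ≠ 0 ∨ s 1 ≠ 0
  · refine fin 1 ?_ ?_ h1 <;> · intro j hj; fin_cases j <;> simp_all
  push Not at h1
  by_cases h2 : r 2 ≠ 0 ∨ s 2 ≠ 0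
  · refine fin 2 ?_ ?_ h2 <;> · intro j hj; fin_cases j <;> simp_all
  push Not at h2
  left
  rw [lead_of_two h0.1 h1.1, lead_of_two h0.2 h1.2, lead_of_two, e, h2.1, h2.2] <;>
    simp [e, h0.1, h0.2, h1.1, h1.2]

lemma wedge_neg_left (r s : Fin 3 → F) : wedge (-r) s = - wedge r s := by
  funext i; fin_cases i <;> simp [wedge] <;> ring

lemma wedge_neg_right (r s : Fin 3 → F) : wedge r (-s) = - wedge r s := by
  funext i; fin_cases i <;> simp [wedge] <;> ring

lemma wedge_swap (r s : Fin 3 → F) : wedge r s = - wedge s r := by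
  funext i; fin_cases i <;> simp [wedge] <;> ring

lemma wedge_add_left (r r' s : Fin 3 → F) : wedge (r + r') s = wedge r s + wedge r' s := by
  funext i; fin_cases i <;> simp [wedge] <;> ring

lemma wedge_smul_left (c : F) (r s : Fin 3 → F) : wedge (c • r) s = c • wedge r s := by
  funext i; fin_cases i <;> simp [wedge] <;> ring

lemma wedge_smul_right (c : F) (r s : Fin 3 → F) : wedge r (c • s) = c • wedge r s := by
  funext i; fin_cases i <;> simp [wedge] <;> ring

lemma wedge_self (r : Fin 3 → F) : wedge r r = 0 := by
  funext i; fin_cases i <;> simp [wedge] <;> ring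

/-- Leading terms of the Plücker relation. -/
lemma trop_plucker {p q r : Fin 3 → F} (hpq : wedge p q ≠ 0) (hpr : wedge p r ≠ 0)
    (hqr : wedge q r ≠ 0) (h : p 0 ≠ 0 ∨ q 0 ≠ 0 ∨ r 0 ≠ 0) :
    Trop (lead p * lead (wedge q r)) (-(lead q * lead (wedge p r)))
      (lead r * lead (wedge p q)) := by
  -- If only a meets the first column, the minors on columns 01 and 02 are multiples by a 0 of the
  -- remaining entries of b. In these degenerate cases two terms of the Plücker relation cancel.
  have lead0 : ∀ a b : Fin 3 → F, a 0 ≠ 0 → b 0 = 0 → lead (wedge a b) = a 0 * lead b := by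
    intro a b ha hb
    have : lead (wedge a b) = lead (a 0 • b) := by
      by_cases h1 : b 1 = 0
      · by_cases h2 : b 2 = 0
        · simp [lead, firstNonzero, wedge, hb, h1, h2]
        · simp [lead, firstNonzero, wedge, hb, h1, ha, h2]
      · simp [lead, firstNonzero, wedge, hb, ha, h1]
    rw [this, lead_smul]
  have lead0' : ∀ a b : Fin 3 → F, b 0 ≠ 0 → a 0 = 0 → lead (wedge a b) = -(b 0 * lead a) := by
    intro a b hb ha
    rw [wedge_swap, lead_neg, lead0 b a hb ha]
  by_cases p0 : p 0 = 0
  · by_cases q0 : q 0 = 0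
    · have r0 : r 0 ≠ 0 := by simpa [p0, q0] using h
      right; left
      rw [lead0' q r r0 q0, lead0' p r r0 p0]; ring
    · by_cases r0 : r 0 = 0
      · right; right; right
        rw [lead0 q r q0 r0, lead0' p q q0 p0]; ring
      · right; right; left
        rw [lead0' p r r0 p0, lead0' p q q0 p0, lead_of_zero q0, lead_of_zero r0]; ring
  · by_cases q0 : q 0 = 0
    · by_cases r0 : r 0 = 0
      · right; right; left
        rw [lead0 p r p0 r0, lead0 p q p0 q0]; ring
      · right; right; right
        rw [lead0' q r r0 q0, lead0 p q p0 q0, lead_of_zero p0, lead_of_zero r0]; ring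
    · by_cases r0 : r 0 = 0
      · right; left
        rw [lead0 q r q0 r0, lead0 p r p0 r0, lead_of_zero p0, lead_of_zero q0]; ring
      · -- all leading entries are nonzero: use the vectors of the minors `01`, `02`
        have hw : ∀ a b : Fin 3 → F, a 0 ≠ 0 → wedge a b ≠ 0 →
            lead (wedge a b) = lead ![(wedge a b) 0, (wedge a b) 1, 0] := by
          intro a b ha hab
          by_cases h0 : wedge a b 0 = 0
          · by_cases h1 : wedge a b 1 = 0
            · exfalso
              apply hab
              -- The relation a ∧ a ∧ b = 0 determines the last minor from the first two, as a 0 is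
              -- invertible.
              have h2 : a 0 * wedge a b 2 = 0 := by
                have : a 0 * wedge a b 2 = a 1 * wedge a b 1 - a 2 * wedge a b 0 := by
                  simp [wedge]; ring
                rw [this, h0, h1]; ring
              funext i
              fin_cases i
              · exact h0
              · exact h1
              · exact (mul_eq_zero.1 h2).resolve_left ha
            · rw [lead_of_one h0 h1, lead_of_one (by simpa using h0) (by simpa using h1)]; rfl
          · rw [lead_of_zero h0, lead_of_zero (by simpa using h0)]; rfl
        rw [hw q r q0 hqr, hw p r p0 hpr, hw p q p0 hpq, lead_of_zero p0, lead_of_zero q0,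
          lead_of_zero r0, ← lead_smul, ← lead_smul, ← lead_smul, ← lead_neg]
        apply trop_lead
        funext i; fin_cases i <;> simp [wedge] <;> ring

end Lead

/-! ### Torus part of a matrix and translation by N and T -/

section Torus

variable {F : Type*} [Field F]

/-- `SL₃(F)`. -/
local notation "SL" => Matrix.SpecialLinearGroup (Fin 3) F

/-- The diagonal part of the Bruhat decomposition of an element of `SL₃(F)`. -/
def tor (g : SL) : Fin 3 → F := torusPart g.1

lemma row_ne_zero (g : SL) (i : Fin 3) : g.1 i ≠ 0 := by
  intro h
  have := g.2
  rw [Matrix.det_eq_zero_of_row_eq_zero i (fun j => congrFun h j)] at this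
  exact zero_ne_one this

lemma det_rows (g : SL) : g.1 0 0 * wedge (g.1 1) (g.1 2) 2 - g.1 0 1 * wedge (g.1 1) (g.1 2) 1
    + g.1 0 2 * wedge (g.1 1) (g.1 2) 0 = 1 := by
  have := g.2
  rw [Matrix.det_fin_three] at this
  simp only [wedge, Matrix.cons_val]
  linear_combination this

lemma wedge_ne_zero (g : SL) {i j : Fin 3} (hij : i ≠ j) : wedge (g.1 i) (g.1 j) ≠ 0 := by
  intro h
  have := g.2
  rw [Matrix.det_fin_three] at this
  have h0 := congrFun h 0
  have h1 := congrFun h 1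
  have h2 := congrFun h 2
  simp only [wedge, Matrix.cons_val, Pi.zero_apply] at h0 h1 h2
  apply zero_ne_one (α := F)
  rw [← this]
  fin_cases i <;> fin_cases j <;> simp only [Fin.mk_zero, Fin.mk_one, Fin.reduceFinMk,
    ne_eq, not_true_eq_false] at h0 h1 h2 hij
  · linear_combination -(g.1 2 2) * h0 + g.1 2 1 * h1 - g.1 2 0 * h2
  · linear_combination (g.1 1 2) * h0 - g.1 1 1 * h1 + g.1 1 0 * h2
  · linear_combination (g.1 2 2) * h0 - g.1 2 1 * h1 + g.1 2 0 * h2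
  · linear_combination -(g.1 0 2) * h0 + g.1 0 1 * h1 - g.1 0 0 * h2
  · linear_combination -(g.1 1 2) * h0 + g.1 1 1 * h1 - g.1 1 0 * h2
  · linear_combination (g.1 0 2) * h0 - g.1 0 1 * h1 + g.1 0 0 * h2

lemma lead_row_ne (g : SL) (i : Fin 3) : lead (g.1 i) ≠ 0 := lead_ne_zero (row_ne_zero g i)

lemma lead_wedge_ne (g : SL) {i j : Fin 3} (hij : i ≠ j) : lead (wedge (g.1 i) (g.1 j)) ≠ 0 :=
  lead_ne_zero (wedge_ne_zero g hij)

lemma tor_two (g : SL) : tor g 2 = lead (g.1 2) := rfl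

lemma tor_one (g : SL) : tor g 1 = lead (wedge (g.1 1) (g.1 2)) / lead (g.1 2) := rfl

lemma tor_zero (g : SL) : tor g 0 = 1 / lead (wedge (g.1 1) (g.1 2)) := by
  show g.1.det / _ = _
  rw [g.2]; rfl

lemma tor_ne (g : SL) (i : Fin 3) : tor g i ≠ 0 := by
  fin_cases i
  · show tor g 0 ≠ 0
    rw [tor_zero]; exact one_div_ne_zero (lead_wedge_ne g (by decide))
  · show tor g 1 ≠ 0
    rw [tor_one]; exact div_ne_zero (lead_wedge_ne g (by decide)) (lead_row_ne g 2)
  · exact lead_row_ne g 2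

/-- The simple reflections in `SL₃`. -/
def sSL (a : Fin 2) : SL :=
  ⟨simpleRefl a, by fin_cases a <;> simp [simpleRefl, Matrix.det_fin_three]⟩

/-- The diagonal matrix `diag(a, b, (ab)⁻¹)`. -/
def dSL (a b : Fˣ) : SL :=
  ⟨Matrix.diagonal ![(a : F), b, (a * b : F)⁻¹], by
    rw [Matrix.det_diagonal, Fin.prod_univ_three]; simp; field_simp⟩

lemma coe_sl_mul (g h : SL) : (g * h).1 = g.1 * h.1 := rfl

lemma coe_sSL (a : Fin 2) : (sSL a : SL).1 = simpleRefl a := rfl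

lemma coe_dSL (a b : Fˣ) :
    (dSL a b : SL).1 = Matrix.diagonal ![(a : F), b, (a * b : F)⁻¹] := rfl

lemma coe_unipSL (x y z : F) : (unipSL x y z : SL).1 = !![1, x, z; 0, 1, y; 0, 0, 1] := rfl

lemma coe_sl_one : (1 : SL).1 = 1 := rfl

lemma sl_ext {g h : SL} (H : ∀ i j, g.1 i j = h.1 i j) : g = h :=
  Matrix.SpecialLinearGroup.ext _ _ H

lemma sSL_zero_rows (g : SL) : (sSL 0 * g).1 0 = - g.1 1 ∧ (sSL 0 * g).1 1 = g.1 0 ∧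
    (sSL 0 * g).1 2 = g.1 2 := by
  refine ⟨?_, ?_, ?_⟩ <;> funext i <;>
    simp [coe_sl_mul, coe_sSL, simpleRefl, Matrix.mul_apply, Fin.sum_univ_three]

lemma sSL_one_rows (g : SL) : (sSL 1 * g).1 0 = g.1 0 ∧ (sSL 1 * g).1 1 = - g.1 2 ∧
    (sSL 1 * g).1 2 = g.1 1 := by
  refine ⟨?_, ?_, ?_⟩ <;> funext i <;>
    simp [coe_sl_mul, coe_sSL, simpleRefl, Matrix.mul_apply, Fin.sum_univ_three]

lemma dSL_rows (a b : Fˣ) (g : SL) : (dSL a b * g).1 0 = (a : F) • g.1 0 ∧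
    (dSL a b * g).1 1 = (b : F) • g.1 1 ∧ (dSL a b * g).1 2 = (a * b : F)⁻¹ • g.1 2 := by
  refine ⟨?_, ?_, ?_⟩ <;> funext i <;> simp [coe_sl_mul, coe_dSL]

lemma unipSL_rows (x y z : F) (g : SL) :
    (unipSL x y z * g).1 0 = g.1 0 + x • g.1 1 + z • g.1 2 ∧
    (unipSL x y z * g).1 1 = g.1 1 + y • g.1 2 ∧ (unipSL x y z * g).1 2 = g.1 2 := by
  refine ⟨?_, ?_, ?_⟩ <;> funext i <;>
    simp [coe_sl_mul, coe_sl_one, coe_unipSL, Matrix.mul_apply, Fin.sum_univ_three]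

lemma mul_unipSL_apply (g : SL) (x y z : F) (i : Fin 3) :
    (g * unipSL x y z).1 i = ![g.1 i 0, x * g.1 i 0 + g.1 i 1,
      z * g.1 i 0 + y * g.1 i 1 + g.1 i 2] := by
  funext j; fin_cases j <;>
    simp [coe_sl_mul, coe_sl_one, coe_unipSL, Matrix.mul_apply, Fin.sum_univ_three] <;> ring

lemma lead_mul_unip (g : SL) (x y z : F) (i : Fin 3) :
    lead ((g * unipSL x y z).1 i) = lead (g.1 i) := by
  rw [mul_unipSL_apply]
  exact lead_triangular rfl rfl rfl

lemma lead_wedge_mul_unip (g : SL) (x y z : F) (i j : Fin 3) :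
    lead (wedge ((g * unipSL x y z).1 i) ((g * unipSL x y z).1 j)) =
      lead (wedge (g.1 i) (g.1 j)) := by
  rw [mul_unipSL_apply, mul_unipSL_apply]
  apply lead_triangular (a := y) (b := x * y - z) (c := x) <;> simp [wedge] <;> ring

lemma tor_mul_unip (g : SL) (x y z : F) : tor (g * unipSL x y z) = tor g := by
  funext i; fin_cases i
  · show tor _ 0 = tor g 0
    rw [tor_zero, tor_zero, lead_wedge_mul_unip]
  · show tor _ 1 = tor g 1
    rw [tor_one, tor_one, lead_wedge_mul_unip, lead_mul_unip]
  · show tor _ 2 = tor g 2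
    rw [tor_two, tor_two, lead_mul_unip]

lemma wedge_unip_bottom (x y z : F) (g : SL) :
    wedge ((unipSL x y z * g).1 1) ((unipSL x y z * g).1 2) = wedge (g.1 1) (g.1 2) := by
  obtain ⟨-, h1, h2⟩ := unipSL_rows x y z g
  rw [h1, h2, wedge_add_left, wedge_smul_left, wedge_self, smul_zero, add_zero]

lemma tor_unip_mul (x y z : F) (g : SL) : tor (unipSL x y z * g) = tor g := by
  funext i; fin_cases i
  · show tor _ 0 = tor g 0
    rw [tor_zero, tor_zero, wedge_unip_bottom]
  · show tor _ 1 = tor g 1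
    rw [tor_one, tor_one, wedge_unip_bottom, (unipSL_rows x y z g).2.2]
  · show tor _ 2 = tor g 2
    rw [tor_two, tor_two, (unipSL_rows x y z g).2.2]

lemma tor_dSL_mul (a b : Fˣ) (g : SL) : tor (dSL a b * g) 0 = a * tor g 0 ∧
    tor (dSL a b * g) 1 = b * tor g 1 ∧ tor (dSL a b * g) 2 = (a * b : F)⁻¹ * tor g 2 := by
  obtain ⟨-, h1, h2⟩ := dSL_rows a b g
  have h3 := lead_row_ne g 2
  have h4 := lead_wedge_ne g (i := 1) (j := 2) (by decide)
  have ha := a.ne_zero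
  have hb := b.ne_zero
  rw [tor_zero, tor_one, tor_two, tor_zero, tor_one, tor_two, h1, h2, wedge_smul_left,
    wedge_smul_right, lead_smul, lead_smul, lead_smul]
  refine ⟨?_, ?_, rfl⟩ <;> field_simp

@[simp] lemma tor_one' : tor (1 : SL) = 1 := by
  funext i
  fin_cases i <;> simp [tor, torusPart, bottomMinor, firstNonzero]

/-! Products -/

lemma unipSL_mul (x y z x' y' z' : F) :
    unipSL x y z * unipSL x' y' z' = unipSL (x + x') (y + y') (z + z' + x * y') := by
  refine sl_ext fun i j => ?_
  fin_cases i <;> fin_cases j <;>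
    simp [coe_sl_mul, coe_sl_one, coe_unipSL, Matrix.mul_apply, Fin.sum_univ_three] <;> ring

@[simp] lemma unipSL_zero : unipSL (0 : F) 0 0 = 1 := by
  refine sl_ext fun i j => ?_
  fin_cases i <;> fin_cases j <;> simp [coe_sl_mul, coe_sl_one, coe_unipSL]

lemma dSL_mul (a b a' b' : Fˣ) : dSL a b * dSL a' b' = dSL (F := F) (a * a') (b * b') := by
  refine sl_ext fun i j => ?_
  fin_cases i <;> fin_cases j <;> simp [coe_sl_mul, coe_sl_one, coe_dSL]; ring

@[simp] lemma dSL_one : dSL (1 : Fˣ) 1 = 1 := by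
  refine sl_ext fun i j => ?_
  fin_cases i <;> fin_cases j <;> simp [coe_sl_mul, coe_sl_one, coe_dSL]

/-- `diag(t) · unip · diag(t)⁻¹`. -/
lemma dSL_unip (a b : Fˣ) (x y z : F) : dSL a b * unipSL x y z =
    unipSL (a / b * x) (a * b ^ 2 * y) (a ^ 2 * b * z) * dSL a b := by
  have ha := a.ne_zero
  have hb := b.ne_zero
  refine sl_ext fun i j => ?_
  fin_cases i <;> fin_cases j <;>
    simp [coe_sl_mul, coe_sl_one, coe_unipSL, coe_dSL, Matrix.mul_apply, Fin.sum_univ_three] <;> field_simp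

end Torus

/-! ### Weyl words and normal forms -/

section Words

variable {F : Type*} [Field F]

local notation "SL" => Matrix.SpecialLinearGroup (Fin 3) F

/-- The product of the simple reflections in a word. -/
def wSL (l : List (Fin 2)) : SL := (l.map sSL).prod

@[simp] lemma wSL_nil : (wSL [] : SL) = 1 := rfl

lemma wSL_cons (a : Fin 2) (l : List (Fin 2)) : (wSL (a :: l) : SL) = sSL a * wSL l := by
  simp [wSL]

lemma coe_wSL (l : List (Fin 2)) : (wSL l : SL).1 = wordProd l := by
  induction l with
  | nil => rfl
  | cons a l ih => rw [wSL_cons, coe_sl_mul, ih]; simp [wordProd, coe_sSL]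

lemma coe_wSL_0 : (wSL [0] : SL).1 = !![0, -1, 0; 1, 0, 0; 0, 0, 1] := by
  simp [wSL, coe_sSL, simpleRefl]

lemma coe_wSL_1 : (wSL [1] : SL).1 = !![1, 0, 0; 0, 0, -1; 0, 1, 0] := by
  simp [wSL, coe_sSL, simpleRefl]

lemma coe_wSL_01 : (wSL [0, 1] : SL).1 = !![0, 0, 1; 1, 0, 0; 0, 1, 0] := by
  rw [coe_wSL]; simp [wordProd, simpleRefl, Matrix.mul_fin_three]

lemma coe_wSL_10 : (wSL [1, 0] : SL).1 = !![0, -1, 0; 0, 0, -1; 1, 0, 0] := by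
  rw [coe_wSL]; simp [wordProd, simpleRefl, Matrix.mul_fin_three]

lemma coe_wSL_010 : (wSL [0, 1, 0] : SL).1 = !![0, 0, 1; 0, -1, 0; 1, 0, 0] := by
  rw [coe_wSL]; simp [wordProd, simpleRefl, Matrix.mul_fin_three]

lemma coe_wSL_101 : (wSL [1, 0, 1] : SL).1 = !![0, 0, 1; 0, -1, 0; 1, 0, 0] := by
  rw [coe_wSL]; simp [wordProd, simpleRefl, Matrix.mul_fin_three]

lemma wSL_braid : (wSL [1, 0, 1] : SL) = wSL [0, 1, 0] := by
  apply Subtype.ext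
  exact coe_wSL_101.trans coe_wSL_010.symm

/-- The reduced words used for the six elements of the Weyl group. -/
def reducedWords : List (List (Fin 2)) := [[], [0], [1], [0, 1], [1, 0], [0, 1, 0]]

lemma forall_reduced {P : List (Fin 2) → Prop} (h : P [] ∧ P [0] ∧ P [1] ∧ P [0, 1] ∧ P [1, 0] ∧
    P [0, 1, 0]) : ∀ l ∈ reducedWords, P l := by
  intro l hl
  simp only [reducedWords, List.mem_cons, List.not_mem_nil, or_false] at hl
  obtain ⟨h1, h2, h3, h4, h5, h6⟩ := h
  rcases hl with rfl | rfl | rfl | rfl | rfl | rfl <;> assumption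

lemma tor_wSL : ∀ l ∈ reducedWords, tor (wSL l : SL) = 1 := by
  refine forall_reduced ⟨tor_one', ?_, ?_, ?_, ?_, ?_⟩ <;> funext i <;>
    simp only [tor, coe_wSL_0, coe_wSL_1, coe_wSL_01, coe_wSL_10, coe_wSL_010] <;>
    fin_cases i <;>
    simp [torusPart, bottomMinor, firstNonzero, Matrix.det_fin_three]

lemma tor_normal (a b : Fˣ) {l : List (Fin 2)} (hl : l ∈ reducedWords) (x y z : F) :
    tor (dSL a b * wSL l * unipSL x y z) 0 = (a : F) ∧
    tor (dSL a b * wSL l * unipSL x y z) 1 = (b : F) ∧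
    tor (dSL a b * wSL l * unipSL x y z) 2 = (a * b : F)⁻¹ := by
  rw [tor_mul_unip]
  have h := tor_dSL_mul a b (wSL l)
  rw [tor_wSL l hl] at h
  simpa using h

lemma coe_normal (a b : Fˣ) (l : List (Fin 2)) (x y z : F) :
    (dSL a b * wSL l * unipSL x y z).1 = Matrix.diagonal ![(a : F), b, (a * b : F)⁻¹] *
      (wSL l).1 * !![1, x, z; 0, 1, y; 0, 0, 1] := rfl

lemma word_normal (a b : Fˣ) {l : List (Fin 2)} (hl : l ∈ reducedWords) (x y z : F) :
    bruhatWord (dSL a b * wSL l * unipSL x y z).1 = l := by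
  revert l
  have ha := a.ne_zero
  have hb := b.ne_zero
  refine forall_reduced ⟨?_, ?_, ?_, ?_, ?_, ?_⟩ <;> rw [coe_normal] <;>
    simp [coe_wSL_0, coe_wSL_1, coe_wSL_01, coe_wSL_10, coe_wSL_010, bruhatWord, bottomMinor,
      Matrix.mul_apply, Fin.sum_univ_three, Matrix.diagonal]

/-- The part of `unip x y z` that cannot be moved to the left of the Weyl group element. -/
def rightPart : List (Fin 2) → F → F → F → F × F × F
  | [0], x, _, _ => (x, 0, 0)
  | [1], _, y, _ => (0, y, 0)
  | [0, 1], x, y, z => (0, y, z - x * y)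
  | [1, 0], x, _, z => (x, 0, z)
  | [0, 1, 0], x, y, z => (x, y, z)
  | _, _, _, _ => (0, 0, 0)

/-- The part of `unip x y z` that can be moved to the left of the Weyl group element. -/
def leftPart : List (Fin 2) → F → F → F → F × F × F
  | [0], _, y, z => (0, y, z)
  | [1], x, y, z => (x, 0, z - x * y)
  | [0, 1], x, _, _ => (x, 0, 0)
  | [1, 0], _, y, _ => (0, y, 0)
  | [0, 1, 0], _, _, _ => (0, 0, 0)
  | _, x, y, z => (x, y, z)

/-- `unipSL` on triples. -/
def uSL (p : F × F × F) : SL := unipSL p.1 p.2.1 p.2.2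

lemma left_mul_right : ∀ l ∈ reducedWords, ∀ x y z : F,
    unipSL x y z = uSL (leftPart l x y z) * uSL (rightPart l x y z) := by
  refine forall_reduced ⟨?_, ?_, ?_, ?_, ?_, ?_⟩ <;> intro x y z <;>
    simp [leftPart, rightPart, uSL, unipSL_mul]

lemma right_normal (a b : Fˣ) {l : List (Fin 2)} (hl : l ∈ reducedWords) (x y z : F) :
    bruhatRight (dSL a b * wSL l * unipSL x y z).1 = (uSL (rightPart l x y z)).1 := by
  revert l
  have ha := a.ne_zero
  have hb := b.ne_zero
  refine forall_reduced ⟨?_, ?_, ?_, ?_, ?_, ?_⟩ <;> rw [coe_normal] <;>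
    simp [coe_wSL_0, coe_wSL_1, coe_wSL_01, coe_wSL_10, coe_wSL_010, bruhatRight, bottomMinor,
      Matrix.mul_apply, Fin.sum_univ_three, Matrix.diagonal, rightPart, uSL, coe_unipSL, unip,
      ← Matrix.ext_iff, Fin.forall_fin_succ, Matrix.one_apply] <;>
    field_simp <;> ring_nf

lemma unip_inv (x y z : F) : (unipSL x y z)⁻¹ = unipSL (-x) (-y) (x * y - z) := by
  rw [inv_eq_iff_mul_eq_one, unipSL_mul]
  convert unipSL_zero using 2 <;> ring

end Words

/-! ### The cocycle in normal form and the Bruhat decomposition -/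

section Cocycle

variable {F : Type*} [Field F] [ValuativeRel F] [TopologicalSpace F]
  [IsNonarchimedeanLocalField F]

local notation "SL" => Matrix.SpecialLinearGroup (Fin 3) F

/-- `σ(s_a, g)`, additively. -/
def rc (a : Fin 2) (g : SL) : Additive (rootsOfUnity 3 F) :=
  hs (tor g a.succ) (tor (sSL a * g) a.succ)

/-- The cocycle of a word and an element, additively. -/
def wc : List (Fin 2) → SL → Additive (rootsOfUnity 3 F)
  | [], _ => 0
  | a :: l, g => rc a (wSL l * g) + wc l g

/-- The cocycle on the torus, additively. -/
def tc (t u : Fin 3 → F) : Additive (rootsOfUnity 3 F) :=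
  hs (t 0) (u 1) + hs (t 0) (u 2) + hs (t 1) (u 2)

/-- The block compatible cocycle on `SL₃(F)`, additively. -/
def sg (g h : SL) : Additive (rootsOfUnity 3 F) := Additive.ofMul (blockCocycle g.1 h.1)

lemma ofMul_wordCocycle (l : List (Fin 2)) (g : SL) :
    Additive.ofMul (wordCocycle l g.1) = wc l g := by
  induction l with
  | nil => rfl
  | cons a l ih =>
    rw [wc, ← ih, wordCocycle, ofMul_mul, ← coe_wSL]
    rfl

lemma sg_eq {g k n : SL} (hn : bruhatRight g.1 = n.1) :
    sg g k = tc (tor g) (tor (wSL (bruhatWord g.1) * (n * k))) + wc (bruhatWord g.1) (n * k) := by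
  unfold sg blockCocycle
  rw [hn, ofMul_mul, ← coe_wSL, ← coe_sl_mul, ← coe_sl_mul, ← ofMul_wordCocycle]
  rfl

lemma uSL_rows (p : F × F × F) (g : SL) : uSL p * g = unipSL p.1 p.2.1 p.2.2 * g := rfl

lemma s0_unip (y z : F) : (sSL 0 : SL) * unipSL 0 y z = unipSL 0 z (-y) * sSL 0 := by
  refine sl_ext fun i j => ?_
  fin_cases i <;> fin_cases j <;>
    simp [coe_sl_mul, coe_sSL, coe_unipSL, simpleRefl, Matrix.mul_apply, Fin.sum_univ_three]

lemma s1_unip (x z : F) : (sSL 1 : SL) * unipSL x 0 z = unipSL (-z) 0 x * sSL 1 := by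
  refine sl_ext fun i j => ?_
  fin_cases i <;> fin_cases j <;>
    simp [coe_sl_mul, coe_sSL, coe_unipSL, simpleRefl, Matrix.mul_apply, Fin.sum_univ_three]

lemma rc0_unip (y z : F) (g : SL) : rc 0 (unipSL 0 y z * g) = rc 0 g := by
  unfold rc
  rw [tor_unip_mul, ← mul_assoc, s0_unip, mul_assoc, tor_unip_mul]

lemma rc1_unip (x z : F) (g : SL) : rc 1 (unipSL x 0 z * g) = rc 1 g := by
  unfold rc
  rw [tor_unip_mul, ← mul_assoc, s1_unip, mul_assoc, tor_unip_mul]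

lemma rc_mul_unip (a : Fin 2) (g : SL) (x y z : F) : rc a (g * unipSL x y z) = rc a g := by
  unfold rc
  rw [tor_mul_unip, ← mul_assoc, tor_mul_unip]

/-- The left part crosses the Weyl element and stays upper triangular unipotent, where `tor` does
not see it. -/
lemma tor_w_left : ∀ l ∈ reducedWords, ∀ (x y z : F) (g : SL),
    tor (wSL l * (uSL (leftPart l x y z) * g)) = tor (wSL l * g) := by
  refine forall_reduced ⟨?_, ?_, ?_, ?_, ?_, ?_⟩ <;> intro x y z g <;>
    simp only [leftPart, uSL, wSL_cons, wSL_nil, one_mul, mul_one]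
  · rw [tor_unip_mul]
  · rw [← mul_assoc, s0_unip, mul_assoc, tor_unip_mul]
  · rw [← mul_assoc, s1_unip, mul_assoc, tor_unip_mul]
  · rw [mul_assoc, ← mul_assoc (sSL 1), s1_unip, neg_zero, mul_assoc, ← mul_assoc (sSL 0), s0_unip,
      mul_assoc, tor_unip_mul, mul_assoc]
  · rw [mul_assoc, ← mul_assoc (sSL 0), s0_unip, mul_assoc, ← mul_assoc (sSL 1), s1_unip,
      mul_assoc, tor_unip_mul, mul_assoc]
  · rw [unipSL_zero, one_mul]

lemma wc_left : ∀ l ∈ reducedWords, ∀ (x y z : F) (g : SL),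
    wc l (uSL (leftPart l x y z) * g) = wc l g := by
  refine forall_reduced ⟨?_, ?_, ?_, ?_, ?_, ?_⟩ <;> intro x y z g <;>
    simp only [leftPart, uSL, wc, wSL_cons, wSL_nil, one_mul, mul_one]
  · rw [rc0_unip]
  · rw [rc1_unip]
  · rw [← mul_assoc, s1_unip, neg_zero, mul_assoc, rc0_unip, rc1_unip]
  · rw [← mul_assoc, s0_unip, mul_assoc, rc1_unip, rc0_unip]
  · rw [unipSL_zero, one_mul]

/-- Evaluation of the cocycle on a Bruhat decomposition. -/
lemma sg_normal (a b : Fˣ) {l : List (Fin 2)} (hl : l ∈ reducedWords) (x y z : F) (k : SL) :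
    sg (dSL a b * wSL l * unipSL x y z) k =
      tc ![(a : F), b, (a * b : F)⁻¹] (tor (wSL l * (unipSL x y z * k))) +
        wc l (unipSL x y z * k) := by
  have e1 : wc l (unipSL x y z * k) = wc l (uSL (rightPart l x y z) * k) := by
    rw [left_mul_right l hl x y z, mul_assoc, wc_left l hl]
  have e2 : tor (wSL l * (unipSL x y z * k)) = tor (wSL l * (uSL (rightPart l x y z) * k)) := by
    rw [left_mul_right l hl x y z, mul_assoc, tor_w_left l hl]
  rw [sg_eq (right_normal a b hl x y z), word_normal a b hl, e1, e2]
  obtain ⟨h0, h1, h2⟩ := tor_normal a b hl x y z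
  congr 1
  simp only [tc, h0, h1, h2]
  simp

lemma bruhatWord_unip_mul (x y z : F) (g : SL) : bruhatWord (unipSL x y z * g).1 = bruhatWord g.1 ∧
    bruhatRight (unipSL x y z * g).1 = bruhatRight g.1 := by
  have e2 : ∀ i, (unipSL x y z * g).1 2 i = g.1 2 i := fun i =>
    congrFun (unipSL_rows x y z g).2.2 i
  have e1 : ∀ i j, bottomMinor (unipSL x y z * g).1 i j = bottomMinor g.1 i j := fun i j => by
    have := congrFun (unipSL_rows x y z g).2.1
    simp only [bottomMinor, e2, this, Pi.add_apply, Pi.smul_apply, smul_eq_mul]; ring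
  constructor
  · unfold bruhatWord
    split_ifs <;> simp_all
  · unfold bruhatRight
    split_ifs <;> simp_all

lemma bruhatRight_eq (g : SL) : ∃ p : F × F × F, bruhatRight g.1 = (uSL p).1 := by
  unfold bruhatRight
  split_ifs
  · exact ⟨(_, _, _), rfl⟩
  · exact ⟨(_, _, _), rfl⟩
  · exact ⟨(_, _, _), rfl⟩
  · exact ⟨(_, _, _), rfl⟩
  · exact ⟨(_, _, _), rfl⟩
  · exact ⟨(0, 0, 0), by simp [uSL, coe_sl_one]⟩

lemma sg_unip_mul (x y z : F) (g k : SL) : sg (unipSL x y z * g) k = sg g k := by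
  obtain ⟨p, hp⟩ := bruhatRight_eq g
  obtain ⟨h1, h2⟩ := bruhatWord_unip_mul x y z g
  rw [sg_eq hp, sg_eq (h2.trans hp), h1, tor_unip_mul]

/-- Two elements of `SL₃` with the same bottom row and the same minors of the two bottom rows. -/
lemma eq_uSL_mul {g X : SL} (h2 : X.1 2 = g.1 2)
    (hw : wedge (X.1 1) (X.1 2) = wedge (g.1 1) (g.1 2)) : ∃ p, X = uSL p * g := by
  have hg := det_rows g
  have hX := det_rows X
  have w0 := congrFun hw 0
  have w1 := congrFun hw 1
  have w2 := congrFun hw 2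
  have h20 := congrFun h2 0
  have h21 := congrFun h2 1
  have h22 := congrFun h2 2
  simp only [wedge, Matrix.cons_val] at w0 w1 w2 hg hX
  rw [h20, h21] at w0
  rw [h20, h22] at w1
  rw [h21, h22] at w2
  rw [h20, h21, h22] at hX
  -- These are the entries (0,1), (1,2), (0,2) of X g⁻¹, with g⁻¹ written as the adjugate because
  -- det g = 1.
  refine ⟨(X.1 0 0 * (g.1 0 2 * g.1 2 1 - g.1 0 1 * g.1 2 2) +
      X.1 0 1 * (g.1 0 0 * g.1 2 2 - g.1 0 2 * g.1 2 0) +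
      X.1 0 2 * (g.1 0 1 * g.1 2 0 - g.1 0 0 * g.1 2 1),
    X.1 1 0 * (g.1 0 1 * g.1 1 2 - g.1 0 2 * g.1 1 1) +
      X.1 1 1 * (g.1 0 2 * g.1 1 0 - g.1 0 0 * g.1 1 2) +
      X.1 1 2 * (g.1 0 0 * g.1 1 1 - g.1 0 1 * g.1 1 0),
    X.1 0 0 * (g.1 0 1 * g.1 1 2 - g.1 0 2 * g.1 1 1) +
      X.1 0 1 * (g.1 0 2 * g.1 1 0 - g.1 0 0 * g.1 1 2) +
      X.1 0 2 * (g.1 0 0 * g.1 1 1 - g.1 0 1 * g.1 1 0)), ?_⟩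
  obtain ⟨r0, r1, r2⟩ := unipSL_rows (F := F) _ _ _ g
  refine sl_ext fun i j => ?_
  rw [uSL_rows]
  fin_cases i
  · refine Eq.trans ?_ (congrFun r0 j).symm
    fin_cases j <;> simp only [Fin.zero_eta, Fin.mk_one, Fin.reduceFinMk, Pi.add_apply, Pi.smul_apply, smul_eq_mul]
    · linear_combination (-X.1 0 0) * hg + g.1 0 0 * hX - g.1 0 0 * (X.1 0 0 * w2 - X.1 0 1 * w1 + X.1 0 2 * w0)
    · linear_combination (-X.1 0 1) * hg + g.1 0 1 * hX - g.1 0 1 * (X.1 0 0 * w2 - X.1 0 1 * w1 + X.1 0 2 * w0)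
    · linear_combination (-X.1 0 2) * hg + g.1 0 2 * hX - g.1 0 2 * (X.1 0 0 * w2 - X.1 0 1 * w1 + X.1 0 2 * w0)
  · refine Eq.trans ?_ (congrFun r1 j).symm
    fin_cases j <;> simp only [Fin.zero_eta, Fin.mk_one, Fin.reduceFinMk, Pi.add_apply, Pi.smul_apply, smul_eq_mul]
    · linear_combination (-X.1 1 0) * hg - g.1 0 0 * (X.1 1 0 * w2 - X.1 1 1 * w1 + X.1 1 2 * w0) +
        g.1 1 0 * ((g.1 0 0 * w2 - g.1 0 1 * w1 + g.1 0 2 * w0) + hg)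
    · linear_combination (-X.1 1 1) * hg - g.1 0 1 * (X.1 1 0 * w2 - X.1 1 1 * w1 + X.1 1 2 * w0) +
        g.1 1 1 * ((g.1 0 0 * w2 - g.1 0 1 * w1 + g.1 0 2 * w0) + hg)
    · linear_combination (-X.1 1 2) * hg - g.1 0 2 * (X.1 1 0 * w2 - X.1 1 1 * w1 + X.1 1 2 * w0) +
        g.1 1 2 * ((g.1 0 0 * w2 - g.1 0 1 * w1 + g.1 0 2 * w0) + hg)
  · exact Eq.trans (congrFun h2 j) (congrFun r2 j).symm

/-- The Bruhat decomposition of `SL₃(F)`. -/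
lemma bruhat (g : SL) : ∃ (p : F × F × F) (a b : Fˣ) (l : List (Fin 2)) (q : F × F × F),
    l ∈ reducedWords ∧ g = uSL p * (dSL a b * wSL l * uSL q) := by
  have hpl : g.1 2 0 * wedge (g.1 1) (g.1 2) 2 - g.1 2 1 * wedge (g.1 1) (g.1 2) 1
      + g.1 2 2 * wedge (g.1 1) (g.1 2) 0 = 0 := by
    simp only [wedge, Matrix.cons_val]; ring
  have hr := row_ne_zero g 2
  have hw := wedge_ne_zero g (i := 1) (j := 2) (by decide)
  set c := g.1 2 with hc
  set m := wedge (g.1 1) (g.1 2) with hm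
  -- A stands for the leading bottom minor and B for the leading bottom entry, so the torus part is
  -- diag(A⁻¹, A/B, B). It is enough to match the bottom row and the bottom minors; the rest differs
  -- by a left factor in N.
  have key : ∀ (A B : F) (hA : A ≠ 0) (hB : B ≠ 0) (l : List (Fin 2)) (q : F × F × F),
      l ∈ reducedWords →
      (dSL (Units.mk0 A hA)⁻¹ (Units.mk0 A hA / Units.mk0 B hB) * wSL l * uSL q).1 2 = c →
      wedge ((dSL (Units.mk0 A hA)⁻¹ (Units.mk0 A hA / Units.mk0 B hB) * wSL l * uSL q).1 1)
       ((dSL (Units.mk0 A hA)⁻¹ (Units.mk0 A hA / Units.mk0 B hB) * wSL l * uSL q).1 2) = m →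
      ∃ (p : F × F × F) (a b : Fˣ) (l : List (Fin 2)) (q : F × F × F),
        l ∈ reducedWords ∧ g = uSL p * (dSL a b * wSL l * uSL q) := by
    intro A B hA hB l q hl h1 h2
    obtain ⟨p, hp⟩ := eq_uSL_mul h1.symm h2.symm
    exact ⟨p, _, _, l, q, hl, hp⟩
  by_cases c0 : c 0 = 0
  · by_cases c1 : c 1 = 0
    · have c2 : c 2 ≠ 0 := fun h => hr (by funext i; fin_cases i <;> assumption)
      have m0 : m 0 = 0 := by simpa [c0, c1, c2] using hpl
      by_cases m1 : m 1 = 0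
      · have m2 : m 2 ≠ 0 := fun h => hw (by funext i; fin_cases i <;> assumption)
        refine key (m 2) (c 2) m2 c2 [] (0, 0, 0) (by simp [reducedWords]) ?_ ?_ <;> funext i <;>
          rw [uSL, coe_normal] <;> fin_cases i <;>
          simp [wedge, c0, c1, m0, m1, coe_sl_one, Matrix.mul_apply, Fin.sum_univ_three,
            Matrix.diagonal] <;> field_simp
      · refine key (m 1) (c 2) m1 c2 [0] (m 2 / m 1, 0, 0) (by simp [reducedWords]) ?_ ?_ <;>
          funext i <;> rw [uSL, coe_normal] <;> fin_cases i <;>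
          simp [wedge, c0, c1, m0, coe_wSL_0, Matrix.mul_apply, Fin.sum_univ_three,
            Matrix.diagonal] <;> field_simp
    · by_cases m0 : m 0 = 0
      · have m1 : m 1 = 0 := by simpa [c0, c1, m0] using hpl
        have m2 : m 2 ≠ 0 := fun h => hw (by funext i; fin_cases i <;> assumption)
        refine key (m 2) (c 1) m2 c1 [1] (0, c 2 / c 1, 0) (by simp [reducedWords]) ?_ ?_ <;>
          funext i <;> rw [uSL, coe_normal] <;> fin_cases i <;>
          simp [wedge, c0, m0, m1, coe_wSL_1, Matrix.mul_apply, Fin.sum_univ_three,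
            Matrix.diagonal] <;> field_simp
      · have e1 : m 1 = c 2 * m 0 / c 1 := by
          rw [eq_div_iff c1]; rw [c0] at hpl; linear_combination -hpl
        refine key (m 0) (c 1) m0 c1 [0, 1] (0, c 2 / c 1, -(m 2 / m 0))
            (by simp [reducedWords]) ?_ ?_ <;>
          funext i <;> rw [uSL, coe_normal] <;> fin_cases i <;>
          simp [wedge, c0, e1, coe_wSL_01, Matrix.mul_apply, Fin.sum_univ_three,
            Matrix.diagonal] <;> field_simp
  · by_cases m0 : m 0 = 0
    · have e2 : m 2 = c 1 * m 1 / c 0 := by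
        rw [eq_div_iff c0]; rw [m0] at hpl; linear_combination hpl
      have m1 : m 1 ≠ 0 := fun h => hw (by
        funext i; fin_cases i
        · exact m0
        · exact h
        · show m 2 = 0
          rw [e2, h]; simp)
      refine key (m 1) (c 0) m1 c0 [1, 0] (c 1 / c 0, 0, c 2 / c 0)
            (by simp [reducedWords]) ?_ ?_ <;>
          funext i <;> rw [uSL, coe_normal] <;> fin_cases i <;>
          simp [wedge, m0, e2, coe_wSL_10, Matrix.mul_apply, Fin.sum_univ_three,
            Matrix.diagonal] <;> field_simp
    · have e2 : m 2 = (c 1 * m 1 - c 2 * m 0) / c 0 := by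
        rw [eq_div_iff c0]; linear_combination hpl
      refine key (m 0) (c 0) m0 c0 [0, 1, 0] (c 1 / c 0, m 1 / m 0, c 2 / c 0)
            (by simp [reducedWords]) ?_ ?_ <;>
          funext i <;> rw [uSL, coe_normal] <;> fin_cases i <;>
          simp [wedge, e2, coe_wSL_010, Matrix.mul_apply, Fin.sum_univ_three,
            Matrix.diagonal] <;> field_simp <;> ring

end Cocycle

/-! ### Left association for N and T; rank-one and braid relations -/

section Nucleus

variable {F : Type*} [Field F] [ValuativeRel F] [TopologicalSpace F]
  [IsNonarchimedeanLocalField F] [TameCubic F]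

local notation "SL" => Matrix.SpecialLinearGroup (Fin 3) F

/-- Elements that associate on the left. -/
def Nuc (g : SL) : Prop := ∀ h k : SL, sg g h + sg (g * h) k = sg g (h * k) + sg h k

/-- Applying the hypothesis on g to the triples with g', g'h and hk expresses every value of σ(gg',
·) through σ(g, ·), and these cancel to leave the identity for g'. -/
lemma Nuc.mul {g g' : SL} (hg : Nuc g) (hg' : Nuc g') : Nuc (g * g') := by
  intro h k
  have h1 := hg g' h
  have h2 := hg (g' * h) k
  have h3 := hg' h k
  have h4 := hg g' (h * k)
  rw [mul_assoc g' h k] at h2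
  rw [mul_assoc g g' h]
  have e1 : sg (g * g') h = sg g (g' * h) + sg g' h - sg g g' := by rw [← h1]; abel
  have e2 : sg (g * g') (h * k) = sg g (g' * (h * k)) + sg g' (h * k) - sg g g' := by
    rw [← h4]; abel
  have e3 : sg (g * (g' * h)) k = sg g (g' * (h * k)) + sg (g' * h) k - sg g (g' * h) := by
    rw [← h2]; abel
  rw [e1, e2, e3]
  have e4 : sg g' h + sg (g' * h) k - (sg g' (h * k) + sg h k) = 0 := by rw [h3]; abel
  rw [← sub_eq_zero, ← e4]; abel

lemma tc_one (u : Fin 3 → F) (hu : ∀ i, u i ≠ 0) : tc ![((1 : Fˣ) : F), (1 : Fˣ),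
    ((1 : Fˣ) * (1 : Fˣ) : F)⁻¹] u = 0 := by
  simp [tc, hu]

lemma sg_word_mul_unip {l : List (Fin 2)} (hl : l ∈ reducedWords) (x y z : F) (k : SL) :
    sg (wSL l * unipSL x y z) k = wc l (unipSL x y z * k) := by
  have := sg_normal 1 1 hl x y z k
  rw [tc_one _ (tor_ne _), zero_add, dSL_one, one_mul] at this
  exact this

lemma sg_word {l : List (Fin 2)} (hl : l ∈ reducedWords) (k : SL) : sg (wSL l) k = wc l k := by
  have := sg_word_mul_unip hl 0 0 0 k
  rwa [unipSL_zero, mul_one, one_mul] at this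

lemma sg_sSL (a : Fin 2) (k : SL) : sg (sSL a) k = rc a k := by
  have : (sSL a : SL) = wSL [a] := by simp [wSL]
  rw [this, sg_word (by fin_cases a <;> simp [reducedWords])]
  simp [wc]

lemma sg_unip (x y z : F) (k : SL) : sg (unipSL x y z) k = 0 := by
  have := sg_word_mul_unip (l := []) (by simp [reducedWords]) x y z k
  simpa [wc] using this

lemma sg_one (k : SL) : sg 1 k = 0 := by simpa using sg_unip (0 : F) 0 0 k

lemma nuc_unip (x y z : F) : Nuc (unipSL x y z) := by
  intro h k
  rw [sg_unip, sg_unip, sg_unip_mul]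

lemma sg_dSL (a b : Fˣ) (k : SL) : sg (dSL a b) k = tc ![(a : F), b, (a * b : F)⁻¹] (tor k) := by
  have := sg_normal a b (l := []) (by simp [reducedWords]) 0 0 0 k
  simpa [wc] using this

/-- Middle associativity for `N`. -/
lemma sg_mul_unip_left (g : SL) (x y z : F) (k : SL) :
    sg (g * unipSL x y z) k = sg g (unipSL x y z * k) := by
  obtain ⟨p, a, b, l, q, hl, rfl⟩ := bruhat g
  rw [uSL, uSL, mul_assoc (unipSL _ _ _), sg_unip_mul, sg_unip_mul, mul_assoc _ (unipSL _ _ _),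
    unipSL_mul, sg_normal _ _ hl, sg_normal _ _ hl, ← unipSL_mul]
  simp only [mul_assoc]

/-- The torus part is multiplicative under left translation by the torus, so in Bruhat coordinates
for h the identity is bilinearity of the symbol. -/
lemma sg_dSL_mul_left (a b : Fˣ) (h k : SL) : sg (dSL a b * h) k + sg (dSL a b) h =
    sg (dSL a b) (h * k) + sg h k := by
  obtain ⟨p, a', b', l, q, hl, rfl⟩ := bruhat h
  have ha := a.ne_zero
  have hb := b.ne_zero
  have ha' := a'.ne_zero
  have hb' := b'.ne_zero
  have e : dSL a b * (uSL p * (dSL a' b' * wSL l * uSL q)) =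
      uSL (a / b * p.1, a * b ^ 2 * p.2.1, a ^ 2 * b * p.2.2) *
        (dSL (a * a') (b * b') * wSL l * uSL q) := by
    rw [uSL, ← mul_assoc, dSL_unip, mul_assoc, ← mul_assoc (dSL a b), ← mul_assoc (dSL a b),
      dSL_mul]; rfl
  rw [e, sg_dSL, sg_dSL, uSL, uSL, uSL, sg_unip_mul, sg_unip_mul, sg_normal _ _ hl,
    sg_normal _ _ hl, tor_unip_mul, mul_assoc (unipSL _ _ _), tor_unip_mul]
  simp only [mul_assoc]
  set X := wSL l * (unipSL q.1 q.2.1 q.2.2 * k) with hX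
  obtain ⟨-, t1, t2⟩ := tor_normal a' b' hl q.1 q.2.1 q.2.2
  obtain ⟨-, u1, u2⟩ := tor_dSL_mul a' b' X
  rw [mul_assoc] at t1 t2
  have x1 := tor_ne X 1
  have x2 := tor_ne X 2
  simp only [tc, t1, t2, u1, u2, Matrix.cons_val, Units.val_mul]
  simp only [mul_inv, hs_mul_left, hs_mul_right, hs_inv_left, hs_inv_right, ne_eq, inv_eq_zero,
    mul_eq_zero, not_or, ha, hb, ha', hb', x1, x2, not_false_eq_true, and_self]
  abel

lemma nuc_dSL (a b : Fˣ) : Nuc (dSL a b : SL) := by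
  intro h k
  rw [← sg_dSL_mul_left]; abel

/-- Conjugation of the torus by a simple reflection. -/
def sTor : Fin 2 → Fˣ → Fˣ → SL
  | 0, a, b => dSL b a
  | 1, a, b => dSL a (a * b)⁻¹

lemma sSL_dSL (i : Fin 2) (a b : Fˣ) : sSL i * dSL a b = sTor i a b * sSL i := by
  have ha := a.ne_zero
  have hb := b.ne_zero
  refine sl_ext fun i' j => ?_
  fin_cases i <;> fin_cases i' <;> fin_cases j <;>
    simp [coe_sl_mul, coe_sSL, coe_dSL, simpleRefl, Matrix.mul_apply, Fin.sum_univ_three, sTor]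
      <;> field_simp

lemma tor_sSL_zero (X : SL) : tor (sSL 0 * X) 0 = 1 / lead (wedge (X.1 0) (X.1 2)) ∧
    tor (sSL 0 * X) 1 = lead (wedge (X.1 0) (X.1 2)) / lead (X.1 2) ∧
    tor (sSL 0 * X) 2 = lead (X.1 2) := by
  obtain ⟨-, h1, h2⟩ := sSL_zero_rows X
  rw [tor_zero, tor_one, tor_two, h1, h2]; exact ⟨rfl, rfl, rfl⟩

lemma tor_sSL_one (X : SL) : tor (sSL 1 * X) 0 = 1 / lead (wedge (X.1 1) (X.1 2)) ∧
    tor (sSL 1 * X) 1 = lead (wedge (X.1 1) (X.1 2)) / lead (X.1 1) ∧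
    tor (sSL 1 * X) 2 = lead (X.1 1) := by
  obtain ⟨-, h1, h2⟩ := sSL_one_rows X
  rw [tor_zero, tor_one, tor_two, h1, h2, wedge_neg_left, ← wedge_swap]; exact ⟨rfl, rfl, rfl⟩

lemma rc_zero (X : SL) : rc 0 X = hs (lead (wedge (X.1 1) (X.1 2)) / lead (X.1 2))
    (lead (wedge (X.1 0) (X.1 2)) / lead (X.1 2)) := by
  show hs (tor X 1) (tor (sSL 0 * X) 1) = _
  rw [tor_one, (tor_sSL_zero X).2.1]

lemma rc_one (X : SL) : rc 1 X = hs (lead (X.1 2)) (lead (X.1 1)) := by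
  show hs (tor X 2) (tor (sSL 1 * X) 2) = _
  rw [tor_two, (tor_sSL_one X).2.2]

/-- Commutation of a simple reflection with the torus. -/
lemma rc_dSL (i : Fin 2) (a b : Fˣ) : ∃ c : Additive (rootsOfUnity 3 F), ∀ X : SL,
    rc i (dSL a b * X) + sg (dSL a b) X = c + rc i X + sg (sTor i a b) (sSL i * X) := by
  have ha := a.ne_zero
  have hb := b.ne_zero
  have h02 : (0 : Fin 3) ≠ 2 := by decide
  have h12 : (1 : Fin 3) ≠ 2 := by decide
  fin_cases i
  · refine ⟨hs (b : F) a, fun X => ?_⟩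
    obtain ⟨r0, r1, r2⟩ := dSL_rows a b X
    obtain ⟨-, t1, t2⟩ := tor_sSL_zero X
    have x1 := lead_row_ne X 2
    have x2 := lead_wedge_ne X h02
    have x3 := lead_wedge_ne X h12
    simp only [Fin.zero_eta, sTor]
    rw [rc_zero, rc_zero, sg_dSL, sg_dSL, r0, r1, r2]
    simp only [tc, tor_one, tor_two, t1, t2, Matrix.cons_val, wedge_smul_left, wedge_smul_right,
      lead_smul]
    simp only [mul_inv, hs_mul_left, hs_mul_right, hs_inv_left, hs_inv_right, ne_eq, inv_eq_zero,
      mul_eq_zero, not_or, ha, hb, x1, x2, x3, not_false_eq_true, and_self, div_eq_mul_inv,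
      hs_self]
    simp only [hs_antisymm hb ha, hs_antisymm x3 ha, hs_antisymm x1 ha]
    abel
  · refine ⟨hs (a * b : F)⁻¹ b, fun X => ?_⟩
    obtain ⟨r0, r1, r2⟩ := dSL_rows a b X
    obtain ⟨-, t1, t2⟩ := tor_sSL_one X
    have x1 := lead_row_ne X 2
    have x2 := lead_row_ne X 1
    have x3 := lead_wedge_ne X h12
    simp only [Fin.mk_one, sTor]
    rw [rc_one, rc_one, sg_dSL, sg_dSL, r1, r2]
    simp only [tc, tor_one, tor_two, t1, t2, Matrix.cons_val, lead_smul, Units.val_inv_eq_inv_val,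
      Units.val_mul]
    simp only [mul_inv, hs_mul_left, hs_mul_right, hs_inv_left, hs_inv_right, ne_eq, inv_eq_zero,
      mul_eq_zero, not_or, ha, hb, x1, x2, x3, not_false_eq_true, and_self, div_eq_mul_inv,
      hs_self]
    rw [hs_antisymm x1 hb]
    abel

/-- Leading-term form of the Steinberg relation for a simple root. -/
lemma rank_one_symbol {b c e u : F} (hb : b ≠ 0) (hc : c ≠ 0) (he : e ≠ 0) (hu : u ≠ 0)
    (h : Trop (u * c) (-b) (-e)) :
    hs c e + hs b c = hs u⁻¹ (e / u) + hs b (e / u) := by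
  have h1 := hs_trop (mul_ne_zero hu hc) (neg_ne_zero.2 hb) (neg_ne_zero.2 he) h
  simp only [hs_neg_right, hs_neg_left, hs_mul_left, hs_mul_right, ne_eq, neg_eq_zero,
    mul_eq_zero, not_or, hb, hc, he, hu, not_false_eq_true, and_self] at h1
  simp only [div_eq_mul_inv, hs_mul_left, hs_mul_right, hs_inv_left, hs_inv_right, ne_eq,
    inv_eq_zero, mul_eq_zero, not_or, hb, hc, he, hu, not_false_eq_true, and_self, hs_self]
  simp only [hs_antisymm he hu, hs_antisymm he hc, hs_antisymm he hb, hs_antisymm hc hb,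
    hs_antisymm hu hb, hs_antisymm hu hc] at h1 ⊢
  linear_combination (norm := abel) (-1 : ℤ) • h1

/-- The unipotent subgroup of a simple root. -/
def xSL : Fin 2 → F → SL
  | 0, u => unipSL u 0 0
  | 1, u => unipSL 0 u 0

/-- The coroot of a simple root. -/
def hSL : Fin 2 → Fˣ → SL
  | 0, u => dSL u⁻¹ u
  | 1, u => dSL 1 u⁻¹

/-- The SL₂ identity that brings a product with two occurrences of the same reflection back to the
big cell. -/
lemma rank_one_mul (i : Fin 2) (u : Fˣ) : sSL i * xSL i (u : F) * sSL i =
    xSL i (-(u : F)⁻¹) * (hSL i u * (sSL i * xSL i (-(u : F)⁻¹))) := by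
  have hu := u.ne_zero
  refine sl_ext fun i' j => ?_
  fin_cases i <;> fin_cases i' <;> fin_cases j <;>
    simp [coe_sl_mul, coe_sSL, coe_dSL, coe_unipSL, simpleRefl, Matrix.mul_apply,
      Fin.sum_univ_three, xSL, hSL, Matrix.diagonal]

/-- The symbols attached to both sides of `rank_one_mul`. With A and B the two rows (or minors)
exchanged by the reflection, the third vector is −B + uA; its leading term is related to those of uA
and −B as in `trop_lead`, and `rank_one_symbol` applies. -/
lemma rank_one (i : Fin 2) (u : Fˣ) (X : SL) :
    rc i (xSL i (u : F) * (sSL i * X)) + rc i X =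
      sg (hSL i u) (sSL i * (xSL i (-(u : F)⁻¹) * X)) + rc i (xSL i (-(u : F)⁻¹) * X) := by
  have hu := u.ne_zero
  have h02 : (0 : Fin 3) ≠ 2 := by decide
  have h12 : (1 : Fin 3) ≠ 2 := by decide
  fin_cases i
  · simp only [Fin.zero_eta, xSL, hSL]
    obtain ⟨r0, r1, r2⟩ := unipSL_rows (u : F) 0 0 (sSL 0 * X)
    obtain ⟨s0, s1, s2⟩ := sSL_zero_rows X
    obtain ⟨q0, q1, q2⟩ := unipSL_rows (-(u : F)⁻¹) 0 0 X
    simp only [zero_smul, add_zero, s0, s1, s2] at r0 r1 r2 q0 q1 q2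
    obtain ⟨-, t1, t2⟩ := tor_sSL_zero (unipSL (-(u : F)⁻¹) 0 0 * X)
    rw [rc_zero, rc_zero, rc_zero, sg_dSL, r0, r1, r2, q0, q1, q2]
    simp only [tc, t1, t2, q0, q1, q2, Matrix.cons_val]
    have x1 := lead_row_ne X 2
    have x2 := lead_wedge_ne X h02
    have x3 := lead_wedge_ne X h12
    have x4 := lead_wedge_ne (unipSL (u : F) 0 0 * (sSL 0 * X)) h02
    rw [r0, r2] at x4
    set A := wedge (X.1 0) (X.1 2)
    set B := wedge (X.1 1) (X.1 2)
    have eA : wedge (-X.1 1 + (u : F) • X.1 0) (X.1 2) = -B + (u : F) • A := by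
      rw [wedge_add_left, wedge_smul_left, wedge_neg_left]
    have eB : wedge (X.1 0 + -(u : F)⁻¹ • X.1 1) (X.1 2) = (u : F)⁻¹ • (-B + (u : F) • A) := by
      rw [wedge_add_left, wedge_smul_left, smul_add, smul_smul, inv_mul_cancel₀ hu]
      module
    rw [eA] at x4
    rw [eA, eB, lead_smul]
    have ht : Trop ((u : F) * lead A) (-lead B) (-lead (-B + (u : F) • A)) := by
      rw [← lead_smul, ← lead_neg, ← lead_neg]
      apply trop_lead; module
    have ht' : Trop ((u : F) * (lead A / lead (X.1 2))) (-(lead B / lead (X.1 2)))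
        (-(lead (-B + (u : F) • A) / lead (X.1 2))) := by
      unfold Trop at ht ⊢
      have e : ∀ w : F, w / lead (X.1 2) = 0 ↔ w = 0 := fun w => by simp [x1]
      rw [show (u : F) * (lead A / lead (X.1 2)) = (u : F) * lead A / lead (X.1 2) by ring,
        ← neg_div, ← neg_div, ← add_div, ← add_div, ← add_div, ← add_div, e, e, e, e]
      exact ht
    have := rank_one_symbol (div_ne_zero x3 x1) (div_ne_zero x2 x1) (div_ne_zero x4 x1) hu ht'
    rw [this, show (u : F)⁻¹ * lead (-B + (u : F) • A) / lead (X.1 2) =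
      lead (-B + (u : F) • A) / lead (X.1 2) / u by ring, Units.val_inv_eq_inv_val,
      hs_inv_left hu x1]
    abel
  · simp only [Fin.mk_one, xSL, hSL]
    obtain ⟨r0, r1, r2⟩ := unipSL_rows 0 (u : F) 0 (sSL 1 * X)
    obtain ⟨s0, s1, s2⟩ := sSL_one_rows X
    obtain ⟨q0, q1, q2⟩ := unipSL_rows 0 (-(u : F)⁻¹) 0 X
    simp only [zero_smul, add_zero, s0, s1, s2] at r0 r1 r2 q0 q1 q2
    obtain ⟨-, t1, t2⟩ := tor_sSL_one (unipSL 0 (-(u : F)⁻¹) 0 * X)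
    rw [rc_one, rc_one, rc_one, sg_dSL, r1, r2, q1, q2]
    simp only [tc, t1, t2, q0, q1, q2, Matrix.cons_val]
    have x1 := lead_row_ne X 2
    have x2 := lead_row_ne X 1
    have x3 := lead_wedge_ne X h12
    have x4 := lead_row_ne (unipSL 0 (u : F) 0 * (sSL 1 * X)) 1
    rw [r1] at x4
    set A := X.1 1
    set B := X.1 2
    have eB : A + -(u : F)⁻¹ • B = (u : F)⁻¹ • (-B + (u : F) • A) := by
      rw [smul_add, smul_smul, inv_mul_cancel₀ hu]; module
    have x5 : lead (A + -(u : F)⁻¹ • B) ≠ 0 := by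
      rw [eB, lead_smul]; exact mul_ne_zero (inv_ne_zero hu) x4
    have ht : Trop ((u : F) * lead A) (-lead B) (-lead (-B + (u : F) • A)) := by
      rw [← lead_smul, ← lead_neg, ← lead_neg]
      apply trop_lead; module
    rw [rank_one_symbol x1 x2 x4 hu ht, Units.val_one, hs_one_left x5, Units.val_inv_eq_inv_val,
      hs_one_left (by
        have := tor_ne (sSL 1 * (unipSL 0 (-(u : F)⁻¹) 0 * X)) 1
        rw [t1, q1, q2] at this; exact this), eB, lead_smul,
      show (u : F)⁻¹ * lead (-B + (u : F) • A) = lead (-B + (u : F) • A) / u by ring]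
    abel

/-- The two expressions for the cocycle of the longest element. -/
lemma wc_braid (X : SL) : wc [1, 0, 1] X = wc [0, 1, 0] X := by
  have h01 : (0 : Fin 3) ≠ 1 := by decide
  have h02 : (0 : Fin 3) ≠ 2 := by decide
  have h12 : (1 : Fin 3) ≠ 2 := by decide
  obtain ⟨s0, s1, s2⟩ := sSL_zero_rows X
  obtain ⟨r0, r1, r2⟩ := sSL_one_rows X
  obtain ⟨q0, q1, q2⟩ := sSL_zero_rows (sSL 1 * X)
  obtain ⟨p0, p1, p2⟩ := sSL_one_rows (sSL 0 * X)
  have a1 := lead_row_ne X 0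
  have a2 := lead_row_ne X 1
  have a3 := lead_row_ne X 2
  have w12 := lead_wedge_ne X h01
  have w13 := lead_wedge_ne X h02
  have w23 := lead_wedge_ne X h12
  -- The Plücker relation on leading terms requires a nonzero entry in the first column, which
  -- invertibility provides.
  have hh : X.1 0 0 ≠ 0 ∨ X.1 1 0 ≠ 0 ∨ X.1 2 0 ≠ 0 := by
    by_contra hcon
    push Not at hcon
    have := X.2
    rw [Matrix.det_eq_zero_of_column_eq_zero 0 (by
      intro i; fin_cases i; exacts [hcon.1, hcon.2.1, hcon.2.2])] at this
    exact zero_ne_one this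
  -- After bilinear expansion the two words differ by exactly one Steinberg relation, that of the
  -- leading terms of the Plücker relation among the three rows.
  have ht := hs_trop (mul_ne_zero a1 w23) (neg_ne_zero.2 (mul_ne_zero a2 w13))
    (mul_ne_zero a3 w12)
    (trop_plucker (wedge_ne_zero X h01) (wedge_ne_zero X h02) (wedge_ne_zero X h12) hh)
  simp only [wc, wSL_cons, wSL_nil, mul_one, one_mul, mul_assoc]
  rw [rc_one, rc_one, rc_zero, rc_zero, rc_zero, rc_one, q1, q2, p0, p1, p2, s0, s1, s2, r0, r1, r2]
  simp only [wedge_neg_left, wedge_neg_right, wedge_swap (X.1 2) (X.1 1),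
    wedge_swap (X.1 1) (X.1 0), wedge_swap (X.1 2) (X.1 0), lead_neg, neg_neg]
  simp only [hs_neg_left, hs_neg_right, neg_div, hs_mul_left, hs_mul_right, hs_inv_left,
    hs_inv_right, ne_eq, inv_eq_zero, neg_eq_zero, div_eq_zero_iff,
    mul_eq_zero, not_or, a1, a2, a3, w12, w13, w23, not_false_eq_true, and_self,
    div_eq_mul_inv, hs_self] at ht ⊢
  simp only [hs_antisymm a2 a1, hs_antisymm a3 a1, hs_antisymm a3 a2, hs_antisymm w12 a1,
    hs_antisymm w12 a2, hs_antisymm w12 a3, hs_antisymm w13 a1, hs_antisymm w13 a2,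
    hs_antisymm w13 a3, hs_antisymm w23 a1, hs_antisymm w23 a2, hs_antisymm w23 a3,
    hs_antisymm w13 w12, hs_antisymm w23 w12, hs_antisymm w23 w13] at ht ⊢
  linear_combination (norm := abel) (-1 : ℤ) • ht

end Nucleus

/-! ### Simple reflections, the cocycle identity and the group law -/

section Associativity

variable {F : Type*} [Field F] [ValuativeRel F] [TopologicalSpace F]
  [IsNonarchimedeanLocalField F] [TameCubic F]

local notation "SL" => Matrix.SpecialLinearGroup (Fin 3) F

/-- Associativity of the triple `s_i, h, k` for all `k`. -/
def NucS (i : Fin 2) (h : SL) : Prop :=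
  ∀ k : SL, rc i h + sg (sSL i * h) k = rc i (h * k) + sg h k

/-- The radical of the parabolic subgroup of a simple root. -/
def radSL : Fin 2 → F → F → SL
  | 0, y, z => unipSL 0 y z
  | 1, x, z => unipSL x 0 z

lemma sSL_rad (i : Fin 2) (y z : F) : ∃ p : F × F × F, sSL i * radSL i y z = uSL p * sSL i := by
  fin_cases i
  · exact ⟨(0, z, -y), s0_unip y z⟩
  · exact ⟨(-z, 0, y), s1_unip y z⟩

lemma rc_rad (i : Fin 2) (y z : F) (g : SL) : rc i (radSL i y z * g) = rc i g := by
  fin_cases i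
  · exact rc0_unip y z g
  · exact rc1_unip y z g

lemma sg_uSL_mul (p : F × F × F) (g k : SL) : sg (uSL p * g) k = sg g k := sg_unip_mul _ _ _ _ _

lemma sg_rad_mul (i : Fin 2) (y z : F) (g k : SL) : sg (radSL i y z * g) k = sg g k := by
  fin_cases i <;> exact sg_unip_mul _ _ _ _ _

lemma sg_x_mul (i : Fin 2) (u : F) (g k : SL) : sg (xSL i u * g) k = sg g k := by
  fin_cases i <;> exact sg_unip_mul _ _ _ _ _

/-- Together with `NucS.right` and `NucS.dSL`, this strips h of its parabolic radical, torus and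
right unipotent factors, leaving only h = x_i(u) w. -/
lemma NucS.rad {i : Fin 2} {h : SL} (H : NucS i h) (y z : F) : NucS i (radSL i y z * h) := by
  intro k
  obtain ⟨p, hp⟩ := sSL_rad i y z
  rw [rc_rad, ← mul_assoc, hp, mul_assoc, sg_uSL_mul, sg_rad_mul, mul_assoc, rc_rad, H k]

lemma NucS.right {i : Fin 2} {h : SL} (H : NucS i h) (q : F × F × F) : NucS i (h * uSL q) := by
  intro k
  have := H (uSL q * k)
  rw [uSL] at *
  rw [rc_mul_unip, ← mul_assoc, sg_mul_unip_left, sg_mul_unip_left, mul_assoc, this]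

lemma hSL_eq (i : Fin 2) (u : Fˣ) : ∃ a b : Fˣ, (hSL i u : SL) = dSL a b := by
  fin_cases i
  exacts [⟨_, _, rfl⟩, ⟨_, _, rfl⟩]

lemma sTor_eq (i : Fin 2) (a b : Fˣ) : ∃ a' b' : Fˣ, (sTor i a b : SL) = dSL a' b' := by
  fin_cases i
  exacts [⟨_, _, rfl⟩, ⟨_, _, rfl⟩]

lemma NucS.dSL {i : Fin 2} {h : SL} (H : NucS i h) (a b : Fˣ) : NucS i (dSL a b * h) := by
  intro k
  obtain ⟨c, hc⟩ := rc_dSL (F := F) i a b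
  obtain ⟨a', b', hd⟩ := sTor_eq (F := F) i a b
  have h1 := hc h
  have h2 := hc (h * k)
  have h3 := sg_dSL_mul_left a b h k
  have h4 := sg_dSL_mul_left a' b' (sSL i * h) k
  rw [← hd] at h4
  rw [← mul_assoc, sSL_dSL, mul_assoc, mul_assoc]
  rw [mul_assoc] at h4
  linear_combination (norm := abel) h1 - h2 - h3 + h4 + H k

lemma sg_dSL_of_tor (a b : Fˣ) {k : SL} (hk : tor k = 1) : sg (CubicCover.dSL a b) k = 0 := by
  simp only [sg_dSL, tc, hk, Pi.one_apply]
  simp [hs_one_right]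

lemma rc_of_tor (i : Fin 2) {k : SL} (hk : tor k = 1) : rc i k = 0 := by
  show hs (tor k i.succ) _ = 0
  rw [hk, Pi.one_apply, hs_one_left]
  exact tor_ne _ _

lemma rc_sSL (i : Fin 2) (X : SL) : rc i (sSL i * X) + rc i X = 0 := by
  fin_cases i
  · obtain ⟨s0, s1, s2⟩ := sSL_zero_rows X
    simp only [Fin.zero_eta]
    have h02 : (0 : Fin 3) ≠ 2 := by decide
    have h12 : (1 : Fin 3) ≠ 2 := by decide
    have x1 := lead_row_ne X 2
    have x2 := lead_wedge_ne X h02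
    have x3 := lead_wedge_ne X h12
    rw [rc_zero, rc_zero, s0, s1, s2, wedge_neg_left, lead_neg, neg_div,
      hs_neg_right (div_ne_zero x2 x1) (div_ne_zero x3 x1),
      hs_antisymm (div_ne_zero x2 x1) (div_ne_zero x3 x1)]
    abel
  · obtain ⟨s0, s1, s2⟩ := sSL_one_rows X
    simp only [Fin.mk_one]
    have x1 := lead_row_ne X 2
    have x2 := lead_row_ne X 1
    rw [rc_one, rc_one, s1, s2, lead_neg, hs_neg_right x2 x1, hs_antisymm x2 x1]
    abel

lemma sSL_sq (i : Fin 2) : ∃ a b : Fˣ, (sSL i * sSL i : SL) = CubicCover.dSL a b ∧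
    ((a : F) = 1 ∨ (a : F) = -1) ∧ ((b : F) = 1 ∨ (b : F) = -1) := by
  fin_cases i
  · refine ⟨-1, -1, sl_ext fun i j => ?_, by simp, by simp⟩
    fin_cases i <;> fin_cases j <;> simp [coe_sl_mul, coe_sSL, coe_dSL, simpleRefl,
      Matrix.mul_apply, Fin.sum_univ_three]
  · refine ⟨1, -1, sl_ext fun i j => ?_, by simp, by simp⟩
    fin_cases i <;> fin_cases j <;> simp [coe_sl_mul, coe_sSL, coe_dSL, simpleRefl,
      Matrix.mul_apply, Fin.sum_univ_three]

lemma hs_sign_left {a y : F} (ha : a = 1 ∨ a = -1) (hy : y ≠ 0) : hs a y = 0 := by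
  rcases ha with rfl | rfl
  · exact hs_one_left hy
  · exact hs_neg_one_left hy

lemma sg_sign {a b : Fˣ} (ha : (a : F) = 1 ∨ (a : F) = -1) (hb : (b : F) = 1 ∨ (b : F) = -1)
    (k : SL) : sg (CubicCover.dSL a b) k = 0 := by
  simp only [sg_dSL, tc, Matrix.cons_val]
  rw [hs_sign_left ha (tor_ne _ _), hs_sign_left ha (tor_ne _ _), hs_sign_left hb (tor_ne _ _)]
  simp

/-- `s_i W` is a longer representative than `W`. -/
structure Ascends (i : Fin 2) (W : SL) : Prop where
  move : ∀ u : F, ∃ q, xSL i u * W = W * uSL q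
  tor_eq : tor W = 1
  tor_s : tor (sSL i * W) = 1
  sg_s : ∀ k, sg (sSL i * W) k = rc i (W * k) + sg W k

lemma Ascends.nucS {i : Fin 2} {W : SL} (H : Ascends i W) : NucS i W := by
  intro k
  rw [rc_of_tor i H.tor_eq, zero_add, H.sg_s]

lemma Ascends.nucS_x {i : Fin 2} {W : SL} (H : Ascends i W) (u : F) : NucS i (xSL i u * W) := by
  obtain ⟨q, hq⟩ := H.move u
  rw [hq]
  exact H.nucS.right q

lemma xSL_zero (i : Fin 2) : (xSL i 0 : SL) = 1 := by
  fin_cases i <;> exact unipSL_zero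

/-- For u = 0 the square of s_i is diagonal with entries ±1, on which all symbols vanish. For u ≠ 0,
`rank_one_mul` leads back to s_i W up to factors already under control, and `rank_one` is compared
at W and at Wk. -/
lemma Ascends.nucS_down {i : Fin 2} {W : SL} (H : Ascends i W) (u : F) :
    NucS i (xSL i u * (sSL i * W)) := by
  intro k
  by_cases hu : u = 0
  · subst hu
    obtain ⟨a, b, hd, ha, hb⟩ := sSL_sq (F := F) i
    have h3 := sg_dSL_mul_left a b W k
    rw [sg_sign ha hb, sg_sign ha hb] at h3
    have h1 := rc_sSL i (W * k)
    have h2 := H.sg_s k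
    rw [xSL_zero, one_mul, ← mul_assoc, hd, rc_of_tor i H.tor_s, mul_assoc]
    linear_combination (norm := abel) h3 - h1 - h2
  · lift u to Fˣ using IsUnit.mk0 u hu
    -- The factor x_i(−u⁻¹) can be moved to the right of W by the ascent hypothesis, so that each
    -- torus part occurring at k = 1 is trivial.
    obtain ⟨a, b, hd⟩ := hSL_eq (F := F) i u
    obtain ⟨q, hq⟩ := H.move (-(u : F)⁻¹)
    have e : sSL i * (xSL i (u : F) * (sSL i * W)) =
        xSL i (-(u : F)⁻¹) * (hSL i u * (sSL i * W * uSL q)) := by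
      rw [mul_assoc (sSL i) W, ← hq]
      simpa only [mul_assoc] using congrArg (· * W) (rank_one_mul i u)
    have r1 := rank_one i u W
    have r2 := rank_one i u (W * k)
    have t : tor (sSL i * W * uSL q) = 1 := by rw [uSL, tor_mul_unip, H.tor_s]
    have t' : tor (W * uSL q) = 1 := by rw [uSL, tor_mul_unip, H.tor_eq]
    rw [hq, ← mul_assoc (sSL i), hd, sg_dSL_of_tor a b t, rc_of_tor i t', rc_of_tor i H.tor_eq] at r1
    have h3 := sg_dSL_mul_left a b (sSL i * W * uSL q) k
    rw [sg_dSL_of_tor a b t] at h3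
    have h4 := H.sg_s (uSL q * k)
    have h5 : sg (sSL i * W * uSL q) k = sg (sSL i * W) (uSL q * k) := sg_mul_unip_left _ _ _ _ _
    have h6 : sg W (uSL q * k) = sg W k := by
      rw [← sg_x_mul i (-(u : F)⁻¹) W k, hq]; exact (sg_mul_unip_left _ _ _ _ _).symm
    have h7 := H.sg_s k
    have e2 : xSL i (-(u : F)⁻¹) * (W * k) = W * (uSL q * k) := by
      rw [← mul_assoc, hq, mul_assoc]
    have e3 : sSL i * (W * (uSL q * k)) = sSL i * W * uSL q * k := by simp only [mul_assoc]
    rw [e2, hd, e3] at r2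
    rw [e, sg_x_mul, sg_x_mul, hd]
    have e4 : xSL i (u : F) * (sSL i * W) * k = xSL i (u : F) * (sSL i * (W * k)) := by
      simp only [mul_assoc]
    rw [e4]
    linear_combination (norm := abel) r1 - r2 + h3 + h4 + h5 + h6 - h7

lemma ascends_of_words {i : Fin 2} {l : List (Fin 2)} (hl : l ∈ reducedWords)
    (hl' : i :: l ∈ reducedWords) (q : F → F × F × F)
    (hq : ∀ u : F, xSL i u * wSL l = wSL l * uSL (q u)) : Ascends i (wSL l : SL) := by
  refine ⟨fun u => ⟨q u, hq u⟩, tor_wSL l hl, ?_, fun k => ?_⟩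
  · rw [← wSL_cons]; exact tor_wSL _ hl'
  · rw [← wSL_cons, sg_word hl', sg_word hl]; rfl

lemma ascends_0 : Ascends 0 (wSL [] : SL) :=
  ascends_of_words (by simp [reducedWords]) (by simp [reducedWords]) (fun u => (u, 0, 0))
    fun u => by simp [xSL, uSL]

lemma ascends_1 : Ascends 1 (wSL [] : SL) :=
  ascends_of_words (by simp [reducedWords]) (by simp [reducedWords]) (fun u => (0, u, 0))
    fun u => by simp [xSL, uSL]

lemma ascends_01 : Ascends 0 (wSL [1] : SL) :=
  ascends_of_words (by simp [reducedWords]) (by simp [reducedWords]) (fun u => (0, 0, -u))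
    fun u => sl_ext fun i j => by
      rw [coe_sl_mul, coe_sl_mul, coe_wSL_1]
      fin_cases i <;> fin_cases j <;> simp [xSL, uSL, coe_unipSL, Matrix.mul_apply,
        Fin.sum_univ_three]

lemma ascends_10 : Ascends 1 (wSL [0] : SL) :=
  ascends_of_words (by simp [reducedWords]) (by simp [reducedWords]) (fun u => (0, 0, u))
    fun u => sl_ext fun i j => by
      rw [coe_sl_mul, coe_sl_mul, coe_wSL_0]
      fin_cases i <;> fin_cases j <;> simp [xSL, uSL, coe_unipSL, Matrix.mul_apply,
        Fin.sum_univ_three]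

lemma ascends_010 : Ascends 0 (wSL [1, 0] : SL) :=
  ascends_of_words (by simp [reducedWords]) (by simp [reducedWords]) (fun u => (0, u, 0))
    fun u => sl_ext fun i j => by
      rw [coe_sl_mul, coe_sl_mul, coe_wSL_10]
      fin_cases i <;> fin_cases j <;> simp [xSL, uSL, coe_unipSL, Matrix.mul_apply,
        Fin.sum_univ_three]

/-- The one ascent that spells the longest element by the word not chosen in `reducedWords`; the
comparison of the two words is `wc_braid`. -/
lemma ascends_101 : Ascends 1 (wSL [0, 1] : SL) := by
  have e : (sSL 1 * wSL [0, 1] : SL) = wSL [0, 1, 0] := by rw [← wSL_cons, wSL_braid]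
  refine ⟨fun u => ⟨(u, 0, 0), sl_ext fun i j => ?_⟩, tor_wSL _ (by simp [reducedWords]), ?_,
    fun k => ?_⟩
  · rw [coe_sl_mul, coe_sl_mul, coe_wSL_01]
    fin_cases i <;> fin_cases j <;> simp [xSL, uSL, coe_unipSL, Matrix.mul_apply,
      Fin.sum_univ_three]
  · rw [e]; exact tor_wSL _ (by simp [reducedWords])
  · rw [e, sg_word (by simp [reducedWords]), sg_word (by simp [reducedWords]), ← wc_braid]; rfl

lemma nucS_word (i : Fin 2) (u : F) : ∀ l ∈ reducedWords, NucS i (xSL i u * wSL l) := by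
  have d010 : (wSL [0, 1, 0] : SL) = sSL 1 * wSL [0, 1] := by rw [← wSL_cons, wSL_braid]
  apply forall_reduced
  fin_cases i
  · refine ⟨ascends_0.nucS_x u, ?_, ascends_01.nucS_x u, ?_, ascends_010.nucS_x u, ?_⟩
    · rw [wSL_cons]; exact ascends_0.nucS_down u
    · rw [wSL_cons]; exact ascends_01.nucS_down u
    · rw [wSL_cons]; exact ascends_010.nucS_down u
  · refine ⟨ascends_1.nucS_x u, ascends_10.nucS_x u, ?_, ascends_101.nucS_x u, ?_, ?_⟩
    · rw [wSL_cons]; exact ascends_1.nucS_down u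
    · rw [wSL_cons]; exact ascends_10.nucS_down u
    · rw [d010]; exact ascends_101.nucS_down u

/-- In the Bruhat decomposition of h, the factor in N splits into the radical of the minimal
parabolic and x_i(u). The radical and the torus are removed on the left, N on the right, and a Weyl
word remains. -/
lemma nuc_sSL (i : Fin 2) : Nuc (sSL i : SL) := by
  intro h k
  rw [sg_sSL, sg_sSL]
  revert k
  show NucS i h
  obtain ⟨p, a, b, l, q, hl, rfl⟩ := bruhat h
  obtain ⟨y, z, u, hp⟩ : ∃ y z u, uSL p = radSL i y z * xSL i u := by
    fin_cases i
    · refine ⟨p.2.1, p.2.2 , p.1, ?_⟩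
      simp [radSL, xSL, uSL, unipSL_mul]
    · refine ⟨p.1, p.2.2 - p.1 * p.2.1, p.2.1, ?_⟩
      simp [radSL, xSL, uSL, unipSL_mul]
  obtain ⟨u', hu'⟩ : ∃ u', xSL i u * dSL a b = dSL a b * xSL i u' := by
    have ha := a.ne_zero
    have hb := b.ne_zero
    fin_cases i
    · refine ⟨b / a * u, ?_⟩
      simp only [Fin.zero_eta, xSL]
      rw [dSL_unip, mul_zero, mul_zero]; congr 2; field_simp
    · refine ⟨u / (a * b ^ 2), ?_⟩
      simp only [Fin.mk_one, xSL]
      rw [dSL_unip, mul_zero, mul_zero]; congr 2; field_simp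
  rw [hp, mul_assoc, mul_assoc (dSL a b), ← mul_assoc (xSL i u), hu', mul_assoc (dSL a b),
    ← mul_assoc (xSL i u')]
  exact (((nucS_word i u' l hl).right q).dSL a b).rad y z

lemma nuc_wSL (l : List (Fin 2)) : Nuc (wSL l : SL) := by
  induction l with
  | nil => intro h k; simp [sg_one]
  | cons a l ih => rw [wSL_cons]; exact (nuc_sSL a).mul ih

/-- The cocycle identity. -/
lemma sg_cocycle (g h k : SL) : sg g h + sg (g * h) k = sg g (h * k) + sg h k := by
  obtain ⟨p, a, b, l, q, hl, rfl⟩ := bruhat g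
  exact ((nuc_unip _ _ _).mul (((nuc_dSL a b).mul (nuc_wSL l)).mul (nuc_unip _ _ _))) h k

lemma sg_one_right (g : SL) : sg g 1 = 0 := by
  have := sg_cocycle g 1 1
  simpa [sg_one] using this

lemma blockCocycle_eq (g h : SL) : blockCocycle g.1 h.1 = (sg g h).toMul := rfl

instance : One (MetaSL3 F) := ⟨sec 1⟩

instance : Inv (MetaSL3 F) := ⟨fun x => ⟨x.mat⁻¹, x.root⁻¹ * (blockCocycle x.mat⁻¹.1 x.mat.1)⁻¹⟩⟩

@[simp] lemma one_mat : (1 : MetaSL3 F).mat = 1 := rfl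
@[simp] lemma one_root : (1 : MetaSL3 F).root = 1 := rfl
@[simp] lemma mul_mat (x y : MetaSL3 F) : (x * y).mat = x.mat * y.mat := rfl
lemma mul_root (x y : MetaSL3 F) :
    (x * y).root = x.root * y.root * (sg x.mat y.mat).toMul := rfl

instance : Group (MetaSL3 F) := Group.ofLeftAxioms
  (by
    intro x y z
    ext : 1
    · simp [mul_assoc]
    · simp only [mul_root, mul_mat]
      have := congrArg Additive.toMul (sg_cocycle x.mat y.mat z.mat)
      simp only [toMul_add] at this
      calc _ = x.root * y.root * z.root * ((sg x.mat y.mat).toMul *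
            (sg (x.mat * y.mat) z.mat).toMul) := by
            simp only [mul_comm, mul_left_comm, mul_assoc]
        _ = _ := by rw [this]; simp only [mul_comm, mul_left_comm, mul_assoc])
  (by
    intro x
    ext : 1
    · simp
    · simp [mul_root, sg_one])
  (by
    intro x
    ext : 1
    · show x.mat⁻¹ * x.mat = 1; simp
    · show x.root⁻¹ * (blockCocycle x.mat⁻¹.1 x.mat.1)⁻¹ * x.root * _ = 1
      rw [blockCocycle_eq]
      show x.root⁻¹ * (sg x.mat⁻¹ x.mat).toMul⁻¹ * x.root * (sg x.mat⁻¹ x.mat).toMul = 1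
      rw [mul_comm (x.root⁻¹), mul_assoc _ x.root⁻¹]; simp)

end Associativity

/-! ### Integral matrices and invariance of the longest-word cocycle -/

section Integral

variable {F : Type*} [Field F] [ValuativeRel F] [TopologicalSpace F]
  [IsNonarchimedeanLocalField F] [TameCubic F]

local notation "v" => valuation F
local notation "SL" => Matrix.SpecialLinearGroup (Fin 3) F

/-- Matrices with integral entries. -/
def IsInt (g : SL) : Prop := ∀ i j, v (g.1 i j) ≤ 1

lemma isInt_iff (g : SL) : IsInt g ↔ ∃ k, inclK k = g := by
  constructor
  · intro h
    let M : Matrix (Fin 3) (Fin 3) 𝒪[F] := fun i j => ⟨g.1 i j, h i j⟩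
    have hM : (algebraMap 𝒪[F] F).mapMatrix M = g.1 := by ext i j; rfl
    refine ⟨⟨M, ?_⟩, ?_⟩
    · apply (FaithfulSMul.algebraMap_injective 𝒪[F] F)
      rw [RingHom.map_det, hM, map_one]; exact g.2
    · apply Subtype.ext; exact hM
  · rintro ⟨k, rfl⟩ i j
    exact (k.1 i j).2

lemma inclK_mul (k k' : Matrix.SpecialLinearGroup (Fin 3) 𝒪[F]) :
    inclK (k * k') = inclK k * inclK k' := map_mul _ _ _

lemma inclK_inv (k : Matrix.SpecialLinearGroup (Fin 3) 𝒪[F]) :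
    inclK k⁻¹ = (inclK k)⁻¹ := map_inv _ _

lemma inclK_injective : Function.Injective (inclK (F := F)) := by
  intro k k' h
  apply Subtype.ext
  ext i j
  exact congrArg (fun g : SL => g.1 i j) h

lemma isInt_inclK (k : Matrix.SpecialLinearGroup (Fin 3) 𝒪[F]) : IsInt (inclK k) :=
  (isInt_iff _).2 ⟨k, rfl⟩

lemma IsInt.mul {g h : SL} (hg : IsInt g) (hh : IsInt h) : IsInt (g * h) := by
  obtain ⟨k, rfl⟩ := (isInt_iff _).1 hg
  obtain ⟨k', rfl⟩ := (isInt_iff _).1 hh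
  rw [← inclK_mul]; exact isInt_inclK _

lemma IsInt.inv {g : SL} (hg : IsInt g) : IsInt g⁻¹ := by
  obtain ⟨k, rfl⟩ := (isInt_iff _).1 hg
  rw [← inclK_inv]; exact isInt_inclK _

lemma isInt_one : IsInt (1 : SL) := (isInt_iff _).2 ⟨1, map_one _⟩

lemma isInt_unip {x y z : F} (hx : v x ≤ 1) (hy : v y ≤ 1) (hz : v z ≤ 1) :
    IsInt (unipSL x y z) := by
  intro i j
  rw [coe_unipSL]
  fin_cases i <;> fin_cases j <;> simp [hx, hy, hz]

lemma isInt_sSL (i : Fin 2) : IsInt (sSL i : SL) := by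
  intro a b
  rw [coe_sSL]
  fin_cases i <;> fin_cases a <;> fin_cases b <;> simp [simpleRefl]

lemma isInt_wSL (l : List (Fin 2)) : IsInt (wSL l : SL) := by
  induction l with
  | nil => exact isInt_one
  | cons a l ih => rw [wSL_cons]; exact (isInt_sSL a).mul ih

lemma isInt_dSL {a b : Fˣ} (ha : v (a : F) = 1) (hb : v (b : F) = 1) : IsInt (dSL a b : SL) := by
  intro i j
  rw [coe_dSL]
  fin_cases i <;> fin_cases j <;> simp [ha, hb]

lemma IsInt.wedge_le {g : SL} (hg : IsInt g) (i j c : Fin 3) : v (wedge (g.1 i) (g.1 j) c) ≤ 1 := by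
  fin_cases c <;>
    exact v_sub_le (v_mul_le (hg _ _) (hg _ _)) (v_mul_le (hg _ _) (hg _ _))

/-- The open cell of the Bruhat decomposition modulo `𝔭`, up to the longest element. -/
structure InV (g : SL) : Prop where
  int : IsInt g
  fst : v (g.1 0 0) = 1
  snd : v (wedge (g.1 0) (g.1 1) 0) = 1

lemma lead_unit {r : Fin 3 → F} (h : v (r 0) = 1) : lead r = r 0 :=
  lead_of_zero (ne_zero_of_v h)

/-- The dichotomy behind the congruences below: a unit leading entry pairs trivially with units, and
otherwise the entry of the first column lies in 𝔭, so multiples of it do not affect residues. -/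
lemma lead_alt {r : Fin 3 → F} (h : v (r 0) ≤ 1) : v (lead r) = 1 ∨ v (r 0) < 1 := by
  by_cases h1 : v (r 0) < 1
  · exact Or.inr h1
  · left
    have := v_eq_one_of_not_lt h h1
    rwa [lead_unit this]

lemma plucker (g : SL) : g.1 0 0 * wedge (g.1 1) (g.1 2) 0 - g.1 1 0 * wedge (g.1 0) (g.1 2) 0 +
    g.1 2 0 * wedge (g.1 0) (g.1 1) 0 = 0 := by
  simp only [wedge, Matrix.cons_val_zero]; ring

/-- The cocycle of the longest element. -/
lemma wc_left_form (X : SL) : wc [0, 1, 0] X =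
    rc 0 X + hs (lead (X.1 2)) (lead (X.1 0)) +
      hs (lead (wedge (X.1 0) (X.1 2)) / lead (X.1 0))
        (lead (wedge (X.1 0) (X.1 1)) / lead (X.1 0)) := by
  obtain ⟨s0, s1, s2⟩ := sSL_zero_rows X
  obtain ⟨q0, q1, q2⟩ := sSL_one_rows (sSL 0 * X)
  simp only [wc, wSL_cons, wSL_nil, mul_one, one_mul, mul_assoc]
  rw [rc_one, rc_zero (sSL 1 * (sSL 0 * X)), q0, q1, q2, s0, s1, s2]
  have a1 := lead_row_ne X 0
  have w12 := lead_wedge_ne X (show (0 : Fin 3) ≠ 1 by decide)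
  have w13 := lead_wedge_ne X (show (0 : Fin 3) ≠ 2 by decide)
  simp only [wedge_neg_left, wedge_swap (X.1 2) (X.1 0), wedge_swap (X.1 1) (X.1 0), lead_neg,
    neg_neg]
  abel

/-- The same cocycle computed with the other reduced word. `wc_left_form` contains s_0 first and is
adapted to translations by (0, y, z); this one is adapted to (x, 0, z). -/
lemma wc_right_form (X : SL) : wc [0, 1, 0] X =
    rc 1 X + hs (lead (wedge (X.1 1) (X.1 2)) / lead (X.1 1))
        (lead (wedge (X.1 0) (X.1 1)) / lead (X.1 1)) + hs (lead (X.1 1)) (lead (X.1 0)) := by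
  rw [← wc_braid]
  obtain ⟨s0, s1, s2⟩ := sSL_one_rows X
  obtain ⟨q0, q1, q2⟩ := sSL_zero_rows (sSL 1 * X)
  simp only [wc, wSL_cons, wSL_nil, mul_one, one_mul, mul_assoc]
  rw [rc_one (sSL 0 * _), rc_zero, q1, q2, s0, s1, s2]
  simp only [wedge_neg_left, wedge_swap (X.1 2) (X.1 1), lead_neg, neg_neg]
  abel

lemma InV.lead0 {g : SL} (h : InV g) : lead (g.1 0) = g.1 0 0 := lead_unit h.fst

lemma InV.lead01 {g : SL} (h : InV g) : lead (wedge (g.1 0) (g.1 1)) = wedge (g.1 0) (g.1 1) 0 :=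
  lead_unit h.snd

lemma InV.wc_left {g : SL} (h : InV g) : wc [0, 1, 0] g =
    rc 0 g + hs (lead (g.1 2)) (g.1 0 0) +
      (hs (lead (wedge (g.1 0) (g.1 2))) (wedge (g.1 0) (g.1 1) 0) -
        hs (lead (wedge (g.1 0) (g.1 2))) (g.1 0 0)) := by
  have w13 := lead_wedge_ne g (show (0 : Fin 3) ≠ 2 by decide)
  have a := ne_zero_of_v h.fst
  have m := ne_zero_of_v h.snd
  rw [wc_left_form, h.lead0, h.lead01, hs_div_left w13 a (div_ne_zero m a),
    hs_unit_unit h.fst (v_unit_div h.snd h.fst), hs_div_right w13 m a, sub_zero]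

lemma InV.wc_right {g : SL} (h : InV g) : wc [0, 1, 0] g =
    hs (lead (g.1 2)) (lead (g.1 1)) - hs (lead (wedge (g.1 1) (g.1 2))) (lead (g.1 1)) +
      hs (lead (wedge (g.1 1) (g.1 2))) (wedge (g.1 0) (g.1 1) 0) +
      (hs (lead (g.1 1)) (g.1 0 0) - hs (lead (g.1 1)) (wedge (g.1 0) (g.1 1) 0)) := by
  have w23 := lead_wedge_ne g (show (1 : Fin 3) ≠ 2 by decide)
  have a := lead_row_ne g 1
  have m := ne_zero_of_v h.snd
  rw [wc_right_form, h.lead0, h.lead01, rc_one, hs_div_left w23 a (div_ne_zero m a),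
    hs_div_right w23 m a, hs_div_right a m a, hs_self a]
  abel

lemma hs_sub_eq {x p q p' q' : F} (hx : x ≠ 0) (hp : v p = 1) (hq : v q = 1) (hp' : v p' = 1)
    (hq' : v q' = 1) (h : v x = 1 ∨ v (p' * q - p * q') < 1) :
    hs x p' - hs x q' = hs x p - hs x q := by
  rcases h with h | h
  · rw [hs_unit_unit h hp, hs_unit_unit h hq, hs_unit_unit h hp', hs_unit_unit h hq']
  · have := hs_cong_right hx (v_unit_mul hp' hq) h
    rw [hs_mul_right hx (ne_zero_of_v hp') (ne_zero_of_v hq),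
      hs_mul_right hx (ne_zero_of_v hp) (ne_zero_of_v hq')] at this
    linear_combination (norm := abel) this

lemma hs_eq_of_cong {x p p' : F} (hx : x ≠ 0) (hp : v p = 1) (hp' : v p' = 1)
    (h : v x = 1 ∨ v (p' - p) < 1) : hs x p' = hs x p := by
  rcases h with h | h
  · rw [hs_unit_unit h hp, hs_unit_unit h hp']
  · exact hs_cong_right hx hp' h

/-- In `InV.wc_left` only the unit arguments, the first entry and the first 2 × 2 minor, change
under this translation. They change by elements of 𝔭 whenever the entry they are paired with is not
a unit. -/
lemma InV.wc_unip_right {g : SL} (h : InV g) {y z : F} (hy : v y ≤ 1) (hz : v z ≤ 1)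
    (h' : InV (unipSL 0 y z * g)) : wc [0, 1, 0] (unipSL 0 y z * g) = wc [0, 1, 0] g := by
  obtain ⟨r0, r1, r2⟩ := unipSL_rows 0 y z g
  have e13 : wedge ((unipSL 0 y z * g).1 0) ((unipSL 0 y z * g).1 2) =
      wedge (g.1 0) (g.1 2) := by
    rw [r0, r2]; simp only [wedge_add_left, wedge_smul_left, wedge_self, zero_smul, smul_zero,
      add_zero]
  have ea : (unipSL 0 y z * g).1 0 0 = g.1 0 0 + z * g.1 2 0 := by rw [r0]; simp
  have em : wedge ((unipSL 0 y z * g).1 0) ((unipSL 0 y z * g).1 1) 0 =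
      wedge (g.1 0) (g.1 1) 0 + y * wedge (g.1 0) (g.1 2) 0 - z * wedge (g.1 1) (g.1 2) 0 := by
    rw [r0, r1]; simp [wedge]; ring
  have w13 := lead_wedge_ne g (show (0 : Fin 3) ≠ 2 by decide)
  rw [h'.wc_left, h.wc_left, rc0_unip, e13, r2]
  rw [hs_eq_of_cong (lead_row_ne g 2) h.fst h'.fst ?_, hs_sub_eq w13 h.snd h.fst h'.snd h'.fst ?_]
  pick_goal 2
  · rw [ea]
    rcases lead_alt (h.int 2 0) with h1 | h1
    · exact Or.inl h1
    · right; rw [add_sub_cancel_left]; exact v_mul_lt hz h1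
  · rcases lead_alt (h.int.wedge_le 0 2 0) with h1 | h1
    · exact Or.inl h1
    · right
      -- The two units move simultaneously; only the cross difference matters, and the Plücker
      -- relation makes it a multiple of the minor of rows 0 and 2, which lies in 𝔭 here.
      have := plucker g
      rw [show wedge ((unipSL 0 y z * g).1 0) ((unipSL 0 y z * g).1 1) 0 * g.1 0 0 -
        wedge (g.1 0) (g.1 1) 0 * (unipSL 0 y z * g).1 0 0 =
        (y * g.1 0 0 - z * g.1 1 0) * wedge (g.1 0) (g.1 2) 0 by
          rw [ea, em]; linear_combination (-z) * this]
      exact v_mul_lt (v_sub_le (v_mul_le hy (h.int _ _)) (v_mul_le hz (h.int _ _))) h1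

lemma InV.wc_unip_left {g : SL} (h : InV g) {x z : F} (hx : v x ≤ 1) (hz : v z ≤ 1)
    (h' : InV (unipSL x 0 z * g)) : wc [0, 1, 0] (unipSL x 0 z * g) = wc [0, 1, 0] g := by
  obtain ⟨r0, r1, r2⟩ := unipSL_rows x 0 z g
  rw [zero_smul, add_zero] at r1
  have ea : (unipSL x 0 z * g).1 0 0 = g.1 0 0 + x * g.1 1 0 + z * g.1 2 0 := by rw [r0]; simp
  have em : wedge ((unipSL x 0 z * g).1 0) ((unipSL x 0 z * g).1 1) 0 =
      wedge (g.1 0) (g.1 1) 0 - z * wedge (g.1 1) (g.1 2) 0 := by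
    rw [r0, r1]; simp [wedge]; ring
  have w23 := lead_wedge_ne g (show (1 : Fin 3) ≠ 2 by decide)
  have e1 : lead ((unipSL x 0 z * g).1 1) = lead (g.1 1) := congrArg lead r1
  have e2 : lead ((unipSL x 0 z * g).1 2) = lead (g.1 2) := congrArg lead r2
  rw [h'.wc_right, h.wc_right, wedge_unip_bottom, e1, e2, hs_eq_of_cong w23 h.snd h'.snd ?_,
    hs_sub_eq (lead_row_ne g 1) h.fst h.snd h'.fst h'.snd ?_]
  · rcases lead_alt (h.int 1 0) with h1 | h1
    · exact Or.inl h1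
    · right
      have := plucker g
      rw [show (unipSL x 0 z * g).1 0 0 * wedge (g.1 0) (g.1 1) 0 -
        g.1 0 0 * wedge ((unipSL x 0 z * g).1 0) ((unipSL x 0 z * g).1 1) 0 =
        (x * wedge (g.1 0) (g.1 1) 0 + z * wedge (g.1 0) (g.1 2) 0) * g.1 1 0 by
          rw [ea, em]; linear_combination z * this]
      exact v_mul_lt (v_add_le (v_mul_le hx (h.int.wedge_le _ _ _))
        (v_mul_le hz (h.int.wedge_le _ _ _))) h1
  · rcases lead_alt (h.int.wedge_le 1 2 0) with h1 | h1
    · exact Or.inl h1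
    · right
      rw [em, sub_sub_cancel_left, Valuation.map_neg]; exact v_mul_lt hz h1

lemma red_ne_zero_iff {x : F} (hx : v x ≤ 1) : red x ≠ 0 ↔ v x = 1 := by
  rw [Ne, red_eq_zero hx]
  exact ⟨v_eq_one_of_not_lt hx, fun h => by simp [h]⟩

lemma red_zero : red (0 : F) = 0 := by rw [red_eq_zero] <;> simp

lemma red_two_ne : (2 : 𝓀[F]) ≠ 0 := by
  have h2 := TameCubic.two (F := F)
  have := (red_ne_zero_iff h2.le).2 h2
  rwa [show (2 : F) = 1 + 1 by norm_num, red_add (by simp) (by simp), red_one,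
    one_add_one_eq_two] at this

/-- Avoiding two affine conditions. -/
lemma exists_avoid {k : Type*} [Field k] (h2 : (2 : k) ≠ 0) {a b c d : k} (h : a ≠ 0 ∨ b ≠ 0)
    (h' : c ≠ 0 ∨ d ≠ 0) : ∃ t : k, a + t * b ≠ 0 ∧ c + t * d ≠ 0 := by
  by_contra hcon
  push Not at hcon
  -- Each condition excludes at most one t, and 0, 1, −1 are three distinct points because 2 ≠ 0.
  have h0 := hcon 0
  have h1 := hcon 1
  have hm := hcon (-1)
  simp only [zero_mul, add_zero, one_mul, neg_mul] at h0 h1 hm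
  by_cases ha : a = 0
  · have hb : b ≠ 0 := by simpa [ha] using h
    have e1 := h1 (by simpa [ha])
    have e2 := hm (by simpa [ha])
    have hc : c = 0 := by
      apply (mul_eq_zero.1 (show 2 * c = 0 by linear_combination e1 + e2)).resolve_left h2
    rw [hc, zero_add] at e1
    simp [hc, e1] at h'
  · have hc := h0 ha
    have hd : d ≠ 0 := by simpa [hc] using h'
    have e1 : a + b = 0 := by
      by_contra h3; apply hd; simpa [hc] using h1 h3
    have e2 : a + -b = 0 := by
      by_contra h3; apply hd; simpa [hc] using hm h3
    exact ha ((mul_eq_zero.1 (show 2 * a = 0 by linear_combination e1 + e2)).resolve_left h2)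

/-- Nonzero first column (a, b, c) and nonzero minors (p, q, r) of the first two columns: a
unipotent translation makes the first entry and first minor nonzero at once. -/
lemma exists_open_cell {k : Type*} [Field k] (h2 : (2 : k) ≠ 0) {a b c p q r : k}
    (h : a ≠ 0 ∨ b ≠ 0 ∨ c ≠ 0) (h' : p ≠ 0 ∨ q ≠ 0 ∨ r ≠ 0) :
    ∃ x y z : k, a + x * b + z * c ≠ 0 ∧ p + y * q + (x * y - z) * r ≠ 0 := by
  by_cases hpr : p = 0 ∧ r = 0
  · obtain ⟨rfl, rfl⟩ := hpr
    have hq : q ≠ 0 := by simpa using h'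
    rcases h with h | h | h
    · exact ⟨0, 1, 0, by simpa, by simpa⟩
    · by_cases ha : a = 0
      · exact ⟨1, 1, 0, by simpa [ha], by simpa⟩
      · exact ⟨0, 1, 0, by simpa, by simpa⟩
    · by_cases ha : a = 0
      · exact ⟨0, 1, 1, by simpa [ha], by simpa⟩
      · exact ⟨0, 1, 0, by simpa, by simpa⟩
  · have hpr' : p ≠ 0 ∨ -r ≠ 0 := by
      by_contra hcon; push Not at hcon; exact hpr ⟨hcon.1, by simpa using hcon.2⟩
    by_cases hac : a ≠ 0 ∨ c ≠ 0
    · obtain ⟨t, h1, h3⟩ := exists_avoid h2 hac hpr'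
      exact ⟨0, 0, t, by simpa using h1, by simpa using h3⟩
    · push Not at hac
      have hb : b ≠ 0 := by simpa [hac] using h
      rcases hpr' with h1 | h1
      · exact ⟨1, 0, 0, by simpa [hac], by simpa⟩
      · by_cases hp : p = 0
        · exact ⟨1, 0, 1, by simpa [hac], by simpa [hp] using h1⟩
        · exact ⟨1, 0, 0, by simpa [hac], by simpa⟩

lemma IsInt.col_red {g : SL} (hg : IsInt g) :
    red (g.1 0 0) ≠ 0 ∨ red (g.1 1 0) ≠ 0 ∨ red (g.1 2 0) ≠ 0 := by
  by_contra hcon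
  push Not at hcon
  simp only [red_eq_zero (hg _ _)] at hcon
  have h1 : v (1 : F) < 1 := by
    rw [← g.2, Matrix.det_fin_three]
    have h := fun i j => hg i j
    refine v_sub_lt (v_add_lt (v_add_lt (v_sub_lt (v_sub_lt ?_ ?_) ?_) ?_) ?_) ?_
    · exact v_mul_lt' (v_mul_lt' hcon.1 (h _ _)) (h _ _)
    · exact v_mul_lt' (v_mul_lt' hcon.1 (h _ _)) (h _ _)
    · exact v_mul_lt' (v_mul_lt (h _ _) hcon.2.1) (h _ _)
    · exact v_mul_lt (v_mul_le (h _ _) (h _ _)) hcon.2.2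
    · exact v_mul_lt' (v_mul_lt (h _ _) hcon.2.1) (h _ _)
    · exact v_mul_lt (v_mul_le (h _ _) (h _ _)) hcon.2.2
  simp at h1

lemma IsInt.minor_red {g : SL} (hg : IsInt g) : red (wedge (g.1 0) (g.1 1) 0) ≠ 0 ∨
    red (wedge (g.1 0) (g.1 2) 0) ≠ 0 ∨ red (wedge (g.1 1) (g.1 2) 0) ≠ 0 := by
  by_contra hcon
  push Not at hcon
  simp only [red_eq_zero (hg.wedge_le _ _ _)] at hcon
  have h1 : v (1 : F) < 1 := by
    have e : (1 : F) = g.1 2 2 * wedge (g.1 0) (g.1 1) 0 - g.1 1 2 * wedge (g.1 0) (g.1 2) 0 +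
        g.1 0 2 * wedge (g.1 1) (g.1 2) 0 := by
      have h := g.2
      rw [Matrix.det_fin_three] at h
      simp only [wedge, Matrix.cons_val_zero]
      linear_combination -h
    rw [e]
    exact v_add_lt (v_sub_lt (v_mul_lt (hg _ _) hcon.1) (v_mul_lt (hg _ _) hcon.2.1))
      (v_mul_lt (hg _ _) hcon.2.2)
  simp at h1

lemma unip_fst (x y z : F) (g : SL) :
    (unipSL x y z * g).1 0 0 = g.1 0 0 + x * g.1 1 0 + z * g.1 2 0 := by
  rw [(unipSL_rows x y z g).1]; simp

lemma unip_snd (x y z : F) (g : SL) :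
    wedge ((unipSL x y z * g).1 0) ((unipSL x y z * g).1 1) 0 =
      wedge (g.1 0) (g.1 1) 0 + y * wedge (g.1 0) (g.1 2) 0 +
        (x * y - z) * wedge (g.1 1) (g.1 2) 0 := by
  obtain ⟨r0, r1, r2⟩ := unipSL_rows x y z g
  rw [r0, r1]; simp [wedge]; ring

lemma IsInt.exists_inV {g : SL} (hg : IsInt g) : ∃ x y z : F, v x ≤ 1 ∧ v y ≤ 1 ∧ v z ≤ 1 ∧
    InV (unipSL x y z * g) := by
  obtain ⟨x, y, z, h1, h2⟩ := exists_open_cell red_two_ne hg.col_red hg.minor_red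
  obtain ⟨x, hx, rfl⟩ := red_surjective (F := F) x
  obtain ⟨y, hy, rfl⟩ := red_surjective (F := F) y
  obtain ⟨z, hz, rfl⟩ := red_surjective (F := F) z
  have hi := (isInt_unip hx hy hz).mul hg
  refine ⟨x, y, z, hx, hy, hz, hi, ?_, ?_⟩
  · rw [← red_ne_zero_iff (hi _ _), unip_fst]
    rwa [red_add (v_add_le (hg _ _) (v_mul_le hx (hg _ _))) (v_mul_le hz (hg _ _)),
      red_add (hg _ _) (v_mul_le hx (hg _ _)), red_mul hx (hg _ _), red_mul hz (hg _ _)]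
  · rw [← red_ne_zero_iff (hi.wedge_le _ _ _), unip_snd]
    have a := hg.wedge_le 0 1 0
    have b := v_mul_le hy (hg.wedge_le 0 2 0)
    have c := v_sub_le (v_mul_le hx hy) hz
    rwa [red_add (v_add_le a b) (v_mul_le c (hg.wedge_le 1 2 0)), red_add a b,
      red_mul hy (hg.wedge_le 0 2 0), red_mul c (hg.wedge_le 1 2 0), red_sub (v_mul_le hx hy) hz,
      red_mul hx hy]

/-- The translation is done in two moves, of types (0, y, t) and (x, 0, ·). The parameter t is
chosen so that the intermediate matrix also lies in the open cell, where both one-step lemmas are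
available. -/
lemma InV.wc_unip {g : SL} (h : InV g) {x y z : F} (hx : v x ≤ 1) (hy : v y ≤ 1) (hz : v z ≤ 1)
    (h' : InV (unipSL x y z * g)) : wc [0, 1, 0] (unipSL x y z * g) = wc [0, 1, 0] g := by
  have hg := h.int
  have a := hg.wedge_le 0 1 0
  have b := v_mul_le hy (hg.wedge_le 0 2 0)
  have c := hg.wedge_le 1 2 0
  have h1 : red (g.1 0 0) ≠ 0 ∨ red (g.1 2 0) ≠ 0 := Or.inl ((red_ne_zero_iff (hg _ _)).2 h.fst)
  have h2 : red (wedge (g.1 0) (g.1 1) 0 + y * wedge (g.1 0) (g.1 2) 0) ≠ 0 ∨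
      -red (wedge (g.1 1) (g.1 2) 0) ≠ 0 := by
    by_contra hcon
    push Not at hcon
    have h3 := h'.snd
    rw [neg_eq_zero, red_eq_zero c, red_eq_zero (v_add_le a b)] at hcon
    rw [unip_snd] at h3
    have := v_add_lt hcon.1 (v_mul_lt (v_sub_le (v_mul_le hx hy) hz) hcon.2)
    rw [h3] at this
    simp at this
  obtain ⟨t, h3, h4⟩ := exists_avoid red_two_ne h1 h2
  obtain ⟨t, ht, rfl⟩ := red_surjective (F := F) t
  have hi := (isInt_unip (show v 0 ≤ 1 by simp) hy ht).mul hg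
  have hV : InV (unipSL 0 y t * g) := by
    refine ⟨hi, ?_, ?_⟩
    · rw [← red_ne_zero_iff (hi _ _), unip_fst, zero_mul, add_zero,
        red_add (hg _ _) (v_mul_le ht (hg _ _)), red_mul ht (hg _ _)]
      exact h3
    · rw [← red_ne_zero_iff (hi.wedge_le _ _ _), unip_snd, zero_mul, zero_sub, neg_mul,
        ← sub_eq_add_neg, red_sub (v_add_le a b) (v_mul_le ht c), red_mul ht c]
      rwa [mul_neg, ← sub_eq_add_neg] at h4
  have e : unipSL x y z * g = unipSL x 0 (z - t - x * y) * (unipSL 0 y t * g) := by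
    rw [← mul_assoc, unipSL_mul]
    congr 2 <;> ring
  rw [e] at h' ⊢
  rw [hV.wc_unip_left hx (v_sub_le (v_sub_le hz ht) (v_mul_le hx hy)) h',
    h.wc_unip_right hy ht hV]

end Integral

/-! ### The splitting and its behaviour under generators -/

section Splitting

variable {F : Type*} [Field F] [ValuativeRel F] [TopologicalSpace F]
  [IsNonarchimedeanLocalField F] [TameCubic F]

local notation "v" => valuation F
local notation "SL" => Matrix.SpecialLinearGroup (Fin 3) F

/-- Integral points of `N`. -/
def IntN (p : F × F × F) : Prop := v p.1 ≤ 1 ∧ v p.2.1 ≤ 1 ∧ v p.2.2 ≤ 1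

lemma IntN.isInt {p : F × F × F} (h : IntN p) : IsInt (uSL p) := isInt_unip h.1 h.2.1 h.2.2

lemma IsInt.exists_inV' {g : SL} (hg : IsInt g) : ∃ p : F × F × F, IntN p ∧ InV (uSL p * g) := by
  obtain ⟨x, y, z, hx, hy, hz, h⟩ := hg.exists_inV
  exact ⟨(x, y, z), ⟨hx, hy, hz⟩, h⟩

open Classical in
/-- The splitting over integral matrices, additively. -/
def kap (g : SL) : Additive (rootsOfUnity 3 F) :=
  if h : IsInt g then - wc [0, 1, 0] (uSL h.exists_inV'.choose * g) else 0

lemma InV.wc_uSL {g : SL} (h : InV g) {p : F × F × F} (hp : IntN p) (h' : InV (uSL p * g)) :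
    wc [0, 1, 0] (uSL p * g) = wc [0, 1, 0] g :=
  h.wc_unip hp.1 hp.2.1 hp.2.2 h'

lemma IntN.exists_mul {p q : F × F × F} (hp : IntN p) (hq : IntN q) :
    ∃ r, IntN r ∧ uSL r = uSL p * (uSL q)⁻¹ := by
  refine ⟨(p.1 + -q.1, p.2.1 + -q.2.1, p.2.2 + (q.1 * q.2.1 - q.2.2) + p.1 * -q.2.1), ?_, ?_⟩
  · have n1 : v (-q.1) ≤ 1 := by rw [Valuation.map_neg]; exact hq.1
    have n2 : v (-q.2.1) ≤ 1 := by rw [Valuation.map_neg]; exact hq.2.1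
    exact ⟨v_add_le hp.1 n1, v_add_le hp.2.1 n2, v_add_le (v_add_le hp.2.2
      (v_sub_le (v_mul_le hq.1 hq.2.1) hq.2.2)) (v_mul_le hp.1 n2)⟩
  · rw [uSL, uSL, uSL, unip_inv, unipSL_mul]

/-- Independence of the choice made in `kap`. The formula is the forced one: for g in the open cell,
w₀g has unit torus part and lies in the big cell, where a splitting trivial on w₀, N(𝒪) and the unit
torus must give the inverse of σ(w₀, g). -/
lemma kap_eq {g : SL} (hg : IsInt g) {p : F × F × F} (hp : IntN p) (h : InV (uSL p * g)) :
    kap g = - wc [0, 1, 0] (uSL p * g) := by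
  obtain ⟨h1, h2⟩ := hg.exists_inV'.choose_spec
  rw [kap, dif_pos hg]
  obtain ⟨r, hr, e⟩ := h1.exists_mul hp
  have e2 : uSL hg.exists_inV'.choose * g = uSL r * (uSL p * g) := by rw [e]; group
  rw [e2] at h2 ⊢
  rw [h.wc_uSL hr h2]

lemma kap_of_inV {g : SL} (h : InV g) : kap g = - wc [0, 1, 0] g := by
  have hp : IntN (0 : F × F × F) := by simp [IntN]
  have e : uSL (0 : F × F × F) * g = g := by
    show unipSL 0 0 0 * g = g; simp
  have := kap_eq h.int hp (by rwa [e])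
  rwa [e] at this

lemma kap_uSL_mul {g : SL} (hg : IsInt g) {p : F × F × F} (hp : IntN p) :
    kap (uSL p * g) = kap g := by
  obtain ⟨q, hq, h⟩ := hg.exists_inV'
  obtain ⟨r, hr, e⟩ := hq.exists_mul hp
  have e2 : uSL r * (uSL p * g) = uSL q * g := by rw [e]; group
  rw [kap_eq hg hq h, kap_eq (hp.isInt.mul hg) hr (by rwa [e2]), e2]

lemma kap_one : kap (1 : SL) = 0 := by
  have h : InV (1 : SL) := ⟨isInt_one, by simp [coe_sl_one], by simp [coe_sl_one, wedge]⟩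
  rw [kap_of_inV h, ← sg_word (by simp [reducedWords]), sg_one_right, neg_zero]

lemma kap_uSL {p : F × F × F} (hp : IntN p) : kap (uSL p) = 0 := by
  rw [← mul_one (uSL p), kap_uSL_mul isInt_one hp, kap_one]

lemma InV.dSL_mul {g : SL} (h : InV g) {a b : Fˣ} (ha : v (a : F) = 1) (hb : v (b : F) = 1) :
    InV (dSL a b * g) := by
  obtain ⟨r0, r1, r2⟩ := dSL_rows a b g
  refine ⟨(isInt_dSL ha hb).mul h.int, ?_, ?_⟩
  · rw [r0]; simp [ha, h.fst]
  · rw [r0, r1, wedge_smul_left, wedge_smul_right]; simp [ha, hb, h.snd]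

lemma InV.wc_dSL {g : SL} (h : InV g) {a b : Fˣ} (ha : v (a : F) = 1) (hb : v (b : F) = 1) :
    wc [0, 1, 0] (CubicCover.dSL a b * g) = wc [0, 1, 0] g - sg (CubicCover.dSL a b) g := by
  obtain ⟨r0, r1, r2⟩ := dSL_rows a b g
  have ha0 := a.ne_zero
  have hb0 := b.ne_zero
  have a3 := lead_row_ne g 2
  have w13 := lead_wedge_ne g (show (0 : Fin 3) ≠ 2 by decide)
  have w23 := lead_wedge_ne g (show (1 : Fin 3) ≠ 2 by decide)
  have a1 := ne_zero_of_v h.fst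
  have m := ne_zero_of_v h.snd
  rw [(h.dSL_mul ha hb).wc_left, h.wc_left, rc_zero, rc_zero, sg_dSL, r0, r1, r2]
  simp only [tc, tor_one, tor_two, Matrix.cons_val, wedge_smul_left, wedge_smul_right,
    lead_smul, Pi.smul_apply, smul_eq_mul]
  simp only [mul_inv, hs_mul_left, hs_mul_right, hs_inv_left, hs_inv_right, ne_eq, inv_eq_zero,
    mul_eq_zero, not_or, ha0, hb0, a3, w13, w23, a1, m, not_false_eq_true, and_self,
    div_eq_mul_inv, hs_self, hs_unit_unit ha h.fst, hs_unit_unit hb h.fst, hs_unit_unit ha h.snd,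
    hs_unit_unit hb h.snd, hs_unit_unit ha hb, hs_unit_unit hb ha,
    hs_antisymm a3 ha0, hs_antisymm a3 hb0, hs_antisymm w13 ha0, hs_antisymm w13 hb0,
    hs_antisymm w23 ha0, hs_antisymm w23 hb0]
  abel

lemma kap_dSL_mul {g : SL} (hg : IsInt g) {a b : Fˣ} (ha : v (a : F) = 1) (hb : v (b : F) = 1) :
    kap (dSL a b * g) = kap g + sg (dSL a b) g := by
  obtain ⟨p, hp, h⟩ := hg.exists_inV'
  have hp' : IntN ((a / b * p.1, a * b ^ 2 * p.2.1, a ^ 2 * b * p.2.2) : F × F × F) := by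
    simp [IntN, ha, hb, hp.1, hp.2.1, hp.2.2]
  have e : uSL ((a / b * p.1, a * b ^ 2 * p.2.1, a ^ 2 * b * p.2.2) : F × F × F) *
      (dSL a b * g) = dSL a b * (uSL p * g) := by
    rw [← mul_assoc, ← mul_assoc, uSL, uSL, dSL_unip]
  rw [kap_eq hg hp h, kap_eq ((isInt_dSL ha hb).mul hg) hp' (by rw [e]; exact h.dSL_mul ha hb), e,
    h.wc_dSL ha hb]
  have : sg (dSL a b) (uSL p * g) = sg (dSL a b) g := by
    rw [sg_dSL, sg_dSL, uSL, tor_unip_mul]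
  rw [this]; abel

/-- The reflected matrix is evaluated with one reduced word of w₀ and g with the other. The terms
then match apart from the cocycle of s_i and symbols of two units, which are trivial. -/
lemma InV.kap_reflection {i : Fin 2} {u : F} {g : SL} (h : InV g) (hu : v u ≤ 1)
    (h' : InV (xSL i u * (sSL i * g))) : kap (sSL i * g) = kap g + rc i g := by
  have e : kap (xSL i u * (sSL i * g)) = kap (sSL i * g) := by
    have hi := (isInt_sSL i).mul h.int
    fin_cases i
    · exact kap_uSL_mul (p := (u, 0, 0)) hi (by simp [IntN, hu])
    · exact kap_uSL_mul (p := (0, u, 0)) hi (by simp [IntN, hu])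
  rw [← e, kap_of_inV h, kap_of_inV h']
  have hA := h'.lead0
  have hB := h'.lead01
  have hA' := h'.fst
  have hB' := h'.snd
  rw [← hA] at hA'
  rw [← hB] at hB'
  have ga := h.fst
  have gm := h.snd
  rw [← h.lead0] at ga
  rw [← h.lead01] at gm
  fin_cases i
  · simp only [Fin.zero_eta, xSL] at h' hA' hB' ⊢
    obtain ⟨r0, r1, r2⟩ := unipSL_rows u 0 0 (sSL 0 * g)
    obtain ⟨s0, s1, s2⟩ := sSL_zero_rows g
    simp only [zero_smul, add_zero, s0, s1, s2] at r0 r1 r2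
    have ew : wedge ((unipSL u 0 0 * (sSL 0 * g)).1 0) ((unipSL u 0 0 * (sSL 0 * g)).1 1) =
        wedge (g.1 0) (g.1 1) := by
      rw [r0, r1, wedge_add_left, wedge_smul_left, wedge_self, smul_zero, add_zero,
        wedge_neg_left, ← wedge_swap]
    rw [wc_left_form g, wc_right_form (unipSL u 0 0 * (sSL 0 * g)), ew, rc_one,
      congrArg lead r1, congrArg lead r2, r1, r2, hs_unit_unit ga hA']
    abel
  · simp only [Fin.mk_one, xSL] at h' hA' hB' ⊢
    obtain ⟨r0, r1, r2⟩ := unipSL_rows 0 u 0 (sSL 1 * g)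
    obtain ⟨s0, s1, s2⟩ := sSL_one_rows g
    simp only [zero_smul, add_zero, s0, s1, s2] at r0 r1 r2
    have ew : wedge ((unipSL 0 u 0 * (sSL 1 * g)).1 1) ((unipSL 0 u 0 * (sSL 1 * g)).1 2) =
        wedge (g.1 1) (g.1 2) := by
      rw [r1, r2, wedge_add_left, wedge_smul_left, wedge_self, smul_zero, add_zero,
        wedge_neg_left, ← wedge_swap]
    have e02 : wedge ((unipSL 0 u 0 * (sSL 1 * g)).1 0) ((unipSL 0 u 0 * (sSL 1 * g)).1 2) =
        wedge (g.1 0) (g.1 1) := by rw [r0, r2]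
    rw [wc_right_form g, wc_left_form (unipSL 0 u 0 * (sSL 1 * g)), rc_zero, ew, e02,
      hs_unit_unit (v_unit_div gm hA') (v_unit_div hB' hA'),
      congrArg lead r2, congrArg lead r0]
    abel

lemma exists_avoid_one {a b : F} (ha : v a ≤ 1) (hb : v b ≤ 1) (h : v a = 1 ∨ v b = 1) :
    ∃ t : F, v t ≤ 1 ∧ v (a + t * b) = 1 := by
  by_cases h1 : v a = 1
  · exact ⟨0, by simp, by simpa⟩
  · refine ⟨1, by simp, ?_⟩
    have h2 := h.resolve_left h1
    rw [one_mul, add_comm]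
    exact v_unit_add h2 (lt_of_le_of_ne ha h1)

lemma kap_sSL_sq {i : Fin 2} {g : SL} (hg : IsInt g) : kap (sSL i * (sSL i * g)) = kap g := by
  obtain ⟨a, b, hd, ha, hb⟩ := sSL_sq (F := F) i
  have va : v (a : F) = 1 := by rcases ha with h | h <;> simp [h]
  have vb : v (b : F) = 1 := by rcases hb with h | h <;> simp [h]
  rw [← mul_assoc, hd, kap_dSL_mul hg va vb, sg_sign ha hb, add_zero]

lemma inV_x_mul_sq {i : Fin 2} {g : SL} {u : F} (h : InV (xSL i u * g)) :
    ∃ u', v u' = v u ∧ InV (xSL i u' * (sSL i * (sSL i * g))) := by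
  obtain ⟨a, b, hd, ha, hb⟩ := sSL_sq (F := F) i
  have va : v (a : F) = 1 := by rcases ha with h | h <;> simp [h]
  have vb : v (b : F) = 1 := by rcases hb with h | h <;> simp [h]
  have h1 := h.dSL_mul va vb
  rw [← mul_assoc] at h1
  fin_cases i
  · refine ⟨a / b * u, by simp [va, vb], ?_⟩
    simp only [Fin.zero_eta, xSL] at h1 hd ⊢
    rw [dSL_unip, mul_zero, mul_zero] at h1
    rwa [← mul_assoc (sSL 0), hd, ← mul_assoc]
  · refine ⟨a * b ^ 2 * u, by simp [va, vb], ?_⟩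
    simp only [Fin.mk_one, xSL] at h1 hd ⊢
    rw [dSL_unip, mul_zero, mul_zero] at h1
    rwa [← mul_assoc (sSL 1), hd, ← mul_assoc]

/-- The reflection formula when `g` or `s_i g` lies in the open cell up to `x_i(𝒪)`. -/
lemma kap_reflection_of_cells {i : Fin 2} {u w : F} {g : SL} (hg : IsInt g) (hu : v u ≤ 1)
    (hw : v w ≤ 1) (h : InV (xSL i u * g)) (h' : InV (xSL i w * (sSL i * g)))
    (hor : InV g ∨ InV (sSL i * g)) : kap (sSL i * g) = kap g + rc i g := by
  rcases hor with h1 | h1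
  · exact h1.kap_reflection hw h'
  · obtain ⟨u', hu', h2⟩ := inV_x_mul_sq h
    have := h1.kap_reflection (hu'.le.trans hu) h2
    rw [kap_sSL_sq hg] at this
    have h3 := rc_sSL i g
    linear_combination (norm := abel) -h3 - this

/-- Both sides are unchanged by the integral radical of the minimal parabolic, so g may be moved to
a matrix for which g or s_i g lies in the open cell, and then `kap_reflection_of_cells` applies. -/
lemma kap_sSL_mul (i : Fin 2) {g : SL} (hg : IsInt g) : kap (sSL i * g) = kap g + rc i g := by
  suffices H : ∃ y z, v y ≤ 1 ∧ v z ≤ 1 ∧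
      kap (sSL i * (radSL i y z * g)) = kap (radSL i y z * g) + rc i (radSL i y z * g) by
    obtain ⟨y, z, hy, hz, h⟩ := H
    have e1 : kap (radSL i y z * g) = kap g := by
      fin_cases i
      · exact kap_uSL_mul (p := (0, y, z)) hg (by simp [IntN, hy, hz])
      · exact kap_uSL_mul (p := (y, 0, z)) hg (by simp [IntN, hy, hz])
    have e2 : kap (sSL i * (radSL i y z * g)) = kap (sSL i * g) := by
      have hi := (isInt_sSL i).mul hg
      rw [← mul_assoc]
      fin_cases i
      · have : (sSL 0 : SL) * radSL 0 y z = uSL (0, z, -y) * sSL 0 := s0_unip y z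
        simp only [Fin.zero_eta, this, mul_assoc]
        exact kap_uSL_mul hi (by simp [IntN, hy, hz])
      · have : (sSL 1 : SL) * radSL 1 y z = uSL (-z, 0, y) * sSL 1 := s1_unip y z
        simp only [Fin.mk_one, this, mul_assoc]
        exact kap_uSL_mul hi (by simp [IntN, hy, hz])
    rw [← e2, h, e1, rc_rad]
  have inv_iff : ∀ {x : F}, v x ≤ 1 → (red x ≠ 0 ↔ v x = 1) := fun hx => red_ne_zero_iff hx
  fin_cases i
  · simp only [Fin.zero_eta]
    -- For i = 0 the minor of rows 0 and 1 is unchanged up to sign by s_0 and x_0, so it is made a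
    -- unit once and for all. What remains is the first entry, which s_0 exchanges with the entry
    -- below it.
    obtain ⟨y, z, hy, hz, hm⟩ : ∃ y z : F, v y ≤ 1 ∧ v z ≤ 1 ∧
        v (wedge (g.1 0) (g.1 1) 0 + y * wedge (g.1 0) (g.1 2) 0 +
          (0 * y - z) * wedge (g.1 1) (g.1 2) 0) = 1 := by
      have hr := hg.minor_red
      rw [inv_iff (hg.wedge_le _ _ _), inv_iff (hg.wedge_le _ _ _),
        inv_iff (hg.wedge_le _ _ _)] at hr
      by_cases h1 : v (wedge (g.1 0) (g.1 1) 0) = 1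
      · exact ⟨0, 0, by simp, by simp, by simpa⟩
      have h1' := lt_of_le_of_ne (hg.wedge_le 0 1 0) h1
      by_cases h2 : v (wedge (g.1 0) (g.1 2) 0) = 1
      · exact ⟨1, 0, by simp, by simp, by
          simp only [one_mul, zero_mul, sub_zero, add_zero]
          rw [add_comm]; exact v_unit_add h2 h1'⟩
      · have h3 := (hr.resolve_left h1).resolve_left h2
        exact ⟨0, 1, by simp, by simp, by
          simp only [zero_mul, zero_sub, add_zero, neg_one_mul, mul_zero]
          rw [add_comm]; exact v_unit_add (by simpa using h3) h1'⟩
    refine ⟨y, z, hy, hz, ?_⟩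
    have hi : IsInt (radSL 0 y z * g) := (isInt_unip (by simp) hy hz).mul hg
    rw [← unip_snd] at hm
    replace hm : v (wedge ((radSL 0 y z * g).1 0) ((radSL 0 y z * g).1 1) 0) = 1 := hm
    generalize radSL 0 y z * g = k at hi hm
    have hor : v (k.1 0 0) = 1 ∨ v (k.1 1 0) = 1 := by
      by_contra hcon
      push Not at hcon
      have h0 := lt_of_le_of_ne (hi 0 0) hcon.1
      have h1 := lt_of_le_of_ne (hi 1 0) hcon.2
      have := v_sub_lt (v_mul_lt' h0 (hi 1 1)) (v_mul_lt (hi 0 1) h1)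
      rw [show wedge (k.1 0) (k.1 1) 0 = k.1 0 0 * k.1 1 1 - k.1 0 1 * k.1 1 0 from rfl] at hm
      simp [hm] at this
    obtain ⟨s0, s1, s2⟩ := sSL_zero_rows k
    have hsm : v (wedge ((sSL 0 * k).1 0) ((sSL 0 * k).1 1) 0) = 1 := by
      rw [s0, s1, wedge_neg_left, ← wedge_swap]; exact hm
    have hs0 : (sSL 0 * k).1 0 0 = - k.1 1 0 := by rw [s0]; rfl
    have hsi := (isInt_sSL 0).mul hi
    have cell : ∀ {t : F} {h : SL}, v t ≤ 1 → IsInt h → v (h.1 0 0 + t * h.1 1 0) = 1 →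
        v (wedge (h.1 0) (h.1 1) 0) = 1 → InV (xSL 0 t * h) := by
      intro t h ht hh h1 h2
      refine ⟨(isInt_unip ht (by simp) (by simp)).mul hh, ?_, ?_⟩
      · rw [xSL, unip_fst]; simpa using h1
      · rw [xSL, unip_snd]; simpa using h2
    obtain ⟨u, hu, hu'⟩ := exists_avoid_one (hi 0 0) (hi 1 0) hor
    obtain ⟨w, hw, hw'⟩ := exists_avoid_one (hsi 0 0) (hsi 1 0) (by
      rw [hs0, Valuation.map_neg, congrFun s1 0]; exact hor.symm)
    refine kap_reflection_of_cells hi hu hw (cell hu hi hu' hm) (cell hw hsi hw' hsm) ?_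
    rcases hor with h | h
    · exact Or.inl ⟨hi, h, hm⟩
    · exact Or.inr ⟨hsi, by rw [hs0, Valuation.map_neg]; exact h, hsm⟩
  · simp only [Fin.mk_one]
    -- For i = 1 the roles are dual: the first entry is fixed, and s_1 exchanges up to sign the
    -- minors of rows 01 and 02.
    obtain ⟨y, z, hy, hz, hm⟩ : ∃ y z : F, v y ≤ 1 ∧ v z ≤ 1 ∧
        v (g.1 0 0 + y * g.1 1 0 + z * g.1 2 0) = 1 := by
      have hr := hg.col_red
      rw [inv_iff (hg _ _), inv_iff (hg _ _), inv_iff (hg _ _)] at hr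
      by_cases h1 : v (g.1 0 0) = 1
      · exact ⟨0, 0, by simp, by simp, by simpa⟩
      have h1' := lt_of_le_of_ne (hg 0 0) h1
      by_cases h2 : v (g.1 1 0) = 1
      · exact ⟨1, 0, by simp, by simp, by
          simp only [one_mul, zero_mul, add_zero]
          rw [add_comm]; exact v_unit_add h2 h1'⟩
      · have h3 := (hr.resolve_left h1).resolve_left h2
        exact ⟨0, 1, by simp, by simp, by
          simp only [zero_mul, one_mul, add_zero]
          rw [add_comm]; exact v_unit_add h3 h1'⟩
    refine ⟨y, z, hy, hz, ?_⟩
    have hi : IsInt (radSL 1 y z * g) := (isInt_unip hy (by simp) hz).mul hg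
    rw [← unip_fst y 0 z] at hm
    replace hm : v ((radSL 1 y z * g).1 0 0) = 1 := hm
    generalize radSL 1 y z * g = k at hi hm
    have hor : v (wedge (k.1 0) (k.1 1) 0) = 1 ∨ v (wedge (k.1 0) (k.1 2) 0) = 1 := by
      by_contra hcon
      push Not at hcon
      have h0 := lt_of_le_of_ne (hi.wedge_le 0 1 0) hcon.1
      have h1 := lt_of_le_of_ne (hi.wedge_le 0 2 0) hcon.2
      have h2 : v (k.1 0 0 * wedge (k.1 1) (k.1 2) 0) < 1 := by
        rw [show k.1 0 0 * wedge (k.1 1) (k.1 2) 0 = k.1 1 0 * wedge (k.1 0) (k.1 2) 0 -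
          k.1 2 0 * wedge (k.1 0) (k.1 1) 0 by linear_combination plucker k]
        exact v_sub_lt (v_mul_lt (hi _ _) h1) (v_mul_lt (hi _ _) h0)
      have hr := hi.minor_red
      rw [inv_iff (hi.wedge_le _ _ _), inv_iff (hi.wedge_le _ _ _),
        inv_iff (hi.wedge_le _ _ _)] at hr
      rw [map_mul, hm, (hr.resolve_left hcon.1).resolve_left hcon.2] at h2
      simp at h2
    obtain ⟨s0, s1, s2⟩ := sSL_one_rows k
    have hsm : v ((sSL 1 * k).1 0 0) = 1 := by rw [s0]; exact hm
    have hs0 : wedge ((sSL 1 * k).1 0) ((sSL 1 * k).1 1) 0 = - wedge (k.1 0) (k.1 2) 0 := by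
      rw [s0, s1, wedge_neg_right]; rfl
    have hs1 : wedge ((sSL 1 * k).1 0) ((sSL 1 * k).1 2) 0 = wedge (k.1 0) (k.1 1) 0 := by
      rw [s0, s2]
    have hsi := (isInt_sSL 1).mul hi
    have cell : ∀ {t : F} {h : SL}, v t ≤ 1 → IsInt h →
        v (wedge (h.1 0) (h.1 1) 0 + t * wedge (h.1 0) (h.1 2) 0) = 1 →
        v (h.1 0 0) = 1 → InV (xSL 1 t * h) := by
      intro t h ht hh h1 h2
      refine ⟨(isInt_unip (by simp) ht (by simp)).mul hh, ?_, ?_⟩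
      · rw [xSL, unip_fst]; simpa using h2
      · rw [xSL, unip_snd]; simpa using h1
    obtain ⟨u, hu, hu'⟩ := exists_avoid_one (hi.wedge_le 0 1 0) (hi.wedge_le 0 2 0) hor
    obtain ⟨w, hw, hw'⟩ := exists_avoid_one (hsi.wedge_le 0 1 0) (hsi.wedge_le 0 2 0) (by
      rw [hs0, Valuation.map_neg, hs1]; exact hor.symm)
    refine kap_reflection_of_cells hi hu hw (cell hu hi hu' hm) (cell hw hsi hw' hsm) ?_
    rcases hor with h | h
    · exact Or.inl ⟨hi, hm, h⟩
    · exact Or.inr ⟨hsi, hsm, by rw [hs0, Valuation.map_neg]; exact h⟩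

end Splitting

/-! ### Generation of SL₃(𝒪); existence and uniqueness of the splitting -/

section Generation

variable {F : Type*} [Field F] [ValuativeRel F] [TopologicalSpace F]
  [IsNonarchimedeanLocalField F] [TameCubic F]

local notation "v" => valuation F
local notation "SL" => Matrix.SpecialLinearGroup (Fin 3) F

/-- Lower triangular unipotent matrices. -/
def lowSL (x y z : F) : SL := wSL [0, 1, 0] * unipSL (-y) (-x) z * wSL [0, 1, 0]

lemma coe_lowSL (x y z : F) : (lowSL x y z : SL).1 = !![1, 0, 0; x, 1, 0; z, y, 1] := by
  rw [lowSL, coe_sl_mul, coe_sl_mul, coe_wSL_010, coe_unipSL]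
  ext i j
  fin_cases i <;> fin_cases j <;> simp [Matrix.mul_apply, Fin.sum_univ_three]

lemma lowSL_mul (x y z x' y' z' : F) :
    lowSL x y z * lowSL x' y' z' = lowSL (x + x') (y + y') (z + z' + y * x') := by
  refine sl_ext fun i j => ?_
  rw [coe_sl_mul, coe_lowSL, coe_lowSL, coe_lowSL]
  fin_cases i <;> fin_cases j <;> simp [Matrix.mul_apply, Fin.sum_univ_three] <;> ring

lemma coe_dSL' (a b : Fˣ) :
    (dSL a b : SL).1 = !![(a : F), 0, 0; 0, b, 0; 0, 0, (a * b : F)⁻¹] := by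
  rw [coe_dSL]; ext i j
  fin_cases i <;> fin_cases j <;> simp

lemma v_div_le {x y : F} (hx : v x ≤ 1) (hy : v y = 1) : v (x / y) ≤ 1 := by
  rw [map_div₀, hy, div_one]; exact hx

/-- Lower-diagonal-upper decomposition. -/
lemma InV.ldu {g : SL} (h : InV g) : ∃ (a b : Fˣ) (p : F × F × F), v (a : F) = 1 ∧ v (b : F) = 1 ∧
    IntN p ∧ g = lowSL (g.1 1 0 / g.1 0 0)
      (wedge (g.1 0) (g.1 2) 0 / wedge (g.1 0) (g.1 1) 0) (g.1 2 0 / g.1 0 0) *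
        dSL a b * uSL p := by
  have ha := ne_zero_of_v h.fst
  have hm := ne_zero_of_v h.snd
  have hi := h.int
  refine ⟨Units.mk0 _ ha, Units.mk0 (wedge (g.1 0) (g.1 1) 0 / g.1 0 0) (div_ne_zero hm ha),
    (g.1 0 1 / g.1 0 0, wedge (g.1 0) (g.1 1) 1 / wedge (g.1 0) (g.1 1) 0, g.1 0 2 / g.1 0 0),
    h.fst, v_unit_div h.snd h.fst, ⟨?_, ?_, ?_⟩, ?_⟩
  · simpa [h.fst] using hi 0 1
  · simpa [h.snd] using hi.wedge_le 0 1 1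
  · simpa [h.fst] using hi 0 2
  · have hdet := g.2
    rw [Matrix.det_fin_three] at hdet
    have hm' : g.1 0 0 * g.1 1 1 - g.1 0 1 * g.1 1 0 ≠ 0 := hm
    have hm2 : g.1 0 0 * g.1 1 1 - g.1 1 0 * g.1 0 1 ≠ 0 := by rwa [mul_comm (g.1 1 0)]
    refine sl_ext fun i j => ?_
    rw [coe_sl_mul, coe_sl_mul, coe_lowSL, coe_dSL', uSL, coe_unipSL]
    fin_cases i <;> fin_cases j <;>
      simp [Matrix.mul_apply, Fin.sum_univ_three, wedge] <;>
      field_simp <;> first | ring1 | linear_combination (g.1 0 0) * hdet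

/-- `SL₃(𝒪)` is generated by integral unipotent matrices, units and reflections. -/
lemma IsInt.induction {P : SL → Prop} (hmul : ∀ g h, IsInt g → IsInt h → P g → P h → P (g * h))
    (hN : ∀ p : F × F × F, IntN p → P (uSL p))
    (hT : ∀ a b : Fˣ, v (a : F) = 1 → v (b : F) = 1 → P (dSL a b))
    (hS : ∀ i, P (sSL i)) {g : SL} (hg : IsInt g) : P g := by
  obtain ⟨p, hp, h⟩ := hg.exists_inV'
  obtain ⟨a, b, q, ha, hb, hq, e⟩ := h.ldu
  have hp0 : IntN (0 : F × F × F) := by simp [IntN]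
  obtain ⟨p', hp', e'⟩ := hp0.exists_mul hp
  have e0 : uSL (0 : F × F × F) = 1 := unipSL_zero
  rw [e0, one_mul] at e'
  have hw : P (wSL [0, 1, 0]) := by
    have : (wSL [0, 1, 0] : SL) = sSL 0 * (sSL 1 * sSL 0) := by simp [wSL]
    rw [this]
    exact hmul _ _ (isInt_sSL 0) ((isInt_sSL 1).mul (isInt_sSL 0)) (hS 0)
      (hmul _ _ (isInt_sSL 1) (isInt_sSL 0) (hS 1) (hS 0))
  have hi := h.int
  have hl : IntN ((-(wedge ((uSL p * g).1 0) ((uSL p * g).1 2) 0 /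
      wedge ((uSL p * g).1 0) ((uSL p * g).1 1) 0), -((uSL p * g).1 1 0 / (uSL p * g).1 0 0),
      (uSL p * g).1 2 0 / (uSL p * g).1 0 0) : F × F × F) := by
    refine ⟨?_, ?_, ?_⟩
    · rw [Valuation.map_neg]; exact v_div_le (hi.wedge_le 0 2 0) h.snd
    · rw [Valuation.map_neg]; exact v_div_le (hi 1 0) h.fst
    · exact v_div_le (hi 2 0) h.fst
  have iw := isInt_wSL (F := F) [0, 1, 0]
  have il := (iw.mul hl.isInt).mul iw
  have it := isInt_dSL ha hb
  have hPl := hmul _ _ (iw.mul hl.isInt) iw (hmul _ _ iw hl.isInt hw (hN _ hl)) hw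
  have hfin := hmul _ _ (il.mul it) hq.isInt (hmul _ _ il it hPl (hT a b ha hb)) (hN _ hq)
  have e2 : g = uSL p' * (uSL p * g) := by rw [e']; group
  rw [e2]
  refine hmul _ _ hp'.isInt hi (hN _ hp') ?_
  rw [e]
  exact hfin

/-- The set of g for which this holds with all h is closed under products by the cocycle identity,
so generators suffice. -/
lemma kap_mul {g h : SL} (hg : IsInt g) (hh : IsInt h) : kap (g * h) = kap g + kap h + sg g h := by
  revert h
  refine IsInt.induction (P := fun g => ∀ {h : SL}, IsInt h → kap (g * h) = kap g + kap h + sg g h)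
    ?_ ?_ ?_ ?_ hg
  · intro g g' ig ig' hg hg' h hh
    rw [mul_assoc, hg (ig'.mul hh), hg' hh, hg ig']
    have := sg_cocycle g g' h
    linear_combination (norm := abel) -this
  · intro p hp h hh
    rw [kap_uSL_mul hh hp, kap_uSL hp, uSL, sg_unip]; abel
  · intro a b ha hb h hh
    have := kap_dSL_mul (isInt_one (F := F)) ha hb
    rw [mul_one, kap_one, sg_one_right] at this
    rw [kap_dSL_mul hh ha hb, this]; abel
  · intro i h hh
    have := kap_sSL_mul i (isInt_one (F := F))
    rw [mul_one, kap_one, ← sg_sSL, sg_one_right] at this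
    rw [kap_sSL_mul i hh, this, sg_sSL]; abel

/-- Additive characters of `SL₃(𝒪)` of order three are trivial. -/
lemma IsInt.char_trivial {c : SL → Additive (rootsOfUnity 3 F)}
    (hc : ∀ g h, IsInt g → IsInt h → c (g * h) = c g + c h) {g : SL} (hg : IsInt g) : c g = 0 := by
  have h1 : c 1 = 0 := by simpa using hc 1 1 isInt_one isInt_one
  have h3 := (three_hs : ∀ a : Additive (rootsOfUnity 3 F), 3 • a = 0)
  have hS : ∀ i, c (sSL i) = 0 := by
    intro i
    have i1 := isInt_sSL (F := F) i
    have i2 := i1.mul i1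
    obtain ⟨a, b, hd, ha, hb⟩ := sSL_sq (F := F) i
    -- From s_i⁴ = 1 the value c(s_i) is killed by 4, hence zero in a group of exponent three.
    have e : (sSL i * sSL i) * (sSL i * sSL i) = (1 : SL) := by
      rw [hd, dSL_mul]
      have ea : a * a = 1 := by
        apply Units.ext; rcases ha with h | h <;> simp [h]
      have eb : b * b = 1 := by
        apply Units.ext; rcases hb with h | h <;> simp [h]
      rw [ea, eb, dSL_one]
    have := hc _ _ i2 i2
    rw [e, h1, hc _ _ i1 i1] at this
    have h3 := h3 (c (sSL i))
    have h4 : c (sSL i) + c (sSL i) + c (sSL i) = 0 := by rw [← h3]; abel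
    linear_combination (norm := abel) -this - h4
  have hinv : ∀ i, c (sSL i)⁻¹ = 0 := by
    intro i
    have := hc _ _ (isInt_sSL i) (isInt_sSL i).inv
    rw [mul_inv_cancel, h1, hS, zero_add] at this
    exact this.symm
  have two_torsion : ∀ x : Additive (rootsOfUnity 3 F), x + x = 0 → x = 0 := by
    intro x hx
    have h4 : x + x + x = 0 := by rw [← h3 x]; abel
    linear_combination (norm := abel) h4 - hx
  refine IsInt.induction (P := fun g => c g = 0) ?_ ?_ ?_ hS hg
  · intro g h ig ih hg hh
    rw [hc g h ig ih, hg, hh, add_zero]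
  · intro p hp
    have v3 := TameCubic.three (F := F)
    have n3 : (3 : F) ≠ 0 := ne_zero_of_v v3
    have h13 : v (1 / 3 : F) = 1 := by simp [v3]
    -- The cube root of the unipotent matrix, integral because 3 is a unit; a character of order
    -- three is trivial on cubes.
    let q : F × F × F := (p.1 / 3, p.2.1 / 3, (p.2.2 - p.1 * p.2.1 / 3) / 3)
    have hq : IntN q := by
      refine ⟨?_, ?_, ?_⟩
      · simpa [q, v3] using hp.1
      · simpa [q, v3] using hp.2.1
      · have := v_sub_le hp.2.2 (v_mul_le h13.le (v_mul_le hp.1 hp.2.1))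
        rw [show 1 / 3 * (p.1 * p.2.1) = p.1 * p.2.1 / 3 by ring] at this
        simpa [q, v3] using this
    have e : uSL p = uSL q * (uSL q * uSL q) := by
      simp only [uSL, unipSL_mul, q]
      congr 1 <;> field_simp <;> ring
    rw [e, hc _ _ hq.isInt (hq.isInt.mul hq.isInt), hc _ _ hq.isInt hq.isInt]
    have := h3 (c (uSL q))
    rw [← this]; abel
  · have hconj : ∀ i (g : SL), IsInt g → c (sSL i * g * (sSL i)⁻¹) = c g := by
      intro i g ig
      rw [hc _ _ ((isInt_sSL i).mul ig) (isInt_sSL i).inv, hc _ _ (isInt_sSL i) ig, hS, hinv]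
      abel
    -- The reflection s_0 inverts diag(a, a⁻¹, 1), and conjugation does not change c. So the value
    -- is 2-torsion as well as 3-torsion. The same argument with s_1 treats diag(1, a, a⁻¹), and
    -- these generate the unit torus.
    have hA : ∀ a : Fˣ, v (a : F) = 1 → c (dSL a a⁻¹) = 0 := by
      intro a ha
      have ia := isInt_dSL ha (b := a⁻¹) (by simpa using ha)
      have ia' := isInt_dSL (a := a⁻¹) (b := a) (by simpa using ha) ha
      have e : (sSL 0 * dSL a a⁻¹ * (sSL 0)⁻¹ : SL) = dSL a⁻¹ a := by
        rw [sSL_dSL]; simp [sTor]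
      have h5 := hconj 0 _ ia
      rw [e] at h5
      have h6 := hc _ _ ia ia'
      rw [dSL_mul, mul_inv_cancel, inv_mul_cancel, dSL_one, h1, h5] at h6
      exact two_torsion _ h6.symm
    have hB : ∀ a : Fˣ, v (a : F) = 1 → c (dSL 1 a) = 0 := by
      intro a ha
      have ia := isInt_dSL (a := (1 : Fˣ)) (by simp) ha
      have ia' := isInt_dSL (a := (1 : Fˣ)) (b := a⁻¹) (by simp) (by simpa using ha)
      have e : (sSL 1 * dSL 1 a * (sSL 1)⁻¹ : SL) = dSL 1 a⁻¹ := by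
        rw [sSL_dSL]; simp [sTor]
      have h5 := hconj 1 _ ia
      rw [e] at h5
      have h6 := hc _ _ ia ia'
      rw [dSL_mul, mul_one, mul_inv_cancel, dSL_one, h1, h5] at h6
      exact two_torsion _ h6.symm
    intro a b ha hb
    have e : (dSL a b : SL) = dSL a a⁻¹ * dSL 1 (a * b) := by
      rw [dSL_mul]; simp
    rw [e, hc _ _ (isInt_dSL ha (by simpa using ha))
      (isInt_dSL (by simp) (by simp [ha, hb])), hA a ha, hB _ (by simp [ha, hb]), add_zero]

/-- The splitting of the cover over integral matrices. -/
def lift (g : SL) : MetaSL3 F := ⟨g, (kap g).toMul⟩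

lemma lift_mul {g h : SL} (hg : IsInt g) (hh : IsInt h) : lift (g * h) = lift g * lift h := by
  ext : 1
  · rfl
  · show (kap (g * h)).toMul = (kap g).toMul * (kap h).toMul * (sg g h).toMul
    rw [kap_mul hg hh]; rfl

lemma lift_one : lift (1 : SL) = 1 := by
  ext : 1
  · rfl
  · show (kap (1 : SL)).toMul = 1
    rw [kap_one]; rfl

lemma lift_inv {g : SL} (hg : IsInt g) : lift g⁻¹ = (lift g)⁻¹ := by
  rw [eq_inv_iff_mul_eq_one, ← lift_mul hg.inv hg, inv_mul_cancel, lift_one]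

lemma isSplitting_kap : IsSplitting (F := F) fun k => (kap (inclK k)).toMul := by
  intro k k'
  show (kap (inclK (k * k'))).toMul = _
  rw [inclK_mul, kap_mul (isInt_inclK k) (isInt_inclK k')]
  rfl

/-- The ratio of two splittings is a homomorphism on SL₃(𝒪) with values in μ₃, hence trivial. -/
lemma IsSplitting.eq {κ : Matrix.SpecialLinearGroup (Fin 3) 𝒪[F] → rootsOfUnity 3 F}
    (h : IsSplitting κ) (k : Matrix.SpecialLinearGroup (Fin 3) 𝒪[F]) :
    κ k = (kap (inclK k)).toMul := by
  classical
  let c : SL → Additive (rootsOfUnity 3 F) := fun g =>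
    if hg : IsInt g then Additive.ofMul (κ ((isInt_iff g).1 hg).choose) - kap g else 0
  have hc' : ∀ k, c (inclK k) = Additive.ofMul (κ k) - kap (inclK k) := by
    intro k
    have hk := isInt_inclK k
    simp only [c, dif_pos hk]
    rw [inclK_injective ((isInt_iff _).1 hk).choose_spec]
  have hc : ∀ g h, IsInt g → IsInt h → c (g * h) = c g + c h := by
    intro g g' hg hg'
    obtain ⟨k, rfl⟩ := (isInt_iff _).1 hg
    obtain ⟨k', rfl⟩ := (isInt_iff _).1 hg'
    rw [← inclK_mul, hc', hc', hc', inclK_mul, kap_mul hg hg', h k k']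
    simp only [ofMul_mul]
    have : sg (inclK k) (inclK k') = Additive.ofMul (blockCocycle (inclK k).1 (inclK k').1) := rfl
    rw [this]; abel
  have := IsInt.char_trivial hc (isInt_inclK k)
  rw [hc', sub_eq_zero] at this
  rw [← this]; rfl

lemma existsUnique_splitting :
    ∃! κ : Matrix.SpecialLinearGroup (Fin 3) 𝒪[F] → rootsOfUnity 3 F, IsSplitting κ :=
  ⟨_, isSplitting_kap, fun κ h => funext h.eq⟩

lemma IsSplitting.liftK_eq {κ : Matrix.SpecialLinearGroup (Fin 3) 𝒪[F] → rootsOfUnity 3 F}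
    (h : IsSplitting κ) (k : Matrix.SpecialLinearGroup (Fin 3) 𝒪[F]) :
    liftK κ k = lift (inclK k) := by
  rw [liftK, h.eq k]; rfl

end Generation

/-! ### Canonical lifts through cubes and the commutation rules of the cover -/

section CanonicalLifts

variable {F : Type*} [Field F] [ValuativeRel F] [TopologicalSpace F]
  [IsNonarchimedeanLocalField F] [TameCubic F]

local notation "v" => valuation F
local notation "SL" => Matrix.SpecialLinearGroup (Fin 3) F

lemma central_mul (ζ : rootsOfUnity 3 F) (x : MetaSL3 F) :
    central ζ * x = ⟨x.mat, ζ * x.root⟩ := by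
  ext : 1
  · simp [central]
  · rw [mul_root]; simp [central, sg_one]

lemma mul_central (ζ : rootsOfUnity 3 F) (x : MetaSL3 F) : x * central ζ = central ζ * x := by
  rw [central_mul]
  ext : 1
  · simp [central]
  · rw [mul_root]; simp [central, sg_one_right, mul_comm]

lemma central_mul_central (ζ ξ : rootsOfUnity 3 F) :
    central ζ * central ξ = (central (ζ * ξ) : MetaSL3 F) := by
  rw [central_mul]; rfl

lemma central_one : (central 1 : MetaSL3 F) = 1 := rfl

lemma central_injective : Function.Injective (central (F := F)) := fun a b h =>
  congrArg MetaSL3.root h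

lemma eq_central_mul {x y : MetaSL3 F} (h : x.mat = y.mat) :
    x = central (x.root / y.root) * y := by
  rw [central_mul]
  ext : 1
  · exact h
  · simp

/-- Elements over the same matrix differ by a central cube root of unity. -/
lemma cube_congr {x y : MetaSL3 F} (h : x.mat = y.mat) : x ^ 3 = y ^ 3 := by
  rw [eq_central_mul h, Commute.mul_pow (mul_central _ y).symm]
  rw [pow_three (central _), central_mul_central, central_mul_central, ← pow_three, root_cube,
    central_one, one_mul]

/-- The conjugate of sec g lies over g', so its cube is sec g' cubed. Relations between matrices
that are cubes thereby lift without computing the cocycle. -/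
lemma conj_cube (X : MetaSL3 F) {g g' : SL} (h : X.mat * g = g' * X.mat) :
    X * sec g ^ 3 = sec g' ^ 3 * X := by
  have : (X * sec g * X⁻¹) ^ 3 = sec g' ^ 3 := by
    apply cube_congr
    show X.mat * g * X.mat⁻¹ = g'
    rw [h]; group
  rw [← this, conj_pow]; group

lemma lift_pow {g : SL} (hg : IsInt g) : lift (g ^ 3) = lift g ^ 3 := by
  rw [pow_three, pow_three, lift_mul hg (hg.mul hg), lift_mul hg hg]

lemma lift_cube {g : SL} (hg : IsInt g) : lift (g ^ 3) = sec g ^ 3 := by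
  rw [lift_pow hg]; exact cube_congr rfl

lemma conj_lift (X : MetaSL3 F) {g g' : SL} (hg : IsInt g) (hg' : IsInt g')
    (h : X.mat * g = g' * X.mat) : X * lift (g ^ 3) = lift (g' ^ 3) * X := by
  rw [lift_cube hg, lift_cube hg', conj_cube X h]

lemma sec_unip_mul (p : F × F × F) (g : SL) : sec (uSL p) * sec g = sec (uSL p * g) := by
  ext : 1
  · rfl
  · rw [mul_root]; simp [sec, uSL, sg_unip]

lemma sec_one : sec (1 : SL) = 1 := rfl

/-- Coordinates of the cube root of a unipotent matrix. -/
def cubeRoot (p : F × F × F) : F × F × F :=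
  (p.1 / 3, p.2.1 / 3, (p.2.2 - p.1 * p.2.1 / 3) / 3)

lemma three_ne : (3 : F) ≠ 0 := ne_zero_of_v TameCubic.three

lemma uSL_cubeRoot (p : F × F × F) : uSL (cubeRoot p) ^ 3 = uSL p := by
  have := three_ne (F := F)
  rw [pow_three]
  simp only [uSL, unipSL_mul, cubeRoot]
  congr 1 <;> field_simp <;> ring

lemma IntN.cubeRoot {p : F × F × F} (hp : IntN p) : IntN (cubeRoot p) := by
  have v3 := TameCubic.three (F := F)
  have h13 : v (1 / 3 : F) = 1 := by simp [v3]
  refine ⟨v_div_le hp.1 v3, v_div_le hp.2.1 v3, v_div_le (v_sub_le hp.2.2 ?_) v3⟩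
  exact v_div_le (v_mul_le hp.1 hp.2.1) v3

lemma conj_unip (X : MetaSL3 F) {p p' : F × F × F}
    (h : X.mat * uSL (cubeRoot p) = uSL (cubeRoot p') * X.mat) :
    X * sec (uSL p) = sec (uSL p') * X := by
  have e : ∀ p : F × F × F, sec (uSL p) = sec (uSL (cubeRoot p)) ^ 3 := by
    intro p
    rw [pow_three, sec_unip_mul, sec_unip_mul, ← pow_three, uSL_cubeRoot]
  rw [e p, e p', conj_cube X h]

lemma lift_uSL {p : F × F × F} (hp : IntN p) : lift (uSL p) = sec (uSL p) := by
  rw [lift, kap_uSL hp]; rfl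

lemma kap_dSL {a b : Fˣ} (ha : v (a : F) = 1) (hb : v (b : F) = 1) : kap (dSL a b) = 0 := by
  have := kap_dSL_mul (isInt_one (F := F)) ha hb
  rwa [mul_one, kap_one, sg_one_right, add_zero] at this

lemma lift_dSL {a b : Fˣ} (ha : v (a : F) = 1) (hb : v (b : F) = 1) :
    lift (dSL a b) = sec (dSL a b) := by
  rw [lift, kap_dSL ha hb]; rfl

lemma kap_sSL (i : Fin 2) : kap (sSL i : SL) = 0 := by
  have := kap_sSL_mul i (isInt_one (F := F))
  rwa [mul_one, kap_one, ← sg_sSL, sg_one_right, add_zero] at this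

lemma lift_sSL (i : Fin 2) : lift (sSL i : SL) = sec (sSL i) := by
  rw [lift, kap_sSL]; rfl

/-- Lower triangular unipotent matrices by coordinates. -/
def lSL (p : F × F × F) : SL := lowSL p.1 p.2.1 p.2.2

lemma lSL_cubeRoot (p : F × F × F) : lSL (cubeRoot p) ^ 3 = lSL p := by
  have := three_ne (F := F)
  rw [pow_three]
  simp only [lSL, lowSL_mul, cubeRoot]
  congr 1 <;> field_simp <;> ring

lemma IntN.isInt_lSL {p : F × F × F} (h : IntN p) : IsInt (lSL p) := by
  intro i j
  rw [lSL, coe_lowSL]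
  fin_cases i <;> fin_cases j <;> simp [h.1, h.2.1, h.2.2]

lemma conj_lSL (X : MetaSL3 F) {p p' : F × F × F} (hp : IntN p) (hp' : IntN p')
    (h : X.mat * lSL (cubeRoot p) = lSL (cubeRoot p') * X.mat) :
    X * lift (lSL p) = lift (lSL p') * X := by
  rw [← lSL_cubeRoot p, ← lSL_cubeRoot p']
  exact conj_lift X hp.cubeRoot.isInt_lSL hp'.cubeRoot.isInt_lSL h

lemma dSL_low (a b : Fˣ) (p : F × F × F) : dSL a b * lSL p =
    lSL (b / a * p.1, p.2.1 / (a * b ^ 2), p.2.2 / (a ^ 2 * b)) * dSL a b := by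
  have ha := a.ne_zero
  have hb := b.ne_zero
  refine sl_ext fun i j => ?_
  rw [coe_sl_mul, coe_sl_mul, coe_dSL', lSL, lSL, coe_lowSL, coe_lowSL]
  fin_cases i <;> fin_cases j <;> simp [Matrix.mul_apply, Fin.sum_univ_three] <;> field_simp

/-- Powers of a uniformizer in the torus. -/
def pT (ϖ : Fˣ) (a b : ℤ) : SL := dSL (ϖ ^ a) (ϖ ^ b)

lemma pT_mul (ϖ : Fˣ) (a b a' b' : ℤ) : pT ϖ a b * pT ϖ a' b' = pT ϖ (a + a') (b + b') := by
  rw [pT, pT, pT, dSL_mul, zpow_add, zpow_add]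

lemma pT_zero (ϖ : Fˣ) : pT ϖ 0 0 = 1 := by simp [pT]

lemma pT_inv (ϖ : Fˣ) (a b : ℤ) : (pT ϖ a b)⁻¹ = pT ϖ (-a) (-b) := by
  rw [inv_eq_iff_mul_eq_one, pT_mul, add_neg_cancel, add_neg_cancel, pT_zero]

lemma diagPow_eq (ϖ : Fˣ) (a b c : ℤ) (h : a + b + c = 0) : diagPow ϖ a b c h = pT ϖ a b := by
  have hc : c = -(a + b) := by linarith
  refine sl_ext fun i j => ?_
  rw [pT, coe_dSL, diagPow]
  fin_cases i <;> fin_cases j <;> simp [hc]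
  rw [← mul_inv, ← zpow_add₀ ϖ.ne_zero, ← zpow_neg]; congr 1; ring

lemma tor_dSL (a b : Fˣ) : tor (dSL a b : SL) 0 = a ∧ tor (dSL a b : SL) 1 = b ∧
    tor (dSL a b : SL) 2 = (a * b : F)⁻¹ := by
  have := tor_normal a b (l := []) (by simp [reducedWords]) 0 0 0
  simpa using this

lemma hs_pow_pow (ϖ : Fˣ) (a b : ℤ) : hs ((ϖ : F) ^ a) ((ϖ : F) ^ b) = 0 := by
  rw [hs_zpow_left ϖ.ne_zero (zpow_ne_zero _ ϖ.ne_zero), hs_zpow_right ϖ.ne_zero ϖ.ne_zero,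
    hs_self ϖ.ne_zero, smul_zero, smul_zero]

lemma pow_third (ϖ : Fˣ) (a b : ℤ) : ((ϖ : F) ^ a * (ϖ : F) ^ b)⁻¹ = (ϖ : F) ^ (-a - b) := by
  rw [← zpow_add₀ ϖ.ne_zero, ← zpow_neg]; congr 1; ring

lemma sec_pT_mul (ϖ : Fˣ) (a b a' b' : ℤ) :
    sec (pT ϖ a b) * sec (pT ϖ a' b') = sec (pT ϖ (a + a') (b + b')) := by
  ext : 1
  · exact pT_mul ϖ a b a' b'
  · rw [mul_root]
    have : sg (pT ϖ a b) (pT ϖ a' b') = 0 := by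
      obtain ⟨-, h1, h2⟩ := tor_dSL (ϖ ^ a') (ϖ ^ b')
      simp only [pT, sg_dSL, tc, h1, h2, Matrix.cons_val, Units.val_zpow_eq_zpow_val, pow_third,
        hs_pow_pow, add_zero]
    simp [sec, this]

lemma sec_pT_inv (ϖ : Fˣ) (a b : ℤ) : (sec (pT ϖ a b))⁻¹ = sec (pT ϖ (-a) (-b)) := by
  rw [inv_eq_iff_mul_eq_one, sec_pT_mul, add_neg_cancel, add_neg_cancel, pT_zero, sec_one]

/-- The root of unity `(a / b, ϖ) ^ e`. -/
def torusSymbol (ϖ : Fˣ) (a b : Fˣ) (e : ℤ) : Additive (rootsOfUnity 3 F) :=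
  e • (hs (a : F) ϖ - hs (b : F) ϖ)

lemma three_zsmul (k : ℤ) (x : Additive (rootsOfUnity 3 F)) : (3 * k) • x = 0 := by
  rw [mul_comm, mul_zsmul]
  have := three_hs x
  rw [show (3 : ℤ) • x = (3 : ℕ) • x from natCast_zsmul x 3, this, smul_zero]

/-- Commutator of the torus with powers of the uniformizer. -/
lemma sec_dSL_pT (ϖ : Fˣ) {a b : Fˣ} (e f : ℤ) :
    sec (dSL a b) * sec (pT ϖ e f) =
      central (torusSymbol ϖ a b (e - f)).toMul * (sec (pT ϖ e f) * sec (dSL a b)) := by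
  have ha := a.ne_zero
  have hb := b.ne_zero
  have hw := ϖ.ne_zero
  rw [central_mul]
  ext : 1
  · show dSL a b * pT ϖ e f = pT ϖ e f * dSL a b
    rw [pT, dSL_mul, dSL_mul, mul_comm a, mul_comm b]
  · show (sec (dSL a b) * sec (pT ϖ e f)).root =
      (torusSymbol ϖ a b (e - f)).toMul * (sec (pT ϖ e f) * sec (dSL a b)).root
    rw [mul_root, mul_root]
    simp only [sec, one_mul]
    rw [← toMul_add]
    congr 1
    obtain ⟨-, h1, h2⟩ := tor_dSL (ϖ ^ e) (ϖ ^ f)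
    obtain ⟨-, t1, t2⟩ := tor_dSL a b
    have hp : ∀ k : ℤ, (ϖ : F) ^ k ≠ 0 := fun k => zpow_ne_zero _ hw
    simp only [pT, sg_dSL, tc, h1, h2, t1, t2, Matrix.cons_val, Units.val_zpow_eq_zpow_val,
      pow_third, torusSymbol]
    rw [hs_zpow_right ha hw, hs_zpow_right ha hw, hs_zpow_right hb hw, hs_zpow_left hw hb,
      hs_inv_right (hp _) (mul_ne_zero ha hb), hs_inv_right (hp _) (mul_ne_zero ha hb),
      hs_mul_right (hp _) ha hb, hs_mul_right (hp _) ha hb, hs_zpow_left hw ha,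
      hs_zpow_left hw hb, hs_zpow_left hw ha, hs_zpow_left hw hb, hs_antisymm hw ha,
      hs_antisymm hw hb]
    have h3 := three_zsmul e (hs (a : F) ϖ)
    have h4 := three_zsmul f (hs (b : F) ϖ)
    rw [← sub_eq_zero]
    linear_combination (norm := module) -h3 - h4

lemma sec_sSL_mul_of_tor (i : Fin 2) {k : SL} (h : rc i k = 0) : sec (sSL i) * sec k =
    sec (sSL i * k) := by
  ext : 1
  · rfl
  · rw [mul_root]
    simp [sec, sg_sSL, h]

lemma sec_mul_sSL (a b : Fˣ) (i : Fin 2) : sec (dSL a b) * sec (sSL i) =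
    sec (dSL a b * sSL i) := by
  ext : 1
  · rfl
  · rw [mul_root]
    have : tor (sSL i : SL) = 1 := by
      have := tor_wSL (F := F) [i] (by fin_cases i <;> simp [reducedWords])
      simpa [wSL] using this
    simp [sec, sg_dSL_of_tor a b this]

lemma coe_pT (ϖ : Fˣ) (a b : ℤ) : (pT ϖ a b).1 =
    !![(ϖ : F) ^ a, 0, 0; 0, (ϖ : F) ^ b, 0; 0, 0, (ϖ : F) ^ (-a - b)] := by
  rw [pT, coe_dSL', ← pow_third]; simp

/-- All entries and minors of the matrix are powers of ϖ, and (ϖ, ϖ) = 1. Hence reflections permute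
the exponents in the cover with no root of unity. -/
lemma rc_pT (ϖ : Fˣ) (i : Fin 2) (a b : ℤ) : rc i (pT ϖ a b) = 0 := by
  have hw := ϖ.ne_zero
  obtain ⟨h0, h1, h2⟩ := tor_dSL (ϖ ^ a) (ϖ ^ b)
  have hp : ∀ k : ℤ, (ϖ : F) ^ k ≠ 0 := fun k => zpow_ne_zero _ hw
  have l0 : lead ((pT ϖ a b).1 0) = (ϖ : F) ^ a := by
    rw [lead_of_zero] <;> simp [coe_pT, hp]
  have l1 : lead ((pT ϖ a b).1 1) = (ϖ : F) ^ b := by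
    rw [lead_of_one] <;> simp [coe_pT, hp]
  have l2 : lead ((pT ϖ a b).1 2) = (ϖ : F) ^ (-a - b) := by
    rw [lead_of_two] <;> simp [coe_pT, hp]
  have l02 : lead (wedge ((pT ϖ a b).1 0) ((pT ϖ a b).1 2)) = (ϖ : F) ^ a * (ϖ : F) ^ (-a - b) := by
    rw [lead_of_one] <;> simp [coe_pT, hp, wedge]
  have l12 : lead (wedge ((pT ϖ a b).1 1) ((pT ϖ a b).1 2)) = (ϖ : F) ^ b * (ϖ : F) ^ (-a - b) := by
    rw [lead_of_two] <;> simp [coe_pT, hp, wedge]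
  fin_cases i
  · simp only [Fin.zero_eta]
    rw [rc_zero, l02, l12, l2, mul_div_cancel_right₀ _ (hp _), mul_div_cancel_right₀ _ (hp _),
      hs_pow_pow]
  · simp only [Fin.mk_one]
    rw [rc_one, l1, l2, hs_pow_pow]

lemma sec_s0_pT (ϖ : Fˣ) (a b : ℤ) :
    sec (sSL 0) * sec (pT ϖ a b) = sec (pT ϖ b a) * sec (sSL 0) := by
  rw [sec_sSL_mul_of_tor 0 (rc_pT ϖ 0 a b), pT, pT, sSL_dSL, sec_mul_sSL]; rfl

lemma sec_s1_pT (ϖ : Fˣ) (a b : ℤ) :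
    sec (sSL 1) * sec (pT ϖ a b) = sec (pT ϖ a (-a - b)) * sec (sSL 1) := by
  rw [sec_sSL_mul_of_tor 1 (rc_pT ϖ 1 a b), pT, pT, sSL_dSL, sec_mul_sSL]
  simp only [sTor]
  congr 3
  rw [mul_inv, ← zpow_neg, ← zpow_neg, ← zpow_add]; rfl

end CanonicalLifts

/-! ### Conjugation of integral matrices by powers of the uniformizer -/

section Hecke

variable {F : Type*} [Field F] [ValuativeRel F] [TopologicalSpace F]
  [IsNonarchimedeanLocalField F] [TameCubic F]

local notation "v" => valuation F
local notation "SL" => Matrix.SpecialLinearGroup (Fin 3) F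

/-- Torus action on unipotent coordinates. -/
def scale (s t : F) (p : F × F × F) : F × F × F := (s * p.1, t * p.2.1, s * t * p.2.2)

lemma cubeRoot_scale (s t : F) (p : F × F × F) :
    cubeRoot (scale s t p) = scale s t (cubeRoot p) := by
  simp only [cubeRoot, scale, Prod.mk.injEq]
  refine ⟨by ring, by ring, by ring⟩

lemma dSL_uSL (a b : Fˣ) (p : F × F × F) :
    dSL a b * uSL p = uSL (scale (a / b : F) (a * b ^ 2 : F) p) * dSL a b := by
  have hb := b.ne_zero
  rw [uSL, dSL_unip, uSL, scale]
  congr 2; field_simp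

lemma dSL_lSL (a b : Fˣ) (p : F × F × F) :
    dSL a b * lSL p = lSL (scale (b / a : F) (a * b ^ 2 : F)⁻¹ p) * dSL a b := by
  have ha := a.ne_zero
  have hb := b.ne_zero
  rw [dSL_low, scale]
  congr 4
  · rw [div_eq_inv_mul]
  · field_simp

lemma conj_unip_dSL {X : MetaSL3 F} {a b : Fˣ} (h : X.mat = dSL a b) (p : F × F × F) :
    X * sec (uSL p) = sec (uSL (scale (a / b : F) (a * b ^ 2 : F) p)) * X := by
  apply conj_unip
  rw [h, cubeRoot_scale, dSL_uSL]

lemma conj_low_dSL {X : MetaSL3 F} {a b : Fˣ} (h : X.mat = dSL a b) {p : F × F × F}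
    (hp : IntN p) (hp' : IntN (scale (b / a : F) (a * b ^ 2 : F)⁻¹ p)) :
    X * lift (lSL p) = lift (lSL (scale (b / a : F) (a * b ^ 2 : F)⁻¹ p)) * X := by
  apply conj_lSL X hp hp'
  rw [h, cubeRoot_scale, dSL_lSL]

lemma dSL_inv (a b : Fˣ) : (dSL a b : SL)⁻¹ = dSL a⁻¹ b⁻¹ := by
  rw [inv_eq_iff_mul_eq_one, dSL_mul, mul_inv_cancel, mul_inv_cancel, dSL_one]

lemma conj_entries (a b : Fˣ) (g : SL) : (dSL a b * g * (dSL a b)⁻¹).1 =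
    !![g.1 0 0, (a / b) * g.1 0 1, (a ^ 2 * b) * g.1 0 2;
      (b / a) * g.1 1 0, g.1 1 1, (a * b ^ 2) * g.1 1 2;
      (a ^ 2 * b : F)⁻¹ * g.1 2 0, (a * b ^ 2 : F)⁻¹ * g.1 2 1, g.1 2 2] := by
  have ha := a.ne_zero
  have hb := b.ne_zero
  rw [dSL_inv, coe_sl_mul, coe_sl_mul, coe_dSL, coe_dSL]
  ext i j
  rw [Matrix.mul_diagonal, Matrix.diagonal_mul]
  fin_cases i <;> fin_cases j <;> simp <;> field_simp

lemma val_pow_unif {ϖ : Fˣ} (hϖ : val (ϖ : F) = 1) (k : ℤ) : val ((ϖ : F) ^ k) = k := by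
  rw [val_zpow, hϖ, mul_one]

lemma v_pow_le_one {ϖ : Fˣ} (hϖ : val (ϖ : F) = 1) {k : ℤ} : v ((ϖ : F) ^ k) ≤ 1 ↔ 0 ≤ k := by
  rw [v_le_one_iff (zpow_ne_zero _ ϖ.ne_zero), val_pow_unif hϖ]

lemma v_pow_le_pow {ϖ : Fˣ} (hϖ : val (ϖ : F) = 1) {k l : ℤ} :
    v ((ϖ : F) ^ k) ≤ v ((ϖ : F) ^ l) ↔ l ≤ k := by
  rw [v_le_iff (zpow_ne_zero _ ϖ.ne_zero) (zpow_ne_zero _ ϖ.ne_zero), val_pow_unif hϖ,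
    val_pow_unif hϖ]

lemma torusSymbol_three (ϖ a b : Fˣ) {e : ℤ} (h : 3 ∣ e) : torusSymbol ϖ a b e = 0 := by
  obtain ⟨k, rfl⟩ := h
  exact three_zsmul _ _

/-- Conjugation of integral matrices by powers of the uniformizer commutes with lifting. -/
lemma sec_pT_lift {ϖ : Fˣ} (hϖ : val (ϖ : F) = 1) {e f : ℤ} (h1 : f ≤ e) (h2 : -e - f ≤ f)
    (h3 : 3 ∣ e - f) {k : SL} (hk : IsInt k) (hk' : IsInt (pT ϖ e f * k * (pT ϖ e f)⁻¹)) :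
    sec (pT ϖ e f) * lift k = lift (pT ϖ e f * k * (pT ϖ e f)⁻¹) * sec (pT ϖ e f) := by
  have hw := ϖ.ne_zero
  have hmul : ∀ {g h : SL}, IsInt g → IsInt h → IsInt (pT ϖ e f * g * (pT ϖ e f)⁻¹) →
      IsInt (pT ϖ e f * h * (pT ϖ e f)⁻¹) →
      sec (pT ϖ e f) * lift g = lift (pT ϖ e f * g * (pT ϖ e f)⁻¹) * sec (pT ϖ e f) →
      sec (pT ϖ e f) * lift h = lift (pT ϖ e f * h * (pT ϖ e f)⁻¹) * sec (pT ϖ e f) →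
      sec (pT ϖ e f) * lift (g * h) =
        lift (pT ϖ e f * (g * h) * (pT ϖ e f)⁻¹) * sec (pT ϖ e f) := by
    intro g h ig ih ig' ih' hg hh
    have e1 : pT ϖ e f * (g * h) * (pT ϖ e f)⁻¹ =
      (pT ϖ e f * g * (pT ϖ e f)⁻¹) * (pT ϖ e f * h * (pT ϖ e f)⁻¹) := by group
    rw [e1, lift_mul ig ih, lift_mul ig' ih', ← mul_assoc, hg,
      mul_assoc (lift _) (sec _), hh, mul_assoc (lift _) (lift _)]
  set A : Fˣ := ϖ ^ e with hA
  set B : Fˣ := ϖ ^ f with hB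
  have hAB : (A / B : F) = (ϖ : F) ^ (e - f) := by simp [hA, hB, zpow_sub₀ hw]
  have hABB : (A * B ^ 2 : F) = (ϖ : F) ^ (e + 2 * f) := by
    simp only [hA, hB, Units.val_zpow_eq_zpow_val]
    rw [zpow_add₀ hw, mul_comm 2 f, zpow_mul]; norm_cast
  -- The order of the exponents makes conjugation contract the upper unipotent matrices; only the
  -- lower triangular factor needs the hypothesis that the conjugate of k is integral.
  have sU : ∀ p : F × F × F, IntN p → IntN (scale (A / B : F) (A * B ^ 2 : F) p) := by
    intro p hp
    have i1 : v (A / B : F) ≤ 1 := by rw [hAB, v_pow_le_one hϖ]; linarith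
    have i2 : v (A * B ^ 2 : F) ≤ 1 := by rw [hABB, v_pow_le_one hϖ]; linarith
    exact ⟨v_mul_le i1 hp.1, v_mul_le i2 hp.2.1, v_mul_le (v_mul_le i1 i2) hp.2.2⟩
  have cU : ∀ p : F × F × F, pT ϖ e f * uSL p * (pT ϖ e f)⁻¹ =
      uSL (scale (A / B : F) (A * B ^ 2 : F) p) := by
    intro p
    rw [pT, dSL_uSL, mul_inv_cancel_right]
  have cL : ∀ p : F × F × F, pT ϖ e f * lSL p * (pT ϖ e f)⁻¹ =
      lSL (scale (B / A : F) (A * B ^ 2 : F)⁻¹ p) := by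
    intro p
    rw [pT, dSL_lSL, mul_inv_cancel_right]
  have gU : ∀ p : F × F × F, IntN p → IsInt (pT ϖ e f * uSL p * (pT ϖ e f)⁻¹) ∧
      sec (pT ϖ e f) * lift (uSL p) =
        lift (pT ϖ e f * uSL p * (pT ϖ e f)⁻¹) * sec (pT ϖ e f) := by
    intro p hp
    rw [cU, lift_uSL hp, lift_uSL (sU p hp)]
    exact ⟨(sU p hp).isInt, conj_unip_dSL rfl p⟩
  have gT : ∀ a b : Fˣ, v (a : F) = 1 → v (b : F) = 1 →
      IsInt (pT ϖ e f * dSL a b * (pT ϖ e f)⁻¹) ∧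
      sec (pT ϖ e f) * lift (dSL a b) =
        lift (pT ϖ e f * dSL a b * (pT ϖ e f)⁻¹) * sec (pT ϖ e f) := by
    intro a b ha hb
    have e1 : pT ϖ e f * dSL a b * (pT ϖ e f)⁻¹ = dSL a b := by
      rw [pT, dSL_mul, mul_comm _ a, mul_comm _ b, ← dSL_mul]; group
    rw [e1, lift_dSL ha hb]
    refine ⟨isInt_dSL ha hb, ?_⟩
    -- The congruence modulo 3 is used only here: it makes the unit torus commute with sec(ϖ^(e,f)).
    rw [sec_dSL_pT, torusSymbol_three ϖ a b h3, toMul_zero, central_one, one_mul]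
  obtain ⟨p, hp, hV⟩ := hk.exists_inV'
  have hp0 : IntN (0 : F × F × F) := by simp [IntN]
  obtain ⟨p', hp', e'⟩ := hp0.exists_mul hp
  have e0 : uSL (0 : F × F × F) = 1 := unipSL_zero
  rw [e0, one_mul] at e'
  have e2 : k = uSL p' * (uSL p * k) := by rw [e']; group
  have hV' : IsInt (pT ϖ e f * (uSL p * k) * (pT ϖ e f)⁻¹) := by
    rw [show pT ϖ e f * (uSL p * k) * (pT ϖ e f)⁻¹ = (pT ϖ e f * uSL p * (pT ϖ e f)⁻¹) *
      (pT ϖ e f * k * (pT ϖ e f)⁻¹) by group]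
    exact (gU p hp).1.mul hk'
  rw [e2]
  refine hmul hp'.isInt hV.int (gU p' hp').1 hV' (gU p' hp').2 ?_
  generalize uSL p * k = h at hV hV'
  obtain ⟨a, b, q, ha, hb, hq, eh⟩ := hV.ldu
  set l : F × F × F := (h.1 1 0 / h.1 0 0, wedge (h.1 0) (h.1 2) 0 / wedge (h.1 0) (h.1 1) 0,
    h.1 2 0 / h.1 0 0) with hl
  have il : IntN l := ⟨v_div_le (hV.int _ _) hV.fst, v_div_le (hV.int.wedge_le _ _ _) hV.snd,
    v_div_le (hV.int _ _) hV.fst⟩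
  have hA0 := A.ne_zero
  have hB0 := B.ne_zero
  -- The coordinates of the lower factor are quotients of entries and minors by units, so after
  -- conjugation they are the corresponding quotients for the conjugate matrix, which is integral.
  have il' : IntN (scale (B / A : F) (A * B ^ 2 : F)⁻¹ l) := by
    have hc := conj_entries A B h
    have c10 := hV' 1 0
    have c20 := hV' 2 0
    have c02 := hV'.wedge_le 0 2 0
    rw [pT] at c10 c20 c02
    simp only [wedge] at c02
    rw [hc] at c10 c20 c02
    simp at c10 c20 c02
    simp only [scale, hl]
    refine ⟨?_, ?_, ?_⟩
    · rw [← mul_div_assoc]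
      exact v_div_le (by simpa using c10) hV.fst
    · show v ((A * B ^ 2 : F)⁻¹ * _) ≤ 1
      rw [← mul_div_assoc]
      refine v_div_le ?_ hV.snd
      rw [show (A * B ^ 2 : F)⁻¹ * wedge (h.1 0) (h.1 2) 0 =
        h.1 0 0 * ((B ^ 2 : F)⁻¹ * (A : F)⁻¹ * h.1 2 1) -
          A / B * h.1 0 1 * ((B : F)⁻¹ * (A ^ 2 : F)⁻¹ * h.1 2 0) by
            simp only [wedge, Matrix.cons_val_zero]; field_simp]
      exact c02
    · show v ((B / A * (A * B ^ 2 : F)⁻¹) * _) ≤ 1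
      rw [← mul_div_assoc]
      refine v_div_le ?_ hV.fst
      rw [show (B / A * (A * B ^ 2 : F)⁻¹) * h.1 2 0 = (B : F)⁻¹ * (A ^ 2 : F)⁻¹ * h.1 2 0 by
        field_simp]
      simpa using c20
  have gL : IsInt (pT ϖ e f * lSL l * (pT ϖ e f)⁻¹) ∧ sec (pT ϖ e f) * lift (lSL l) =
        lift (pT ϖ e f * lSL l * (pT ϖ e f)⁻¹) * sec (pT ϖ e f) := by
    rw [cL]
    exact ⟨il'.isInt_lSL, conj_low_dSL rfl il il'⟩
  have eh' : h = lSL l * dSL a b * uSL q := eh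
  have it := isInt_dSL ha hb
  rw [eh']
  have hi1 := hmul il.isInt_lSL it gL.1 (gT a b ha hb).1 gL.2 (gT a b ha hb).2
  refine hmul (il.isInt_lSL.mul it) hq.isInt ?_ (gU q hq).1 hi1 (gU q hq).2
  rw [show pT ϖ e f * (lSL l * dSL a b) * (pT ϖ e f)⁻¹ = (pT ϖ e f * lSL l * (pT ϖ e f)⁻¹) *
    (pT ϖ e f * dSL a b * (pT ϖ e f)⁻¹) by group]
  exact gL.1.mul (gT a b ha hb).1

end Hecke

/-! ### Existence, uniqueness and torus values of the Hecke functions -/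

section HeckeBasis

variable {F : Type*} [Field F] [ValuativeRel F] [TopologicalSpace F]
  [IsNonarchimedeanLocalField F] [TameCubic F]

local notation "v" => valuation F
local notation "SL" => Matrix.SpecialLinearGroup (Fin 3) F

/-- `x` lies in the double coset of `sec d`, with central coordinate `ζ`. -/
def InCoset (d : SL) (x : MetaSL3 F) (ζ : rootsOfUnity 3 F) : Prop :=
  ∃ k₁ k₂ : SL, IsInt k₁ ∧ IsInt k₂ ∧ x = central ζ * (lift k₁ * sec d * lift k₂)

/-- If k₁dk₂ = l₁dl₂, then l₁⁻¹k₁ is integral together with its conjugate by d⁻¹. By `sec_pT_lift`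
this conjugation respects the lifts, so the two decompositions agree in the cover and not only up to
μ₃. This permits a nonzero anti-genuine function on the double coset. -/
lemma InCoset.unique {ϖ : Fˣ} (hϖ : val (ϖ : F) = 1) {a b : ℤ} (h1 : a ≤ b) (h2 : b ≤ -a - b)
    (h3 : 3 ∣ a - b) {x : MetaSL3 F} {ζ ξ : rootsOfUnity 3 F} (hζ : InCoset (pT ϖ a b) x ζ)
    (hξ : InCoset (pT ϖ a b) x ξ) : ζ = ξ := by
  obtain ⟨k₁, k₂, i₁, i₂, e⟩ := hζ
  obtain ⟨l₁, l₂, j₁, j₂, e'⟩ := hξ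
  set d := pT ϖ a b with hd
  have hdi : sec (pT ϖ (-a) (-b)) = (sec d)⁻¹ := by rw [hd, sec_pT_inv]
  have hdi' : pT ϖ (-a) (-b) = d⁻¹ := by rw [hd, pT_inv]
  have hm : k₁ * d * k₂ = l₁ * d * l₂ := by
    have := congrArg MetaSL3.mat (e.symm.trans e')
    simpa [central, lift, sec] using this
  have hk := j₁.inv.mul i₁
  have hc : d⁻¹ * (l₁⁻¹ * k₁) * d = l₂ * k₂⁻¹ := by
    rw [show d⁻¹ * (l₁⁻¹ * k₁) * d = d⁻¹ * l₁⁻¹ * (k₁ * d * k₂) * k₂⁻¹ by group, hm]; group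
  have hcomm := sec_pT_lift hϖ (e := -a) (f := -b) (by linarith) (by linarith)
    (by have := h3.neg_right; rwa [neg_sub, show b - a = -a - -b by ring] at this) hk (by
      rw [hdi', inv_inv, hc]; exact j₂.mul i₂.inv)
  rw [hdi, hdi', inv_inv, hc, lift_mul j₁.inv i₁, lift_mul j₂ i₂.inv, lift_inv j₁, lift_inv i₂]
    at hcomm
  have e3 : lift k₁ * sec d * lift k₂ = lift l₁ * sec d * lift l₂ := by
    have : (lift l₁)⁻¹ * lift k₁ = sec d * (lift l₂ * (lift k₂)⁻¹ * (sec d)⁻¹) := by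
      rw [← hcomm]; group
    have h5 : lift k₁ = lift l₁ * (sec d * (lift l₂ * (lift k₂)⁻¹ * (sec d)⁻¹)) := by
      rw [← this]; group
    rw [h5]; group
  rw [e, e3] at e'
  exact central_injective (mul_right_cancel e')

variable {ι : rootsOfUnity 3 F ≃* rootsOfUnity 3 ℂ}

lemma toComplex_mul (ζ ξ : rootsOfUnity 3 F) :
    toComplex ι (ζ * ξ) = toComplex ι ζ * toComplex ι ξ := by
  simp [toComplex]

lemma toComplex_one : toComplex ι 1 = 1 := by simp [toComplex]

lemma toComplex_ne_zero (ζ : rootsOfUnity 3 F) : toComplex ι ζ ≠ 0 := Units.ne_zero _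

lemma toComplex_inv (ζ : rootsOfUnity 3 F) : toComplex ι ζ⁻¹ = (toComplex ι ζ)⁻¹ := by
  simp [toComplex]

/-- The defining properties of the basis element, over integral matrices. -/
structure HeckeFun (ι : rootsOfUnity 3 F ≃* rootsOfUnity 3 ℂ) (d : SL) (f : MetaSL3 F → ℂ) :
    Prop where
  anti : ∀ ζ x, f (central ζ * x) = (toComplex ι ζ)⁻¹ * f x
  left : ∀ k x, IsInt k → f (lift k * x) = f x
  right : ∀ k x, IsInt k → f (x * lift k) = f x
  supp : ∀ x, f x ≠ 0 → ∃ ζ, InCoset d x ζ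
  value : f (sec d) = 1

lemma dMat_eq (ϖ : Fˣ) (m n : ℤ) : dMat ϖ m n = pT ϖ (-n - 2 * m) (m - n) := diagPow_eq _ _ _ _ _

lemma isHeckeBasis_iff {ϖ : Fˣ}
    {κ : Matrix.SpecialLinearGroup (Fin 3) 𝒪[F] → rootsOfUnity 3 F} (hκ : IsSplitting κ)
    {m n : ℕ} {f : MetaSL3 F → ℂ} :
    IsHeckeBasis ι ϖ κ m n f ↔ HeckeFun ι (dMat ϖ m n) f := by
  have hl := hκ.liftK_eq
  constructor
  · rintro ⟨h1, h2, h3, h4, h5⟩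
    refine ⟨h1, ?_, ?_, ?_, h5⟩
    · intro k x hk
      obtain ⟨k, rfl⟩ := (isInt_iff k).1 hk
      rw [← hl, h2]
    · intro k x hk
      obtain ⟨k, rfl⟩ := (isInt_iff k).1 hk
      rw [← hl, h3]
    · intro x hx
      obtain ⟨k₁, k₂, ζ, e⟩ := h4 x hx
      exact ⟨ζ, _, _, isInt_inclK k₁, isInt_inclK k₂, by rw [e, mul_central, hl, hl]⟩
  · rintro ⟨h1, h2, h3, h4, h5⟩
    refine ⟨h1, ?_, ?_, ?_, h5⟩
    · intro k x; rw [hl]; exact h2 _ _ (isInt_inclK k)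
    · intro k x; rw [hl]; exact h3 _ _ (isInt_inclK k)
    · intro x hx
      obtain ⟨ζ, k₁, k₂, i₁, i₂, e⟩ := h4 x hx
      obtain ⟨k₁, rfl⟩ := (isInt_iff k₁).1 i₁
      obtain ⟨k₂, rfl⟩ := (isInt_iff k₂).1 i₂
      exact ⟨k₁, k₂, ζ, by rw [e, mul_central, hl, hl]⟩

lemma HeckeFun.of_inCoset {d : SL} {f : MetaSL3 F → ℂ} (h : HeckeFun ι d f) {x : MetaSL3 F}
    {ζ : rootsOfUnity 3 F} (hx : InCoset d x ζ) : f x = (toComplex ι ζ)⁻¹ := by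
  obtain ⟨k₁, k₂, i₁, i₂, rfl⟩ := hx
  rw [h.anti, h.right _ _ i₂, h.left _ _ i₁, h.value, mul_one]

lemma HeckeFun.unique {d : SL} {f g : MetaSL3 F → ℂ} (hf : HeckeFun ι d f)
    (hg : HeckeFun ι d g) : f = g := by
  funext x
  by_cases h : ∃ ζ, InCoset d x ζ
  · obtain ⟨ζ, h⟩ := h
    rw [hf.of_inCoset h, hg.of_inCoset h]
  · have h1 : f x = 0 := by by_contra h1; exact h (hf.supp x h1)
    have h2 : g x = 0 := by by_contra h2; exact h (hg.supp x h2)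
    rw [h1, h2]

lemma InCoset.central_mul {d : SL} {x : MetaSL3 F} {ζ : rootsOfUnity 3 F} (h : InCoset d x ζ)
    (ξ : rootsOfUnity 3 F) : InCoset d (central ξ * x) (ξ * ζ) := by
  obtain ⟨k₁, k₂, i₁, i₂, rfl⟩ := h
  exact ⟨k₁, k₂, i₁, i₂, by rw [← mul_assoc, central_mul_central]⟩

lemma InCoset.left {d : SL} {x : MetaSL3 F} {ζ : rootsOfUnity 3 F} (h : InCoset d x ζ)
    {k : SL} (hk : IsInt k) : InCoset d (lift k * x) ζ := by
  obtain ⟨k₁, k₂, i₁, i₂, rfl⟩ := h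
  refine ⟨k * k₁, k₂, hk.mul i₁, i₂, ?_⟩
  rw [lift_mul hk i₁, ← mul_assoc, mul_central]; simp only [mul_assoc]

lemma InCoset.right {d : SL} {x : MetaSL3 F} {ζ : rootsOfUnity 3 F} (h : InCoset d x ζ)
    {k : SL} (hk : IsInt k) : InCoset d (x * lift k) ζ := by
  obtain ⟨k₁, k₂, i₁, i₂, rfl⟩ := h
  refine ⟨k₁, k₂ * k, i₁, i₂.mul hk, ?_⟩
  rw [lift_mul i₂ hk]; simp only [mul_assoc]

open Classical in
lemma exists_heckeFun {ϖ : Fˣ} (hϖ : val (ϖ : F) = 1) {a b : ℤ} (h1 : a ≤ b) (h2 : b ≤ -a - b)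
    (h3 : 3 ∣ a - b) : ∃ f, HeckeFun ι (pT ϖ a b) f := by
  let f : MetaSL3 F → ℂ := fun x =>
    if h : ∃ ζ, InCoset (pT ϖ a b) x ζ then (toComplex ι h.choose)⁻¹ else 0
  have hf : ∀ {x ζ}, InCoset (pT ϖ a b) x ζ → f x = (toComplex ι ζ)⁻¹ := by
    intro x ζ h
    have he : ∃ ζ, InCoset (pT ϖ a b) x ζ := ⟨ζ, h⟩
    simp only [f, dif_pos he]
    rw [InCoset.unique hϖ h1 h2 h3 he.choose_spec h]
  have hf0 : ∀ {x}, (¬ ∃ ζ, InCoset (pT ϖ a b) x ζ) → f x = 0 := fun h => dif_neg h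
  refine ⟨f, ?_, ?_, ?_, ?_, ?_⟩
  · intro ζ x
    by_cases h : ∃ ξ, InCoset (pT ϖ a b) x ξ
    · obtain ⟨ξ, h⟩ := h
      rw [hf h, hf (h.central_mul ζ), toComplex_mul, mul_inv]
    · rw [hf0 h, hf0, mul_zero]
      rintro ⟨ξ, h'⟩
      have := h'.central_mul ζ⁻¹
      rw [← mul_assoc, central_mul_central, inv_mul_cancel, central_one, one_mul] at this
      exact h ⟨_, this⟩
  · intro k x hk
    by_cases h : ∃ ξ, InCoset (pT ϖ a b) x ξ
    · obtain ⟨ξ, h⟩ := h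
      rw [hf h, hf (h.left hk)]
    · rw [hf0 h, hf0]
      rintro ⟨ξ, h'⟩
      have := h'.left hk.inv
      rw [lift_inv hk, inv_mul_cancel_left] at this
      exact h ⟨_, this⟩
  · intro k x hk
    by_cases h : ∃ ξ, InCoset (pT ϖ a b) x ξ
    · obtain ⟨ξ, h⟩ := h
      rw [hf h, hf (h.right hk)]
    · rw [hf0 h, hf0]
      rintro ⟨ξ, h'⟩
      have := h'.right hk.inv
      rw [lift_inv hk, mul_inv_cancel_right] at this
      exact h ⟨_, this⟩
  · intro x hx
    by_contra h
    exact hx (hf0 h)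
  · rw [hf (ζ := 1) ⟨1, 1, isInt_one, isInt_one, by
      rw [lift_one, central_one, one_mul, one_mul, mul_one]⟩, toComplex_one, inv_one]

lemma existsUnique_heckeBasis {ϖ : Fˣ} (hϖ : val (ϖ : F) = 1)
    {κ : Matrix.SpecialLinearGroup (Fin 3) 𝒪[F] → rootsOfUnity 3 F} (hκ : IsSplitting κ)
    (m n : ℕ) : ∃! f, IsHeckeBasis ι ϖ κ m n f := by
  obtain ⟨f, hf⟩ := exists_heckeFun (ι := ι) hϖ (a := -n - 2 * m) (b := m - n)
    (by omega) (by omega) (by omega)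
  refine ⟨f, (isHeckeBasis_iff hκ).2 (by rw [dMat_eq]; exact hf), fun g hg => ?_⟩
  have hg' := (isHeckeBasis_iff hκ).1 hg
  rw [dMat_eq] at hg'
  exact hg'.unique hf

lemma v_mul_entries_le {g k : SL} {r : ValueGroupWithZero F} (hk : IsInt k)
    (hg : ∀ i j, v (g.1 i j) ≤ r) (i j : Fin 3) : v ((k * g).1 i j) ≤ r := by
  rw [coe_sl_mul, Matrix.mul_apply, Fin.sum_univ_three]
  have h : ∀ l, v (k.1 i l * g.1 l j) ≤ r := fun l => by
    rw [map_mul]; exact (mul_le_mul' (hk i l) (hg l j)).trans_eq (one_mul r)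
  exact Valuation.map_add_le _ (Valuation.map_add_le _ (h 0) (h 1)) (h 2)

lemma v_mul_entries_le' {g k : SL} {r : ValueGroupWithZero F} (hk : IsInt k)
    (hg : ∀ i j, v (g.1 i j) ≤ r) (i j : Fin 3) : v ((g * k).1 i j) ≤ r := by
  rw [coe_sl_mul, Matrix.mul_apply, Fin.sum_univ_three]
  have h : ∀ l, v (g.1 i l * k.1 l j) ≤ r := fun l => by
    rw [map_mul]; exact (mul_le_mul' (hg i l) (hk l j)).trans_eq (mul_one r)
  exact Valuation.map_add_le _ (Valuation.map_add_le _ (h 0) (h 1)) (h 2)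

lemma v_pT_le {ϖ : Fˣ} (hϖ : val (ϖ : F) = 1) {a b : ℤ} (h1 : a ≤ b) (h2 : b ≤ -a - b)
    (i j : Fin 3) : v ((pT ϖ a b).1 i j) ≤ v ((ϖ : F) ^ a) := by
  have h : ∀ k, a ≤ k → v ((ϖ : F) ^ k) ≤ v ((ϖ : F) ^ a) := fun k hk => (v_pow_le_pow hϖ).2 hk
  rw [coe_pT]
  fin_cases i <;> fin_cases j <;> simp only [Fin.zero_eta, Fin.mk_one, Fin.reduceFinMk,
    Matrix.of_apply, Matrix.cons_val', Matrix.cons_val, map_zero, zero_le]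
  exacts [le_rfl, h _ h1, h _ (by linarith)]

/-- Multiplication by integral matrices does not enlarge the maximal absolute value of the entries.
-/
lemma exponent_le {ϖ : Fˣ} (hϖ : val (ϖ : F) = 1) {a b p q : ℤ} (h1 : a ≤ b) (h2 : b ≤ -a - b)
    {k₁ k₂ : SL} (i₁ : IsInt k₁) (i₂ : IsInt k₂) (h : pT ϖ p q = k₁ * pT ϖ a b * k₂) :
    a ≤ p ∧ a ≤ q ∧ a ≤ -p - q := by
  have H := v_mul_entries_le' i₂ (v_mul_entries_le i₁ (v_pT_le hϖ h1 h2))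
  rw [← h] at H
  have e0 := H 0 0
  have e1 := H 1 1
  have e2 := H 2 2
  rw [coe_pT] at e0 e1 e2
  exact ⟨(v_pow_le_pow hϖ).1 e0, (v_pow_le_pow hϖ).1 e1, (v_pow_le_pow hϖ).1 e2⟩

lemma reverse_exponents (ϖ : Fˣ) (a b : ℤ) : ∃ k l : SL, IsInt k ∧ IsInt l ∧
    (pT ϖ a b)⁻¹ = k * pT ϖ (a + b) (-b) * l := by
  have hw := isInt_wSL (F := F) [0, 1, 0]
  refine ⟨_, _, hw, hw, ?_⟩
  rw [pT_inv]
  refine sl_ext fun i j => ?_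
  rw [coe_sl_mul, coe_sl_mul, coe_wSL_010, coe_pT, coe_pT]
  fin_cases i <;> fin_cases j <;> simp [Matrix.mul_apply, Fin.sum_univ_three]

/-- The bound of `exponent_le` applied to inverses, after the longest element has sorted the
exponents of d⁻¹. -/
lemma exponent_ge {ϖ : Fˣ} (hϖ : val (ϖ : F) = 1) {a b p q : ℤ} (h1 : a ≤ b) (h2 : b ≤ -a - b)
    {k₁ k₂ : SL} (i₁ : IsInt k₁) (i₂ : IsInt k₂) (h : pT ϖ p q = k₁ * pT ϖ a b * k₂) :
    p ≤ -a - b ∧ q ≤ -a - b ∧ -p - q ≤ -a - b := by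
  obtain ⟨k, l, ik, il, e⟩ := reverse_exponents ϖ a b
  have h' : pT ϖ (-p) (-q) = (k₂⁻¹ * k) * pT ϖ (a + b) (-b) * (l * k₁⁻¹) := by
    rw [← pT_inv, h, mul_inv_rev, mul_inv_rev, e]; group
  have := exponent_le hϖ (by linarith) (by linarith) (i₂.inv.mul ik) (il.mul i₁.inv) h'
  exact ⟨by linarith [this.1], by linarith [this.2.1], by linarith [this.2.2]⟩

variable {ϖ : Fˣ} {a b : ℤ} {f : MetaSL3 F → ℂ}

/-- Ordered exponents in the support are those of `d`. -/
lemma HeckeFun.sec_pT_ordered (h : HeckeFun ι (pT ϖ a b) f) (hϖ : val (ϖ : F) = 1) (h1 : a ≤ b)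
    (h2 : b ≤ -a - b) {p q : ℤ} (hp : p ≤ q) (hq : q ≤ -p - q) :
    f (sec (pT ϖ p q)) = if p = a ∧ q = b then 1 else 0 := by
  split_ifs with hc
  · rw [hc.1, hc.2, h.value]
  · by_contra hne
    obtain ⟨ζ, k₁, k₂, i₁, i₂, e⟩ := h.supp _ hne
    have e1 : pT ϖ p q = k₁ * pT ϖ a b * k₂ := by
      have := congrArg MetaSL3.mat e
      simpa [central, lift, sec] using this
    have e2 : pT ϖ a b = k₁⁻¹ * pT ϖ p q * k₂⁻¹ := by rw [e1]; group
    -- Used in both directions, the bounds determine the smallest and the largest exponent, and the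
    -- middle one follows since the sum is zero.
    have l1 := exponent_le hϖ h1 h2 i₁ i₂ e1
    have l2 := exponent_le hϖ hp hq i₁.inv i₂.inv e2
    have l3 := exponent_ge hϖ h1 h2 i₁ i₂ e1
    have l4 := exponent_ge hϖ hp hq i₁.inv i₂.inv e2
    omega

lemma HeckeFun.sec_pT_s0 (h : HeckeFun ι (pT ϖ a b) f) (p q : ℤ) :
    f (sec (pT ϖ p q)) = f (sec (pT ϖ q p)) := by
  have e := sec_s0_pT ϖ p q
  rw [← lift_sSL] at e
  rw [← h.left _ _ (isInt_sSL 0), e, h.right _ _ (isInt_sSL 0)]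

lemma HeckeFun.sec_pT_s1 (h : HeckeFun ι (pT ϖ a b) f) (p q : ℤ) :
    f (sec (pT ϖ p q)) = f (sec (pT ϖ p (-p - q))) := by
  have e := sec_s1_pT ϖ p q
  rw [← lift_sSL] at e
  rw [← h.left _ _ (isInt_sSL 1), e, h.right _ _ (isInt_sSL 1)]

end HeckeBasis

/-! ### Moving torus and lower unipotent elements past sec(D) -/

section Evaluation

variable {F : Type*} [Field F] [ValuativeRel F] [TopologicalSpace F]
  [IsNonarchimedeanLocalField F] [TameCubic F]

local notation "v" => valuation F
local notation "SL" => Matrix.SpecialLinearGroup (Fin 3) F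

variable {ι : rootsOfUnity 3 F ≃* rootsOfUnity 3 ℂ} {ϖ : Fˣ} {d : Matrix.SpecialLinearGroup (Fin 3) F} {f : MetaSL3 F → ℂ}

/-- The value of a Hecke function at `u D`. -/
def phi (f : MetaSL3 F → ℂ) (D : SL) (p : F × F × F) : ℂ := f (sec (uSL p) * sec D)

/-- The character `(·, ϖ)` with values in `ℂ`. -/
def chi (ι : rootsOfUnity 3 F ≃* rootsOfUnity 3 ℂ) (ϖ : Fˣ) (x : F) : ℂ :=
  toComplex ι (hs x ϖ).toMul

lemma phi_left (h : HeckeFun ι d f) (D : SL) {p : F × F × F} (hp : IntN p) (q : F × F × F) :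
    f (sec (uSL p * uSL q) * sec D) = phi f D q := by
  rw [← sec_unip_mul, ← lift_uSL hp, mul_assoc, h.left _ _ hp.isInt]; rfl

/-- The unit torus lies in K', so it can be inserted on the right. It crosses sec D at the cost of
the commutator symbol, conjugates the unipotent element canonically and is absorbed on the left. -/
lemma phi_torus (h : HeckeFun ι d f) (e₀ e₁ : ℤ) {s t : Fˣ} (hs : v (s : F) = 1)
    (ht : v (t : F) = 1) (p : F × F × F) :
    phi f (pT ϖ e₀ e₁) (scale (s / t : F) (s * t ^ 2 : F) p) =
      toComplex ι (torusSymbol ϖ s t (e₀ - e₁)).toMul * phi f (pT ϖ e₀ e₁) p := by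
  have hi := isInt_dSL hs ht
  have h1 := sec_dSL_pT ϖ (a := s) (b := t) e₀ e₁
  set z := (torusSymbol ϖ s t (e₀ - e₁)).toMul with hz
  have h2 : sec (pT ϖ e₀ e₁) * sec (dSL s t) = central z⁻¹ * (sec (dSL s t) * sec (pT ϖ e₀ e₁)) := by
    rw [h1, ← mul_assoc (central _) (central _), central_mul_central, inv_mul_cancel, central_one,
      one_mul]
  have h3 := conj_unip_dSL (X := sec (dSL s t)) rfl p
  rw [phi, ← h.right _ _ hi, lift_dSL hs ht, mul_assoc, h2, ← mul_assoc, mul_central,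
    mul_assoc (central _), h.anti, ← mul_assoc, ← h3, mul_assoc, ← lift_dSL hs ht,
    h.left _ _ hi, toComplex_inv, inv_inv]
  rfl

/-- Absorption of lower triangular matrices on the right. -/
lemma absorb (h : HeckeFun ι d f) {e₀ e₁ : ℤ} {q : F × F × F} (hq : IntN q)
    (hq' : IntN (scale ((ϖ : F) ^ (e₀ - e₁)) ((ϖ : F) ^ (e₀ + 2 * e₁)) q)) (X : MetaSL3 F) :
    f (X * lift (lSL q) * sec (pT ϖ e₀ e₁)) = f (X * sec (pT ϖ e₀ e₁)) := by
  have hw := ϖ.ne_zero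
  have hp : ∀ k : ℤ, (ϖ : F) ^ k ≠ 0 := fun k => zpow_ne_zero _ hw
  have hAB : (((ϖ ^ e₁ : Fˣ) : F) / ((ϖ ^ e₀ : Fˣ) : F)) = ((ϖ : F) ^ (e₀ - e₁))⁻¹ := by
    simp [zpow_sub₀ hw]
  have hABB : (((ϖ ^ e₀ : Fˣ) : F) * ((ϖ ^ e₁ : Fˣ) : F) ^ 2) = (ϖ : F) ^ (e₀ + 2 * e₁) := by
    simp only [Units.val_zpow_eq_zpow_val]
    rw [zpow_add₀ hw, mul_comm 2 e₁, zpow_mul]; norm_cast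
  set q' := scale ((ϖ : F) ^ (e₀ - e₁)) ((ϖ : F) ^ (e₀ + 2 * e₁)) q with hqd
  -- The coordinates q' are those of D⁻¹ l D, so conjugating them back by D returns q.
  have e : scale (((ϖ ^ e₁ : Fˣ) : F) / ((ϖ ^ e₀ : Fˣ) : F))
      (((ϖ ^ e₀ : Fˣ) : F) * ((ϖ ^ e₁ : Fˣ) : F) ^ 2)⁻¹ q' = q := by
    rw [hAB, hABB, hqd]
    simp only [scale]
    have h1 := hp (e₀ - e₁)
    have h2 := hp (e₀ + 2 * e₁)
    ext <;> field_simp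
  have := conj_low_dSL (X := sec (pT ϖ e₀ e₁)) (a := ϖ ^ e₀) (b := ϖ ^ e₁) rfl hq'
    (by rw [e]; exact hq)
  rw [e] at this
  rw [mul_assoc, ← this, ← mul_assoc, h.right _ _ hq'.isInt_lSL]

lemma absorb_21 (h : HeckeFun ι d f) (hϖ : val (ϖ : F) = 1) {e₀ e₁ : ℤ} (he : e₁ ≤ e₀) {s : F}
    (hs : v s ≤ 1) (X : MetaSL3 F) :
    f (X * lift (lSL (s, 0, 0)) * sec (pT ϖ e₀ e₁)) = f (X * sec (pT ϖ e₀ e₁)) := by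
  refine absorb h (by simp [IntN, hs]) ?_ X
  simp only [scale, mul_zero]
  exact ⟨v_mul_le ((v_pow_le_one hϖ).2 (by linarith)) hs, by simp, by simp⟩

lemma absorb_32 (h : HeckeFun ι d f) (hϖ : val (ϖ : F) = 1) {e₀ e₁ : ℤ} (he : -e₀ - e₁ ≤ e₁)
    {s : F} (hs : v s ≤ 1) (X : MetaSL3 F) :
    f (X * lift (lSL (0, s, 0)) * sec (pT ϖ e₀ e₁)) = f (X * sec (pT ϖ e₀ e₁)) := by
  refine absorb h (by simp [IntN, hs]) ?_ X
  simp only [scale, mul_zero]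
  exact ⟨by simp, v_mul_le ((v_pow_le_one hϖ).2 (by linarith)) hs, by simp⟩

lemma absorb_31 (h : HeckeFun ι d f) (hϖ : val (ϖ : F) = 1) {e₀ e₁ : ℤ} (he : -e₀ - e₁ ≤ e₀)
    {s : F} (hs : v s ≤ 1) (X : MetaSL3 F) :
    f (X * lift (lSL (0, 0, s)) * sec (pT ϖ e₀ e₁)) = f (X * sec (pT ϖ e₀ e₁)) := by
  refine absorb h (by simp [IntN, hs]) ?_ X
  simp only [scale, mul_zero]
  refine ⟨by simp, by simp, ?_⟩
  show v ((ϖ : F) ^ _ * (ϖ : F) ^ _ * s) ≤ 1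
  rw [← zpow_add₀ ϖ.ne_zero]
  exact v_mul_le ((v_pow_le_one hϖ).2 (by linarith)) hs

lemma coe_lSL (p : F × F × F) : (lSL p).1 = !![1, 0, 0; p.1, 1, 0; p.2.2, p.2.1, 1] :=
  coe_lowSL _ _ _

lemma coe_uSL (p : F × F × F) : (uSL p).1 = !![1, p.1, p.2.2; 0, 1, p.2.1; 0, 0, 1] := rfl

lemma unip_low_32 (x z s : F) : sec (uSL (x, 0, z)) * lift (lSL (0, s, 0)) =
    lift (lSL (0, s, 0)) * sec (uSL (x + z * s, 0, z)) := by
  refine (conj_unip _ (sl_ext fun i j => ?_)).symm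
  show (lSL (0, s, 0) * _).1 i j = (_ * lSL (0, s, 0)).1 i j
  rw [coe_sl_mul, coe_sl_mul, coe_lSL, coe_uSL, coe_uSL]
  fin_cases i <;> fin_cases j <;> simp [Matrix.mul_apply, Fin.sum_univ_three, cubeRoot] <;> ring

lemma unip_low_21 (y z s : F) : sec (uSL (0, y + s * z, z)) * lift (lSL (s, 0, 0)) =
    lift (lSL (s, 0, 0)) * sec (uSL (0, y, z)) := by
  refine (conj_unip _ (sl_ext fun i j => ?_)).symm
  show (lSL (s, 0, 0) * _).1 i j = (_ * lSL (s, 0, 0)).1 i j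
  rw [coe_sl_mul, coe_sl_mul, coe_lSL, coe_uSL, coe_uSL]
  fin_cases i <;> fin_cases j <;> simp [Matrix.mul_apply, Fin.sum_univ_three, cubeRoot] <;> ring

/-- The lower element x₃₂(s) is inserted before D. It crosses u while adding zs to x, and is then
removed on the left. -/
lemma phi_shift_x (h : HeckeFun ι d f) (hϖ : val (ϖ : F) = 1) {e₀ e₁ : ℤ} (he : -e₀ - e₁ ≤ e₁)
    {s : F} (hs : v s ≤ 1) (x z : F) :
    phi f (pT ϖ e₀ e₁) (x, 0, z) = phi f (pT ϖ e₀ e₁) (x + z * s, 0, z) := by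
  have i : IntN ((0, s, 0) : F × F × F) := by simp [IntN, hs]
  rw [phi, ← absorb_32 h hϖ he hs, unip_low_32, mul_assoc, h.left _ _ i.isInt_lSL]; rfl

lemma phi_shift_y (h : HeckeFun ι d f) (hϖ : val (ϖ : F) = 1) {e₀ e₁ : ℤ} (he : e₁ ≤ e₀)
    {s : F} (hs : v s ≤ 1) (y z : F) :
    phi f (pT ϖ e₀ e₁) (0, y + s * z, z) = phi f (pT ϖ e₀ e₁) (0, y, z) := by
  have i : IntN ((s, 0, 0) : F × F × F) := by simp [IntN, hs]
  rw [phi, ← absorb_21 h hϖ he hs, unip_low_21, mul_assoc, h.left _ _ i.isInt_lSL]; rfl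

lemma v_unif_lt {ϖ : Fˣ} (hϖ : val (ϖ : F) = 1) : v (ϖ : F) < 1 := by
  rw [v_lt_one_iff ϖ.ne_zero, hϖ]; norm_num

/-- Group identity for the reflection in the root `12` at `ϖ⁻¹`. -/
lemma sec_12 (hϖ : val (ϖ : F) = 1) (e₀ e₁ : ℤ) :
    lift (lSL (-(ϖ : F), 0, 0)) * sec (uSL ((ϖ : F)⁻¹, 0, 0)) * lift (lSL (-(ϖ : F), 0, 0)) *
      sec (pT ϖ e₀ e₁) = sec (pT ϖ (e₁ - 1) (e₀ + 1)) * lift (sSL 0)⁻¹ := by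
  have hw := ϖ.ne_zero
  have v1 := (v_unif_lt hϖ).le
  have i1 : IntN ((-1, 0, 0) : F × F × F) := by simp [IntN]
  have i2 : IntN ((1, 0, 0) : F × F × F) := by simp [IntN]
  have iw : IntN ((-(ϖ : F), 0, 0) : F × F × F) := by simp [IntN, v1]
  have hL : sec (pT ϖ 0 1) * lift (lSL (-1, 0, 0)) =
      lift (lSL (-(ϖ : F), 0, 0)) * sec (pT ϖ 0 1) := by
    have e : scale (((ϖ ^ (1 : ℤ) : Fˣ) : F) / ((ϖ ^ (0 : ℤ) : Fˣ) : F))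
      (((ϖ ^ (0 : ℤ) : Fˣ) : F) * ((ϖ ^ (1 : ℤ) : Fˣ) : F) ^ 2)⁻¹ ((-1, 0, 0) : F × F × F) =
        (-(ϖ : F), 0, 0) := by simp [scale]
    rw [← e]
    exact conj_low_dSL rfl i1 (by rw [e]; exact iw)
  have hU : sec (pT ϖ 0 1) * sec (uSL (1, 0, 0)) =
      sec (uSL ((ϖ : F)⁻¹, 0, 0)) * sec (pT ϖ 0 1) := by
    have := conj_unip_dSL (X := sec (pT ϖ 0 1)) rfl ((1, 0, 0) : F × F × F)
    simpa [scale] using this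
  -- Over 𝒪 this is an identity of matrices, so it holds for the lifts. Conjugation by diag(1, ϖ,
  -- ϖ⁻¹) rescales its entries to −ϖ and ϖ⁻¹.
  have hs0 : lift (lSL (-1, 0, 0)) * sec (uSL ((1 : F), 0, 0)) * lift (lSL (-1, 0, 0)) =
      lift (sSL 0)⁻¹ := by
    rw [← lift_uSL i2, ← lift_mul i1.isInt_lSL i2.isInt,
      ← lift_mul (i1.isInt_lSL.mul i2.isInt) i1.isInt_lSL]
    congr 1
    rw [eq_inv_iff_mul_eq_one]
    refine sl_ext fun i j => ?_
    rw [coe_sl_mul, coe_sl_mul, coe_sl_mul, coe_lSL, coe_uSL, coe_sSL, coe_sl_one]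
    fin_cases i <;> fin_cases j <;> simp [Matrix.mul_apply, Fin.sum_univ_three, simpleRefl]
  have e1 : lift (lSL (-(ϖ : F), 0, 0)) * sec (uSL ((ϖ : F)⁻¹, 0, 0)) *
      lift (lSL (-(ϖ : F), 0, 0)) * sec (pT ϖ 0 1) = sec (pT ϖ 0 1) * lift (sSL 0)⁻¹ := by
    rw [mul_assoc, ← hL, ← mul_assoc, mul_assoc (lift (lSL (-(ϖ : F), 0, 0))), ← hU, ← mul_assoc,
      ← hL, ← hs0]
    simp only [mul_assoc]
  have e2 : sec (pT ϖ e₀ e₁) = sec (pT ϖ 0 1) * sec (pT ϖ e₀ (e₁ - 1)) := by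
    rw [sec_pT_mul]; congr 2 <;> ring
  have e3 : lift (sSL 0)⁻¹ * sec (pT ϖ e₀ (e₁ - 1)) =
      sec (pT ϖ (e₁ - 1) e₀) * lift (sSL 0)⁻¹ := by
    rw [lift_inv (isInt_sSL 0), lift_sSL, inv_mul_eq_iff_eq_mul, ← mul_assoc, sec_s0_pT,
      mul_inv_cancel_right]
  rw [e2, ← mul_assoc, e1, mul_assoc, e3, ← mul_assoc, sec_pT_mul]
  congr 3 <;> ring

lemma sec_23 (hϖ : val (ϖ : F) = 1) (e₀ e₁ : ℤ) :
    lift (lSL (0, -(ϖ : F), 0)) * sec (uSL (0, (ϖ : F)⁻¹, 0)) * lift (lSL (0, -(ϖ : F), 0)) *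
      sec (pT ϖ e₀ e₁) = sec (pT ϖ e₀ (-e₀ - e₁ - 1)) * lift (sSL 1)⁻¹ := by
  have hw := ϖ.ne_zero
  have v1 := (v_unif_lt hϖ).le
  have i1 : IntN ((0, -1, 0) : F × F × F) := by simp [IntN]
  have i2 : IntN ((0, 1, 0) : F × F × F) := by simp [IntN]
  have iw : IntN ((0, -(ϖ : F), 0) : F × F × F) := by simp [IntN, v1]
  have hL : sec (pT ϖ (-1) 0) * lift (lSL (0, -1, 0)) =
      lift (lSL (0, -(ϖ : F), 0)) * sec (pT ϖ (-1) 0) := by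
    have e : scale (((ϖ ^ (0 : ℤ) : Fˣ) : F) / ((ϖ ^ (-1 : ℤ) : Fˣ) : F))
      (((ϖ ^ (-1 : ℤ) : Fˣ) : F) * ((ϖ ^ (0 : ℤ) : Fˣ) : F) ^ 2)⁻¹ ((0, -1, 0) : F × F × F) =
        (0, -(ϖ : F), 0) := by simp [scale]
    rw [← e]
    exact conj_low_dSL rfl i1 (by rw [e]; exact iw)
  have hU : sec (pT ϖ (-1) 0) * sec (uSL (0, 1, 0)) =
      sec (uSL (0, (ϖ : F)⁻¹, 0)) * sec (pT ϖ (-1) 0) := by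
    have := conj_unip_dSL (X := sec (pT ϖ (-1) 0)) rfl ((0, 1, 0) : F × F × F)
    simpa [scale] using this
  have hs0 : lift (lSL (0, -1, 0)) * sec (uSL (0, (1 : F), 0)) * lift (lSL (0, -1, 0)) =
      lift (sSL 1)⁻¹ := by
    rw [← lift_uSL i2, ← lift_mul i1.isInt_lSL i2.isInt,
      ← lift_mul (i1.isInt_lSL.mul i2.isInt) i1.isInt_lSL]
    congr 1
    rw [eq_inv_iff_mul_eq_one]
    refine sl_ext fun i j => ?_
    rw [coe_sl_mul, coe_sl_mul, coe_sl_mul, coe_lSL, coe_uSL, coe_sSL, coe_sl_one]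
    fin_cases i <;> fin_cases j <;> simp [Matrix.mul_apply, Fin.sum_univ_three, simpleRefl]
  have e1 : lift (lSL (0, -(ϖ : F), 0)) * sec (uSL (0, (ϖ : F)⁻¹, 0)) *
      lift (lSL (0, -(ϖ : F), 0)) * sec (pT ϖ (-1) 0) = sec (pT ϖ (-1) 0) * lift (sSL 1)⁻¹ := by
    rw [mul_assoc, ← hL, ← mul_assoc, mul_assoc (lift (lSL (0, -(ϖ : F), 0))), ← hU, ← mul_assoc,
      ← hL, ← hs0]
    simp only [mul_assoc]
  have e2 : sec (pT ϖ e₀ e₁) = sec (pT ϖ (-1) 0) * sec (pT ϖ (e₀ + 1) e₁) := by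
    rw [sec_pT_mul]; congr 2 <;> ring
  have e3 : lift (sSL 1)⁻¹ * sec (pT ϖ (e₀ + 1) e₁) =
      sec (pT ϖ (e₀ + 1) (-(e₀ + 1) - e₁)) * lift (sSL 1)⁻¹ := by
    have := sec_s1_pT ϖ (e₀ + 1) (-(e₀ + 1) - e₁)
    rw [show -(e₀ + 1) - (-(e₀ + 1) - e₁) = e₁ by ring] at this
    rw [lift_inv (isInt_sSL 1), lift_sSL, inv_mul_eq_iff_eq_mul, ← mul_assoc, this,
      mul_inv_cancel_right]
  rw [e2, ← mul_assoc, e1, mul_assoc, e3, ← mul_assoc, sec_pT_mul]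
  congr 3 <;> ring

/-- The longest element reverses the exponents. The reflections contribute no root of unity, and the
sign in the torus factor contributes none because −1 is a cube. -/
lemma lift_w13_pT (p q : ℤ) :
    lift (dSL 1 (-1) * (sSL 0 * (sSL 1 * sSL 0)) : SL) * sec (pT ϖ p q) =
      sec (pT ϖ (-p - q) q) * lift (dSL 1 (-1) * (sSL 0 * (sSL 1 * sSL 0))) := by
  have i0 := isInt_sSL (F := F) 0
  have i1 := isInt_sSL (F := F) 1
  have it : IsInt (dSL 1 (-1) : SL) := isInt_dSL (by simp) (by simp)
  have hsgn : torusSymbol ϖ 1 (-1) (-p - q - q) = 0 := by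
    rw [torusSymbol, Units.val_one, Units.val_neg, Units.val_one, hs_one_left ϖ.ne_zero,
      hs_neg_one_left ϖ.ne_zero, sub_zero, smul_zero]
  have ht : sec (dSL 1 (-1)) * sec (pT ϖ (-p - q) q) =
      sec (pT ϖ (-p - q) q) * sec (dSL 1 (-1)) := by
    rw [sec_dSL_pT, hsgn, toMul_zero, central_one, one_mul]
  have h3 := sec_s0_pT ϖ q (-q - p)
  rw [lift_mul it (i0.mul (i1.mul i0)), lift_mul i0 (i1.mul i0), lift_mul i1 i0, lift_sSL, lift_sSL,
    lift_dSL (by simp) (by simp)]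
  calc _ = sec (dSL 1 (-1)) * (sec (sSL 0) * (sec (sSL 1) * (sec (sSL 0) * sec (pT ϖ p q)))) := by
        simp only [mul_assoc]
    _ = sec (dSL 1 (-1)) * (sec (sSL 0) * ((sec (sSL 1) * sec (pT ϖ q p)) * sec (sSL 0))) := by
        rw [sec_s0_pT]; simp only [mul_assoc]
    _ = sec (dSL 1 (-1)) * ((sec (sSL 0) * sec (pT ϖ q (-q - p))) * sec (sSL 1) * sec (sSL 0)) := by
        rw [sec_s1_pT]; simp only [mul_assoc]
    _ = (sec (dSL 1 (-1)) * sec (pT ϖ (-p - q) q)) * sec (sSL 0) * sec (sSL 1) * sec (sSL 0) := by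
        rw [h3, show -q - p = -p - q by ring]; simp only [mul_assoc]
    _ = _ := by rw [ht]; simp only [mul_assoc]

lemma sec_13 (hϖ : val (ϖ : F) = 1) (e₀ e₁ : ℤ) : ∃ w : SL, IsInt w ∧
    lift (lSL (0, 0, -(ϖ : F) ^ 2)) * sec (uSL (0, 0, ((ϖ : F) ^ 2)⁻¹)) *
      lift (lSL (0, 0, -(ϖ : F) ^ 2)) * sec (pT ϖ e₀ e₁) =
        sec (pT ϖ (-e₀ - e₁ - 2) e₁) * lift w := by
  have hw := ϖ.ne_zero
  have v1 := (v_unif_lt hϖ).le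
  have i1 : IntN ((0, 0, -1) : F × F × F) := by simp [IntN]
  have i2 : IntN ((0, 0, 1) : F × F × F) := by simp [IntN]
  have iw : IntN ((0, 0, -(ϖ : F) ^ 2) : F × F × F) := by
    simp only [IntN, map_zero, zero_le, true_and, Valuation.map_neg]; exact v_pow_le v1 2
  have it : IsInt (dSL 1 (-1) : SL) := isInt_dSL (by simp) (by simp)
  refine ⟨dSL 1 (-1) * (sSL 0 * (sSL 1 * sSL 0)),
    it.mul ((isInt_sSL 0).mul ((isInt_sSL 1).mul (isInt_sSL 0))), ?_⟩
  -- diag(ϖ⁻¹, 1, ϖ) scales the highest root by ϖ⁻², whence the square of ϖ here and the valuation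
  -- −2 of z below.
  have hL : sec (pT ϖ (-1) 0) * lift (lSL (0, 0, -1)) =
      lift (lSL (0, 0, -(ϖ : F) ^ 2)) * sec (pT ϖ (-1) 0) := by
    have e : scale (((ϖ ^ (0 : ℤ) : Fˣ) : F) / ((ϖ ^ (-1 : ℤ) : Fˣ) : F))
      (((ϖ ^ (-1 : ℤ) : Fˣ) : F) * ((ϖ ^ (0 : ℤ) : Fˣ) : F) ^ 2)⁻¹ ((0, 0, -1) : F × F × F) =
        (0, 0, -(ϖ : F) ^ 2) := by simp [scale, sq]
    rw [← e]
    exact conj_low_dSL rfl i1 (by rw [e]; exact iw)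
  have hU : sec (pT ϖ (-1) 0) * sec (uSL (0, 0, 1)) =
      sec (uSL (0, 0, ((ϖ : F) ^ 2)⁻¹)) * sec (pT ϖ (-1) 0) := by
    have := conj_unip_dSL (X := sec (pT ϖ (-1) 0)) rfl ((0, 0, 1) : F × F × F)
    simpa [scale, sq] using this
  have hs0 : lift (lSL (0, 0, -1)) * sec (uSL (0, 0, (1 : F))) * lift (lSL (0, 0, -1)) =
      lift (dSL 1 (-1) * (sSL 0 * (sSL 1 * sSL 0))) := by
    rw [← lift_uSL i2, ← lift_mul i1.isInt_lSL i2.isInt,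
      ← lift_mul (i1.isInt_lSL.mul i2.isInt) i1.isInt_lSL]
    congr 1
    refine sl_ext fun i j => ?_
    simp only [coe_sl_mul, coe_lSL, coe_uSL, coe_sSL, coe_dSL']
    fin_cases i <;> fin_cases j <;>
      simp [Matrix.mul_apply, Fin.sum_univ_three, simpleRefl]
  have e1 : lift (lSL (0, 0, -(ϖ : F) ^ 2)) * sec (uSL (0, 0, ((ϖ : F) ^ 2)⁻¹)) *
      lift (lSL (0, 0, -(ϖ : F) ^ 2)) * sec (pT ϖ (-1) 0) =
        sec (pT ϖ (-1) 0) * lift (dSL 1 (-1) * (sSL 0 * (sSL 1 * sSL 0))) := by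
    rw [mul_assoc, ← hL, ← mul_assoc, mul_assoc (lift (lSL (0, 0, -(ϖ : F) ^ 2))), ← hU,
      ← mul_assoc, ← hL, ← hs0]
    simp only [mul_assoc]
  have e2 : sec (pT ϖ e₀ e₁) = sec (pT ϖ (-1) 0) * sec (pT ϖ (e₀ + 1) e₁) := by
    rw [sec_pT_mul]; congr 2 <;> ring
  rw [e2, ← mul_assoc, e1, mul_assoc, lift_w13_pT, ← mul_assoc, sec_pT_mul]
  congr 3 <;> ring

end Evaluation

/-! ### Values at elementary unipotent elements -/

section Values

variable {F : Type*} [Field F] [ValuativeRel F] [TopologicalSpace F]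
  [IsNonarchimedeanLocalField F] [TameCubic F]

local notation "v" => valuation F
local notation "SL" => Matrix.SpecialLinearGroup (Fin 3) F

variable {ι : rootsOfUnity 3 F ≃* rootsOfUnity 3 ℂ} {ϖ : Fˣ}
  {d : Matrix.SpecialLinearGroup (Fin 3) F} {f : MetaSL3 F → ℂ}

lemma chi_smul (x : F) (k : ℤ) : toComplex ι (k • hs x (ϖ : F)).toMul = chi ι ϖ x ^ k := by
  rw [chi, toMul_zsmul]
  simp [toComplex]

lemma chi_ne_zero (x : F) : chi ι ϖ x ≠ 0 := toComplex_ne_zero _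

lemma chi_cube (x : F) : chi ι ϖ x ^ 3 = 1 := by
  have := chi_smul (ι := ι) (ϖ := ϖ) x 3
  rw [show (3 : ℤ) = 3 * 1 by norm_num, three_zsmul, toMul_zero, toComplex_one] at this
  exact_mod_cast this.symm

lemma chi_zpow_congr (x : F) {k l : ℤ} (h : 3 ∣ k - l) : chi ι ϖ x ^ k = chi ι ϖ x ^ l := by
  obtain ⟨m, hm⟩ := h
  rw [show k = 3 * m + l by linarith, zpow_add₀ (chi_ne_zero x), zpow_mul]
  norm_cast
  rw [chi_cube, one_zpow, one_mul]

lemma chi_mul {x y : F} (hx : x ≠ 0) (hy : y ≠ 0) :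
    chi ι ϖ (x * y) = chi ι ϖ x * chi ι ϖ y := by
  rw [chi, hs_mul_left hx hy ϖ.ne_zero, toMul_add, toComplex_mul]; rfl

lemma chi_one : chi ι ϖ 1 = 1 := by
  rw [chi, hs_one_left ϖ.ne_zero, toMul_zero, toComplex_one]

lemma chi_inv {x : F} (hx : x ≠ 0) : chi ι ϖ x⁻¹ = (chi ι ϖ x)⁻¹ := by
  apply eq_inv_of_mul_eq_one_left
  rw [← chi_mul (inv_ne_zero hx) hx, inv_mul_cancel₀ hx, chi_one]

lemma chi_div {x y : F} (hx : x ≠ 0) (hy : y ≠ 0) :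
    chi ι ϖ (x / y) = chi ι ϖ x / chi ι ϖ y := by
  rw [div_eq_mul_inv, chi_mul hx (inv_ne_zero hy), chi_inv hy, div_eq_mul_inv]

lemma chi_unif : chi ι ϖ (ϖ : F) = 1 := by
  rw [chi, hs_self ϖ.ne_zero, toMul_zero, toComplex_one]

lemma chi_neg {x : F} (hx : x ≠ 0) : chi ι ϖ (-x) = chi ι ϖ x := by
  rw [chi, hs_neg_left hx ϖ.ne_zero]; rfl

lemma chi_one_unit {x : F} (h : v (x - 1) < 1) : chi ι ϖ x = 1 := by
  have hx : v x = 1 := v_unit_of_cong (x := 1) (by simp) (by rwa [Valuation.map_sub_swap])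
  rw [chi, hs_antisymm (ne_zero_of_v hx) ϖ.ne_zero, hs_one_unit_right ϖ.ne_zero h, neg_zero,
    toMul_zero, toComplex_one]

lemma chi_congr {x y : F} (hx : x ≠ 0) (h : v (y - x) < v x) : chi ι ϖ y = chi ι ϖ x := by
  have h1 : v (y / x - 1) < 1 := by
    rw [show y / x - 1 = (y - x) / x by field_simp, map_div₀]
    exact (div_lt_one₀ (zero_lt_iff.2 (v_ne_zero hx))).2 h
  have hy : y ≠ 0 := by
    rintro rfl
    rw [zero_sub, Valuation.map_neg] at h; exact lt_irrefl _ h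
  have := chi_one_unit (ι := ι) (ϖ := ϖ) h1
  rwa [chi_div hy hx, div_eq_one_iff_eq (chi_ne_zero x)] at this

lemma uSL_mul (p q : F × F × F) :
    uSL p * uSL q = uSL (p.1 + q.1, p.2.1 + q.2.1, p.2.2 + q.2.2 + p.1 * q.2.1) :=
  unipSL_mul _ _ _ _ _ _

lemma phi_translate (h : HeckeFun ι d f) (D : SL) {a b c : F} (ha : v a ≤ 1) (hb : v b ≤ 1)
    (hc : v c ≤ 1) (x y z : F) :
    phi f D (a + x, b + y, c + z + a * y) = phi f D (x, y, z) := by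
  have := phi_left h D (p := (a, b, c)) ⟨ha, hb, hc⟩ (x, y, z)
  rw [uSL_mul] at this
  exact this

lemma phi_mul (D : SL) (p q : F × F × F) :
    f (sec (uSL p) * (sec (uSL q) * sec D)) =
      phi f D (p.1 + q.1, p.2.1 + q.2.1, p.2.2 + q.2.2 + p.1 * q.2.1) := by
  rw [← mul_assoc, sec_unip_mul, uSL_mul]; rfl

/-- The torus element diag(s, 1, s⁻¹), on which the two simple roots take the same value s. -/
lemma phi_scale (h : HeckeFun ι d f) (e₀ e₁ : ℤ) {s : F} (hs : v s = 1) (x y z : F) :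
    phi f (pT ϖ e₀ e₁) (s * x, s * y, s * s * z) =
      chi ι ϖ s ^ (e₀ - e₁) * phi f (pT ϖ e₀ e₁) (x, y, z) := by
  have h0 := ne_zero_of_v hs
  have := phi_torus (ϖ := ϖ) h e₀ e₁ (s := Units.mk0 s h0) (t := 1) hs (by simp) (x, y, z)
  rw [torusSymbol, Units.val_mk0, Units.val_one, hs_one_left ϖ.ne_zero, sub_zero, chi_smul] at this
  simpa [scale] using this

lemma phi_scale_z (h : HeckeFun ι d f) (e₀ e₁ : ℤ) {s : F} (hs : v s = 1) (z : F) :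
    phi f (pT ϖ e₀ e₁) (0, 0, s * z) =
      chi ι ϖ s ^ (e₁ - e₀) * phi f (pT ϖ e₀ e₁) (0, 0, z) := by
  have h0 := ne_zero_of_v hs
  have := phi_torus (ϖ := ϖ) h e₀ e₁ (s := 1) (t := Units.mk0 s h0) (by simp) hs (0, 0, z)
  rw [torusSymbol, Units.val_mk0, Units.val_one, hs_one_left ϖ.ne_zero, zero_sub, smul_neg,
    ← neg_smul, chi_smul, neg_sub] at this
  rw [← this]
  simp only [scale, mul_zero]
  congr 3; field_simp

/-- Inserting the lower factor −ϖ on the right completes the left side of `sec_12`. Thus u(ϖ⁻¹) is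
traded for the reflected torus element and a lower factor ϖ, ready to be absorbed on the left. -/
lemma reflect_12 (h : HeckeFun ι d f) (hϖ : val (ϖ : F) = 1) {e₀ e₁ : ℤ} (he : e₁ ≤ e₀)
    (X : MetaSL3 F) :
    f (X * sec (uSL ((ϖ : F)⁻¹, 0, 0)) * sec (pT ϖ e₀ e₁)) =
      f (X * lift (lSL ((ϖ : F), 0, 0)) * sec (pT ϖ (e₁ - 1) (e₀ + 1))) := by
  have v1 := (v_unif_lt hϖ).le
  have i1 : IntN ((-(ϖ : F), 0, 0) : F × F × F) := by simp [IntN, v1]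
  have i2 : IntN (((ϖ : F), 0, 0) : F × F × F) := by simp [IntN, v1]
  have hinv : lift (lSL ((ϖ : F), 0, 0)) * lift (lSL (-(ϖ : F), 0, 0)) = 1 := by
    rw [← lift_mul i2.isInt_lSL i1.isInt_lSL, ← lift_one]
    congr 1
    refine sl_ext fun i j => ?_
    rw [coe_sl_mul, coe_lSL, coe_lSL, coe_sl_one]
    fin_cases i <;> fin_cases j <;> simp [Matrix.mul_apply, Fin.sum_univ_three]
  have e := sec_12 hϖ e₀ e₁
  rw [← absorb_21 h hϖ he (s := -(ϖ : F)) (by simpa using v1)]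
  have e' : sec (uSL ((ϖ : F)⁻¹, 0, 0)) * lift (lSL (-(ϖ : F), 0, 0)) * sec (pT ϖ e₀ e₁) =
      lift (lSL ((ϖ : F), 0, 0)) * sec (pT ϖ (e₁ - 1) (e₀ + 1)) * lift (sSL 0)⁻¹ := by
    rw [mul_assoc (lift _), ← e]
    simp only [← mul_assoc]
    rw [hinv, one_mul]
  rw [mul_assoc X, mul_assoc X, e', ← mul_assoc, h.right _ _ (isInt_sSL 0).inv, ← mul_assoc]

lemma reflect_23 (h : HeckeFun ι d f) (hϖ : val (ϖ : F) = 1) {e₀ e₁ : ℤ} (he : -e₀ - e₁ ≤ e₁)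
    (X : MetaSL3 F) :
    f (X * sec (uSL (0, (ϖ : F)⁻¹, 0)) * sec (pT ϖ e₀ e₁)) =
      f (X * lift (lSL (0, (ϖ : F), 0)) * sec (pT ϖ e₀ (-e₀ - e₁ - 1))) := by
  have v1 := (v_unif_lt hϖ).le
  have i1 : IntN ((0, -(ϖ : F), 0) : F × F × F) := by simp [IntN, v1]
  have i2 : IntN ((0, (ϖ : F), 0) : F × F × F) := by simp [IntN, v1]
  have hinv : lift (lSL (0, (ϖ : F), 0)) * lift (lSL (0, -(ϖ : F), 0)) = 1 := by
    rw [← lift_mul i2.isInt_lSL i1.isInt_lSL, ← lift_one]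
    congr 1
    refine sl_ext fun i j => ?_
    rw [coe_sl_mul, coe_lSL, coe_lSL, coe_sl_one]
    fin_cases i <;> fin_cases j <;> simp [Matrix.mul_apply, Fin.sum_univ_three]
  have e := sec_23 hϖ e₀ e₁
  rw [← absorb_32 h hϖ he (s := -(ϖ : F)) (by simpa using v1)]
  have e' : sec (uSL (0, (ϖ : F)⁻¹, 0)) * lift (lSL (0, -(ϖ : F), 0)) * sec (pT ϖ e₀ e₁) =
      lift (lSL (0, (ϖ : F), 0)) * sec (pT ϖ e₀ (-e₀ - e₁ - 1)) * lift (sSL 1)⁻¹ := by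
    rw [mul_assoc (lift _), ← e]
    simp only [← mul_assoc]
    rw [hinv, one_mul]
  rw [mul_assoc X, mul_assoc X, e', ← mul_assoc, h.right _ _ (isInt_sSL 1).inv, ← mul_assoc]

lemma ne_zero_of_val {x : F} {k : ℤ} (hk : k ≠ 0) (hx : val x = k) : x ≠ 0 := by
  rintro rfl
  apply hk
  rw [← hx]
  simp [val]

/-- The unit xϖ rescales x to ϖ⁻¹ through the torus, which produces the power of χ; the reflection
does the rest. -/
lemma phi_x (h : HeckeFun ι d f) (hϖ : val (ϖ : F) = 1) {e₀ e₁ : ℤ} (he : e₁ ≤ e₀) {x : F}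
    (hx : val x = -1) : phi f (pT ϖ e₀ e₁) (x, 0, 0) =
      chi ι ϖ x ^ (e₀ - e₁) * f (sec (pT ϖ (e₁ - 1) (e₀ + 1))) := by
  have hw := ϖ.ne_zero
  have hx0 := ne_zero_of_val (by norm_num) hx
  have v1 := (v_unif_lt hϖ).le
  have i2 : IntN (((ϖ : F), 0, 0) : F × F × F) := by simp [IntN, v1]
  have hu : v (x * ϖ) = 1 := by
    rw [v_eq_one_iff (mul_ne_zero hx0 hw), val_mul hx0 hw, hx, hϖ]; norm_num
  have e1 := phi_scale (ϖ := ϖ) h e₀ e₁ hu (ϖ : F)⁻¹ 0 0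
  rw [mul_inv_cancel_right₀ hw, mul_zero, mul_zero, chi_mul hx0 hw, chi_unif, mul_one] at e1
  rw [e1, phi]
  have := reflect_12 h hϖ he 1
  rw [one_mul, one_mul, h.left _ _ i2.isInt_lSL] at this
  rw [this]

lemma phi_y (h : HeckeFun ι d f) (hϖ : val (ϖ : F) = 1) {e₀ e₁ : ℤ} (he : -e₀ - e₁ ≤ e₁) {y : F}
    (hy : val y = -1) : phi f (pT ϖ e₀ e₁) (0, y, 0) =
      chi ι ϖ y ^ (e₀ - e₁) * f (sec (pT ϖ e₀ (-e₀ - e₁ - 1))) := by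
  have hw := ϖ.ne_zero
  have hx0 := ne_zero_of_val (by norm_num) hy
  have v1 := (v_unif_lt hϖ).le
  have i2 : IntN ((0, (ϖ : F), 0) : F × F × F) := by simp [IntN, v1]
  have hu : v (y * ϖ) = 1 := by
    rw [v_eq_one_iff (mul_ne_zero hx0 hw), val_mul hx0 hw, hy, hϖ]; norm_num
  have e1 := phi_scale (ϖ := ϖ) h e₀ e₁ hu 0 (ϖ : F)⁻¹ 0
  rw [mul_inv_cancel_right₀ hw, mul_zero, mul_zero, chi_mul hx0 hw, chi_unif, mul_one] at e1
  rw [e1, phi]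
  have := reflect_23 h hϖ he 1
  rw [one_mul, one_mul, h.left _ _ i2.isInt_lSL] at this
  rw [this]

lemma phi_z (h : HeckeFun ι d f) (hϖ : val (ϖ : F) = 1) {e₀ e₁ : ℤ} (he : -e₀ - e₁ ≤ e₀) {z : F}
    (hz : val z = -2) : phi f (pT ϖ e₀ e₁) (0, 0, z) =
      chi ι ϖ z ^ (e₁ - e₀) * f (sec (pT ϖ (-e₀ - e₁ - 2) e₁)) := by
  have hw := ϖ.ne_zero
  have hw2 : (ϖ : F) ^ 2 ≠ 0 := pow_ne_zero _ hw
  have hz0 := ne_zero_of_val (by norm_num) hz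
  have v1 := (v_unif_lt hϖ).le
  have v2 : v (-(ϖ : F) ^ 2) ≤ 1 := by rw [Valuation.map_neg]; exact v_pow_le v1 2
  have i2 : IntN ((0, 0, -(ϖ : F) ^ 2) : F × F × F) := by simp only [IntN]; simp [v1, pow_le_one']
  have hu : v (z * (ϖ : F) ^ 2) = 1 := by
    rw [v_eq_one_iff (mul_ne_zero hz0 hw2), val_mul hz0 hw2, hz, val_pow, hϖ]; norm_num
  have e1 := phi_scale_z (ϖ := ϖ) h e₀ e₁ hu ((ϖ : F) ^ 2)⁻¹
  rw [mul_inv_cancel_right₀ hw2, chi_mul hz0 hw2, sq, chi_mul hw hw, chi_unif, mul_one,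
    mul_one, ← sq] at e1
  rw [e1, phi, ← absorb_31 h hϖ he v2]
  obtain ⟨w, iw, e⟩ := sec_13 hϖ e₀ e₁
  rw [← h.left _ _ i2.isInt_lSL, ← mul_assoc, ← mul_assoc, e, h.right _ _ iw]

/-- Transposition of opposite elementary matrices in the root `23`. -/
lemma unip_low_23 (hϖ : val (ϖ : F) = 1) {y s w : F} (hy : v (ϖ * y) ≤ 1) (hvs : v s < 1)
    (hw : w = 1 + y * s) (hw1 : v w = 1) :
    sec (uSL (0, y, 0)) * lift (lSL (0, s, 0)) =
      central (-hs w ϖ).toMul * (lift (lSL (0, s / w, 0)) * sec (dSL 1 (Units.mk0 w (ne_zero_of_v hw1)))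
        * sec (uSL (0, y / w, 0))) := by
  have h0 := ne_zero_of_v hw1
  have hϖ0 := ϖ.ne_zero
  set W : Fˣ := Units.mk0 w (ne_zero_of_v hw1) with hW
  have hs' : v s ≤ 1 := hvs.le
  have hs1 : v (s / ϖ) ≤ 1 := by
    rcases eq_or_ne s 0 with rfl | hs0
    · simp
    · rw [v_lt_one_iff hs0] at hvs
      rw [v_le_one_iff (div_ne_zero hs0 hϖ0), val_div hs0 hϖ0, hϖ]; omega
  -- Conjugation by diag(ϖ⁻¹, 1, ϖ) relates both factors to integral matrices, for which the
  -- identity lifts. On the way back, the diagonal factor with entry w contributes the symbol (w,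
  -- ϖ)⁻¹.
  have hL : ∀ t : F, v (t / ϖ) ≤ 1 → sec (pT ϖ (-1) 0) * lift (lSL (0, t / ϖ, 0)) =
      lift (lSL (0, t, 0)) * sec (pT ϖ (-1) 0) := by
    intro t ht
    have ht1 : v t ≤ 1 := by
      rw [show t = t / ϖ * ϖ by field_simp]; exact v_mul_le ht (v_unif_lt hϖ).le
    have e : scale (((ϖ ^ (0 : ℤ) : Fˣ) : F) / ((ϖ ^ (-1 : ℤ) : Fˣ) : F))
      (((ϖ ^ (-1 : ℤ) : Fˣ) : F) * ((ϖ ^ (0 : ℤ) : Fˣ) : F) ^ 2)⁻¹ ((0, t / ϖ, 0) : F × F × F) =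
        (0, t, 0) := by simp [scale]; field_simp
    rw [← e]
    exact conj_low_dSL rfl (by simpa [IntN] using ht) (by rw [e]; simpa [IntN] using ht1)
  have hU : ∀ t : F, sec (pT ϖ (-1) 0) * sec (uSL (0, ϖ * t, 0)) =
      sec (uSL (0, t, 0)) * sec (pT ϖ (-1) 0) := by
    intro t
    have := conj_unip_dSL (X := sec (pT ϖ (-1) 0)) rfl ((0, ϖ * t, 0) : F × F × F)
    rw [this]
    simp [scale]
  have hT : sec (dSL 1 W) * sec (pT ϖ (-1) 0) =
      central (hs w ϖ).toMul * (sec (pT ϖ (-1) 0) * sec (dSL 1 W)) := by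
    rw [sec_dSL_pT, torusSymbol, Units.val_one, hs_one_left hϖ0, zero_sub, hW, Units.val_mk0]
    simp
  have hT' : sec (pT ϖ (-1) 0) * sec (dSL 1 W) =
      central (-hs w ϖ).toMul * (sec (dSL 1 W) * sec (pT ϖ (-1) 0)) := by
    rw [hT, ← mul_assoc (central _) (central _), central_mul_central, ← toMul_add, neg_add_cancel,
      toMul_zero, central_one, one_mul]
  have hyw : v (ϖ * (y / w)) ≤ 1 := by rw [← mul_div_assoc]; exact v_div_le hy hw1
  have hsw : v (s / w / ϖ) ≤ 1 := by rw [div_right_comm]; exact v_div_le hs1 hw1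
  have i1 : IntN ((0, ϖ * y, 0) : F × F × F) := by simpa [IntN] using hy
  have i2 : IntN ((0, s / ϖ, 0) : F × F × F) := by simpa [IntN] using hs1
  have i3 : IntN ((0, s / w / ϖ, 0) : F × F × F) := by simpa [IntN] using hsw
  have i4 : IntN ((0, ϖ * (y / w), 0) : F × F × F) := by simpa [IntN] using hyw
  have it : IsInt (dSL 1 W : SL) := isInt_dSL (by simp) hw1
  have key : sec (uSL (0, ϖ * y, 0)) * lift (lSL (0, s / ϖ, 0)) =
      lift (lSL (0, s / w / ϖ, 0)) * sec (dSL 1 W) * sec (uSL (0, ϖ * (y / w), 0)) := by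
    rw [← lift_uSL i1, ← lift_uSL i4, ← lift_dSL (by simp) hw1, ← lift_mul i1.isInt i2.isInt_lSL,
      ← lift_mul i3.isInt_lSL it, ← lift_mul (i3.isInt_lSL.mul it) i4.isInt]
    congr 1
    refine sl_ext fun i j => ?_
    have hw' : s * y = w - 1 := by rw [hw]; ring
    simp only [coe_sl_mul, coe_lSL, coe_uSL, coe_dSL']
    fin_cases i <;> fin_cases j <;>
      simp [Matrix.mul_apply, Fin.sum_univ_three, hW, hw'] <;> field_simp <;> rw [hw] <;> ring
  have h2 : sec (pT ϖ (-1) 0) * (sec (uSL (0, ϖ * y, 0)) * lift (lSL (0, s / ϖ, 0))) =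
      sec (uSL (0, y, 0)) * lift (lSL (0, s, 0)) * sec (pT ϖ (-1) 0) := by
    rw [← mul_assoc, hU, mul_assoc, hL s hs1, mul_assoc]
  have h3 : sec (pT ϖ (-1) 0) * (lift (lSL (0, s / w / ϖ, 0)) * sec (dSL 1 W) *
      sec (uSL (0, ϖ * (y / w), 0))) = central (-hs w ϖ).toMul * (lift (lSL (0, s / w, 0)) *
        sec (dSL 1 W) * sec (uSL (0, y / w, 0))) * sec (pT ϖ (-1) 0) := by
    calc _ = (sec (pT ϖ (-1) 0) * lift (lSL (0, s / w / ϖ, 0))) * (sec (dSL 1 W) *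
          sec (uSL (0, ϖ * (y / w), 0))) := by simp only [mul_assoc]
      _ = lift (lSL (0, s / w, 0)) * ((sec (pT ϖ (-1) 0) * sec (dSL 1 W)) *
          sec (uSL (0, ϖ * (y / w), 0))) := by rw [hL _ hsw]; simp only [mul_assoc]
      _ = (lift (lSL (0, s / w, 0)) * central (-hs w ϖ).toMul) * (sec (dSL 1 W) *
          (sec (pT ϖ (-1) 0) * sec (uSL (0, ϖ * (y / w), 0)))) := by
            rw [hT']; simp only [mul_assoc]
      _ = _ := by rw [hU, mul_central]; simp only [mul_assoc]
  exact mul_right_cancel (h2.symm.trans ((congrArg _ key).trans h3))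

end Values

/-! ### Values of `phi` according to the size of z -/

section Regions

variable {F : Type*} [Field F] [ValuativeRel F] [TopologicalSpace F]
  [IsNonarchimedeanLocalField F] [TameCubic F]

local notation "v" => valuation F
local notation "SL" => Matrix.SpecialLinearGroup (Fin 3) F

variable {ι : rootsOfUnity 3 F ≃* rootsOfUnity 3 ℂ} {ϖ : Fˣ}
  {d : Matrix.SpecialLinearGroup (Fin 3) F} {f : MetaSL3 F → ℂ}

lemma v_div_le_one {x y : F} (hy : y ≠ 0) (h : v x ≤ v y) : v (x / y) ≤ 1 := by
  rw [map_div₀]; exact div_le_one_of_le₀ h zero_le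

lemma phi_x_z (h : HeckeFun ι d f) (hϖ : val (ϖ : F) = 1) {e₀ e₁ : ℤ} (he : -e₀ - e₁ ≤ e₁)
    {x z : F} (hz : z ≠ 0) (hx : v x ≤ v z) :
    phi f (pT ϖ e₀ e₁) (x, 0, z) = phi f (pT ϖ e₀ e₁) (0, 0, z) := by
  rw [phi_shift_x h hϖ he (s := -x / z) (by rw [neg_div, Valuation.map_neg]; exact v_div_le_one hz hx)]
  congr 2; field_simp; ring

lemma phi_y_z (h : HeckeFun ι d f) (hϖ : val (ϖ : F) = 1) {e₀ e₁ : ℤ} (he : e₁ ≤ e₀)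
    {y z : F} (hz : z ≠ 0) (hy : v y ≤ v z) :
    phi f (pT ϖ e₀ e₁) (0, y, z) = phi f (pT ϖ e₀ e₁) (0, 0, z) := by
  rw [← phi_shift_y h hϖ he (s := -y / z) (by rw [neg_div, Valuation.map_neg]; exact v_div_le_one hz hy)]
  congr 3; field_simp; ring

/-- A lower element x₃₂(−x/z) kills x, but it must also cross the factor u(y). By `unip_low_23` this
leaves a unit torus element with entry w = 1 − xy/z, which is the source of χ(w). The remaining y/w
is removed by `phi_y_z`. -/
lemma phi_generic (h : HeckeFun ι d f) (hϖ : val (ϖ : F) = 1) {e₀ e₁ : ℤ} (he : e₁ ≤ e₀)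
    (he' : -e₀ - e₁ ≤ e₁) {x y z : F} (hz : z ≠ 0) (hy1 : v (ϖ * y) ≤ 1) (hx : v x < v z)
    (hy : v y ≤ v z) (hw : v (1 - x * y / z) = 1) :
    phi f (pT ϖ e₀ e₁) (x, y, z) =
      chi ι ϖ (1 - x * y / z) * phi f (pT ϖ e₀ e₁) (0, 0, z) := by
  set w := 1 - x * y / z with hwd
  have h0 := ne_zero_of_v hw
  have hs : v (-x / z) < 1 := by
    rw [neg_div, Valuation.map_neg, map_div₀]
    exact (div_lt_one₀ (zero_lt_iff.2 (v_ne_zero hz))).2 hx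
  have e1 : phi f (pT ϖ e₀ e₁) (x, y, z) =
      f (sec (uSL (0, y, 0)) * sec (uSL (x, 0, z)) * sec (pT ϖ e₀ e₁)) := by
    rw [mul_assoc, phi_mul (f := f)]; simp
  have e2 : x + z * (-x / z) = 0 := by field_simp; ring
  have i : IntN ((0, -x / z / w, 0) : F × F × F) := by
    simp only [IntN, map_zero, zero_le, true_and, and_true]; exact v_div_le hs.le hw
  have it : IsInt (dSL 1 (Units.mk0 w h0) : SL) := isInt_dSL (by simp) hw
  rw [e1, ← absorb_32 h hϖ he' hs.le, mul_assoc (sec (uSL (0, y, 0))), unip_low_32, e2,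
    ← mul_assoc, unip_low_23 hϖ hy1 hs (w := w) (by rw [hwd]; ring) hw]
  simp only [mul_assoc]
  rw [h.anti, h.left _ _ i.isInt_lSL, ← lift_dSL (by simp) hw, h.left _ _ it, phi_mul (f := f)]
  rw [toMul_neg, toComplex_inv, inv_inv]
  simp only [add_zero, zero_add, zero_mul]
  rw [phi_y_z h hϖ he hz]
  · rfl
  · rw [map_div₀, hw, div_one]; exact hy

lemma unip_low_comm_12 (x : F) {s : F} : sec (uSL (x, 0, 0)) * lift (lSL (0, s, 0)) =
    lift (lSL (0, s, 0)) * sec (uSL (x, 0, 0)) := by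
  have := unip_low_32 x 0 s
  rwa [zero_mul, add_zero] at this

lemma unip_low_comm_23 (y : F) {s : F} : sec (uSL (0, y, 0)) * lift (lSL (s, 0, 0)) =
    lift (lSL (s, 0, 0)) * sec (uSL (0, y, 0)) := by
  have := unip_low_21 y 0 s
  rwa [mul_zero, add_zero] at this

/-- An integral translation of y achieves z = xy', so that u = u₁₂(x) u₂₃(y'). The reflections in
the roots 23 and 12 are applied in this order. -/
lemma phi_near_product (h : HeckeFun ι d f) (hϖ : val (ϖ : F) = 1) {e₀ e₁ : ℤ} (he : e₁ ≤ e₀)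
    (he' : -e₀ - e₁ ≤ e₁) {x y z : F} (hx : val x = -1) (hy : val y = -1)
    (hz : v (z - x * y) ≤ v x) :
    phi f (pT ϖ e₀ e₁) (x, y, z) = chi ι ϖ y ^ (e₀ - e₁) *
      ((chi ι ϖ x / chi ι ϖ y) ^ (e₀ - (-e₀ - e₁ - 1)) *
        f (sec (pT ϖ (-e₀ - e₁ - 1 - 1) (e₀ + 1)))) := by
  have hw := ϖ.ne_zero
  have hx0 := ne_zero_of_val (by norm_num) hx
  have hy0 := ne_zero_of_val (by norm_num) hy
  have v1 := (v_unif_lt hϖ).le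
  have i2 : IntN ((0, (ϖ : F), 0) : F × F × F) := by simp [IntN, v1]
  have hb : v ((z - x * y) / x) ≤ 1 := v_div_le_one hx0 hz
  have hbx : (z - x * y) / x + y = z / x := by field_simp; ring
  have e1 := phi_translate h (pT ϖ e₀ e₁) (a := 0) (c := 0) (by simp) hb (by simp) x y z
  rw [hbx, zero_add, zero_add, zero_mul, add_zero] at e1
  set y' := z / x with hy'
  have hyv : v (y' - y) ≤ 1 := by rw [← hbx]; simpa using hb
  have hlt : v (y' - y) < v y := by
    refine hyv.trans_lt ?_
    rw [← map_one (valuation F), v_lt_iff one_ne_zero hy0, hy]; simp [val_of_v]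
  have hvy : v y' = v y := by
    rw [show y' = y + (y' - y) by ring]; exact Valuation.map_add_eq_of_lt_left _ hlt
  have hy'0 : y' ≠ 0 := by rw [← Valuation.ne_zero_iff (valuation F), hvy]; exact v_ne_zero hy0
  have hvaly : val y' = -1 := by rw [← hy]; exact (v_eq_iff hy'0 hy0).1 hvy
  have hu : v (y' * ϖ) = 1 := by
    rw [v_eq_one_iff (mul_ne_zero hy'0 hw), val_mul hy'0 hw, hvaly, hϖ]; norm_num
  have hchi : chi ι ϖ y' = chi ι ϖ y := chi_congr hy0 hlt
  have hx' : val (x / (y' * ϖ)) = -1 := by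
    rw [val_div hx0 (mul_ne_zero hy'0 hw), val_mul hy'0 hw, hvaly, hϖ, hx]; norm_num
  have e2 := phi_scale (ϖ := ϖ) h e₀ e₁ hu (x / (y' * ϖ)) (ϖ : F)⁻¹ (x / (y' * ϖ) * (ϖ : F)⁻¹)
  have e3 : y' * ϖ * (x / (y' * ϖ)) = x := by field_simp
  have e4 : y' * ϖ * (y' * ϖ) * (x / (y' * ϖ) * (ϖ : F)⁻¹) = z := by
    rw [show y' * ϖ * (y' * ϖ) * (x / (y' * ϖ) * (ϖ : F)⁻¹) = y' * x by field_simp, hy']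
    field_simp
  rw [e3, e4, mul_inv_cancel_right₀ hw] at e2
  have e5 : phi f (pT ϖ e₀ e₁) (x / (y' * ϖ), (ϖ : F)⁻¹, x / (y' * ϖ) * (ϖ : F)⁻¹) =
      f (sec (uSL (x / (y' * ϖ), 0, 0)) * sec (uSL (0, (ϖ : F)⁻¹, 0)) * sec (pT ϖ e₀ e₁)) := by
    rw [mul_assoc, phi_mul (f := f)]; simp
  rw [← e1, e2, e5, reflect_23 h hϖ he', unip_low_comm_12, mul_assoc, h.left _ _ i2.isInt_lSL]
  have e6 := phi_x (ϖ := ϖ) h hϖ (e₀ := e₀) (e₁ := -e₀ - e₁ - 1) (by linarith) hx'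
  rw [phi] at e6
  rw [e6, chi_div hx0 (mul_ne_zero hy'0 hw), chi_mul hy'0 hw, chi_unif, mul_one, hchi]

/-- An integral translation of x achieves z = 0, so that u = u₂₃(y) u₁₂(x'). The reflections are
applied in the order opposite to `phi_near_product`. -/
lemma phi_small_z (h : HeckeFun ι d f) (hϖ : val (ϖ : F) = 1) {e₀ e₁ : ℤ} (he : e₁ ≤ e₀)
    (he' : -e₀ - e₁ ≤ e₁) {x y z : F} (hx : val x = -1) (hy : val y = -1) (hz : v z ≤ v y) :
    phi f (pT ϖ e₀ e₁) (x, y, z) = chi ι ϖ x ^ (e₀ - e₁) *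
      ((chi ι ϖ y / chi ι ϖ x) ^ (e₁ - 1 - (e₀ + 1)) *
        f (sec (pT ϖ (e₁ - 1) (-(e₁ - 1) - (e₀ + 1) - 1)))) := by
  have hw := ϖ.ne_zero
  have hx0 := ne_zero_of_val (by norm_num) hx
  have hy0 := ne_zero_of_val (by norm_num) hy
  have v1 := (v_unif_lt hϖ).le
  have i2 : IntN (((ϖ : F), 0, 0) : F × F × F) := by simp [IntN, v1]
  have hb : v (-z / y) ≤ 1 := v_div_le_one hy0 (by rwa [Valuation.map_neg])
  have e1 := phi_translate h (pT ϖ e₀ e₁) (b := 0) (c := 0) hb (by simp) (by simp) x y z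
  rw [zero_add, zero_add, show z + -z / y * y = 0 by field_simp; ring] at e1
  set x' := -z / y + x with hx'
  have hxv : v (x' - x) ≤ 1 := by rw [hx']; simpa using hb
  have hlt : v (x' - x) < v x := by
    refine hxv.trans_lt ?_
    rw [← map_one (valuation F), v_lt_iff one_ne_zero hx0, hx]; simp [val_of_v]
  have hvx : v x' = v x := by
    rw [show x' = x + (x' - x) by ring]; exact Valuation.map_add_eq_of_lt_left _ hlt
  have hx'0 : x' ≠ 0 := by rw [← Valuation.ne_zero_iff (valuation F), hvx]; exact v_ne_zero hx0
  have hvalx : val x' = -1 := by rw [← hx]; exact (v_eq_iff hx'0 hx0).1 hvx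
  have hu : v (x' * ϖ) = 1 := by
    rw [v_eq_one_iff (mul_ne_zero hx'0 hw), val_mul hx'0 hw, hvalx, hϖ]; norm_num
  have hchi : chi ι ϖ x' = chi ι ϖ x := chi_congr hx0 hlt
  have hy' : val (y / (x' * ϖ)) = -1 := by
    rw [val_div hy0 (mul_ne_zero hx'0 hw), val_mul hx'0 hw, hvalx, hϖ, hy]; norm_num
  have e2 := phi_scale (ϖ := ϖ) h e₀ e₁ hu (ϖ : F)⁻¹ (y / (x' * ϖ)) 0
  have e3 : x' * ϖ * (y / (x' * ϖ)) = y := by field_simp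
  rw [e3, mul_zero, mul_inv_cancel_right₀ hw] at e2
  have e5 : phi f (pT ϖ e₀ e₁) ((ϖ : F)⁻¹, y / (x' * ϖ), 0) =
      f (sec (uSL (0, y / (x' * ϖ), 0)) * sec (uSL ((ϖ : F)⁻¹, 0, 0)) * sec (pT ϖ e₀ e₁)) := by
    rw [mul_assoc, phi_mul (f := f)]; simp
  rw [← e1, e2, e5, reflect_12 h hϖ he, unip_low_comm_23, mul_assoc, h.left _ _ i2.isInt_lSL]
  have e6 := phi_y (ϖ := ϖ) h hϖ (e₀ := e₁ - 1) (e₁ := e₀ + 1) (by linarith) hy'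
  rw [phi] at e6
  rw [e6, chi_div hy0 (mul_ne_zero hx'0 hw), chi_mul hx'0 hw, chi_unif, mul_one, hchi]

/-! ### Congruences on the support -/

lemma HeckeFun.sec_pT_sorted {a b : ℤ} (h : HeckeFun ι (pT ϖ a b) f) (p q : ℤ) :
    ∃ p' q' : ℤ, p' ≤ q' ∧ q' ≤ -p' - q' ∧ f (sec (pT ϖ p q)) = f (sec (pT ϖ p' q')) ∧
      ((p' = p ∧ q' = q) ∨ (p' = q ∧ q' = p) ∨ (p' = p ∧ q' = -p - q) ∨ (p' = -p - q ∧ q' = p) ∨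
        (p' = q ∧ q' = -p - q) ∨ (p' = -p - q ∧ q' = q)) := by
  have s0 := h.sec_pT_s0
  have s1 := h.sec_pT_s1
  have t2 : f (sec (pT ϖ p q)) = f (sec (pT ϖ q p)) := s0 _ _
  have t3 : f (sec (pT ϖ p q)) = f (sec (pT ϖ p (-p - q))) := s1 _ _
  have t4 : f (sec (pT ϖ p q)) = f (sec (pT ϖ (-p - q) p)) := by rw [t3, s0]
  have t5 : f (sec (pT ϖ p q)) = f (sec (pT ϖ q (-p - q))) := by
    rw [t2, s1]; congr 3; ring
  have t6 : f (sec (pT ϖ p q)) = f (sec (pT ϖ (-p - q) q)) := by rw [t5, s0]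
  rcases le_total p q with h1 | h1 <;> rcases le_total q (-p - q) with h2 | h2 <;>
    rcases le_total p (-p - q) with h3 | h3
  · exact ⟨p, q, h1, h2, rfl, by simp⟩
  · exact ⟨p, q, h1, h2, rfl, by simp⟩
  · exact ⟨p, -p - q, h3, by linarith, t3, by simp⟩
  · exact ⟨-p - q, p, h3, by linarith, t4, by simp⟩
  · exact ⟨q, p, h1, by linarith, t2, by simp⟩
  · exact ⟨q, -p - q, h2, by linarith, t5, by simp⟩
  · exact ⟨-p - q, q, h2, by linarith, t6, by simp⟩
  · exact ⟨-p - q, q, h2, by linarith, t6, by simp⟩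

/-- As the exponents sum to zero, 3 ∣ a − b makes all three congruent modulo 3, a property invariant
under permutation. -/
lemma HeckeFun.three_dvd {a b : ℤ} (h : HeckeFun ι (pT ϖ a b) f) (hϖ : val (ϖ : F) = 1)
    (h1 : a ≤ b) (h2 : b ≤ -a - b) (h3 : 3 ∣ a - b) {p q : ℤ} (hne : f (sec (pT ϖ p q)) ≠ 0) :
    3 ∣ p - q := by
  obtain ⟨p', q', l1, l2, e, hc⟩ := h.sec_pT_sorted p q
  rw [e, h.sec_pT_ordered hϖ h1 h2 l1 l2] at hne
  simp only [ne_eq, ite_eq_right_iff, one_ne_zero, imp_false, not_not] at hne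
  omega

section Dominant

variable {a b e₀ e₁ : ℤ}

/-- Hypotheses on the exponents `a, b` of the double coset and `e₀, e₁` of the argument. -/
structure Admissible (ι : rootsOfUnity 3 F ≃* rootsOfUnity 3 ℂ) (ϖ : Fˣ) (f : MetaSL3 F → ℂ)
    (a b e₀ e₁ : ℤ) : Prop where
  hecke : HeckeFun ι (pT ϖ a b) f
  unif : val (ϖ : F) = 1
  le₁ : a ≤ b
  le₂ : b ≤ -a - b
  dvd : 3 ∣ a - b
  dom₁ : e₁ ≤ e₀
  dom₂ : -e₀ - e₁ ≤ e₁

lemma Admissible.three_dvd (h : Admissible ι ϖ f a b e₀ e₁) {p q : ℤ}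
    (hne : f (sec (pT ϖ p q)) ≠ 0) : 3 ∣ p - q :=
  h.hecke.three_dvd h.unif h.le₁ h.le₂ h.dvd hne

lemma Admissible.phi_x (h : Admissible ι ϖ f a b e₀ e₁) {x : F} (hx : val x = -1) :
    phi f (pT ϖ e₀ e₁) (x, 0, 0) = chi ι ϖ x * f (sec (pT ϖ (e₁ - 1) (e₀ + 1))) := by
  rw [CubicCover.phi_x h.hecke h.unif h.dom₁ hx]
  by_cases hne : f (sec (pT ϖ (e₁ - 1) (e₀ + 1))) = 0
  · simp [hne]
  · have := h.three_dvd hne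
    -- On the support e₀ − e₁ ≡ −2 ≡ 1 modulo 3, so the power of χ is independent of D.
    rw [chi_zpow_congr x (l := 1) (by omega), zpow_one]

lemma Admissible.phi_y (h : Admissible ι ϖ f a b e₀ e₁) {y : F} (hy : val y = -1) :
    phi f (pT ϖ e₀ e₁) (0, y, 0) = chi ι ϖ y * f (sec (pT ϖ e₀ (-e₀ - e₁ - 1))) := by
  rw [CubicCover.phi_y h.hecke h.unif h.dom₂ hy]
  by_cases hne : f (sec (pT ϖ e₀ (-e₀ - e₁ - 1))) = 0
  · simp [hne]
  · have := h.three_dvd hne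
    rw [chi_zpow_congr y (l := 1) (by omega), zpow_one]

lemma Admissible.phi_z (h : Admissible ι ϖ f a b e₀ e₁) {z : F} (hz : val z = -2) :
    phi f (pT ϖ e₀ e₁) (0, 0, z) = (chi ι ϖ z)⁻¹ * f (sec (pT ϖ (-e₀ - e₁ - 2) e₁)) := by
  have h1 := h.dom₁
  have h2 := h.dom₂
  rw [CubicCover.phi_z h.hecke h.unif (by linarith) hz]
  by_cases hne : f (sec (pT ϖ (-e₀ - e₁ - 2) e₁)) = 0
  · simp [hne]
  · have := h.three_dvd hne
    rw [chi_zpow_congr z (l := -1) (by omega), zpow_neg_one]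

lemma Admissible.phi_near_product (h : Admissible ι ϖ f a b e₀ e₁) {x y z : F} (hx : val x = -1)
    (hy : val y = -1) (hz : v (z - x * y) ≤ v x) : phi f (pT ϖ e₀ e₁) (x, y, z) =
      chi ι ϖ x * (chi ι ϖ y)⁻¹ * f (sec (pT ϖ (-e₀ - e₁ - 2) (e₀ + 1))) := by
  rw [CubicCover.phi_near_product h.hecke h.unif h.dom₁ h.dom₂ hx hy hz,
    show -e₀ - e₁ - 1 - 1 = -e₀ - e₁ - 2 by ring]
  by_cases hne : f (sec (pT ϖ (-e₀ - e₁ - 2) (e₀ + 1))) = 0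
  · simp [hne]
  · have := h.three_dvd hne
    rw [div_zpow, chi_zpow_congr x (l := 1) (by omega), chi_zpow_congr y (l := 0) (by omega),
      chi_zpow_congr y (k := _ - _) (l := 1) (by omega)]
    simp [div_eq_mul_inv]

lemma Admissible.phi_small_z (h : Admissible ι ϖ f a b e₀ e₁) {x y z : F} (hx : val x = -1)
    (hy : val y = -1) (hz : v z ≤ v y) : phi f (pT ϖ e₀ e₁) (x, y, z) =
      chi ι ϖ y * (chi ι ϖ x)⁻¹ * f (sec (pT ϖ (e₁ - 1) (-e₀ - e₁ - 1))) := by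
  rw [CubicCover.phi_small_z h.hecke h.unif h.dom₁ h.dom₂ hx hy hz,
    show -(e₁ - 1) - (e₀ + 1) - 1 = -e₀ - e₁ - 1 by ring]
  by_cases hne : f (sec (pT ϖ (e₁ - 1) (-e₀ - e₁ - 1))) = 0
  · simp [hne]
  · have := h.three_dvd hne
    rw [div_zpow, chi_zpow_congr y (l := 1) (by omega), chi_zpow_congr x (l := 0) (by omega),
      chi_zpow_congr x (k := e₁ - 1 - (e₀ + 1)) (l := 1) (by omega)]
    simp [div_eq_mul_inv]

/-- The double coset of the unipotent element with corner entry `ϖ⁻ᵏ`. -/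
lemma corner_coset (hϖ : val (ϖ : F) = 1) (he : -e₀ - e₁ ≤ e₀) {k : ℤ} (hk : 0 ≤ k) :
    ∃ k₁ k₂ : SL, IsInt k₁ ∧ IsInt k₂ ∧
      k₁ * (uSL (0, 0, (ϖ : F) ^ (-k)) * pT ϖ e₀ e₁) * k₂ = pT ϖ (-e₀ - e₁ - k) e₁ := by
  have hw := ϖ.ne_zero
  have v1 : v ((ϖ : F) ^ k) ≤ 1 := (v_pow_le_one hϖ).2 hk
  have v2 : v ((ϖ : F) ^ (k + (2 * e₀ + e₁))) ≤ 1 := (v_pow_le_one hϖ).2 (by linarith)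
  have i1 : IntN ((0, 0, -(ϖ : F) ^ k) : F × F × F) := by
    simp only [IntN, map_zero, zero_le, true_and, Valuation.map_neg]; exact v1
  have i2 : IntN ((0, 0, -(ϖ : F) ^ (k + (2 * e₀ + e₁))) : F × F × F) := by
    simp only [IntN, map_zero, zero_le, true_and, Valuation.map_neg]; exact v2
  have iw : IsInt (dSL 1 (-1) * (sSL 0 * (sSL 1 * sSL 0)) : SL) :=
    (isInt_dSL (by simp) (by simp)).mul ((isInt_sSL 0).mul ((isInt_sSL 1).mul (isInt_sSL 0)))
  refine ⟨lSL (0, 0, -(ϖ : F) ^ k), lSL (0, 0, -(ϖ : F) ^ (k + (2 * e₀ + e₁))) *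
    (dSL 1 (-1) * (sSL 0 * (sSL 1 * sSL 0)))⁻¹, i1.isInt_lSL, i2.isInt_lSL.mul iw.inv, ?_⟩
  rw [← mul_assoc, mul_inv_eq_iff_eq_mul]
  refine sl_ext fun i j => ?_
  simp only [coe_sl_mul, coe_lSL, coe_uSL, coe_sSL, coe_dSL', coe_pT]
  have p1 : (ϖ : F) ^ (-k) * (ϖ : F) ^ k = 1 := by rw [← zpow_add₀ hw]; simp
  fin_cases i <;> fin_cases j <;>
    simp [Matrix.mul_apply, Fin.sum_univ_three, simpleRefl, zpow_add₀ hw, zpow_sub₀ hw, zpow_neg,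
      zpow_mul, mul_comm] <;> field_simp <;> ring

/-- By `corner_coset`, nonvanishing identifies the double coset of exponents (−e₀−e₁−k, e₁, e₀+k)
with that of d, whose exponents are congruent modulo 3. -/
lemma Admissible.corner_dvd (h : Admissible ι ϖ f a b e₀ e₁) {k : ℤ} (hk : 0 ≤ k) {z : F}
    (hz0 : z ≠ 0) (hz : val z = -k) (hne : phi f (pT ϖ e₀ e₁) (0, 0, z) ≠ 0) :
    3 ∣ e₀ - e₁ + k := by
  have hϖ := h.unif
  have h1 := h.dom₁
  have h2 := h.dom₂
  have l1 := h.le₁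
  have l2 := h.le₂
  have h3 := h.dvd
  have hw := ϖ.ne_zero
  have hwk : (ϖ : F) ^ k ≠ 0 := zpow_ne_zero _ hw
  have hu : v (z * (ϖ : F) ^ k) = 1 := by
    rw [v_eq_one_iff (mul_ne_zero hz0 hwk), val_mul hz0 hwk, hz, val_pow_unif hϖ]; ring
  have e := phi_scale_z (ϖ := ϖ) h.hecke e₀ e₁ hu ((ϖ : F) ^ (-k))
  rw [zpow_neg, mul_inv_cancel_right₀ hwk, ← zpow_neg] at e
  rw [e] at hne
  obtain ⟨ζ, k₁, k₂, i₁, i₂, e1⟩ := h.hecke.supp _ (right_ne_zero_of_mul hne)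
  obtain ⟨l₁, l₂, j₁, j₂, e2⟩ := corner_coset (ϖ := ϖ) (e₀ := e₀) (e₁ := e₁) hϖ (by linarith) hk
  have e3 : uSL (0, 0, (ϖ : F) ^ (-k)) * pT ϖ e₀ e₁ = k₁ * pT ϖ a b * k₂ := by
    have := congrArg MetaSL3.mat e1
    simpa [central, lift, sec] using this
  have e4 : pT ϖ (-e₀ - e₁ - k) e₁ = (l₁ * k₁) * pT ϖ a b * (k₂ * l₂) := by
    rw [← e2, e3]; group
  have e5 : pT ϖ a b = (l₁ * k₁)⁻¹ * pT ϖ (-e₀ - e₁ - k) e₁ * (k₂ * l₂)⁻¹ := by rw [e4]; group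
  have m1 := exponent_le hϖ l1 l2 (j₁.mul i₁) (i₂.mul j₂) e4
  have m2 := exponent_le hϖ (by linarith) (by linarith) (j₁.mul i₁).inv (i₂.mul j₂).inv e5
  have m3 := exponent_ge hϖ l1 l2 (j₁.mul i₁) (i₂.mul j₂) e4
  have m4 := exponent_ge hϖ (by linarith) (by linarith) (j₁.mul i₁).inv (i₂.mul j₂).inv e5
  omega

end Dominant

end Regions

/-! ### Haar measure and fractional ideals -/

section Measure

variable {F : Type*} [Field F] [ValuativeRel F] [TopologicalSpace F]
  [IsNonarchimedeanLocalField F] [TameCubic F]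

local notation "v" => valuation F
local notation "SL" => Matrix.SpecialLinearGroup (Fin 3) F

-- A local field is a proper metric space. Second countability makes the product of Borel structures
-- on F³ the Borel structure, as needed for Fubini with continuous integrands.
omit [TameCubic F] in
lemma secondCountable : SecondCountableTopology F := by
  let := IsTopologicalAddGroup.rightUniformSpace F
  let := isUniformAddGroup_of_addCommGroup (G := F)
  let : (Valued.v (R := F)).RankOne :=
  { hom' := IsRankLeOne.nonempty.some.emb (R := F).comp MonoidWithZeroHom.ValueGroup₀.embedding
    strictMono' := IsRankLeOne.nonempty.some.strictMono.comp
        MonoidWithZeroHom.ValueGroup₀.embedding_strictMono }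
  open scoped Valued in
  have : ProperSpace F := .of_nontriviallyNormedField_of_weaklyLocallyCompactSpace F
  open scoped Valued in
  exact secondCountable_of_proper

instance : SecondCountableTopology F := secondCountable

variable {ϖ : Fˣ}

/-- The fractional ideal generated by `ϖᵏ`. -/
def ball (ϖ : Fˣ) (k : ℤ) : AddSubgroup F where
  carrier := {x | v x ≤ v ((ϖ : F) ^ k)}
  zero_mem' := by simp
  add_mem' := fun {x y} hx hy => by
    rw [Set.mem_ofPred_eq] at hx hy ⊢; exact Valuation.map_add_le _ hx hy
  neg_mem' := fun {x} hx => by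
    simp only [Set.mem_ofPred_eq, Valuation.map_neg] at hx ⊢; exact hx

lemma mem_ball {k : ℤ} {x : F} : x ∈ ball ϖ k ↔ v x ≤ v ((ϖ : F) ^ k) := by
  show x ∈ {x | v x ≤ v ((ϖ : F) ^ k)} ↔ _
  rw [Set.mem_ofPred_eq]

lemma mem_ball_iff (hϖ : val (ϖ : F) = 1) {k : ℤ} {x : F} (hx : x ≠ 0) :
    x ∈ ball ϖ k ↔ k ≤ val x := by
  rw [mem_ball, v_le_iff hx (zpow_ne_zero _ ϖ.ne_zero), val_pow_unif hϖ]

lemma isOpen_ball (k : ℤ) : IsOpen (ball ϖ k : Set F) := by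
  apply AddSubgroup.isOpen_of_mem_nhds (g := 0)
  have hne : v ((ϖ : F) ^ k) ≠ 0 := v_ne_zero (zpow_ne_zero _ ϖ.ne_zero)
  refine Filter.mem_of_superset ((IsValuativeTopology.hasBasis_nhds_zero' F).mem_of_mem hne) ?_
  intro x hx
  rw [Set.mem_ofPred_eq] at hx
  exact mem_ball.2 (le_of_lt hx)

lemma isCompact_ball (k : ℤ) : IsCompact (ball ϖ k : Set F) := by
  have := IsNonarchimedeanLocalField.isCompact_closedBall F (v ((ϖ : F) ^ k))
  exact this

lemma ball_mono (hϖ : val (ϖ : F) = 1) {k l : ℤ} (h : l ≤ k) : ball ϖ k ≤ ball ϖ l :=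
  fun _ hx => mem_ball.2 <| le_trans (mem_ball.1 hx) ((v_pow_le_pow hϖ).2 h)

lemma mem_ball_zero {x : F} : x ∈ ball ϖ 0 ↔ v x ≤ 1 := by rw [mem_ball, zpow_zero, map_one]

lemma mul_mem_ball (hϖ : val (ϖ : F) = 1) {k l : ℤ} {x y : F} (hx : x ∈ ball ϖ k)
    (hy : y ∈ ball ϖ l) : x * y ∈ ball ϖ (k + l) := by
  rw [mem_ball, zpow_add₀ ϖ.ne_zero, map_mul, map_mul]
  exact mul_le_mul' (mem_ball.1 hx) (mem_ball.1 hy)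

lemma div_mem {c x : F} {k : ℤ} (hϖ : val (ϖ : F) = 1) (hc0 : c ≠ 0) (hc : val c = k) :
    v (x / c) ≤ 1 ↔ x ∈ ball ϖ k := by
  have : v c = v ((ϖ : F) ^ k) := by
    rw [v_eq_iff hc0 (zpow_ne_zero _ ϖ.ne_zero), val_pow_unif hϖ, hc]
  rw [map_div₀, div_le_one₀ (zero_lt_iff.2 (v_ne_zero hc0)), mem_ball, this]

lemma div_mem_lt {c x : F} {k : ℤ} (hϖ : val (ϖ : F) = 1) (hc0 : c ≠ 0) (hc : val c = k) :
    v (x / c) < 1 ↔ x ∈ ball ϖ (k + 1) := by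
  rcases eq_or_ne x 0 with rfl | hx
  · simp
  · rw [v_lt_one_iff (div_ne_zero hx hc0), val_div hx hc0, mem_ball_iff hϖ hx]
    omega

variable [MeasurableSpace F] [BorelSpace F] {μ : Measure F} [μ.IsAddHaarMeasure]

lemma measurableSet_ball (k : ℤ) : MeasurableSet (ball ϖ k : Set F) := (isOpen_ball k).measurableSet

lemma measure_ball_ne_top (k : ℤ) : μ (ball ϖ k : Set F) ≠ ⊤ := (isCompact_ball k).measure_ne_top

/-- Integration of a function on a fractional ideal that only depends on residues. -/
lemma integral_residues (hϖ : val (ϖ : F) = 1) {k : ℤ} {c : F} (hc0 : c ≠ 0) (hc : val c = k)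
    {h : F → ℂ} {H : 𝓀[F] → ℂ} (hH : ∀ r : F, v r ≤ 1 → h (c * r) = H (red r)) :
    ∫ x in (ball ϖ k : Set F), h x ∂μ = μ.real (ball ϖ (k + 1) : Set F) * ∑ ρ, H ρ := by
  choose r hr1 hr2 using red_surjective (F := F)
  set S : 𝓀[F] → Set F := fun ρ => (fun x => x + -(c * r ρ)) ⁻¹' (ball ϖ (k + 1) : Set F) with hS
  have memS : ∀ ρ x, x ∈ S ρ ↔ x ∈ ball ϖ k ∧ red (x / c) = ρ := by
    intro ρ x
    have e : (x + -(c * r ρ)) / c = x / c - r ρ := by field_simp; ring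
    show x + -(c * r ρ) ∈ ball ϖ (k + 1) ↔ _
    rw [← div_mem_lt hϖ hc0 hc, e, ← div_mem hϖ hc0 hc]
    constructor
    · intro h1
      have h2 : v (x / c) ≤ 1 := by
        rw [show x / c = (x / c - r ρ) + r ρ by ring]; exact v_add_le h1.le (hr1 ρ)
      exact ⟨h2, by rw [(cong_iff_red h2 (hr1 ρ)).1 h1, hr2]⟩
    · rintro ⟨h2, h3⟩
      rw [cong_iff_red h2 (hr1 ρ), h3, hr2]
  have hU : (ball ϖ k : Set F) = ⋃ ρ, S ρ := by
    ext x
    simp only [Set.mem_iUnion, memS, SetLike.mem_coe]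
    exact ⟨fun hx => ⟨_, hx, rfl⟩, fun ⟨_, hx, _⟩ => hx⟩
  have hmeas : ∀ ρ, MeasurableSet (S ρ) := fun ρ =>
    (measurable_add_const _) (measurableSet_ball (k + 1))
  have hvol : ∀ ρ, μ (S ρ) = μ (ball ϖ (k + 1) : Set F) := fun ρ => measure_preimage_add_right _ _ _
  have hval : ∀ ρ, ∀ x ∈ S ρ, h x = H ρ := by
    intro ρ x hx
    obtain ⟨h1, h2⟩ := (memS ρ x).1 hx
    rw [← h2, ← hH _ ((div_mem hϖ hc0 hc).2 h1), mul_div_cancel₀ _ hc0]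
  have hint : ∀ ρ, IntegrableOn h (S ρ) μ := fun ρ => by
    refine IntegrableOn.congr_fun (f := fun _ => H ρ) ?_ (fun x hx => (hval ρ x hx).symm) (hmeas ρ)
    exact integrableOn_const (by rw [hvol]; exact measure_ball_ne_top _)
  rw [hU, integral_iUnion_fintype hmeas ?_ hint, Finset.mul_sum]
  · refine Finset.sum_congr rfl fun ρ _ => ?_
    rw [setIntegral_congr_fun (hmeas ρ) (hval ρ), setIntegral_const, Measure.real, hvol, Measure.real]
    simp
  · intro ρ σ hne
    rw [Function.onFun, Set.disjoint_left]
    intro x hx hy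
    exact hne (((memS ρ x).1 hx).2.symm.trans ((memS σ x).1 hy).2)

lemma measure_ball_zero (hμ : μ (𝒪[F] : Set F) = 1) : μ.real (ball ϖ 0 : Set F) = 1 := by
  have : (ball ϖ 0 : Set F) = (𝒪[F] : Set F) := by
    ext x; exact mem_ball_zero
  rw [this, Measure.real, hμ]; simp

lemma measure_ball_neg_one (hϖ : val (ϖ : F) = 1) (hμ : μ (𝒪[F] : Set F) = 1) :
    μ.real (ball ϖ (-1) : Set F) = resCard F := by
  have h := integral_residues (μ := μ) hϖ (k := -1) (c := (ϖ : F)⁻¹) (inv_ne_zero ϖ.ne_zero)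
    (by rw [val_inv, hϖ]) (h := fun _ => 1) (H := fun _ => 1) (fun _ _ => rfl)
  rw [setIntegral_const, show (-1 : ℤ) + 1 = 0 by norm_num, measure_ball_zero hμ] at h
  rw [resCard_eq]
  have h' : ((μ.real (ball ϖ (-1) : Set F) : ℝ) : ℂ) = (Fintype.card 𝓀[F] : ℝ) := by
    simpa using h
  exact_mod_cast h'

/-- Uniqueness of Haar measure; the scalar is 1 because a unit preserves 𝒪. -/
lemma measure_unit_smul (hμ : μ (𝒪[F] : Set F) = 1) {s : F} (hs : v s = 1) :
    μ.map (fun x => s * x) = μ := by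
  have h0 := ne_zero_of_v hs
  have hcont : Continuous fun x : F => s * x := continuous_const.mul continuous_id
  have hcont' : Continuous fun x : F => s⁻¹ * x := continuous_const.mul continuous_id
  let e : F ≃+ F :=
    { toFun := fun x => s * x
      invFun := fun x => s⁻¹ * x
      left_inv := fun x => by field_simp
      right_inv := fun x => by field_simp
      map_add' := fun x y => mul_add _ _ _ }
  have : (μ.map e).IsAddHaarMeasure := e.isAddHaarMeasure_map μ hcont hcont'
  have h1 := Measure.isAddLeftInvariant_eq_smul (μ.map e) μ
  have h2 : (μ.map e) (𝒪[F] : Set F) = 1 := by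
    show (μ.map fun x => s * x) _ = 1
    rw [Measure.map_apply hcont.measurable]
    · convert hμ using 2
      ext x
      show v (s * x) ≤ 1 ↔ v x ≤ 1
      rw [map_mul, hs, one_mul]
    · have := measurableSet_ball (ϖ := (1 : Fˣ)) 0
      convert this using 1
      ext x
      exact mem_ball_zero.symm
  rw [h1, Measure.smul_apply, hμ] at h2
  have h3 : Measure.addHaarScalarFactor (μ.map e) μ = 1 := by
    simpa [ENNReal.smul_def] using h2
  rw [h3, one_smul] at h1
  exact h1

lemma integral_unit_smul (hμ : μ (𝒪[F] : Set F) = 1) {s : F} (hs : v s = 1) (h : F → ℂ) :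
    ∫ x, h (s * x) ∂μ = ∫ x, h x ∂μ := by
  have h0 := ne_zero_of_v hs
  have := measure_unit_smul hμ hs
  nth_rewrite 2 [← this]
  exact ((Homeomorph.mulLeft₀ s h0).measurableEmbedding.integral_map h).symm

end Measure

/-! ### Residue characters, Gauss sums and the Jacobi sum -/

section GaussSums

variable {F : Type*} [Field F] [ValuativeRel F] [TopologicalSpace F]
  [IsNonarchimedeanLocalField F] [TameCubic F]

local notation "v" => valuation F
local notation "SL" => Matrix.SpecialLinearGroup (Fin 3) F

variable {ι : rootsOfUnity 3 F ≃* rootsOfUnity 3 ℂ} {ϖ : Fˣ}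

/-- A representative of a residue class. -/
def rep (ρ : 𝓀[F]) : F := (red_surjective ρ).choose

omit [TameCubic F] in
lemma v_rep (ρ : 𝓀[F]) : v (rep ρ) ≤ 1 := (red_surjective ρ).choose_spec.1

omit [TameCubic F] in
lemma red_rep (ρ : 𝓀[F]) : red (rep ρ) = ρ := (red_surjective ρ).choose_spec.2

omit [TameCubic F] in
lemma v_rep_unit {ρ : 𝓀[F]} (h : ρ ≠ 0) : v (rep ρ) = 1 := by
  refine v_eq_one_of_not_lt (v_rep ρ) fun hlt => h ?_
  rw [← red_rep ρ, red_eq_zero (v_rep ρ)]; exact hlt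

lemma chi_of_red {x y : F} (hx : v x = 1) (hy : v y ≤ 1) (h : red y = red x) :
    chi ι ϖ y = chi ι ϖ x :=
  chi_congr (ne_zero_of_v hx) (by rw [hx]; exact (cong_iff_red hy hx.le).2 h)

open Classical in
/-- The character `(·, ϖ)` on the residue field. -/
def resChar (ι : rootsOfUnity 3 F ≃* rootsOfUnity 3 ℂ) (ϖ : Fˣ) : MulChar 𝓀[F] ℂ where
  toFun ρ := if ρ = 0 then 0 else chi ι ϖ (rep ρ)
  map_one' := by
    rw [if_neg one_ne_zero, chi_of_red (x := 1) (by simp) (v_rep _) (by rw [red_rep, red_one]), chi_one]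
  map_mul' ρ σ := by
    by_cases h1 : ρ = 0
    · simp [h1]
    by_cases h2 : σ = 0
    · simp [h2]
    have u1 := v_rep_unit h1
    have u2 := v_rep_unit h2
    simp only [h1, h2, mul_eq_zero, or_self, if_false]
    rw [← chi_mul (ne_zero_of_v u1) (ne_zero_of_v u2)]
    exact chi_of_red (v_unit_mul u1 u2) (v_rep _)
      (by rw [red_rep, red_mul (v_rep _) (v_rep _), red_rep, red_rep])
  map_nonunit' ρ h := if_pos (by simpa using h)

lemma resChar_unit {x : F} (hx : v x = 1) : resChar ι ϖ (red x) = chi ι ϖ x := by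
  have h : red x ≠ 0 := by
    rw [ne_eq, red_eq_zero hx.le, hx]; exact lt_irrefl _
  refine (if_neg h).trans ?_
  exact chi_of_red hx (v_rep _) (red_rep _)

lemma resChar_inv_unit {x : F} (hx : v x = 1) : (resChar ι ϖ)⁻¹ (red x) = (chi ι ϖ x)⁻¹ := by
  rw [MulChar.inv_apply_eq_inv', resChar_unit hx]

lemma resChar_cube : resChar ι ϖ ^ 3 = 1 := by
  ext u
  obtain ⟨x, hx, e⟩ := red_surjective (F := F) (u : 𝓀[F])
  have hu : v x = 1 := by
    refine v_eq_one_of_not_lt hx fun hlt => u.ne_zero ?_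
    rw [← e, (red_eq_zero hx).2 hlt]
  rw [MulChar.pow_apply_coe, MulChar.one_apply_coe, ← e, resChar_unit hu, chi_cube]

/-- On units, (x, ϖ) reduces to the (q − 1)/3-th power of the residue, and the cyclic group of order
q − 1 is not killed by that exponent. -/
lemma exists_chi_ne_one (hϖ : val (ϖ : F) = 1) : ∃ x : F, v x = 1 ∧ chi ι ϖ x ≠ 1 := by
  classical
  have hq := three_dvd (F := F)
  have hcard : Nat.card 𝓀[F]ˣ = resCard F - 1 := by
    rw [Nat.card_eq_fintype_card, Fintype.card_units, resCard_eq]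
  have h1 : 0 < resCard F - 1 := by
    rw [← hcard]; exact Nat.card_pos
  obtain ⟨u, hu⟩ := exists_pow_ne_one_of_isCyclic (G := 𝓀[F]ˣ) (k := (resCard F - 1) / 3)
    (by omega) (by rw [hcard]; omega)
  obtain ⟨x, hx, e⟩ := red_surjective (F := F) (u : 𝓀[F])
  have hvx : v x = 1 := by
    refine v_eq_one_of_not_lt hx fun hlt => u.ne_zero ?_
    rw [← e, (red_eq_zero hx).2 hlt]
  have hx0 := ne_zero_of_v hvx
  refine ⟨x, hvx, fun h => hu ?_⟩
  have h2 : hilbertSymbol x (ϖ : F) = 1 := by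
    have h3 : ι (hilbertSymbol x (ϖ : F)) = 1 := by
      ext; exact h
    simpa using h3
  have h4 := red_hilbert hx0 ϖ.ne_zero
  rw [h2] at h4
  have ht : tameUnit x (ϖ : F) = x := by simp [tameUnit, val_of_v hvx, hϖ]
  rw [ht, e] at h4
  ext
  rw [Units.val_pow_eq_pow_val, ← h4]
  simp [red_one]

lemma resChar_ne_one (hϖ : val (ϖ : F) = 1) : resChar ι ϖ ≠ 1 := by
  obtain ⟨x, hx, h⟩ := exists_chi_ne_one (ι := ι) hϖ
  intro h1
  apply h
  have hr : IsUnit (red x) := by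
    rw [isUnit_iff_ne_zero, ne_eq, red_eq_zero hx.le, hx]; exact lt_irrefl _
  rw [← resChar_unit hx, h1, MulChar.one_apply hr]

lemma resChar_inv : (resChar ι ϖ)⁻¹ = resChar ι ϖ * resChar ι ϖ := by
  rw [inv_eq_iff_mul_eq_one, ← pow_three, resChar_cube]

variable {ψ : AddChar F Circle}

/-- The conductor of `ψ` is the ring of integers. -/
def Unramified (ψ : AddChar F Circle) : Prop :=
  ∀ x : F, (∀ y ∈ 𝒪[F], ψ (x * y) = 1) ↔ x ∈ 𝒪[F]

omit [TameCubic F] in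
lemma Unramified.eq_one (hψ : Unramified ψ) {x : F} (hx : v x ≤ 1) : ψ x = 1 := by
  simpa using (hψ 1).2 (one_mem _) x hx

lemma Unramified.exists_ne (hψ : Unramified ψ) (hϖ : val (ϖ : F) = 1) :
    ∃ y : F, v y ≤ 1 ∧ ψ ((ϖ : F)⁻¹ * y) ≠ 1 := by
  by_contra hcon
  push Not at hcon
  have h : (ϖ : F)⁻¹ ∈ 𝒪[F] := (hψ _).1 hcon
  have h' : v (ϖ : F)⁻¹ ≤ 1 := h
  rw [v_le_one_iff (inv_ne_zero ϖ.ne_zero), val_inv, hϖ] at h'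
  norm_num at h'

lemma Unramified.congr (hψ : Unramified ψ) {x y : F} (h : v (x - y) ≤ 1) : ψ x = ψ y := by
  rw [show x = (x - y) + y by ring, AddChar.map_add_eq_mul, hψ.eq_one h, one_mul]

lemma Unramified.congr_red (hψ : Unramified ψ) (hϖ : val (ϖ : F) = 1) {x y : F} (hx : v x ≤ 1)
    (hy : v y ≤ 1) (h : red x = red y) : ψ ((ϖ : F)⁻¹ * x) = ψ ((ϖ : F)⁻¹ * y) := by
  apply hψ.congr
  rw [← mul_sub, mul_comm, ← div_eq_mul_inv, div_mem hϖ ϖ.ne_zero hϖ]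
  have := (cong_iff_red hx hy).2 h
  have h2 := (div_mem_lt (c := (1 : F)) (k := 0) (x := x - y) hϖ one_ne_zero (by simp [val_of_v])).1
    (by simpa using this)
  simpa using h2

/-- The additive character of the residue field induced by `x ↦ ψ(ϖ⁻¹ x)`. -/
def resAdd (hψ : Unramified ψ) (hϖ : val (ϖ : F) = 1) : AddChar 𝓀[F] ℂ where
  toFun ρ := (ψ ((ϖ : F)⁻¹ * rep ρ) : ℂ)
  map_zero_eq_one' := by
    rw [hψ.congr_red hϖ (y := 0) (v_rep _) (by simp) (by rw [red_rep, red_zero])]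
    simp
  map_add_eq_mul' ρ σ := by
    rw [hψ.congr_red hϖ (y := rep ρ + rep σ) (v_rep _) (v_add_le (v_rep _) (v_rep _))
      (by rw [red_rep, red_add (v_rep _) (v_rep _), red_rep, red_rep]), mul_add,
      AddChar.map_add_eq_mul, Circle.coe_mul]

lemma resAdd_red (hψ : Unramified ψ) (hϖ : val (ϖ : F) = 1) {x : F} (hx : v x ≤ 1) :
    resAdd hψ hϖ (red x) = (ψ ((ϖ : F)⁻¹ * x) : ℂ) := by
  show (ψ ((ϖ : F)⁻¹ * rep (red x)) : ℂ) = _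
  rw [hψ.congr_red hϖ (v_rep _) hx (red_rep _)]

lemma resAdd_primitive (hψ : Unramified ψ) (hϖ : val (ϖ : F) = 1) :
    (resAdd hψ hϖ).IsPrimitive := by
  apply AddChar.IsPrimitive.of_ne_one
  obtain ⟨y, hy, h⟩ := hψ.exists_ne hϖ
  intro h1
  apply h
  have := resAdd_red hψ hϖ hy
  rw [h1, AddChar.one_apply] at this
  exact Circle.coe_inj.1 (this.symm.trans Circle.coe_one.symm)

variable [MeasurableSpace F] [BorelSpace F] {μ : Measure F} [μ.IsAddHaarMeasure]

open Classical in
/-- A character of the residue field transported to the elements of valuation `-1`. -/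
def polar (χ : MulChar 𝓀[F] ℂ) (ϖ : Fˣ) (x : F) : ℂ := if v (ϖ * x) ≤ 1 then χ (red (ϖ * x)) else 0

lemma integral_polar (hμ : μ (𝒪[F] : Set F) = 1) (hψ : Unramified ψ) (hϖ : val (ϖ : F) = 1)
    (χ : MulChar 𝓀[F] ℂ) :
    ∫ x in (ball ϖ (-1) : Set F), polar χ ϖ x * (ψ x : ℂ) ∂μ = _root_.gaussSum χ (resAdd hψ hϖ) := by
  rw [integral_residues hϖ (inv_ne_zero ϖ.ne_zero) (by rw [val_inv, hϖ])
    (H := fun ρ => χ ρ * resAdd hψ hϖ ρ)]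
  · rw [show (-1 : ℤ) + 1 = 0 by norm_num, measure_ball_zero hμ, Complex.ofReal_one, one_mul]; rfl
  · intro r hr
    rw [polar, mul_inv_cancel_left₀ ϖ.ne_zero, if_pos hr, resAdd_red hψ hϖ hr]

lemma polar_inv_of_val (hϖ : val (ϖ : F) = 1) {x : F} (hx : val x = -1) :
    polar (resChar ι ϖ)⁻¹ ϖ x = (chi ι ϖ x)⁻¹ := by
  have hx0 := ne_zero_of_val (by norm_num) hx
  have hu : v (ϖ * x) = 1 := by
    rw [v_eq_one_iff (mul_ne_zero ϖ.ne_zero hx0), val_mul ϖ.ne_zero hx0, hx, hϖ]; norm_num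
  rw [polar, if_pos hu.le, resChar_inv_unit hu, chi_mul ϖ.ne_zero hx0, chi_unif, one_mul]

lemma polar_integral (χ : MulChar 𝓀[F] ℂ) (hϖ : val (ϖ : F) = 1) {x : F} (hx : v x ≤ 1) :
    polar χ ϖ x = 0 := by
  have h1 : v (ϖ * x) < 1 := v_mul_lt' (v_unif_lt hϖ) hx
  rw [polar, if_pos h1.le, (red_eq_zero h1.le).2 h1, MulChar.map_zero]

/-- By antisymmetry (ϖ, x) = χ(x)⁻¹, which depends only on the residue of ϖx because χ(ϖ) = 1.
Extending the domain to ϖ⁻¹𝒪 costs nothing, since a multiplicative character vanishes at 0. -/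
lemma gaussSum_eq (hμ : μ (𝒪[F] : Set F) = 1) (hψ : Unramified ψ) (hϖ : val (ϖ : F) = 1) :
    gaussSum μ ι ψ ϖ = _root_.gaussSum (resChar ι ϖ)⁻¹ (resAdd hψ hϖ) := by
  rw [← integral_polar hμ hψ hϖ, gaussSum]
  have hsub : {x : F | val x = -1} ⊆ (ball ϖ (-1) : Set F) := fun x hx => by
    rw [Set.mem_ofPred_eq] at hx
    exact (mem_ball_iff hϖ (ne_zero_of_val (by norm_num) hx)).2 hx.ge
  have hdiff : {x : F | val x = -1} = (ball ϖ (-1) : Set F) \ (ball ϖ 0 : Set F) := by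
    ext x
    rcases eq_or_ne x 0 with rfl | hx
    · simp [val]
    · simp only [Set.mem_ofPred_eq, Set.mem_sdiff, SetLike.mem_coe, mem_ball_iff hϖ hx]
      omega
  have hm : MeasurableSet {x : F | val x = -1} := by
    rw [hdiff]; exact (measurableSet_ball _).diff (measurableSet_ball _)
  rw [setIntegral_eq_of_subset_of_forall_sdiff_eq_zero (measurableSet_ball (-1)) hsub]
  · refine setIntegral_congr_fun hm fun x hx => ?_
    rw [Set.mem_ofPred_eq] at hx
    have hx0 := ne_zero_of_val (by norm_num) hx
    show toComplex ι (hs (ϖ : F) x).toMul * _ = _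
    rw [polar_inv_of_val hϖ hx, hs_antisymm ϖ.ne_zero hx0, toMul_neg, toComplex_inv]; rfl
  · intro x hx
    rw [hdiff] at hx
    have : v x ≤ 1 := by
      by_contra hcon
      exact hx.2 ⟨hx.1, fun h => hcon (mem_ball_zero.1 h)⟩
    rw [polar_integral _ hϖ this, zero_mul]

/-- Conjugation inverts both characters; the sign in the additive one is absorbed by χ(−1) = 1. -/
lemma conj_gaussSum (hμ : μ (𝒪[F] : Set F) = 1) (hψ : Unramified ψ) (hϖ : val (ϖ : F) = 1) :
    conj (gaussSum μ ι ψ ϖ) = _root_.gaussSum (resChar ι ϖ) (resAdd hψ hϖ) := by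
  have h1 : resChar ι ϖ (-1) = 1 := by
    have := resChar_unit (ι := ι) (ϖ := ϖ) (x := (-1 : F)) (by simp)
    rw [chi_neg one_ne_zero, chi_one] at this
    rw [← this]; congr 1
    have := red_sub (F := F) (x := 0) (y := 1) (by simp) (by simp)
    rw [red_zero, red_one] at this
    simpa using this.symm
  rw [gaussSum_eq hμ hψ hϖ]
  show star _ = _
  rw [star_gaussSum_eq, inv_inv, ← gaussSum_mulShift _ _ (-1 : 𝓀[F]ˣ), Units.val_neg, Units.val_one,
    h1, one_mul]
  congr 1
  ext x
  simp [AddChar.mulShift_apply, AddChar.inv_apply]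

lemma gaussSum_norm (hμ : μ (𝒪[F] : Set F) = 1) (hψ : Unramified ψ) (hϖ : val (ϖ : F) = 1) :
    conj (gaussSum μ ι ψ ϖ) * gaussSum μ ι ψ ϖ = resCard F := by
  have h2 : conj (conj (gaussSum μ ι ψ ϖ)) = gaussSum μ ι ψ ϖ := Complex.conj_conj _
  have h3 : gaussSum μ ι ψ ϖ = star (_root_.gaussSum (resChar ι ϖ) (resAdd hψ hϖ)) := by
    rw [← conj_gaussSum hμ hψ hϖ]; exact h2.symm
  rw [conj_gaussSum hμ hψ hϖ, h3, star_gaussSum_eq, gaussSum_mul_gaussSum_eq_card (resChar_ne_one hϖ) (resAdd_primitive hψ hϖ),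
    resCard_eq]

/-- χ has order three, so χ² = χ⁻¹ in the relation G(χ²) J(χ, χ) = G(χ)². -/
lemma gaussSum_jacobi (hμ : μ (𝒪[F] : Set F) = 1) (hψ : Unramified ψ) (hϖ : val (ϖ : F) = 1) :
    gaussSum μ ι ψ ϖ * jacobiSum (resChar ι ϖ) (resChar ι ϖ) = conj (gaussSum μ ι ψ ϖ) ^ 2 := by
  rw [conj_gaussSum hμ hψ hϖ, gaussSum_eq hμ hψ hϖ, resChar_inv, jacobiSum_mul_nontrivial, sq]
  rw [← resChar_inv]
  exact inv_ne_one.2 (resChar_ne_one hϖ)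

-- The substitution ρ ↦ ρ⁻¹, with 0 fixed, turns χ(1 − ρ⁻¹) χ⁻¹(ρ) into the summand of the Jacobi
-- sum.
open Classical in
lemma sum_jacobi (a b c : ℂ) : ∑ ρ : 𝓀[F], ((if ρ = 0 then a else 0) + (if ρ = 1 then b else 0) +
    c * (resChar ι ϖ (1 - ρ⁻¹) * (resChar ι ϖ)⁻¹ ρ)) =
      a + b + c * jacobiSum (resChar ι ϖ) (resChar ι ϖ) := by
  classical
  rw [Finset.sum_add_distrib, Finset.sum_add_distrib, Finset.sum_ite_eq', Finset.sum_ite_eq',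
    ← Finset.mul_sum]
  simp only [Finset.mem_univ, if_true, jacobiSum]
  congr 2
  refine Fintype.sum_bijective (fun ρ : 𝓀[F] => ρ⁻¹) inv_involutive.bijective _ _ fun ρ => ?_
  rw [MulChar.inv_apply', mul_comm]

end GaussSums

/-! ### The central integral and the reduction to ϖ⁻¹𝒪 -/

section Fubini

variable {F : Type*} [Field F] [ValuativeRel F] [TopologicalSpace F]
  [IsNonarchimedeanLocalField F] [TameCubic F]

local notation "v" => valuation F
local notation "SL" => Matrix.SpecialLinearGroup (Fin 3) F

variable {ι : rootsOfUnity 3 F ≃* rootsOfUnity 3 ℂ} {ϖ : Fˣ}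
  {d : Matrix.SpecialLinearGroup (Fin 3) F} {f : MetaSL3 F → ℂ} {ψ : AddChar F Circle}

lemma eventually_integral {X : Type*} [TopologicalSpace X] {g : X → F} (hg : Continuous g) {x₀ : X}
    (h : g x₀ = 0) : ∀ᶠ x in nhds x₀, v (g x) ≤ 1 := by
  have h1 : (ball (1 : Fˣ) 0 : Set F) ∈ nhds (g x₀) := by
    rw [h]; exact (isOpen_ball 0).mem_nhds (zero_mem _)
  filter_upwards [hg.continuousAt h1] with x hx
  exact mem_ball_zero.1 hx

lemma Unramified.continuous (hψ : Unramified ψ) : Continuous fun x : F => (ψ x : ℂ) := by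
  rw [continuous_iff_continuousAt]
  intro x₀
  refine (continuousAt_const (y := (ψ x₀ : ℂ))).congr ?_
  filter_upwards [eventually_integral (g := fun x : F => x₀ - x) (by fun_prop) (sub_self x₀)]
    with x hx
  rw [hψ.congr hx]

/-- Locally constant by left invariance under N(𝒪); the term (x − x₀)y₀ is the noncommutative
correction in the last coordinate. -/
lemma continuous_phi (h : HeckeFun ι d f) (D : SL) : Continuous (phi f D) := by
  rw [continuous_iff_continuousAt]
  rintro ⟨x₀, y₀, z₀⟩
  refine (continuousAt_const (y := phi f D (x₀, y₀, z₀))).congr ?_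
  filter_upwards [eventually_integral (X := F × F × F) (g := fun p => p.1 - x₀) (x₀ := (x₀, y₀, z₀))
      (by fun_prop) (by simp),
    eventually_integral (X := F × F × F) (g := fun p => p.2.1 - y₀) (x₀ := (x₀, y₀, z₀))
      (by fun_prop) (by simp),
    eventually_integral (X := F × F × F) (g := fun p => p.2.2 - z₀ - (p.1 - x₀) * y₀)
      (x₀ := (x₀, y₀, z₀)) (by fun_prop) (by simp)]
  rintro ⟨x, y, z⟩ hx hy hz
  have := phi_translate h D hx hy hz x₀ y₀ z₀
  rw [← this]
  congr 2
  · simp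
  · ext <;> simp <;> ring

/-- Elements of the double coset have entries in ϖ^a 𝒪, and the coordinates of u are read off the
columns of uD. Compact support follows. -/
lemma phi_support {a b e₀ e₁ : ℤ} (h : Admissible ι ϖ f a b e₀ e₁) {x y z : F}
    (hne : phi f (pT ϖ e₀ e₁) (x, y, z) ≠ 0) :
    x ∈ ball ϖ (a - e₁) ∧ y ∈ ball ϖ (a + e₀ + e₁) ∧ z ∈ ball ϖ (a + e₀ + e₁) := by
  obtain ⟨ζ, k₁, k₂, i₁, i₂, e⟩ := h.hecke.supp _ hne
  have e1 : uSL (x, y, z) * pT ϖ e₀ e₁ = k₁ * pT ϖ a b * k₂ := by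
    have := congrArg MetaSL3.mat e
    simpa [central, lift, sec] using this
  have H := v_mul_entries_le' i₂ (v_mul_entries_le i₁ (v_pT_le h.unif h.le₁ h.le₂))
  rw [← e1] at H
  have key : ∀ (t : F) (l : ℤ), v (t * (ϖ : F) ^ l) ≤ v ((ϖ : F) ^ a) → t ∈ ball ϖ (a - l) := by
    intro t l ht
    have h1 : t * (ϖ : F) ^ l ∈ ball ϖ a := ht
    have h2 : (ϖ : F) ^ (-l) ∈ ball ϖ (-l) := mem_ball.2 le_rfl
    have := mul_mem_ball h.unif h1 h2
    rwa [mul_assoc, ← zpow_add₀ ϖ.ne_zero, add_neg_cancel, zpow_zero, mul_one,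
      ← sub_eq_add_neg] at this
  have h01 := H 0 1
  have h12 := H 1 2
  have h02 := H 0 2
  rw [coe_sl_mul, coe_uSL, coe_pT] at h01 h12 h02
  simp only [Matrix.mul_apply, Fin.sum_univ_three] at h01 h12 h02
  simp at h01 h12 h02
  refine ⟨key _ _ (by simpa using h01), ?_, ?_⟩
  · have := key y (-e₀ - e₁) (by simpa using h12)
    rwa [show a - (-e₀ - e₁) = a + e₀ + e₁ by ring] at this
  · have := key z (-e₀ - e₁) (by simpa using h02)
    rwa [show a - (-e₀ - e₁) = a + e₀ + e₁ by ring] at this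

variable [MeasurableSpace F] [BorelSpace F] {μ : Measure F} [μ.IsAddHaarMeasure]

section Slices

variable {a b e₀ e₁ : ℤ}

lemma continuous_integrand (h : HeckeFun ι d f) (hψ : Unramified ψ) (D : SL) :
    Continuous fun p : F × F × F => phi f D p * (ψ (p.1 + p.2.1) : ℂ) :=
  (continuous_phi h D).mul (hψ.continuous.comp (by fun_prop))

lemma integrable_integrand (h : Admissible ι ϖ f a b e₀ e₁) (hψ : Unramified ψ) :
    Integrable (fun p : F × F × F => phi f (pT ϖ e₀ e₁) p * (ψ (p.1 + p.2.1) : ℂ))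
      (μ.prod (μ.prod μ)) := by
  refine (continuous_integrand h.hecke hψ _).integrable_of_hasCompactSupport ?_
  refine HasCompactSupport.intro ((isCompact_ball (ϖ := ϖ) (a - e₁)).prod
    ((isCompact_ball (ϖ := ϖ) (a + e₀ + e₁)).prod (isCompact_ball (ϖ := ϖ) (a + e₀ + e₁)))) ?_
  rintro ⟨x, y, z⟩ hp
  by_contra hne
  obtain ⟨hx, hy, hz⟩ := phi_support h (left_ne_zero_of_mul hne)
  exact hp ⟨hx, hy, hz⟩

lemma integrable_slice (h : Admissible ι ϖ f a b e₀ e₁) (hψ : Unramified ψ) (x : F) :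
    Integrable (fun p : F × F => phi f (pT ϖ e₀ e₁) (x, p) * (ψ (x + p.1) : ℂ)) (μ.prod μ) := by
  refine Continuous.integrable_of_hasCompactSupport ?_ ?_
  · exact (continuous_integrand h.hecke hψ (pT ϖ e₀ e₁)).comp
      (f := fun p : F × F => ((x, p) : F × F × F)) (by fun_prop)
  · refine HasCompactSupport.intro ((isCompact_ball (ϖ := ϖ) (a + e₀ + e₁)).prod
      (isCompact_ball (ϖ := ϖ) (a + e₀ + e₁))) ?_
    rintro ⟨y, z⟩ hp
    by_contra hne
    obtain ⟨hx, hy, hz⟩ := phi_support h (left_ne_zero_of_mul hne)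
    exact hp ⟨hy, hz⟩

lemma integrable_line (h : Admissible ι ϖ f a b e₀ e₁) (x y : F) :
    Integrable (fun z : F => phi f (pT ϖ e₀ e₁) (x, y, z)) μ := by
  refine Continuous.integrable_of_hasCompactSupport ?_ ?_
  · exact (continuous_phi h.hecke (pT ϖ e₀ e₁)).comp
      (f := fun z : F => ((x, y, z) : F × F × F)) (by fun_prop)
  · refine HasCompactSupport.intro (isCompact_ball (ϖ := ϖ) (a + e₀ + e₁)) ?_
    intro z hp
    by_contra hne
    obtain ⟨hx, hy, hz⟩ := phi_support h hne
    exact hp hz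

/-- The integral of a Hecke function over the centre of `N`. -/
def centralIntegral (μ : Measure F) (f : MetaSL3 F → ℂ) (D : SL) (x y : F) : ℂ :=
  ∫ z, phi f D (x, y, z) ∂μ

lemma centralIntegral_translate (h : HeckeFun ι d f) (D : SL) {a b : F} (ha : v a ≤ 1)
    (hb : v b ≤ 1) (x y : F) :
    centralIntegral μ f D (a + x) (b + y) = centralIntegral μ f D x y := by
  unfold centralIntegral
  rw [← integral_add_right_eq_self (fun z => phi f D (a + x, b + y, z)) (a * y)]
  congr 1
  funext z
  have := phi_translate h D ha hb (c := 0) (by simp) x y z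
  rw [zero_add] at this
  exact this

lemma torusSymbol_one_units (hϖ : val (ϖ : F) = 1) {s t : Fˣ} (hs : v ((s : F) - 1) < 1)
    (ht : v ((t : F) - 1) < 1) (e : ℤ) :
    toComplex ι (torusSymbol ϖ s t e).toMul = 1 := by
  have h1 : ∀ s : Fˣ, v ((s : F) - 1) < 1 → CubicCover.hs (s : F) ϖ = 0 := fun s hs => by
    rw [hs_antisymm s.ne_zero ϖ.ne_zero, hs_one_unit_right ϖ.ne_zero hs, neg_zero]
  rw [torusSymbol, h1 s hs, h1 t ht, sub_zero, smul_zero, toMul_zero, toComplex_one]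

lemma one_unit {s : F} (hs : v (s - 1) < 1) : v s = 1 :=
  v_unit_of_cong (x := 1) (by simp) (by rwa [Valuation.map_sub_swap])

/-- The torus parameters (s², s⁻¹) act by s³ on the root 12 and trivially on the root 23. A 1-unit
carries no symbol, and the rescaling of z preserves the measure. -/
lemma centralIntegral_scale_x (h : HeckeFun ι d f) (hϖ : val (ϖ : F) = 1)
    (hμ : μ (𝒪[F] : Set F) = 1) {s : F} (hs : v (s - 1) < 1) (x y : F) :
    centralIntegral μ f (pT ϖ e₀ e₁) (s ^ 3 * x) y = centralIntegral μ f (pT ϖ e₀ e₁) x y := by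
  have hu := one_unit hs
  have h0 := ne_zero_of_v hu
  have hs2 : v (s ^ 2 - 1) < 1 := by
    rw [show s ^ 2 - 1 = (s + 1) * (s - 1) by ring]
    exact v_mul_lt (v_add_le hu.le (by simp)) hs
  have hsi : v (s⁻¹ - 1) < 1 := by
    rw [show s⁻¹ - 1 = -(s - 1) / s by field_simp; ring, map_div₀, hu, div_one, Valuation.map_neg]
    exact hs
  unfold centralIntegral
  rw [← integral_unit_smul hμ (s := s ^ 3) (by rw [map_pow, hu, one_pow])]
  congr 1
  funext z
  have := phi_torus (ϖ := ϖ) h e₀ e₁ (s := Units.mk0 (s ^ 2) (pow_ne_zero _ h0))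
    (t := Units.mk0 s⁻¹ (inv_ne_zero h0)) (by simp [hu]) (by simp [hu]) (x, y, z)
  rw [torusSymbol_one_units hϖ hs2 hsi, one_mul] at this
  rw [← this]
  simp only [scale, Units.val_mk0]
  congr 2
  · field_simp
  · congr 1 <;> field_simp

lemma centralIntegral_scale_y (h : HeckeFun ι d f) (hϖ : val (ϖ : F) = 1)
    (hμ : μ (𝒪[F] : Set F) = 1) {s : F} (hs : v (s - 1) < 1) (x y : F) :
    centralIntegral μ f (pT ϖ e₀ e₁) x (s ^ 3 * y) = centralIntegral μ f (pT ϖ e₀ e₁) x y := by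
  have hu := one_unit hs
  have h0 := ne_zero_of_v hu
  unfold centralIntegral
  rw [← integral_unit_smul hμ (s := s ^ 3) (by rw [map_pow, hu, one_pow])]
  congr 1
  funext z
  have := phi_torus (ϖ := ϖ) h e₀ e₁ (s := Units.mk0 s h0)
    (t := Units.mk0 s h0) (by simp [hu]) (by simp [hu]) (x, y, z)
  rw [torusSymbol_one_units hϖ hs hs, one_mul] at this
  rw [← this]
  simp only [scale, Units.val_mk0]
  congr 2
  · field_simp
  · congr 1 <;> field_simp

/-- Elements of `ϖ⁻¹𝒪` are added to elements of valuation at most `-2` by multiplication with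
cubes of `1`-units, up to integers. -/
lemma exists_one_unit (hϖ : val (ϖ : F) = 1) {x δ : F} (hx : x ∉ ball ϖ (-1))
    (hδ : δ ∈ ball ϖ (-1)) :
    ∃ s u : F, v (s - 1) < 1 ∧ v u ≤ 1 ∧ s ^ 3 * x = u + (x + δ) := by
  have hx0 : x ≠ 0 := by rintro rfl; exact hx (zero_mem _)
  have hxi : x⁻¹ ∈ ball ϖ 2 := by
    rw [mem_ball_iff hϖ hx0] at hx
    rw [mem_ball_iff hϖ (inv_ne_zero hx0), val_inv]
    omega
  have v3 := TameCubic.three (F := F)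
  have h3 : (3 : F) ≠ 0 := ne_zero_of_v v3
  have h3i : v (3 : F)⁻¹ ≤ 1 := by simp [v3]
  have h1 : δ * x⁻¹ ∈ ball ϖ 1 := mul_mem_ball hϖ hδ hxi
  have h2 : v (δ * (δ * x⁻¹)) ≤ 1 := by
    rw [← mem_ball_zero (ϖ := ϖ)]; exact mul_mem_ball hϖ hδ h1
  have h1' : v (δ * x⁻¹) < 1 := by
    refine lt_of_le_of_lt (mem_ball.1 h1) ?_
    rw [zpow_one]; exact v_unif_lt hϖ
  -- The first-order cube root of 1 + δ/x. The error u = δ²/(3x) + δ³/(27x²) is integral since x⁻¹ ∈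
  -- ϖ²𝒪.
  refine ⟨1 + 3⁻¹ * (δ * x⁻¹), 3⁻¹ * (δ * (δ * x⁻¹)) +
    3⁻¹ * (3⁻¹ * (3⁻¹ * ((δ * (δ * x⁻¹)) * (δ * x⁻¹)))), ?_, ?_, ?_⟩
  · rw [add_sub_cancel_left]; exact v_mul_lt h3i h1'
  · exact v_add_le (v_mul_le h3i h2)
      (v_mul_le h3i (v_mul_le h3i (v_mul_le h3i (v_mul_le h2 h1'.le))))
  · field_simp; ring

lemma centralIntegral_add_x (h : HeckeFun ι d f) (hϖ : val (ϖ : F) = 1)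
    (hμ : μ (𝒪[F] : Set F) = 1) {x δ : F} (hx : x ∉ ball ϖ (-1)) (hδ : δ ∈ ball ϖ (-1)) (y : F) :
    centralIntegral μ f (pT ϖ e₀ e₁) (x + δ) y = centralIntegral μ f (pT ϖ e₀ e₁) x y := by
  obtain ⟨s, u, hs, hu, e⟩ := exists_one_unit hϖ hx hδ
  rw [← centralIntegral_scale_x h hϖ hμ hs x, e]
  have := centralIntegral_translate (μ := μ) h (pT ϖ e₀ e₁) hu (b := 0) (by simp) (x + δ) y
  rw [zero_add] at this
  exact this.symm

lemma centralIntegral_add_y (h : HeckeFun ι d f) (hϖ : val (ϖ : F) = 1)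
    (hμ : μ (𝒪[F] : Set F) = 1) {y δ : F} (hy : y ∉ ball ϖ (-1)) (hδ : δ ∈ ball ϖ (-1)) (x : F) :
    centralIntegral μ f (pT ϖ e₀ e₁) x (y + δ) = centralIntegral μ f (pT ϖ e₀ e₁) x y := by
  obtain ⟨s, u, hs, hu, e⟩ := exists_one_unit hϖ hy hδ
  rw [← centralIntegral_scale_y h hϖ hμ hs x y, e]
  have := centralIntegral_translate (μ := μ) h (pT ϖ e₀ e₁) (a := 0) (by simp) hu x (y + δ)
  rw [zero_add] at this
  exact this.symm

omit [TameCubic F] in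
lemma setIntegral_eq_zero_of_translate {S : Set F} (hS : MeasurableSet S) {L : F → ℂ} {δ : F} {c : ℂ}
    (hc : c ≠ 1) (hδ : ∀ x, x + δ ∈ S ↔ x ∈ S) (hL : ∀ x ∈ S, L (x + δ) = c * L x) :
    ∫ x in S, L x ∂μ = 0 := by
  have h1 : ∫ x in S, L x ∂μ = c * ∫ x in S, L x ∂μ := by
    rw [← integral_indicator hS]
    nth_rewrite 1 [← integral_add_right_eq_self _ δ]
    rw [← integral_const_mul]
    congr 1
    funext x
    by_cases hx : x ∈ S
    · rw [Set.indicator_of_mem hx, Set.indicator_of_mem ((hδ x).2 hx), hL x hx]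
    · rw [Set.indicator_of_notMem hx, Set.indicator_of_notMem (mt (hδ x).1 hx), mul_zero]
  have h2 : (1 - c) * ∫ x in S, L x ∂μ = 0 := by linear_combination h1
  exact (mul_eq_zero.1 h2).resolve_left (sub_ne_zero.2 hc.symm)

/-- The complement of ϖ⁻¹𝒪 is stable under translation by ϖ⁻¹𝒪, on which ψ is not trivial as its
conductor is 𝒪. -/
lemma integral_outside (hψ : Unramified ψ) (hϖ : val (ϖ : F) = 1) {L : F → ℂ}
    (hL : ∀ x ∉ ball ϖ (-1), ∀ δ ∈ ball ϖ (-1), L (x + δ) = (ψ δ : ℂ) * L x) :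
    ∫ x in (ball ϖ (-1) : Set F)ᶜ, L x ∂μ = 0 := by
  obtain ⟨y, hy, hne⟩ := hψ.exists_ne hϖ
  have hδ : (ϖ : F)⁻¹ * y ∈ ball ϖ (-1) := by
    have h1 : (ϖ : F)⁻¹ ∈ ball ϖ (-1) := by rw [mem_ball, zpow_neg_one]
    have := mul_mem_ball hϖ h1 (mem_ball_zero.2 hy)
    simpa using this
  refine setIntegral_eq_zero_of_translate (measurableSet_ball (-1)).compl
    (δ := (ϖ : F)⁻¹ * y) (c := (ψ ((ϖ : F)⁻¹ * y) : ℂ)) ?_ ?_ ?_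
  · exact fun h => hne (Circle.coe_inj.1 (h.trans Circle.coe_one.symm))
  · intro x
    rw [Set.mem_compl_iff, Set.mem_compl_iff, not_iff_not]
    exact (ball ϖ (-1)).add_mem_cancel_right hδ
  · intro x hx
    exact hL x hx _ hδ

/-- The Whittaker integral is an iterated integral over `ϖ⁻¹𝒪`. -/
lemma whittaker_eq_iterated (h : Admissible ι ϖ f a b e₀ e₁) (hψ : Unramified ψ)
    (hμ : μ (𝒪[F] : Set F) = 1) :
    ∫ p, phi f (pT ϖ e₀ e₁) p * (ψ (p.1 + p.2.1) : ℂ) ∂(μ.prod (μ.prod μ)) =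
      ∫ x in (ball ϖ (-1) : Set F), ∫ y in (ball ϖ (-1) : Set F),
        centralIntegral μ f (pT ϖ e₀ e₁) x y * ((ψ x : ℂ) * (ψ y : ℂ)) ∂μ ∂μ := by
  have hϖ := h.unif
  have hI := integrable_integrand (μ := μ) h hψ
  have e1 : ∀ x, ∫ p, phi f (pT ϖ e₀ e₁) (x, p) * (ψ (x + p.1) : ℂ) ∂(μ.prod μ) =
      ∫ y, centralIntegral μ f (pT ϖ e₀ e₁) x y * ((ψ x : ℂ) * (ψ y : ℂ)) ∂μ := by
    intro x
    rw [integral_prod _ (integrable_slice h hψ x)]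
    congr 1
    funext y
    simp only [AddChar.map_add_eq_mul, Circle.coe_mul]
    rw [integral_mul_const]; rfl
  have e2 : ∀ x, ∫ y, centralIntegral μ f (pT ϖ e₀ e₁) x y * ((ψ x : ℂ) * (ψ y : ℂ)) ∂μ =
      ∫ y in (ball ϖ (-1) : Set F),
        centralIntegral μ f (pT ϖ e₀ e₁) x y * ((ψ x : ℂ) * (ψ y : ℂ)) ∂μ := by
    intro x
    have hIx : Integrable (fun y => centralIntegral μ f (pT ϖ e₀ e₁) x y *
        ((ψ x : ℂ) * (ψ y : ℂ))) μ := by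
      refine (integrable_slice (μ := μ) h hψ x).integral_prod_left.congr ?_
      refine Filter.Eventually.of_forall fun y => ?_
      simp only [AddChar.map_add_eq_mul, Circle.coe_mul]
      rw [integral_mul_const]; rfl
    rw [← integral_add_compl (measurableSet_ball (-1)) hIx, integral_outside hψ hϖ, add_zero]
    intro y hy δ hδ
    rw [centralIntegral_add_y h.hecke hϖ hμ hy hδ, AddChar.map_add_eq_mul, Circle.coe_mul]
    ring
  rw [integral_prod _ hI]
  have hIx := hI.integral_prod_left
  simp only [e1] at hIx ⊢
  rw [← integral_add_compl (measurableSet_ball (-1)) hIx, integral_outside hψ hϖ, add_zero]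
  · simp only [e2]
  · intro x hx δ hδ
    rw [← integral_const_mul]
    congr 1
    funext y
    rw [centralIntegral_add_x h.hecke hϖ hμ hx hδ, AddChar.map_add_eq_mul, Circle.coe_mul]
    ring

end Slices

end Fubini

/-! ### The central integral on ϖ⁻¹𝒪 × ϖ⁻¹𝒪 -/

section Formula

variable {F : Type*} [Field F] [ValuativeRel F] [TopologicalSpace F]
  [IsNonarchimedeanLocalField F] [TameCubic F]

local notation "v" => valuation F
local notation "SL" => Matrix.SpecialLinearGroup (Fin 3) F

variable {ι : rootsOfUnity 3 F ≃* rootsOfUnity 3 ℂ} {ϖ : Fˣ}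
  {f : MetaSL3 F → ℂ} {ψ : AddChar F Circle} {a b e₀ e₁ : ℤ}

variable [MeasurableSpace F] [BorelSpace F] {μ : Measure F} [μ.IsAddHaarMeasure]

lemma v_le_of_ball (hϖ : val (ϖ : F) = 1) {x z : F} {k : ℤ} (hx : val x = k) (hk : k ≠ 0)
    (hz : z ∉ ball ϖ (k + 1)) : v x ≤ v z := by
  have hx0 := ne_zero_of_val hk hx
  have hz0 : z ≠ 0 := by rintro rfl; exact hz (zero_mem _)
  rw [mem_ball_iff hϖ hz0] at hz
  rw [v_le_iff hx0 hz0]; omega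

/-- The integral of a Hecke function over the central elements outside `𝒪`. -/
def tailIntegral (μ : Measure F) (ϖ : Fˣ) (f : MetaSL3 F → ℂ)
    (D : Matrix.SpecialLinearGroup (Fin 3) F) : ℂ :=
  ∫ z in (ball ϖ 0 : Set F)ᶜ, phi f D (0, 0, z) ∂μ

/-- On z ∈ 𝒪 the function is constant by left invariance. The part outside 𝒪 is the same for all
such (x, y), hence invisible to ψ later. -/
lemma centralIntegral_split (h : Admissible ι ϖ f a b e₀ e₁) (hμ : μ (𝒪[F] : Set F) = 1) {x y : F}
    (hxy : ∀ z ∉ ball ϖ 0, phi f (pT ϖ e₀ e₁) (x, y, z) = phi f (pT ϖ e₀ e₁) (0, 0, z)) :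
    centralIntegral μ f (pT ϖ e₀ e₁) x y =
      tailIntegral μ ϖ f (pT ϖ e₀ e₁) + phi f (pT ϖ e₀ e₁) (x, y, 0) := by
  rw [centralIntegral, ← integral_add_compl (measurableSet_ball (ϖ := ϖ) 0) (integrable_line h x y),
    add_comm, tailIntegral]
  congr 1
  · exact setIntegral_congr_fun (measurableSet_ball 0).compl fun z hz => hxy z hz
  · have : ∀ z ∈ (ball ϖ 0 : Set F), phi f (pT ϖ e₀ e₁) (x, y, z) =
        phi f (pT ϖ e₀ e₁) (x, y, 0) := by
      intro z hz
      have := phi_translate h.hecke (pT ϖ e₀ e₁) (a := 0) (b := 0) (by simp) (by simp)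
        (mem_ball_zero.1 hz) x y 0
      simpa using this
    rw [setIntegral_congr_fun (measurableSet_ball 0) this, setIntegral_const, measure_ball_zero hμ,
      one_smul]

lemma not_mem_ball_ne_zero {z : F} {k : ℤ} (hz : z ∉ ball ϖ k) : z ≠ 0 := by
  rintro rfl; exact hz (zero_mem _)

lemma centralIntegral_zero (h : Admissible ι ϖ f a b e₀ e₁) (hμ : μ (𝒪[F] : Set F) = 1) :
    centralIntegral μ f (pT ϖ e₀ e₁) 0 0 =
      tailIntegral μ ϖ f (pT ϖ e₀ e₁) + f (sec (pT ϖ e₀ e₁)) := by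
  rw [centralIntegral_split h hμ fun _ _ => rfl]
  congr 1
  have : uSL ((0, 0, 0) : F × F × F) = 1 := by
    refine sl_ext fun i j => ?_
    rw [coe_uSL, coe_sl_one]
    fin_cases i <;> fin_cases j <;> simp
  rw [phi, this, sec_one, one_mul]

lemma centralIntegral_x (h : Admissible ι ϖ f a b e₀ e₁) (hμ : μ (𝒪[F] : Set F) = 1) {x : F}
    (hx : val x = -1) : centralIntegral μ f (pT ϖ e₀ e₁) x 0 =
      tailIntegral μ ϖ f (pT ϖ e₀ e₁) + chi ι ϖ x * f (sec (pT ϖ (e₁ - 1) (e₀ + 1))) := by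
  rw [centralIntegral_split h hμ, h.phi_x hx]
  intro z hz
  exact phi_x_z h.hecke h.unif h.dom₂ (not_mem_ball_ne_zero hz)
    (v_le_of_ball h.unif hx (by norm_num) (by simpa using hz))

lemma centralIntegral_y (h : Admissible ι ϖ f a b e₀ e₁) (hμ : μ (𝒪[F] : Set F) = 1) {y : F}
    (hy : val y = -1) : centralIntegral μ f (pT ϖ e₀ e₁) 0 y =
      tailIntegral μ ϖ f (pT ϖ e₀ e₁) + chi ι ϖ y * f (sec (pT ϖ e₀ (-e₀ - e₁ - 1))) := by
  rw [centralIntegral_split h hμ, h.phi_y hy]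
  intro z hz
  exact phi_y_z h.hecke h.unif h.dom₁ (not_mem_ball_ne_zero hz)
    (v_le_of_ball h.unif hy (by norm_num) (by simpa using hz))

/-- The central elements of valuation `-1` and `-2` do not contribute. -/
lemma shell_integral (h : Admissible ι ϖ f a b e₀ e₁) (hμ : μ (𝒪[F] : Set F) = 1) :
    ∫ z in (ball ϖ (-2) : Set F) \ (ball ϖ 0 : Set F), phi f (pT ϖ e₀ e₁) (0, 0, z) ∂μ = 0 := by
  have hϖ := h.unif
  set S := (ball ϖ (-2) : Set F) \ (ball ϖ 0 : Set F) with hS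
  have hm : MeasurableSet S := (measurableSet_ball _).diff (measurableSet_ball _)
  have hval : ∀ z ∈ S, z ≠ 0 ∧ (val z = -1 ∨ val z = -2) := by
    intro z hz
    have h0 := not_mem_ball_ne_zero hz.2
    have h1 := (mem_ball_iff hϖ h0).1 hz.1
    have h2 := mt (mem_ball_iff hϖ h0).2 hz.2
    exact ⟨h0, by omega⟩
  -- If 3 divides e₀ − e₁, nonvanishing at valuation −1 or −2 would force 3 ∣ 1 or 3 ∣ 2. Otherwise
  -- scaling z by a unit s with χ(s) ≠ 1 multiplies the integral by a nontrivial root of unity.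
  by_cases hd : 3 ∣ e₀ - e₁
  · rw [setIntegral_congr_fun (g := fun _ => (0 : ℂ)) hm, integral_zero]
    intro z hz
    by_contra hne
    obtain ⟨h0, h1 | h1⟩ := hval z hz
    · have := h.corner_dvd (k := 1) (by norm_num) h0 h1 hne
      omega
    · have := h.corner_dvd (k := 2) (by norm_num) h0 h1 hne
      omega
  · obtain ⟨s, hs, hne⟩ := exists_chi_ne_one (ι := ι) hϖ
    have hs0 := ne_zero_of_v hs
    have hc : chi ι ϖ s ^ (e₁ - e₀) ≠ 1 := by
      have h3 : (e₁ - e₀) % 3 = 1 ∨ (e₁ - e₀) % 3 = 2 := by omega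
      rcases h3 with h3 | h3
      · rw [chi_zpow_congr s (l := 1) (by omega), zpow_one]; exact hne
      · rw [chi_zpow_congr s (l := -1) (by omega), zpow_neg_one]; exact inv_ne_one.2 hne
    have hmem : ∀ z, s * z ∈ S ↔ z ∈ S := by
      have key : ∀ (k : ℤ) z, s * z ∈ ball ϖ k ↔ z ∈ ball ϖ k := fun k z => by
        rw [mem_ball, mem_ball, map_mul, hs, one_mul]
      intro z
      rw [hS, Set.mem_sdiff, Set.mem_sdiff, SetLike.mem_coe, SetLike.mem_coe, key, key]; rfl
    have h1 : ∫ z in S, phi f (pT ϖ e₀ e₁) (0, 0, z) ∂μ = chi ι ϖ s ^ (e₁ - e₀) *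
        ∫ z in S, phi f (pT ϖ e₀ e₁) (0, 0, z) ∂μ := by
      rw [← integral_indicator hm]
      nth_rewrite 1 [← integral_unit_smul hμ hs]
      rw [← integral_const_mul]
      congr 1
      funext z
      by_cases hz : z ∈ S
      · rw [Set.indicator_of_mem hz, Set.indicator_of_mem ((hmem z).2 hz),
          phi_scale_z h.hecke e₀ e₁ hs]
      · rw [Set.indicator_of_notMem hz, Set.indicator_of_notMem (mt (hmem z).1 hz), mul_zero]
    have h2 : (1 - chi ι ϖ s ^ (e₁ - e₀)) * ∫ z in S, phi f (pT ϖ e₀ e₁) (0, 0, z) ∂μ = 0 := by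
      linear_combination h1
    exact (mul_eq_zero.1 h2).resolve_left (sub_ne_zero.2 hc.symm)

/-- Allows the cut to be moved from 𝒪 to ϖ⁻²𝒪, so that the same constant appears when x and y both
have valuation −1. -/
lemma tailIntegral_eq (h : Admissible ι ϖ f a b e₀ e₁) (hμ : μ (𝒪[F] : Set F) = 1) :
    tailIntegral μ ϖ f (pT ϖ e₀ e₁) =
      ∫ z in (ball ϖ (-2) : Set F)ᶜ, phi f (pT ϖ e₀ e₁) (0, 0, z) ∂μ := by
  have hu : (ball ϖ 0 : Set F)ᶜ =
      ((ball ϖ (-2) : Set F) \ (ball ϖ 0 : Set F)) ∪ (ball ϖ (-2) : Set F)ᶜ := by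
    ext z
    have := @ball_mono F _ _ _ _ _ ϖ h.unif 0 (-2) (by norm_num) z
    simp only [Set.mem_compl_iff, Set.mem_union, Set.mem_sdiff, SetLike.mem_coe]
    tauto
  have hI := integrable_line (μ := μ) h 0 0
  rw [tailIntegral, hu, setIntegral_union _ (measurableSet_ball _).compl hI.integrableOn
    hI.integrableOn, shell_integral h hμ, zero_add]
  rw [Set.disjoint_left]
  exact fun z hz hz' => hz' hz.1

open Classical in
lemma centralIntegral_xy (h : Admissible ι ϖ f a b e₀ e₁) (hμ : μ (𝒪[F] : Set F) = 1) {x y : F}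
    (hx : val x = -1) (hy : val y = -1) : centralIntegral μ f (pT ϖ e₀ e₁) x y =
      tailIntegral μ ϖ f (pT ϖ e₀ e₁) + resCard F *
        (chi ι ϖ y * (chi ι ϖ x)⁻¹ * f (sec (pT ϖ (e₁ - 1) (-e₀ - e₁ - 1))) +
          chi ι ϖ x * (chi ι ϖ y)⁻¹ * f (sec (pT ϖ (-e₀ - e₁ - 2) (e₀ + 1))) +
          (chi ι ϖ x)⁻¹ * (chi ι ϖ y)⁻¹ * f (sec (pT ϖ (-e₀ - e₁ - 2) e₁)) *
            jacobiSum (resChar ι ϖ) (resChar ι ϖ)) := by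
  have hϖ := h.unif
  have hw := ϖ.ne_zero
  have hx0 := ne_zero_of_val (by norm_num) hx
  have hy0 := ne_zero_of_val (by norm_num) hy
  have hc0 := mul_ne_zero hx0 hy0
  have hc : val (x * y) = -2 := by rw [val_mul hx0 hy0, hx, hy]; norm_num
  have hy1 : v (ϖ * y) ≤ 1 := by
    rw [v_le_one_iff (mul_ne_zero hw hy0), val_mul hw hy0, hϖ, hy]; norm_num
  have hlt : ∀ {t z : F}, val t = -1 → z ≠ 0 → val z ≤ -2 → v t < v z := fun ht hz0 hz => by
    rw [v_lt_iff (ne_zero_of_val (by norm_num) ht) hz0, ht]; omega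
  rw [centralIntegral, ← integral_add_compl (measurableSet_ball (ϖ := ϖ) (-2))
    (integrable_line h x y), add_comm, tailIntegral_eq h hμ]
  congr 1
  · refine setIntegral_congr_fun (measurableSet_ball _).compl fun z hz => ?_
    have hz0 := not_mem_ball_ne_zero hz
    have hvz := mt (mem_ball_iff hϖ hz0).2 hz
    -- Beyond ϖ⁻²𝒪 the quotient xy/z lies in 𝔭, so `phi_generic` gives exactly the value at (0, 0,
    -- z).
    have hw1 : v (1 - x * y / z - 1) < 1 := by
      rw [show 1 - x * y / z - 1 = -(x * y / z) by ring, Valuation.map_neg,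
        v_lt_one_iff (div_ne_zero hc0 hz0), val_div hc0 hz0, hc]
      omega
    show phi f _ (x, y, z) = _
    rw [phi_generic h.hecke hϖ h.dom₁ h.dom₂ hz0 hy1 (hlt hx hz0 (by omega))
      (hlt hy hz0 (by omega)).le (one_unit hw1), chi_one_unit hw1, one_mul]
  -- With z = xyr, the value depends on the residue of r: 0 is the region of small z, 1 the region
  -- near xy, and every other class is generic. Each class has volume q.
  · rw [integral_residues hϖ hc0 hc (H := fun ρ =>
      (if ρ = 0 then chi ι ϖ y * (chi ι ϖ x)⁻¹ * f (sec (pT ϖ (e₁ - 1) (-e₀ - e₁ - 1))) else 0) +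
      (if ρ = 1 then chi ι ϖ x * (chi ι ϖ y)⁻¹ * f (sec (pT ϖ (-e₀ - e₁ - 2) (e₀ + 1))) else 0) +
      (chi ι ϖ x)⁻¹ * (chi ι ϖ y)⁻¹ * f (sec (pT ϖ (-e₀ - e₁ - 2) e₁)) *
        (resChar ι ϖ (1 - ρ⁻¹) * (resChar ι ϖ)⁻¹ ρ)), sum_jacobi, show (-2 : ℤ) + 1 = -1 by norm_num,
      measure_ball_neg_one hϖ hμ]
    · push_cast; rfl
    · intro r hr
      by_cases hr1 : v r < 1
      · have hr0 := (red_eq_zero hr).2 hr1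
        have hz : x * y * r ∈ ball ϖ (-1) := by
          have := div_mem_lt (x := x * y * r) hϖ hc0 hc
          rw [mul_div_cancel_left₀ r hc0] at this
          simpa using this.1 hr1
        have hvy : v y = v ((ϖ : F) ^ (-1 : ℤ)) := by
          rw [v_eq_iff hy0 (zpow_ne_zero _ hw), val_pow_unif hϖ, hy]
        rw [h.phi_small_z hx hy (by rw [hvy]; exact hz), hr0]
        simp [MulChar.map_zero]
      · have hu := v_eq_one_of_not_lt hr hr1
        have hr0 := ne_zero_of_v hu
        have hred0 : red r ≠ 0 := by rw [ne_eq, red_eq_zero hr]; exact hr1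
        by_cases hr2 : red r = 1
        · have h3 : v (r - 1) < 1 := by
            rw [cong_iff_red hr (by simp), hr2, red_one]
          have hz : x * y * r - x * y ∈ ball ϖ (-1) := by
            have := div_mem_lt (x := x * y * r - x * y) hϖ hc0 hc
            rw [show (x * y * r - x * y) / (x * y) = r - 1 by field_simp] at this
            simpa using this.1 h3
          have hvx : v x = v ((ϖ : F) ^ (-1 : ℤ)) := by
            rw [v_eq_iff hx0 (zpow_ne_zero _ hw), val_pow_unif hϖ, hx]
          rw [h.phi_near_product hx hy (by rw [hvx]; exact hz), hr2]
          simp [MulChar.map_zero]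
        · have hz0 : x * y * r ≠ 0 := mul_ne_zero hc0 hr0
          have hzv : val (x * y * r) = -2 := by rw [val_mul hc0 hr0, hc, val_of_v hu]; norm_num
          have hri : v r⁻¹ = 1 := by simp [hu]
          have he : 1 - x * y / (x * y * r) = 1 - r⁻¹ := by field_simp
          have hredi : red r⁻¹ = (red r)⁻¹ := by
            rw [eq_comm, inv_eq_iff_eq_inv, eq_comm]
            apply inv_eq_of_mul_eq_one_left
            rw [← red_mul hr hri.le, mul_inv_cancel₀ hr0, red_one]
          have hred1 : red (1 - r⁻¹) = 1 - (red r)⁻¹ := by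
            rw [red_sub (by simp) hri.le, red_one, hredi]
          have hw1 : v (1 - r⁻¹) = 1 := by
            refine v_eq_one_of_not_lt (v_sub_le (by simp) hri.le) fun hcon => hr2 ?_
            rw [← red_eq_zero (v_sub_le (by simp) hri.le), hred1, sub_eq_zero] at hcon
            rw [← inv_inv (red r), ← hcon, inv_one]
          rw [phi_generic h.hecke hϖ h.dom₁ h.dom₂ hz0 hy1 (hlt hx hz0 hzv.le) (hlt hy hz0 hzv.le).le
            (by rw [he]; exact hw1), he, h.phi_z hzv, if_neg hred0, if_neg hr2, ← hred1,
            resChar_unit hw1, resChar_inv_unit hu, chi_mul hc0 hr0, chi_mul hx0 hy0]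
          rw [mul_inv, mul_inv]; ring

end Formula

/-! ### Summation over residues and torus values -/

section Evaluation

variable {F : Type*} [Field F] [ValuativeRel F] [TopologicalSpace F]
  [IsNonarchimedeanLocalField F] [TameCubic F]

local notation "v" => valuation F
local notation "SL" => Matrix.SpecialLinearGroup (Fin 3) F

variable {ι : rootsOfUnity 3 F ≃* rootsOfUnity 3 ℂ} {ϖ : Fˣ}
  {f : MetaSL3 F → ℂ} {ψ : AddChar F Circle} {a b e₀ e₁ : ℤ}

variable [MeasurableSpace F] [BorelSpace F] {μ : Measure F} [μ.IsAddHaarMeasure]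

open Classical in
/-- The central integral as a function of the residues of the coordinates. -/
def residual (ι : rootsOfUnity 3 F ≃* rootsOfUnity 3 ℂ) (ϖ : Fˣ) (q C F₁ F₂ F₃ F₄ F₅ F₆ : ℂ)
    (ρ σ : 𝓀[F]) : ℂ :=
  C + (if ρ = 0 then 1 else 0) * (if σ = 0 then 1 else 0) * F₁ +
    (if ρ = 0 then 1 else 0) * resChar ι ϖ σ * F₂ +
    resChar ι ϖ ρ * (if σ = 0 then 1 else 0) * F₃ +
    q * (resChar ι ϖ ρ * (resChar ι ϖ)⁻¹ σ * F₄) +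
    q * ((resChar ι ϖ)⁻¹ ρ * resChar ι ϖ σ * F₅) +
    q * ((resChar ι ϖ)⁻¹ ρ * (resChar ι ϖ)⁻¹ σ * F₆ * jacobiSum (resChar ι ϖ) (resChar ι ϖ))

lemma centralIntegral_residual (h : Admissible ι ϖ f a b e₀ e₁) (hμ : μ (𝒪[F] : Set F) = 1)
    {r s : F} (hr : v r ≤ 1) (hs : v s ≤ 1) :
    centralIntegral μ f (pT ϖ e₀ e₁) ((ϖ : F)⁻¹ * r) ((ϖ : F)⁻¹ * s) =
      residual ι ϖ (resCard F) (tailIntegral μ ϖ f (pT ϖ e₀ e₁)) (f (sec (pT ϖ e₀ e₁)))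
        (f (sec (pT ϖ e₀ (-e₀ - e₁ - 1)))) (f (sec (pT ϖ (e₁ - 1) (e₀ + 1))))
        (f (sec (pT ϖ (-e₀ - e₁ - 2) (e₀ + 1)))) (f (sec (pT ϖ (e₁ - 1) (-e₀ - e₁ - 1))))
        (f (sec (pT ϖ (-e₀ - e₁ - 2) e₁))) (red r) (red s) := by
  have hϖ := h.unif
  have hw := ϖ.ne_zero
  have hsmall : ∀ {r : F}, v r < 1 → v ((ϖ : F)⁻¹ * r) ≤ 1 := fun {r} hr => by
    have := (div_mem_lt (x := r) (k := 0) hϖ one_ne_zero (by simp [val_of_v])).1 (by simpa using hr)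
    rw [mul_comm, ← div_eq_mul_inv, div_mem hϖ hw hϖ]; simpa using this
  have hunit : ∀ {r : F}, v r = 1 → val ((ϖ : F)⁻¹ * r) = -1 := fun {r} hr => by
    rw [val_mul (inv_ne_zero hw) (ne_zero_of_v hr), val_inv, hϖ, val_of_v hr]; norm_num
  have hchi : ∀ {r : F}, v r = 1 → chi ι ϖ ((ϖ : F)⁻¹ * r) = chi ι ϖ r := fun {r} hr => by
    rw [chi_mul (inv_ne_zero hw) (ne_zero_of_v hr), chi_inv hw, chi_unif, inv_one, one_mul]
  have hne : ∀ {r : F}, v r = 1 → red r ≠ 0 := fun {r} hr => by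
    rw [ne_eq, red_eq_zero hr.le, hr]; exact lt_irrefl _
  have htr : ∀ x y, v x ≤ 1 →
      centralIntegral μ f (pT ϖ e₀ e₁) x y = centralIntegral μ f (pT ϖ e₀ e₁) 0 y := by
    intro x y hx
    have := centralIntegral_translate (μ := μ) h.hecke (pT ϖ e₀ e₁) hx (b := 0) (by simp) 0 y
    simpa using this
  have htr' : ∀ x y, v y ≤ 1 →
      centralIntegral μ f (pT ϖ e₀ e₁) x y = centralIntegral μ f (pT ϖ e₀ e₁) x 0 := by
    intro x y hy
    have := centralIntegral_translate (μ := μ) h.hecke (pT ϖ e₀ e₁) (a := 0) (by simp) hy x 0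
    simpa using this
  unfold residual
  by_cases hr1 : v r < 1
  · have r0 := (red_eq_zero hr).2 hr1
    by_cases hs1 : v s < 1
    · rw [htr _ _ (hsmall hr1), htr' _ _ (hsmall hs1), centralIntegral_zero h hμ, r0,
        (red_eq_zero hs).2 hs1]
      simp [MulChar.map_zero]
    · have us := v_eq_one_of_not_lt hs hs1
      rw [htr _ _ (hsmall hr1), centralIntegral_y h hμ (hunit us), r0, hchi us, resChar_unit us,
        if_neg (hne us)]
      simp [MulChar.map_zero]
  · have ur := v_eq_one_of_not_lt hr hr1
    by_cases hs1 : v s < 1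
    · rw [htr' _ _ (hsmall hs1), centralIntegral_x h hμ (hunit ur), hchi ur, (red_eq_zero hs).2 hs1,
        resChar_unit ur, if_neg (hne ur)]
      simp [MulChar.map_zero]
    · have us := v_eq_one_of_not_lt hs hs1
      rw [centralIntegral_xy h hμ (hunit ur) (hunit us), hchi ur, hchi us, if_neg (hne ur),
        if_neg (hne us), resChar_unit us, resChar_unit ur, resChar_inv_unit us, resChar_inv_unit ur]
      ring

/-- Every term is a product of a function of ρ and a function of σ, so the double sum factors. The
constant C is killed by the vanishing sum of the additive character. -/
lemma sum_residual (hμ : μ (𝒪[F] : Set F) = 1) (hψ : Unramified ψ) (hϖ : val (ϖ : F) = 1)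
    (C F₁ F₂ F₃ F₄ F₅ F₆ : ℂ) :
    ∑ ρ, ∑ σ, residual ι ϖ (resCard F) C F₁ F₂ F₃ F₄ F₅ F₆ ρ σ *
        (resAdd hψ hϖ ρ * resAdd hψ hϖ σ) =
      F₁ + conj (gaussSum μ ι ψ ϖ) * (F₂ + F₃) + (resCard F : ℂ) ^ 2 * (F₄ + F₅) +
        (resCard F : ℂ) ^ 2 * conj (gaussSum μ ι ψ ϖ) * F₆ := by
  classical
  have hg := gaussSum_norm (ι := ι) hμ hψ hϖ
  have hJ := gaussSum_jacobi (ι := ι) hμ hψ hϖ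
  have h0 : ∑ ρ, resAdd hψ hϖ ρ = 0 := by
    apply AddChar.sum_eq_zero_of_ne_one
    intro h1
    have := resAdd_primitive hψ hϖ (one_ne_zero (α := 𝓀[F]))
    rw [h1] at this
    apply this
    ext; simp [AddChar.mulShift_apply]
  have h1 : ∑ ρ, (if ρ = 0 then (1 : ℂ) else 0) * resAdd hψ hϖ ρ = 1 := by
    simp
  have h2 : ∑ ρ, resChar ι ϖ ρ * resAdd hψ hϖ ρ = conj (gaussSum μ ι ψ ϖ) :=
    (conj_gaussSum hμ hψ hϖ).symm
  have h3 : ∑ ρ, (resChar ι ϖ)⁻¹ ρ * resAdd hψ hϖ ρ = gaussSum μ ι ψ ϖ :=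
    (gaussSum_eq hμ hψ hϖ).symm
  have key : ∀ u w : 𝓀[F] → ℂ, ∑ ρ, ∑ σ, (u ρ * resAdd hψ hϖ ρ) * (w σ * resAdd hψ hϖ σ) =
      (∑ ρ, u ρ * resAdd hψ hϖ ρ) * ∑ σ, w σ * resAdd hψ hϖ σ := fun u w => by
    rw [Finset.sum_mul_sum]
  set Ψ := resAdd hψ hϖ with hΨ
  set X := resChar ι ϖ with hX
  have expand : ∀ ρ σ, residual ι ϖ (resCard F) C F₁ F₂ F₃ F₄ F₅ F₆ ρ σ * (Ψ ρ * Ψ σ) =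
      C * (Ψ ρ * Ψ σ) +
      F₁ * (((if ρ = 0 then 1 else 0) * Ψ ρ) * ((if σ = 0 then 1 else 0) * Ψ σ)) +
      F₂ * (((if ρ = 0 then 1 else 0) * Ψ ρ) * (X σ * Ψ σ)) +
      F₃ * ((X ρ * Ψ ρ) * ((if σ = 0 then 1 else 0) * Ψ σ)) +
      resCard F * F₄ * ((X ρ * Ψ ρ) * (X⁻¹ σ * Ψ σ)) +
      resCard F * F₅ * ((X⁻¹ ρ * Ψ ρ) * (X σ * Ψ σ)) +
      resCard F * F₆ * jacobiSum X X * ((X⁻¹ ρ * Ψ ρ) * (X⁻¹ σ * Ψ σ)) := by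
    intro ρ σ
    unfold residual
    ring
  have k0 : ∑ ρ, ∑ σ, Ψ ρ * Ψ σ = 0 := by
    rw [← Finset.sum_mul_sum, h0, zero_mul]
  simp only [expand, Finset.sum_add_distrib]
  simp only [← Finset.mul_sum, key] at *
  simp only [← Finset.sum_mul, h0, h1, h2, h3]
  -- The relation 𝔤·conj 𝔤 = q settles F₄ and F₅. For F₆, q𝔤²J = q𝔤(conj 𝔤)² = q² conj 𝔤.
  linear_combination (resCard F * (F₄ + F₅) + resCard F * F₆ * conj (gaussSum μ ι ψ ϖ)) * hg +
    resCard F * F₆ * gaussSum μ ι ψ ϖ * hJ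

/-- The Whittaker integral of a Hecke function. -/
theorem whittaker_formula (h : Admissible ι ϖ f a b e₀ e₁) (hψ : Unramified ψ)
    (hμ : μ (𝒪[F] : Set F) = 1) :
    ∫ p, phi f (pT ϖ e₀ e₁) p * (ψ (p.1 + p.2.1) : ℂ) ∂(μ.prod (μ.prod μ)) =
      f (sec (pT ϖ e₀ e₁)) + conj (gaussSum μ ι ψ ϖ) *
        (f (sec (pT ϖ e₀ (-e₀ - e₁ - 1))) + f (sec (pT ϖ (e₁ - 1) (e₀ + 1)))) +
      (resCard F : ℂ) ^ 2 * (f (sec (pT ϖ (-e₀ - e₁ - 2) (e₀ + 1))) +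
        f (sec (pT ϖ (e₁ - 1) (-e₀ - e₁ - 1)))) +
      (resCard F : ℂ) ^ 2 * conj (gaussSum μ ι ψ ϖ) * f (sec (pT ϖ (-e₀ - e₁ - 2) e₁)) := by
  have hϖ := h.unif
  have hc : val (ϖ : F)⁻¹ = -1 := by rw [val_inv, hϖ]
  have hc0 := inv_ne_zero ϖ.ne_zero
  rw [whittaker_eq_iterated h hψ hμ, ← sum_residual hμ hψ hϖ (tailIntegral μ ϖ f (pT ϖ e₀ e₁)),
    integral_residues hϖ hc0 hc]
  · rw [show (-1 : ℤ) + 1 = 0 by norm_num, measure_ball_zero hμ, Complex.ofReal_one, one_mul]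
  · intro r hr
    rw [integral_residues hϖ hc0 hc]
    · rw [show (-1 : ℤ) + 1 = 0 by norm_num, measure_ball_zero hμ, Complex.ofReal_one, one_mul]
    · intro s hs
      rw [centralIntegral_residual h hμ hr hs, resAdd_red hψ hϖ hr, resAdd_red hψ hϖ hs]

/-! ### The values of the Hecke functions on the torus -/

/-- The value at a torus element is that at its sorted exponents, and the sorted rearrangement is
unique. -/
lemma Admissible.sec_eq (h : Admissible ι ϖ f a b e₀ e₁) {p q p' q' : ℤ} (hp : p' ≤ q')
    (hq : q' ≤ -p' - q') (hpq : (p' = p ∧ q' = q) ∨ (p' = q ∧ q' = p) ∨ (p' = p ∧ q' = -p - q) ∨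
      (p' = -p - q ∧ q' = p) ∨ (p' = q ∧ q' = -p - q) ∨ (p' = -p - q ∧ q' = q)) :
    f (sec (pT ϖ p q)) = if p' = a ∧ q' = b then 1 else 0 := by
  obtain ⟨p₁, q₁, h1, h2, e, hc⟩ := h.hecke.sec_pT_sorted p q
  rw [e, h.hecke.sec_pT_ordered h.unif h.le₁ h.le₂ h1 h2]
  have : p₁ = p' ∧ q₁ = q' := by omega
  rw [this.1, this.2]

end Evaluation

/-! ### Consequences of residue characteristic greater than three -/

section Residual

variable {F : Type*} [Field F] [ValuativeRel F] [TopologicalSpace F]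
  [IsNonarchimedeanLocalField F]

local notation "v" => valuation F

lemma v_natCast_of_lt_ringChar {n : ℕ} (h0 : n ≠ 0) (hn : n < ringChar 𝓀[F]) :
    v (n : F) = 1 := by
  have h1 : v (n : F) ≤ 1 := (n : 𝒪[F]).2
  refine le_antisymm h1 (not_lt.1 fun hlt => ?_)
  have h2 : IsLocalRing.residue 𝒪[F] (n : 𝒪[F]) = 0 := by
    rw [IsLocalRing.residue_eq_zero_iff]
    exact Valuation.Integer.not_isUnit_iff_valuation_lt_one.2 hlt
  rw [map_natCast, ringChar.spec] at h2
  exact absurd (Nat.le_of_dvd (Nat.pos_of_ne_zero h0) h2) (not_le.2 hn)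

lemma tameCubic (hchar : 3 < ringChar 𝓀[F]) {ρ : F} (hρ : IsPrimitiveRoot ρ 3) : TameCubic F where
  two := by exact_mod_cast v_natCast_of_lt_ringChar two_ne_zero (by omega)
  three := by exact_mod_cast v_natCast_of_lt_ringChar three_ne_zero hchar
  root := ⟨ρ, hρ⟩

end Residual

/-! ### The Whittaker coefficients as indicators -/

section Coefficients

variable {F : Type*} [Field F] [ValuativeRel F] [TopologicalSpace F]
  [IsNonarchimedeanLocalField F] [TameCubic F] [MeasurableSpace F] [BorelSpace F]
  {μ : Measure F} [μ.IsAddHaarMeasure] {ι : rootsOfUnity 3 F ≃* rootsOfUnity 3 ℂ} {ϖ : Fˣ}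
  {f : MetaSL3 F → ℂ} {ψ : AddChar F Circle} {i j m n : ℤ}

lemma cMat_inv (ϖ : Fˣ) (i j : ℤ) : (cMat ϖ i j)⁻¹ = pT ϖ j (i - j) := by
  rw [cMat, diagPow_eq, pT_inv]
  congr 1 <;> ring

lemma whittakerIntegrand_eq (ϖ : Fˣ) (f : MetaSL3 F → ℂ) (ψ : AddChar F Circle) (i j : ℤ) :
    whittakerIntegrand ψ (rightTranslate (sec (cMat ϖ i j)⁻¹) f) =
      fun p => phi f (pT ϖ j (i - j)) p * (ψ (p.1 + p.2.1) : ℂ) := by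
  rw [cMat_inv]; rfl

/-- D has exponents (j, i − j, −i). Each of the six shifted triples is sorted and compared with
those of d'_{m,n}, which determines (i, j). -/
lemma whittakerCoeff_eq (h : Admissible ι ϖ f (-n - 2 * m) (m - n) j (i - j)) (hm : 0 ≤ m)
    (hn : 0 ≤ n) (hψ : Unramified ψ) (hμ : μ (𝒪[F] : Set F) = 1) :
    whittakerCoeff μ ψ ϖ f i j =
      (if i = 2 * m + n ∧ j = m + 2 * n then 1 else 0) + conj (gaussSum μ ι ψ ϖ) *
        ((if i = 2 * m + n - 1 ∧ j = m + 2 * n then 1 else 0) +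
          if i = 2 * m + n ∧ j = m + 2 * n - 1 then 1 else 0) +
      (resCard F : ℂ) ^ 2 * ((if i = 2 * m + n - 2 ∧ j = m + 2 * n - 1 then 1 else 0) +
        if i = 2 * m + n - 1 ∧ j = m + 2 * n - 2 then 1 else 0) +
      (resCard F : ℂ) ^ 2 * conj (gaussSum μ ι ψ ϖ) *
        if i = 2 * m + n - 2 ∧ j = m + 2 * n - 2 then 1 else 0 := by
  have d1 := h.dom₁
  have d2 := h.dom₂
  rw [whittakerCoeff, whittaker, whittakerIntegrand_eq, whittaker_formula h hψ hμ]
  congr 1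
  · congr 1
    · congr 1
      · rw [h.sec_eq (p' := -i) (q' := i - j) (by omega) (by omega) (by omega)]
        split_ifs <;> first | rfl | omega
      · congr 2
        -- On the wall i = 2j the shift leaves the chamber and the exponents sort differently. There
        -- both indicators vanish: equality would require 3n = 1 or 3n = −1. The term with the other
        -- reflection is analogous.
        · rcases le_or_gt (i - j + 1) j with hc | hc
          · rw [h.sec_eq (p' := -i - 1) (q' := i - j + 1) (by omega) (by omega) (by omega)]
            split_ifs <;> first | rfl | omega
          · rw [h.sec_eq (p' := -i - 1) (q' := j) (by omega) (by omega) (by omega)]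
            split_ifs <;> first | rfl | omega
        · rcases le_or_gt (-i) (i - j - 1) with hc | hc
          · rw [h.sec_eq (p' := -i) (q' := i - j - 1) (by omega) (by omega) (by omega)]
            split_ifs <;> first | rfl | omega
          · rw [h.sec_eq (p' := i - j - 1) (q' := -i) (by omega) (by omega) (by omega)]
            split_ifs <;> first | rfl | omega
    · congr 2
      · rw [h.sec_eq (p' := -i - 2) (q' := i - j + 1) (by omega) (by omega) (by omega)]
        split_ifs <;> first | rfl | omega
      · rw [h.sec_eq (p' := -i - 1) (q' := i - j - 1) (by omega) (by omega) (by omega)]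
        split_ifs <;> first | rfl | omega
  · congr 1
    rw [h.sec_eq (p' := -i - 2) (q' := i - j) (by omega) (by omega) (by omega)]
    split_ifs <;> first | rfl | omega

lemma conj_gaussSum_ne_zero (hψ : Unramified ψ) (hμ : μ (𝒪[F] : Set F) = 1)
    (hϖ : val (ϖ : F) = 1) : conj (gaussSum μ ι ψ ϖ) ≠ 0 := by
  have h := gaussSum_norm (ι := ι) hμ hψ hϖ
  refine left_ne_zero_of_mul (b := gaussSum μ ι ψ ϖ) ?_
  rw [h, resCard_eq]
  exact_mod_cast Fintype.card_ne_zero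

end Coefficients

end

end CubicCover

theorem proposition5 {F : Type*} [Field F] [ValuativeRel F] [TopologicalSpace F]
    [IsNonarchimedeanLocalField F] [MeasurableSpace F] [BorelSpace F]
    (hchar : 3 < ringChar 𝓀[F]) (ρ : F) (hρ : IsPrimitiveRoot ρ 3)
    (ι : rootsOfUnity 3 F ≃* rootsOfUnity 3 ℂ)
    (ϖ : Fˣ) (hϖ : CubicCover.val (ϖ : F) = 1)
    (ψ : AddChar F Circle) (hψ : ∀ x : F, (∀ y ∈ 𝒪[F], ψ (x * y) = 1) ↔ x ∈ 𝒪[F])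
    (μ : Measure F) [μ.IsAddHaarMeasure] (hμ : μ (𝒪[F] : Set F) = 1) :
    -- the splitting of the cover over `SL₃(𝒪)`
    (∃! κ : Matrix.SpecialLinearGroup (Fin 3) 𝒪[F] → rootsOfUnity 3 F,
      CubicCover.IsSplitting κ) ∧
    ∀ κ : Matrix.SpecialLinearGroup (Fin 3) 𝒪[F] → rootsOfUnity 3 F,
      CubicCover.IsSplitting κ → ∀ m n : ℕ,
      -- the basis element `f'_{m,n}`
      (∃! f : CubicCover.MetaSL3 F → ℂ, CubicCover.IsHeckeBasis ι ϖ κ m n f) ∧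
      ∀ f : CubicCover.MetaSL3 F → ℂ, CubicCover.IsHeckeBasis ι ϖ κ m n f →
        ∀ i j : ℤ, j ≤ 2 * i → i ≤ 2 * j →
          -- the integral that defines the coefficient converges
          Integrable (CubicCover.whittakerIntegrand ψ
            (CubicCover.rightTranslate (CubicCover.sec (CubicCover.cMat ϖ i j)⁻¹) f))
            (μ.prod (μ.prod μ)) ∧
          (CubicCover.whittakerCoeff μ ψ ϖ f i j ≠ 0 ↔
            ((i = 2 * (m : ℤ) + n ∧ j = (m : ℤ) + 2 * n) ∨
             (i = 2 * (m : ℤ) + n - 1 ∧ j = (m : ℤ) + 2 * n) ∨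
             (i = 2 * (m : ℤ) + n ∧ j = (m : ℤ) + 2 * n - 1) ∨
             (i = 2 * (m : ℤ) + n - 2 ∧ j = (m : ℤ) + 2 * n - 1) ∨
             (i = 2 * (m : ℤ) + n - 1 ∧ j = (m : ℤ) + 2 * n - 2) ∨
             (i = 2 * (m : ℤ) + n - 2 ∧ j = (m : ℤ) + 2 * n - 2))) ∧
          (i = 2 * (m : ℤ) + n ∧ j = (m : ℤ) + 2 * n →
            CubicCover.whittakerCoeff μ ψ ϖ f i j = 1) ∧
          (i = 2 * (m : ℤ) + n - 1 ∧ j = (m : ℤ) + 2 * n →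
            CubicCover.whittakerCoeff μ ψ ϖ f i j = conj (CubicCover.gaussSum μ ι ψ ϖ)) ∧
          (i = 2 * (m : ℤ) + n ∧ j = (m : ℤ) + 2 * n - 1 →
            CubicCover.whittakerCoeff μ ψ ϖ f i j = conj (CubicCover.gaussSum μ ι ψ ϖ)) ∧
          (i = 2 * (m : ℤ) + n - 2 ∧ j = (m : ℤ) + 2 * n - 1 →
            CubicCover.whittakerCoeff μ ψ ϖ f i j = (CubicCover.resCard F : ℂ) ^ 2) ∧
          (i = 2 * (m : ℤ) + n - 1 ∧ j = (m : ℤ) + 2 * n - 2 →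
            CubicCover.whittakerCoeff μ ψ ϖ f i j = (CubicCover.resCard F : ℂ) ^ 2) ∧
          (i = 2 * (m : ℤ) + n - 2 ∧ j = (m : ℤ) + 2 * n - 2 →
            CubicCover.whittakerCoeff μ ψ ϖ f i j =
              (CubicCover.resCard F : ℂ) ^ 2 * conj (CubicCover.gaussSum μ ι ψ ϖ)) := by
  have := CubicCover.tameCubic hchar hρ
  refine ⟨CubicCover.existsUnique_splitting, fun κ hκ m n =>
    ⟨CubicCover.existsUnique_heckeBasis hϖ hκ m n, fun f hf i j h1 h2 => ?_⟩⟩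
  have h : CubicCover.Admissible ι ϖ f (-n - 2 * m) (m - n) j (i - j) :=
    { hecke := by
        have := (CubicCover.isHeckeBasis_iff hκ).1 hf
        rwa [CubicCover.dMat_eq] at this
      unif := hϖ
      le₁ := by omega
      le₂ := by omega
      -- The first two exponents of d'_{m,n} differ by 3m.
      dvd := by omega
      dom₁ := by omega
      dom₂ := by omega }
  have hg : conj (CubicCover.gaussSum μ ι ψ ϖ) ≠ 0 :=
    CubicCover.conj_gaussSum_ne_zero hψ hμ hϖ
  have hq : (CubicCover.resCard F : ℂ) ≠ 0 := by
    rw [CubicCover.resCard_eq]; exact_mod_cast Fintype.card_ne_zero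
  rw [CubicCover.whittakerIntegrand_eq,
    CubicCover.whittakerCoeff_eq h (Int.natCast_nonneg m) (Int.natCast_nonneg n) hψ hμ]
  refine ⟨CubicCover.integrable_integrand h hψ, ⟨fun hne => ?_, fun hc => ?_⟩, ?_, ?_, ?_, ?_, ?_, ?_⟩
  · by_contra hcon
    simp only [not_or] at hcon
    obtain ⟨c1, c2, c3, c4, c5, c6⟩ := hcon
    exact hne (by simp only [if_neg c1, if_neg c2, if_neg c3, if_neg c4, if_neg c5, if_neg c6]; ring)
  -- The six pairs are distinct, so exactly one indicator survives, with a nonzero coefficient.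
  · split_ifs <;> first | omega | simp [hg, hq]
  all_goals
    intro hc
    split_ifs <;> first | omega | simp
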